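/- Let $p$ be a prime, let $(A,\Gamma)=(\mathrm{BP}_{2*},\mathrm{BP}_{2*}\mathrm{BP})$ be the Hopf algebroid with $A=\mathbb Z_{(p)}[v_1,v_2,\dots]$, $\Gamma=A[t_1,t_2,\dots]$ and $|v_i|=|t_i|=p^i-1$, and let $I=(p,v_1,v_2,\dots)\subset A$. Let $Y$ be a graded $\Gamma$-comodule whose underlying $A$-module has Levin index 1, i.e. the maps $\mathrm{Ext}^{*}_{A}(I^{n-1}Y,\mathbb F_p)\to \mathrm{Ext}^{*}_{A}(I^{n}Y,\mathbb F_p)$ induced by the inclusions $I^nY\subset I^{n-1}Y$ are zero for all $n\ge 1$ (here $\mathbb F_p=A/I$). Consider the following two trigraded algebraic Novikov spectral sequences of $Y$. (1) The spectral sequence $\{{}'E_r^{n,s,k}\}$ of the cobar complex $C^\bullet(Y)$, where $C^s(Y)=Y\otimes_A\Gamma^{\otimes_A s}$, filtered by the subcomplexes $F^nC^\bullet(Y)=C^\bullet(I^nY)$ (all of $C^\bullet(Y)$ for $n\le 0$). (2) The spectral sequence $\{{}''E_r^{m,s,k}\}$ of the cosimplicial object $Y\wedge \mathrm{CB}^\bullet(\Gamma/I)$,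 $\mathrm{CB}^m(\Gamma/I)=(\Gamma/I)^{\wedge (m+1)}$, in $\mathrm{Hov}(\Gamma)$, with ${}''E_1^{m,*,*}=\pi_*\mathrm{map}_{\mathrm{Hov}(\Gamma)}(A,Y\wedge \mathrm{CB}^m(\Gamma/I))$. It is the spectral sequence of the total complex $\mathrm{Tot}(Y)$ of $m\mapsto C^\bullet(Y\otimes_A R^{\otimes_A (m+1)})$, filtered by the cosimplicial degree $m$, where $R$ is the resolution $K(p,v_1,v_2,\dots)\otimes_A\Gamma$ of $\Gamma/I=A/I\otimes_A\Gamma$ by flat cofree comodules and $K$ is the Koszul complex. In both, the first index is the filtration degree, $s$ is the total cohomological degree, $k$ is the internal degree, and $d_r$ has tridegree $(r,1,0)$. Let $\alpha:C^\bullet(Y)\to \mathrm{Tot}(Y)$ be the map induced by the coaugmentation $Y\to Y\otimes_A R$. Then the two spectral sequences are equivalent, starting from the page ${}'E_1={}''E_2$: there are isomorphisms $$\varphi_r:\ {}'E_r^{\,n,s,k}\ \cong\ {}''E_{r+1}^{\,n+s,\,s,\,k}\qquad (r\ge 1,\ n,s,k\in\mathbb Z)$$ that commute with the differentials $d_r$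 and $d_{r+1}$ and such that $\varphi_{r+1}$ is the isomorphism induced by $\varphi_r$ on cohomology. They are compatible with the abutments: for a cocycle $z\in C^s(Y)$ of internal degree $k$, the class of $z$ comes from $F^nC^\bullet(Y)$ if and only if the class of $\alpha(z)$ comes from the $(n+s)$-th stage of the filtration of $\mathrm{Tot}(Y)$; and if $z\in F^n$ is a cocycle and $\alpha(z)$ is cohomologous to $y$ in the $(n+s)$-th stage, then $\varphi_r[z]=[y]$ for all $r\ge 1$ with $r\ge n+s$. -/

import Mathlib

open scoped TensorProduct DirectSum

noncomputable section

namespace AlgNov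

universe u w

section Hazewinkel

open Finset.HasAntidiagonal Finset.Nat

variable {S : Type*} [CommRing S]

/-- Scaled coefficients `p ^ n * ℓ n` of the logarithm with Hazewinkel generators: the `ℓ n` are
given by `ℓ 0 = 1` and `p * ℓ n = ∑_{0 ≤ i < n} ℓ i * v_{n-i} ^ (p ^ i)`.
The generator `v_{j+1}` is the entry `v j` of the sequence `v`. -/
def hlog (p : ℕ) (v : ℕ → S) : ℕ → S
  | 0 => 1
  | n + 1 => ∑ i : Fin (n + 1), (p : S) ^ (n - i) * hlog p v i * v (n - i) ^ (p ^ (i : ℕ))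

lemma hlog_zero (p : ℕ) (v : ℕ → S) : hlog p v 0 = 1 := by rw [hlog]

lemma hlog_succ (p : ℕ) (v : ℕ → S) (n : ℕ) : hlog p v (n + 1) =
    ∑ x ∈ antidiagonal n, (p : S) ^ x.2 * hlog p v x.1 * v x.2 ^ (p ^ x.1) := by
  rw [hlog, sum_antidiagonal_eq_sum_range_succ_mk,
    Finset.sum_range (fun i => (p : S) ^ (n - i) * hlog p v i * v (n - i) ^ (p ^ i))]

lemma map_hlog {T : Type*} [CommRing T] (f : S →+* T) (p : ℕ) (v : ℕ → S) (n : ℕ) :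
    f (hlog p v n) = hlog p (fun i => f (v i)) n := by
  induction n using Nat.strong_induction_on with
  | _ n ih =>
    cases n with
    | zero => simp [hlog_zero]
    | succ n =>
      simp only [hlog_succ, map_sum, map_mul, map_pow, map_natCast]
      refine Finset.sum_congr rfl fun x hx => ?_
      rw [ih x.1 (by have := mem_antidiagonal.1 hx; omega)]

/-- The sequence `0, v 0, v 1, …`. -/
def sh (v : ℕ → S) : ℕ → S
  | 0 => 0
  | n + 1 => v n

lemma p_mul_hlog {p : ℕ} (hp : p ≠ 0) (v : ℕ → S) (n : ℕ) : (p : S) * hlog p v n =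
    (if n = 0 then (p : S) else 0) +
      ∑ x ∈ antidiagonal n, (p : S) ^ x.2 * hlog p v x.1 * sh v x.2 ^ (p ^ x.1) := by
  cases n with
  | zero => simp [hlog_zero, sh]
  | succ n =>
    rw [sum_antidiagonal_succ']
    simp only [sh, hlog_succ, Finset.mul_sum]
    rw [zero_pow (pow_ne_zero _ hp)]
    simp only [mul_zero, zero_add, Nat.add_eq_zero_iff, one_ne_zero, and_false, if_false]
    refine Finset.sum_congr rfl fun x _ => ?_
    ring

lemma sum_antidiagonal_assoc {M : Type*} [AddCommMonoid M] (n : ℕ) (f : ℕ → ℕ → ℕ → M) :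
    ∑ x ∈ antidiagonal n, ∑ y ∈ antidiagonal x.1, f y.1 y.2 x.2 =
      ∑ x ∈ antidiagonal n, ∑ y ∈ antidiagonal x.2, f x.1 y.1 y.2 := by
  rw [Finset.sum_sigma', Finset.sum_sigma']
  refine Finset.sum_nbij' (fun z => ⟨(z.2.1, z.2.2 + z.1.2), (z.2.2, z.1.2)⟩)
    (fun z => ⟨(z.1.1 + z.2.1, z.2.2), (z.1.1, z.2.1)⟩) ?_ ?_ ?_ ?_ ?_
  all_goals
    rintro ⟨⟨a, b⟩, ⟨c, d⟩⟩ h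
    simp only [Finset.mem_sigma, mem_antidiagonal] at h ⊢
    try obtain ⟨h1, h2⟩ := h
    try subst h2
    try subst h1
    try simp [add_assoc]

variable {p : ℕ} (σ : S →+* S) (v : ℕ → S)

lemma sigma_iter (hv : ∀ i, σ (v i) = v i ^ p) (b i : ℕ) (hp : p ≠ 0) :
    (σ^[b]) (sh v i) = sh v i ^ p ^ b := by
  induction b with
  | zero => simp
  | succ b ih =>
    rw [Function.iterate_succ_apply', ih, map_pow]
    cases i with
    | zero => simp [sh, hp]
    | succ i => simp only [sh, hv]; rw [← pow_mul, ← pow_succ']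

lemma p_mul_hlog' (hp : p ≠ 0) (hreg : ∀ x : S, (p : S) * x = 0 → x = 0)
    (hv : ∀ i, σ (v i) = v i ^ p) (n : ℕ) : (p : S) * hlog p v n =
    (if n = 0 then (p : S) else 0) +
      ∑ x ∈ antidiagonal n, (p : S) ^ x.1 * sh v x.1 * (σ ^ x.1) (hlog p v x.2) := by
  induction n using Nat.strong_induction_on with
  | _ n ih =>
    have key : ∀ y ∈ antidiagonal n, (p : S) ^ y.2 * (p * hlog p v y.1) * sh v y.2 ^ (p ^ y.1) =
        (p : S) ^ y.2 * ((if y.1 = 0 then (p : S) else 0) +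
      ∑ x ∈ antidiagonal y.1, (p : S) ^ x.1 * sh v x.1 * (σ ^ x.1) (hlog p v x.2)) *
        sh v y.2 ^ (p ^ y.1) := by
      rintro ⟨i, j⟩ hij
      rcases Nat.eq_zero_or_pos j with rfl | hj
      · simp [sh, zero_pow (pow_ne_zero _ hp)]
      · rw [ih]
        have := mem_antidiagonal.1 hij
        simp only at this ⊢; omega
    rw [← sub_eq_zero]
    apply hreg
    have e1 : (p : S) * (p * hlog p v n) = p * (if n = 0 then (p : S) else 0) +
        (p ^ (n + 1) * sh v n + ∑ x ∈ antidiagonal n, ∑ y ∈ antidiagonal x.2,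
          (p : S) ^ x.1 * sh v x.1 * ((σ ^ x.1) (hlog p v y.1) * p ^ y.2 *
            sh v y.2 ^ p ^ (x.1 + y.1))) := by
      rw [p_mul_hlog hp, mul_add]
      congr 1
      rw [Finset.mul_sum]
      calc _ = ∑ y ∈ antidiagonal n, ((if y.1 = 0 then (p : S) ^ (y.2 + 1) * sh v y.2 else 0) +
              ∑ x ∈ antidiagonal y.1, (p : S) ^ x.1 * sh v x.1 * ((σ ^ x.1) (hlog p v x.2) *
              p ^ y.2 * sh v y.2 ^ p ^ (x.1 + x.2))) := by
            refine Finset.sum_congr rfl fun y hy => ?_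
            have h0 : (p : S) * (p ^ y.2 * hlog p v y.1 * sh v y.2 ^ p ^ y.1) =
              p ^ y.2 * (p * hlog p v y.1) * sh v y.2 ^ p ^ y.1 := by ring
            rw [h0, key y hy, mul_add, add_mul, Finset.mul_sum, Finset.sum_mul]
            congr 1
            · split_ifs with h
              · rw [h]; ring
              · ring
            · refine Finset.sum_congr rfl fun x hx => ?_
              rw [mem_antidiagonal.1 hx]; ring
        _ = _ := by
            rw [Finset.sum_add_distrib, sum_antidiagonal_assoc n (fun a b c =>
              (p : S) ^ a * sh v a * ((σ ^ a) (hlog p v b) * p ^ c * sh v c ^ p ^ (a + b)))]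
            congr 1
            rw [Finset.sum_eq_single (0, n)]
            · simp
            · rintro ⟨a, b⟩ h h'
              have := mem_antidiagonal.1 h
              simp only at this ⊢
              rw [if_neg]
              rintro rfl
              simp at this; exact h' (by rw [this])
            · simp
    have e2 : ∀ x ∈ antidiagonal n, ∑ y ∈ antidiagonal x.2,
          (p : S) ^ x.1 * sh v x.1 * ((σ ^ x.1) (hlog p v y.1) * p ^ y.2 *
            sh v y.2 ^ p ^ (x.1 + y.1)) =
          (p : S) ^ x.1 * sh v x.1 * (p * (σ ^ x.1) (hlog p v x.2)) -
            (if x.2 = 0 then (p : S) ^ (x.1 + 1) * sh v x.1 else 0) := by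
      intro x hx
      have h := congrArg (σ ^ x.1) (p_mul_hlog hp v x.2)
      rw [map_mul, map_natCast, map_add, map_sum] at h
      have h3 : (σ ^ x.1) (if x.2 = 0 then (p : S) else 0) = (if x.2 = 0 then (p : S) else 0) := by
        split_ifs <;> simp
      rw [h, h3, ← Finset.mul_sum, mul_add]
      have h4 : (p : S) ^ x.1 * sh v x.1 * (if x.2 = 0 then (p : S) else 0) =
          (if x.2 = 0 then (p : S) ^ (x.1 + 1) * sh v x.1 else 0) := by
        split_ifs <;> ring
      rw [h4, add_sub_cancel_left]
      congr 1
      refine Finset.sum_congr rfl fun y hy => ?_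
      rw [map_mul, map_mul, map_pow, map_pow, map_natCast, RingHom.coe_pow, sigma_iter σ v hv _ _ hp,
        ← pow_mul, ← pow_add]
      ring
    rw [mul_sub, e1, Finset.sum_congr rfl e2, Finset.sum_sub_distrib]
    have e3 : ∑ x ∈ antidiagonal n, (if x.2 = 0 then (p : S) ^ (x.1 + 1) * sh v x.1 else 0) =
        p ^ (n + 1) * sh v n := by
      rw [Finset.sum_eq_single (n, 0)]
      · simp
      · rintro ⟨a, b⟩ h h'
        have := mem_antidiagonal.1 h
        simp only at this ⊢
        rw [if_neg]
        rintro rfl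
        simp at this; exact h' (by rw [this])
      · simp
    rw [e3, mul_add, Finset.mul_sum]
    have e4 : ∀ x ∈ antidiagonal n, (p : S) ^ x.1 * sh v x.1 * (p * (σ ^ x.1) (hlog p v x.2)) =
      p * (p ^ x.1 * sh v x.1 * (σ ^ x.1) (hlog p v x.2)) := fun x _ => by ring
    rw [Finset.sum_congr rfl e4]
    ring

/-- Integrality lemma of Dwork--Hazewinkel type. -/
lemma hazewinkel_dvd (hp : p ≠ 0) (hreg : ∀ x : S, (p : S) * x = 0 → x = 0)
    (hv : ∀ i, σ (v i) = v i ^ p) (D : ℕ → ℕ → S)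
    (hD : ∀ m e b, (p : S) ^ (e + 1) ∣ D m (b + e) - (σ ^ b) (D m e)) (n : ℕ)
    (h : ∀ m < n, (p : S) ^ (m + 1) ∣
      ∑ x ∈ antidiagonal m, (p : S) ^ x.2 * hlog p v x.1 * D x.2 x.1) :
    (p : S) ^ n ∣ ∑ x ∈ antidiagonal n, (p : S) ^ x.2 * hlog p v x.1 * D x.2 x.1 := by
  have main : (p : S) ^ (n + 1) ∣
      p * ∑ x ∈ antidiagonal n, (p : S) ^ x.2 * hlog p v x.1 * D x.2 x.1 := by
    have e1 : p * ∑ x ∈ antidiagonal n, (p : S) ^ x.2 * hlog p v x.1 * D x.2 x.1 =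
        (p : S) ^ (n + 1) * D n 0 + ∑ x ∈ antidiagonal n, (p : S) ^ x.1 * sh v x.1 *
          ∑ y ∈ antidiagonal x.2, p ^ y.2 * (σ ^ x.1) (hlog p v y.1) * D y.2 (x.1 + y.1) := by
      rw [Finset.mul_sum]
      calc _ = ∑ y ∈ antidiagonal n, ((if y.1 = 0 then (p : S) ^ (y.2 + 1) * D y.2 0 else 0) +
              ∑ x ∈ antidiagonal y.1, (p : S) ^ x.1 * sh v x.1 * (p ^ y.2 *
                (σ ^ x.1) (hlog p v x.2) * D y.2 (x.1 + x.2))) := by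
            refine Finset.sum_congr rfl fun y hy => ?_
            have : (p : S) * (p ^ y.2 * hlog p v y.1 * D y.2 y.1) =
              p ^ y.2 * (p * hlog p v y.1) * D y.2 y.1 := by ring
            rw [this, p_mul_hlog' σ v hp hreg hv, mul_add, add_mul, Finset.mul_sum, Finset.sum_mul]
            congr 1
            · split_ifs with h
              · rw [h]; ring
              · ring
            · refine Finset.sum_congr rfl fun x hx => ?_
              rw [mem_antidiagonal.1 hx]; ring
        _ = _ := by
            rw [Finset.sum_add_distrib, sum_antidiagonal_assoc n (fun a b c =>
              (p : S) ^ a * sh v a * (p ^ c * (σ ^ a) (hlog p v b) * D c (a + b)))]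
            simp only [Finset.mul_sum]
            congr 1
            rw [Finset.sum_eq_single (0, n)]
            · simp
            · rintro ⟨a, b⟩ h h'
              have := mem_antidiagonal.1 h
              simp only at this ⊢
              rw [if_neg]
              rintro rfl
              simp at this; exact h' (by rw [this])
            · simp
    rw [e1]
    refine dvd_add (dvd_mul_right _ _) (Finset.dvd_sum ?_)
    rintro ⟨b, q⟩ hbq
    have hbq' := mem_antidiagonal.1 hbq
    simp only at hbq' ⊢
    cases b with
    | zero => simp [sh]
    | succ b =>
      have : (p : S) ^ (n + 1) = p ^ (b + 1) * p ^ (q + 1) := by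
        rw [← pow_add]; congr 1; omega
      rw [this, mul_assoc]
      refine mul_dvd_mul_left _ (Dvd.dvd.mul_left ?_ _)
      have h1 : (p : S) ^ (q + 1) ∣ (σ ^ (b + 1)) (∑ x ∈ antidiagonal q,
          (p : S) ^ x.2 * hlog p v x.1 * D x.2 x.1) := by
        obtain ⟨c, hc⟩ := h q (by omega)
        rw [hc, map_mul, map_pow, map_natCast]
        exact dvd_mul_right _ _
      refine (dvd_iff_dvd_of_dvd_sub ?_).2 h1
      rw [map_sum, ← Finset.sum_sub_distrib]
      refine Finset.dvd_sum fun x hx => ?_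
      rw [map_mul, map_mul, map_pow, map_natCast, ← mul_sub]
      have : q + 1 = x.2 + (x.1 + 1) := by have := mem_antidiagonal.1 hx; omega
      rw [this, pow_add, mul_assoc]
      exact mul_dvd_mul_left _ (Dvd.dvd.mul_left (hD _ _ _) _)
  obtain ⟨c, hc⟩ := main
  refine ⟨c, sub_eq_zero.1 (hreg _ ?_)⟩
  rw [mul_sub, hc]; ring

lemma exists_seq (Q : ℕ → (ℕ → S) → Prop)
    (hloc : ∀ n w w', (∀ i ≤ n, w i = w' i) → Q n w → Q n w')
    (step : ∀ n w, (∀ m < n, Q m w) → ∃ c, Q n (Function.update w n c)) : ∃ w, ∀ n, Q n w := by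
  classical
  let g : (n : ℕ) → ((m : ℕ) → m < n → S) → S := fun n f =>
    if h : ∃ c, Q n (fun i => if hi : i < n then f i hi else c) then h.choose else 0
  let w : ℕ → S := fun n => Nat.strongRec (motive := fun _ => S) g n
  have hw : ∀ n, w n = g n (fun m _ => w m) := fun n => by
    exact Nat.strongRec_eq (motive := fun _ => S) g n
  refine ⟨w, fun n => ?_⟩
  induction n using Nat.strong_induction_on with
  | _ n ih =>
    have h : ∃ c, Q n (fun i => if _ : i < n then w i else c) := by
      obtain ⟨c, hc⟩ := step n w ih
      refine ⟨c, hloc n _ _ (fun i hi => ?_) hc⟩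
      by_cases h : i < n
      · simp [h, h.ne]
      · have : i = n := by omega
        subst this; simp
    have hn : w n = h.choose := by
      rw [hw]; exact dif_pos h
    refine hloc n _ _ (fun i hi => ?_) h.choose_spec
    by_cases h' : i < n
    · simp [h']
    · have : i = n := by omega
      subst this; simp [hn]

/-- Solving an equation of formal sums recursively. -/
lemma exists_curve (hp : p ≠ 0) (hreg : ∀ x : S, (p : S) * x = 0 → x = 0)
    (hσ : ∀ x, (p : S) ∣ x ^ p - σ x)
    (hv : ∀ i, σ (v i) = v i ^ p) (G : ℕ → (ℕ → S) → ℕ → S)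
    (hloc : ∀ n w w', (∀ i < n, w i = w' i) → G n w = G n w')
    (hG : ∀ w m e b, (p : S) ^ (e + 1) ∣ G m w (b + e) - (σ ^ b) (G m w e)) (τ : ℕ → S) :
    ∃ w : ℕ → S, ∀ n, ∑ x ∈ antidiagonal n, (p : S) ^ x.2 * hlog p v x.1 *
      (G x.2 w x.1 - w x.2 ^ p ^ x.1) = p ^ (n + 1) * τ n := by
  have hσb : ∀ b x, (p : S) ∣ x ^ p ^ b - (σ ^ b) x := by
    intro b x
    induction b with
    | zero => simp
    | succ b ih =>
      have h1 : (p : S) ∣ x ^ p ^ (b + 1) - ((σ ^ b) x) ^ p := by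
        rw [pow_succ, pow_mul]
        exact ih.trans (sub_dvd_pow_sub_pow _ _ _)
      have h2 := hσ ((σ ^ b) x)
      have := dvd_add h1 h2
      rw [sub_add_sub_cancel] at this
      rwa [pow_succ' σ]
  have hpow : ∀ x e b, (p : S) ^ (e + 1) ∣ x ^ p ^ (b + e) - (σ ^ b) (x ^ p ^ e) := by
    intro x e b
    rw [pow_add p, pow_mul, map_pow]
    exact dvd_sub_pow_of_dvd_sub (hσb b x) e
  refine exists_seq _ ?_ ?_
  · intro n w w' h hQ
    rw [← hQ]
    refine Finset.sum_congr rfl fun x hx => ?_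
    have := mem_antidiagonal.1 hx
    rw [hloc x.2 w w' (fun i hi => h i (by omega)), h x.2 (by omega)]
  · intro n w h
    obtain ⟨c, hc⟩ := hazewinkel_dvd σ v hp hreg hv (fun m a => G m w a - w m ^ p ^ a)
      (fun m e b => by
        have := dvd_sub (hG w m e b) (hpow (w m) e b)
        rw [map_sub]
        convert this using 1
        ring) n (fun m hm => by
          rw [h m hm]; exact dvd_mul_right _ _)
    refine ⟨c + w n - p * τ n, ?_⟩
    have hG' : ∀ m ≤ n, G m (Function.update w n (c + w n - p * τ n)) = G m w := fun m hm =>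
      hloc _ _ _ fun i hi => by rw [Function.update_of_ne (by omega)]
    cases n with
    | zero =>
      simp [hlog_zero, hG'] at hc ⊢
      linear_combination hc
    | succ n =>
      rw [sum_antidiagonal_succ] at hc ⊢
      have : ∑ x ∈ antidiagonal n, (p : S) ^ x.2 * hlog p v (x.1 + 1) *
          (G x.2 (Function.update w (n + 1) (c + w (n + 1) - p * τ (n + 1))) (x.1 + 1) -
            Function.update w (n + 1) (c + w (n + 1) - p * τ (n + 1)) x.2 ^ p ^ (x.1 + 1)) =
          ∑ x ∈ antidiagonal n, (p : S) ^ x.2 * hlog p v (x.1 + 1) *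
          (G x.2 w (x.1 + 1) - w x.2 ^ p ^ (x.1 + 1)) := by
        refine Finset.sum_congr rfl fun x hx => ?_
        have := mem_antidiagonal.1 hx
        rw [hG' _ (by omega), Function.update_of_ne (by omega)]
      rw [this, hG' _ le_rfl, Function.update_self]
      simp only [hlog_zero, pow_zero, pow_one, mul_one] at hc ⊢
      linear_combination hc

end Hazewinkel

section Cofree

variable {A Γ : Type} [CommRing A] [CommRing Γ] [Algebra A Γ]

/-- For a pair `(A, Γ)` with left unit the algebra map and right unit `η`, the `A`-module
`M ⊗_A Γ` underlying the cofree right comodule on `M`: the tensor product is formed over the left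
unit and `A` acts through the right unit. The factor `Γ` is written first. -/
def Cofree (_η : A →+* Γ) (M : Type u) [AddCommGroup M] [Module A M] : Type u := Γ ⊗[A] M

variable (η : A →+* Γ) {M : Type u} [AddCommGroup M] [Module A M]
  {N : Type w} [AddCommGroup N] [Module A N]

namespace Cofree

instance : AddCommGroup (Cofree η M) := inferInstanceAs (AddCommGroup (Γ ⊗[A] M))
instance : Module Γ (Cofree η M) := inferInstanceAs (Module Γ (Γ ⊗[A] M))
instance : Module A (Cofree η M) where
  smul a z := η a • z
  one_smul z := show η 1 • z = z by rw [_root_.map_one, one_smul]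
  mul_smul a b z := show η (a * b) • z = η a • η b • z by rw [_root_.map_mul, mul_smul]
  smul_zero a := smul_zero (η a)
  smul_add a x y := smul_add (η a) x y
  add_smul a b z := show η (a + b) • z = η a • z + η b • z by rw [_root_.map_add, add_smul]
  zero_smul z := show η 0 • z = 0 by rw [_root_.map_zero, zero_smul]

/-- The class of `m ⊗ γ`. -/
def mk (γ : Γ) (m : M) : Cofree η M := (γ ⊗ₜ[A] m : Γ ⊗[A] M)

lemma smul_def (a : A) (z : Cofree η M) : a • z = η a • z := rfl
lemma smul_mk (γ γ' : Γ) (m : M) : γ • mk η γ' m = mk η (γ * γ') m := rfl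
lemma asmul_mk (a : A) (γ : Γ) (m : M) : a • mk η γ m = mk η (η a * γ) m := rfl
lemma mk_add (γ : Γ) (m m' : M) : mk η γ (m + m') = mk η γ m + mk η γ m' :=
  TensorProduct.tmul_add _ _ _
lemma add_mk (γ γ' : Γ) (m : M) : mk η (γ + γ') m = mk η γ m + mk η γ' m :=
  TensorProduct.add_tmul _ _ _
lemma mk_zero (γ : Γ) : mk η γ (0 : M) = 0 := TensorProduct.tmul_zero _ _
lemma zero_mk (m : M) : mk η 0 m = 0 := TensorProduct.zero_tmul _ _
lemma mk_smul (γ : Γ) (a : A) (m : M) : mk η γ (a • m) = mk η (algebraMap A Γ a * γ) m := by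
  unfold mk; rw [← TensorProduct.smul_tmul, Algebra.smul_def]

variable {η}

@[elab_as_elim]
lemma induction {P : Cofree η M → Prop} (z : Cofree η M) (h0 : P 0)
    (hmk : ∀ γ m, P (mk η γ m)) (hadd : ∀ x y, P x → P y → P (x + y)) : P z :=
  TensorProduct.induction_on (motive := P) z h0 hmk hadd

/-- Two additive maps out of `M ⊗_A Γ` that agree on pure tensors agree. -/
lemma hom_ext {P : Type*} [AddCommMonoid P] {f g : Cofree η M →+ P}
    (h : ∀ γ m, f (mk η γ m) = g (mk η γ m)) : f = g := by
  ext z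
  induction z using Cofree.induction with
  | h0 => simp
  | hmk γ m => exact h γ m
  | hadd x y hx hy => simp [hx, hy]

lemma lin_ext {P : Type*} [AddCommMonoid P] [Module A P] {f g : Cofree η M →ₗ[A] P}
    (h : ∀ γ m, f (mk η γ m) = g (mk η γ m)) : f = g := by
  have := hom_ext (f := f.toAddMonoidHom) (g := g.toAddMonoidHom) h
  ext z; exact DFunLike.congr_fun this z

variable (η) in
/-- `f ⊗ id : M ⊗_A Γ → N ⊗_A Γ`. -/
def map (f : M →ₗ[A] N) : Cofree η M →ₗ[A] Cofree η N where
  toFun := fun z => (TensorProduct.AlgebraTensorModule.lTensor Γ Γ f : Γ ⊗[A] M →ₗ[Γ] Γ ⊗[A] N) z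
  map_add' := fun x y => map_add (TensorProduct.AlgebraTensorModule.lTensor Γ Γ f) x y
  map_smul' := fun a x => map_smul (TensorProduct.AlgebraTensorModule.lTensor Γ Γ f) (η a) x

@[simp] lemma map_mk (f : M →ₗ[A] N) (γ : Γ) (m : M) : map η f (mk η γ m) = mk η γ (f m) := rfl

lemma map_gsmul (f : M →ₗ[A] N) (γ : Γ) (z : Cofree η M) : map η f (γ • z) = γ • map η f z :=
  map_smul (TensorProduct.AlgebraTensorModule.lTensor Γ Γ f) γ z

lemma map_comp {N' : Type*} [AddCommGroup N'] [Module A N'] (g : N →ₗ[A] N') (f : M →ₗ[A] N) :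
    map η (g ∘ₗ f) = map η g ∘ₗ map η f := lin_ext fun γ m => by simp

@[simp] lemma map_id : map η (LinearMap.id : M →ₗ[A] M) = LinearMap.id :=
  lin_ext fun γ m => by simp

lemma map_add' (f g : M →ₗ[A] N) : map η (f + g) = map η f + map η g :=
  lin_ext fun γ m => by simp [mk_add]

@[simp] lemma map_zero' : map η (0 : M →ₗ[A] N) = 0 :=
  lin_ext fun γ m => mk_zero η γ

lemma map_smul' (c : ℤ) (f : M →ₗ[A] N) : map η (c • f) = c • map η f := by
  let F : (M →ₗ[A] N) →+ (Cofree η M →ₗ[A] Cofree η N) :=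
    { toFun := map η, map_zero' := map_zero', map_add' := map_add' }
  exact map_zsmul F c f

variable (η) in
/-- `m ↦ m ⊗ 1`; it is additive, and `A`-linear for the left unit only. -/
def one : M →+ Cofree η M where
  toFun := mk η 1
  map_zero' := mk_zero η 1
  map_add' := mk_add η 1

lemma map_one (f : M →ₗ[A] N) (m : M) : map η f (one η m) = one η (f m) := rfl

/-- Additive maps out of `M ⊗_A Γ` from balanced biadditive maps. -/
def lift {P : Type*} [AddCommGroup P] (f : Γ →+ M →+ P)
    (hf : ∀ a γ m, f (algebraMap A Γ a * γ) m = f γ (a • m)) : Cofree η M →+ P :=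
  TensorProduct.liftAddHom f fun a γ m => by rw [Algebra.smul_def, hf]

@[simp] lemma lift_mk {P : Type*} [AddCommGroup P] (f : Γ →+ M →+ P)
    (hf : ∀ a γ m, f (algebraMap A Γ a * γ) m = f γ (a • m)) (γ : Γ) (m : M) :
    lift (η := η) f hf (mk η γ m) = f γ m := rfl

variable (η) (N) in
/-- Auxiliary map `n ⊗ γ' ↦ (m ⊗ n) ⊗ γ γ'`. -/
def muAux (γ : Γ) (m : M) : Cofree η N →ₗ[A] Cofree η (M ⊗[A] N) where
  toFun := fun z => γ • map η (TensorProduct.mk A M N m) z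
  map_add' := fun x y => by rw [_root_.map_add, smul_add]
  map_smul' := fun a x => by
    rw [_root_.map_smul, RingHom.id_apply, smul_def, smul_def, smul_smul, smul_smul, mul_comm]

@[simp] lemma muAux_mk (γ γ' : Γ) (m : M) (n : N) :
    muAux η N γ m (mk η γ' n) = mk η (γ * γ') (m ⊗ₜ n) := rfl

variable (η) (M N) in
/-- Auxiliary map for the lax monoidal structure. -/
def muLift : Cofree η M →+ (Cofree η N →ₗ[A] Cofree η (M ⊗[A] N)) :=
  lift
    { toFun := fun γ =>
        { toFun := fun m => muAux η N γ m
          map_zero' := lin_ext fun γ' n => by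
            rw [muAux_mk, TensorProduct.zero_tmul, mk_zero, LinearMap.zero_apply]
          map_add' := fun m m' => lin_ext fun γ' n => by
            rw [LinearMap.add_apply, muAux_mk, muAux_mk, muAux_mk, TensorProduct.add_tmul, mk_add] }
      map_zero' := AddMonoidHom.ext fun m => lin_ext fun γ' n => by
        rw [AddMonoidHom.coe_mk, ZeroHom.coe_mk, muAux_mk, zero_mul, zero_mk]
        rfl
      map_add' := fun γ γ' => AddMonoidHom.ext fun m => lin_ext fun γ'' n => by
        rw [AddMonoidHom.add_apply, LinearMap.add_apply]
        simp only [AddMonoidHom.coe_mk, ZeroHom.coe_mk, muAux_mk, add_mul, add_mk] }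
    (fun a γ m => lin_ext fun γ' n => by
      simp only [AddMonoidHom.coe_mk, ZeroHom.coe_mk, muAux_mk]
      rw [← TensorProduct.smul_tmul', mk_smul, mul_assoc])

lemma muLift_mk (γ : Γ) (m : M) : muLift η M N (mk η γ m) = muAux η N γ m := rfl

variable (η) (M N) in
/-- The lax monoidal structure `(m ⊗ γ) ⊗ (n ⊗ γ') ↦ (m ⊗ n) ⊗ γ γ'`. -/
def mu : Cofree η M ⊗[A] Cofree η N →ₗ[A] Cofree η (M ⊗[A] N) :=
  TensorProduct.lift
    { toFun := muLift η M N
      map_add' := fun x y => _root_.map_add _ x y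
      map_smul' := fun a z => by
        induction z using Cofree.induction with
        | h0 => rw [smul_zero, _root_.map_zero, smul_zero]
        | hmk γ m =>
          refine lin_ext fun γ' n => ?_
          rw [asmul_mk, muLift_mk, RingHom.id_apply, LinearMap.smul_apply, muLift_mk, muAux_mk,
            muAux_mk, asmul_mk, mul_assoc]
        | hadd x y hx hy => rw [smul_add, _root_.map_add, hx, hy, _root_.map_add, smul_add] }

@[simp] lemma mu_mk (γ γ' : Γ) (m : M) (n : N) :
    mu η M N (mk η γ m ⊗ₜ mk η γ' n) = mk η (γ * γ') (m ⊗ₜ n) := rfl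

lemma mu_natural {M' N' : Type*} [AddCommGroup M'] [Module A M'] [AddCommGroup N'] [Module A N']
    (f : M →ₗ[A] M') (g : N →ₗ[A] N') :
    mu η M' N' ∘ₗ TensorProduct.map (map η f) (map η g) =
      map η (TensorProduct.map f g) ∘ₗ mu η M N := by
  refine TensorProduct.ext' fun x y => ?_
  simp only [LinearMap.comp_apply, TensorProduct.map_tmul]
  induction x using Cofree.induction with
  | h0 => simp
  | hadd x y hx hy => simp only [_root_.map_add, TensorProduct.add_tmul, hx, hy]
  | hmk γ m =>
    induction y using Cofree.induction with
    | h0 => simp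
    | hadd x y hx hy => simp only [_root_.map_add, TensorProduct.tmul_add, hx, hy]
    | hmk γ' n => simp

section Ring

variable (S : Type u) [CommRing S] [Algebra A S]

/-- For an `A`-algebra `S`, the ring `S ⊗_A Γ`. -/
instance : CommRing (Cofree η S) := inferInstanceAs (CommRing (Γ ⊗[A] S))

variable {S} in
lemma mk_mul_mk (γ γ' : Γ) (s s' : S) : mk η γ s * mk η γ' s' = mk η (γ * γ') (s * s') :=
  Algebra.TensorProduct.tmul_mul_tmul _ _ _ _

lemma one_def : (1 : Cofree η S) = mk η 1 1 := rfl

/-- `S ⊗_A Γ` as an `A`-algebra through the right unit. -/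
instance : Algebra A (Cofree η S) where
  toSMul := (inferInstance : Module A (Cofree η S)).toSMul
  algebraMap :=
    { toFun := fun a => mk η (η a) 1
      map_one' := by rw [_root_.map_one]; rfl
      map_mul' := fun a b => by rw [mk_mul_mk, mul_one, _root_.map_mul]
      map_zero' := by rw [_root_.map_zero, zero_mk]
      map_add' := fun a b => by rw [_root_.map_add, add_mk] }
  commutes' := fun a x => mul_comm _ _
  smul_def' := fun a x => by
    induction x using Cofree.induction with
    | h0 => rw [mul_zero]; exact smul_zero (A := Γ ⊗[A] S) (η a)
    | hadd x y hx hy => rw [mul_add, ← hx, ← hy]; exact smul_add (A := Γ ⊗[A] S) (η a) x y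
    | hmk γ m => exact (mk_mul_mk (η := η) (η a) γ 1 m).trans (by rw [one_mul]; rfl) |>.symm


end Ring

end Cofree

/-- `Γ` as an `A`-algebra through the right unit. -/
def RightUnit (_η : A →+* Γ) : Type := Γ

instance : CommRing (RightUnit η) := inferInstanceAs (CommRing Γ)
instance : Algebra A (RightUnit η) := η.toAlgebra

/-- The identity map from `Γ`. -/
def RightUnit.of : Γ →+* RightUnit η := RingHom.id Γ

lemma RightUnit.smul_of (a : A) (x : Γ) : a • RightUnit.of η x = RightUnit.of η (η a * x) := rfl

lemma RightUnit.exists_of (x : RightUnit η) : ∃ y : Γ, RightUnit.of η y = x := ⟨x, rfl⟩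

end Cofree

/-- The structure maps of a Hopf algebroid `(A, Γ)` (without the conjugation, which plays no role
for comodules), with their compatibilities with the units. The left unit is the algebra map.
The target of `Δ` is the tensor product `Γ ⊗_A Γ` of the right `A`-module `Γ` with the left
`A`-module `Γ`; recall that `mk x y` is the tensor `y ⊗ x`. -/
structure HopfData (A Γ : Type) [CommRing A] [CommRing Γ] [Algebra A Γ] where
  ηR : A →+* Γ
  Δ : Γ →+* Cofree ηR (RightUnit ηR)
  ε : Γ →ₐ[A] A
  ε_ηR : ∀ a, ε (ηR a) = a
  Δ_ηL : ∀ a, Δ (algebraMap A Γ a) = Cofree.mk ηR 1 (RightUnit.of ηR (algebraMap A Γ a))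
  Δ_ηR : ∀ a, Δ (ηR a) = Cofree.mk ηR (ηR a) 1

namespace HopfData

variable {A Γ : Type} [CommRing A] [CommRing Γ] [Algebra A Γ] (H : HopfData A Γ)
  (M : Type u) [AddCommGroup M] [Module A M] {N : Type w} [AddCommGroup N] [Module A N]

/-- `Δ` as an `A`-linear map for the right units. -/
def Δl : RightUnit H.ηR →ₗ[A] Cofree H.ηR (RightUnit H.ηR) where
  toFun := fun x => H.Δ x
  map_add' := fun x y => _root_.map_add H.Δ x y
  map_smul' := fun a x => by
    have h : ∀ y : Γ, H.Δ (H.ηR a * y) = H.Δ (H.ηR a) * H.Δ y := fun y => _root_.map_mul _ _ _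
    rw [H.Δ_ηR] at h
    refine (h x).trans ?_
    change _ = a • H.Δ x
    generalize H.Δ x = z
    induction z using Cofree.induction with
    | h0 => rw [mul_zero, smul_zero]
    | hadd x y hx hy => rw [mul_add, hx, hy, smul_add]
    | hmk x y => rw [Cofree.mk_mul_mk, one_mul, Cofree.asmul_mk]

lemma Δl_of (x : Γ) : H.Δl (RightUnit.of H.ηR x) = H.Δ x := rfl

variable {M} in
/-- `γ ↦ m ⊗ γ`. -/
def ins (m : M) : RightUnit H.ηR →ₗ[A] Cofree H.ηR M where
  toFun := fun γ => Cofree.mk H.ηR (γ : Γ) m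
  map_add' := fun x y => Cofree.add_mk H.ηR x y m
  map_smul' := fun _ _ => rfl

@[simp] lemma ins_of (m : M) (γ : Γ) : H.ins m (RightUnit.of H.ηR γ) = Cofree.mk H.ηR γ m := rfl

variable {M} in
lemma ins_add (m m' : M) : H.ins (m + m') = H.ins m + H.ins m' :=
  LinearMap.ext fun γ => Cofree.mk_add H.ηR γ m m'

lemma ins_zero : H.ins (0 : M) = 0 := LinearMap.ext fun γ => Cofree.mk_zero H.ηR γ

variable {M} in
lemma map_ins_smul (m : M) (a : A) (z : Cofree H.ηR (RightUnit H.ηR)) :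
    Cofree.map H.ηR (H.ins m) (Cofree.mk H.ηR 1 (RightUnit.of H.ηR (algebraMap A Γ a)) * z) =
      Cofree.map H.ηR (H.ins (a • m)) z := by
  induction z using Cofree.induction with
  | h0 => rw [mul_zero, _root_.map_zero, _root_.map_zero]
  | hadd x y hx hy => rw [mul_add, _root_.map_add, hx, hy, _root_.map_add]
  | hmk x y =>
    obtain ⟨y, rfl⟩ := RightUnit.exists_of _ y
    rw [Cofree.mk_mul_mk, one_mul, ← _root_.map_mul, Cofree.map_mk, Cofree.map_mk, ins_of, ins_of,
      Cofree.mk_smul]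

/-- Auxiliary biadditive map for the comultiplication of the cofree comodule. -/
def δAux : Γ →+ M →+ Cofree H.ηR (Cofree H.ηR M) where
  toFun := fun γ =>
    { toFun := fun m => Cofree.map H.ηR (H.ins m) (H.Δ γ)
      map_zero' := by rw [ins_zero, Cofree.map_zero', LinearMap.zero_apply]
      map_add' := fun m m' => by rw [ins_add, Cofree.map_add', LinearMap.add_apply] }
  map_zero' := AddMonoidHom.ext fun m => by
    rw [AddMonoidHom.coe_mk, ZeroHom.coe_mk, _root_.map_zero, _root_.map_zero]; rfl
  map_add' := fun γ γ' => AddMonoidHom.ext fun m => by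
    rw [AddMonoidHom.coe_mk, ZeroHom.coe_mk, _root_.map_add, _root_.map_add]; rfl

lemma δAux_apply (γ : Γ) (m : M) :
    H.δAux M γ m = Cofree.map H.ηR (H.ins m) (H.Δ γ) := rfl

/-- The comultiplication `id ⊗ Δ : M ⊗_A Γ → M ⊗_A Γ ⊗_A Γ` of the cofree comodule. -/
def δ : Cofree H.ηR M →ₗ[A] Cofree H.ηR (Cofree H.ηR M) where
  toFun := Cofree.lift (H.δAux M) fun a γ m => by
    rw [δAux_apply, δAux_apply, _root_.map_mul, H.Δ_ηL, map_ins_smul]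
  map_add' := fun x y => _root_.map_add _ x y
  map_smul' := fun a z => by
    induction z using Cofree.induction with
    | h0 => rw [smul_zero, _root_.map_zero, smul_zero]
    | hadd x y hx hy => rw [smul_add, _root_.map_add, hx, hy, _root_.map_add, smul_add]
    | hmk γ m =>
      rw [Cofree.asmul_mk, Cofree.lift_mk, Cofree.lift_mk, RingHom.id_apply, δAux_apply, δAux_apply,
        ← _root_.map_smul]
      congr 1
      exact _root_.map_smul H.Δl a (RightUnit.of H.ηR γ)

lemma δ_mk (γ : Γ) (m : M) :
    H.δ M (Cofree.mk H.ηR γ m) = Cofree.map H.ηR (H.ins m) (H.Δ γ) := rfl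

variable {M} in
lemma δ_natural (f : M →ₗ[A] N) :
    Cofree.map H.ηR (Cofree.map H.ηR f) ∘ₗ H.δ M = H.δ N ∘ₗ Cofree.map H.ηR f := by
  refine Cofree.lin_ext fun γ m => ?_
  have : Cofree.map H.ηR f ∘ₗ H.ins m = H.ins (f m) := LinearMap.ext fun _ => rfl
  rw [LinearMap.comp_apply, LinearMap.comp_apply, δ_mk, Cofree.map_mk, δ_mk,
    ← LinearMap.comp_apply, ← Cofree.map_comp, this]

variable {M} in
lemma δ_one (m : M) : H.δ M (Cofree.one H.ηR m) = Cofree.one H.ηR (Cofree.one H.ηR m) := by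
  change H.δ M (Cofree.mk H.ηR 1 m) = _
  rw [δ_mk, _root_.map_one]
  rfl

/-- The counit `id ⊗ ε : M ⊗_A Γ → M`. -/
def counit : Cofree H.ηR M →ₗ[A] M where
  toFun := Cofree.lift
    { toFun := fun γ => DistribSMul.toAddMonoidHom M (H.ε γ)
      map_zero' := AddMonoidHom.ext fun m => by
        rw [_root_.map_zero]; exact zero_smul A m
      map_add' := fun γ γ' => AddMonoidHom.ext fun m => by
        rw [_root_.map_add]; exact add_smul (H.ε γ) (H.ε γ') m }
    (fun a γ m => by
      change H.ε (algebraMap A Γ a * γ) • m = H.ε γ • a • m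
      rw [_root_.map_mul, AlgHom.commutes, smul_smul, mul_comm]; rfl)
  map_add' := fun x y => _root_.map_add _ x y
  map_smul' := fun a z => by
    induction z using Cofree.induction with
    | h0 => rw [smul_zero, _root_.map_zero, smul_zero]
    | hadd x y hx hy => rw [smul_add, _root_.map_add, hx, hy, _root_.map_add, smul_add]
    | hmk γ m =>
      change H.ε (H.ηR a * γ) • m = a • H.ε γ • m
      rw [_root_.map_mul, H.ε_ηR, mul_smul]

@[simp] lemma counit_mk (γ : Γ) (m : M) : H.counit M (Cofree.mk H.ηR γ m) = H.ε γ • m := rfl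

variable {M} in
lemma counit_natural (f : M →ₗ[A] N) : H.counit N ∘ₗ Cofree.map H.ηR f = f ∘ₗ H.counit M :=
  Cofree.lin_ext fun γ m => by simp

lemma counit_mu : H.counit (M ⊗[A] N) ∘ₗ Cofree.mu H.ηR M N =
    TensorProduct.map (H.counit M) (H.counit N) := by
  refine TensorProduct.ext' fun x y => ?_
  rw [LinearMap.comp_apply, TensorProduct.map_tmul]
  induction x using Cofree.induction with
  | h0 => simp only [TensorProduct.zero_tmul, _root_.map_zero]
  | hadd x y hx hy => simp only [_root_.map_add, TensorProduct.add_tmul, hx, hy]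
  | hmk γ m =>
    induction y using Cofree.induction with
    | h0 => simp only [TensorProduct.tmul_zero, _root_.map_zero]
    | hadd x y hx hy => simp only [_root_.map_add, TensorProduct.tmul_add, hx, hy]
    | hmk γ' n =>
      rw [Cofree.mu_mk, counit_mk, counit_mk, counit_mk, _root_.map_mul,
        TensorProduct.smul_tmul_smul]

/-- `ε` as an `A`-linear map for the right unit. -/
def εl : RightUnit H.ηR →ₗ[A] A where
  toFun := fun x => H.ε x
  map_add' := fun x y => _root_.map_add H.ε x y
  map_smul' := fun a x => by
    have h : ∀ y : Γ, H.ε (H.ηR a * y) = H.ε (H.ηR a) * H.ε y := fun y => _root_.map_mul _ _ _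
    rw [H.ε_ηR] at h
    exact h x

end HopfData

/-- A (commutative) Hopf algebroid: coassociativity `(id ⊗ Δ) Δ = (Δ ⊗ id) Δ` and the two counit
laws. The conjugation is omitted, as it plays no role for comodules. -/
structure HopfAlgebroid (A Γ : Type) [CommRing A] [CommRing Γ] [Algebra A Γ] extends
    HopfData A Γ where
  coassoc : ∀ x : Γ, Cofree.map ηR toHopfData.Δl (Δ x) = toHopfData.δ (RightUnit ηR) (Δ x)
  counit_Δ : ∀ x : Γ, toHopfData.counit (RightUnit ηR) (Δ x) = RightUnit.of ηR x
  counit_Δ' : ∀ x : Γ, Cofree.map ηR toHopfData.εl (Δ x) = Cofree.mk ηR x 1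

namespace HopfAlgebroid

variable {A Γ : Type} [CommRing A] [CommRing Γ] [Algebra A Γ] (H : HopfAlgebroid A Γ)
  (M : Type u) [AddCommGroup M] [Module A M] (N : Type w) [AddCommGroup N] [Module A N]

lemma δ_coassoc : Cofree.map H.ηR (H.δ M) ∘ₗ H.δ M = H.δ (Cofree H.ηR M) ∘ₗ H.δ M := by
  refine Cofree.lin_ext fun γ m => ?_
  have e1 : H.δ M ∘ₗ H.ins m = Cofree.map H.ηR (H.ins m) ∘ₗ H.Δl :=
    LinearMap.ext fun x => H.δ_mk M x m
  rw [LinearMap.comp_apply, LinearMap.comp_apply, HopfData.δ_mk, ← LinearMap.comp_apply,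
    ← Cofree.map_comp, e1, Cofree.map_comp, LinearMap.comp_apply, H.coassoc,
    ← LinearMap.comp_apply, ← LinearMap.comp_apply, HopfData.δ_natural]

lemma counit_δ : H.counit (Cofree H.ηR M) ∘ₗ H.δ M = LinearMap.id := by
  refine Cofree.lin_ext fun γ m => ?_
  rw [LinearMap.comp_apply, HopfData.δ_mk, ← LinearMap.comp_apply, HopfData.counit_natural,
    LinearMap.comp_apply, H.counit_Δ]
  rfl

lemma δ_mu : H.δ (M ⊗[A] N) ∘ₗ Cofree.mu H.ηR M N =
    Cofree.map H.ηR (Cofree.mu H.ηR M N) ∘ₗ Cofree.mu H.ηR (Cofree H.ηR M) (Cofree H.ηR N) ∘ₗ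
      TensorProduct.map (H.δ M) (H.δ N) := by
  refine TensorProduct.ext' fun x y => ?_
  induction x using Cofree.induction with
  | h0 => rw [TensorProduct.zero_tmul, map_zero, map_zero]
  | hadd x y hx hy => rw [TensorProduct.add_tmul, map_add, map_add, hx, hy]
  | hmk γ m =>
    induction y using Cofree.induction with
    | h0 => rw [TensorProduct.tmul_zero, map_zero, map_zero]
    | hadd x y hx hy => rw [TensorProduct.tmul_add, map_add, map_add, hx, hy]
    | hmk γ' n =>
      simp only [LinearMap.comp_apply, TensorProduct.map_tmul, Cofree.mu_mk, HopfData.δ_mk]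
      rw [map_mul]
      generalize H.Δ γ = z
      generalize H.Δ γ' = z'
      induction z using Cofree.induction with
      | h0 => rw [zero_mul, map_zero, map_zero, TensorProduct.zero_tmul, map_zero, map_zero]
      | hadd x y hx hy =>
        rw [add_mul, map_add, map_add, TensorProduct.add_tmul, map_add, map_add, hx, hy]
      | hmk a b =>
        obtain ⟨b, rfl⟩ := RightUnit.exists_of _ b
        induction z' using Cofree.induction with
        | h0 => rw [mul_zero, map_zero, map_zero, TensorProduct.tmul_zero, map_zero, map_zero]
        | hadd x y hx hy =>
          rw [mul_add, map_add, map_add, TensorProduct.tmul_add, map_add, map_add, hx, hy]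
        | hmk c d =>
          obtain ⟨d, rfl⟩ := RightUnit.exists_of _ d
          rw [Cofree.mk_mul_mk, ← map_mul]
          simp only [Cofree.map_mk, HopfData.ins_of, Cofree.mu_mk]

end HopfAlgebroid

section FrobeniusLift

variable {p : ℕ} {S : Type*} [CommRing S]

/-- Extension of a lift of Frobenius to a polynomial ring. -/
def polyLift (p : ℕ) (τ : Type*) (σ : S →+* S) : MvPolynomial τ S →+* MvPolynomial τ S :=
  MvPolynomial.eval₂Hom (MvPolynomial.C.comp σ) fun i => MvPolynomial.X i ^ p

lemma polyLift_dvd (hp : p.Prime) (τ : Type*) (σ : S →+* S) (hσ : ∀ x, (p : S) ∣ x ^ p - σ x)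
    (f : MvPolynomial τ S) : (p : MvPolynomial τ S) ∣ f ^ p - polyLift p τ σ f := by
  induction f using MvPolynomial.induction_on with
  | C a =>
    obtain ⟨c, hc⟩ := hσ a
    refine ⟨MvPolynomial.C c, ?_⟩
    simp only [polyLift, MvPolynomial.coe_eval₂Hom, MvPolynomial.eval₂_C, RingHom.comp_apply]
    rw [← map_pow, ← map_sub, hc, map_mul, map_natCast]
  | add f g hf hg =>
    obtain ⟨r, hr⟩ := exists_add_pow_prime_eq hp f g
    have := dvd_add (dvd_add hf hg) (dvd_mul_right (p : MvPolynomial τ S) (f * g * r))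
    rw [map_add, hr]
    convert this using 1
    ring
  | mul_X f i hf =>
    have h1 : polyLift p τ σ (MvPolynomial.X i) = MvPolynomial.X i ^ p := by simp [polyLift]
    rw [map_mul, h1, mul_pow, ← sub_mul]
    exact hf.mul_right _

lemma pow_iter_dvd (σ : S →+* S) (hσ : ∀ x, (p : S) ∣ x ^ p - σ x) (x : S) (e b : ℕ) :
    (p : S) ^ (e + 1) ∣ x ^ p ^ (b + e) - (σ ^ b) (x ^ p ^ e) := by
  have hσb : ∀ b, (p : S) ∣ x ^ p ^ b - (σ ^ b) x := by
    intro b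
    induction b with
    | zero => simp
    | succ b ih =>
      have h1 : (p : S) ∣ x ^ p ^ (b + 1) - ((σ ^ b) x) ^ p := by
        rw [pow_succ, pow_mul]
        exact ih.trans (sub_dvd_pow_sub_pow _ _ _)
      have := dvd_add h1 (hσ ((σ ^ b) x))
      rw [sub_add_sub_cancel] at this
      rwa [pow_succ' σ]
  rw [pow_add p, pow_mul, map_pow]
  exact dvd_sub_pow_of_dvd_sub (hσb b) e

lemma hlog_injective (hp : p ≠ 0) (hreg : ∀ x : S, (p : S) * x = 0 → x = 0) (a b : ℕ → S)
    (h : ∀ n, hlog p a n = hlog p b n) (n : ℕ) : a n = b n := by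
  have hreg' : ∀ (k : ℕ) (x : S), (p : S) ^ k * x = 0 → x = 0 := by
    intro k
    induction k with
    | zero => simp
    | succ k ih => intro x hx; rw [pow_succ, mul_assoc] at hx; exact hreg _ (ih _ hx)
  induction n using Nat.strong_induction_on with
  | _ n ih =>
    have h1 := h (n + 1)
    rw [hlog_succ, hlog_succ] at h1
    cases n with
    | zero => simpa [hlog_zero] using h1
    | succ n =>
      rw [Finset.Nat.sum_antidiagonal_succ, Finset.Nat.sum_antidiagonal_succ] at h1
      have h2 : ∀ x ∈ Finset.HasAntidiagonal.antidiagonal n,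
          (p : S) ^ x.2 * hlog p a (x.1 + 1) * a x.2 ^ p ^ (x.1 + 1) =
          (p : S) ^ x.2 * hlog p b (x.1 + 1) * b x.2 ^ p ^ (x.1 + 1) := fun x hx => by
        have := Finset.HasAntidiagonal.mem_antidiagonal.1 hx
        rw [h, ih x.2 (by omega)]
      rw [Finset.sum_congr rfl h2] at h1
      simp only [hlog_zero, pow_zero, pow_one, mul_one] at h1
      rw [← sub_eq_zero]
      apply hreg' (n + 1)
      linear_combination h1

end FrobeniusLift

section Integrality

open Finset.HasAntidiagonal Finset.Nat

variable {p : ℕ} {S : Type*} [CommRing S]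

/-- For sequences `v = (v_1, v_2, …)` and `t = (t_0, t_1, …)`, the element
`p ^ n * ∑_{i + j = n} ℓ i * t_j ^ (p ^ i)`. -/
def rlog (p : ℕ) (v t : ℕ → S) (n : ℕ) : S :=
  ∑ x ∈ antidiagonal n, (p : S) ^ x.2 * hlog p v x.1 * t x.2 ^ p ^ x.1

lemma map_rlog {T : Type*} [CommRing T] (f : S →+* T) (v t : ℕ → S) (n : ℕ) :
    f (rlog p v t n) = rlog p (fun i => f (v i)) (fun i => f (t i)) n := by
  simp only [rlog, map_sum, map_mul, map_pow, map_natCast, map_hlog]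

lemma sum_ite_fst (n : ℕ) (f : ℕ → S) :
    ∑ x ∈ antidiagonal n, (if x.1 = 0 then f x.2 else 0) = f n := by
  rw [Finset.sum_eq_single (0, n)]
  · simp
  · rintro ⟨a, b⟩ h h'
    have := mem_antidiagonal.1 h
    simp only at this ⊢
    rw [if_neg]
    rintro rfl
    simp at this; exact h' (by rw [this])
  · simp

lemma sum_pow_dvd (σ : S →+* S) (hσ : ∀ x, (p : S) ∣ x ^ p - σ x)
    {ι : Type*} (s : Finset ι) (f : ι → S) (e b : ℕ) :
    (p : S) ^ (e + 1) ∣ ∑ i ∈ s, f i ^ p ^ (b + e) - (σ ^ b) (∑ i ∈ s, f i ^ p ^ e) := by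
  rw [map_sum, ← Finset.sum_sub_distrib]
  exact Finset.dvd_sum fun i _ => pow_iter_dvd σ hσ _ _ _

lemma rlog_conv (v : ℕ → S) (t u : ℕ → S) (n : ℕ) :
    ∑ x ∈ antidiagonal n, (p : S) ^ x.2 * rlog p v t x.1 * u x.2 ^ p ^ x.1 =
      ∑ x ∈ antidiagonal n, (p : S) ^ x.2 * hlog p v x.1 *
        ∑ y ∈ antidiagonal x.2, (t y.1 * u y.2 ^ p ^ y.1) ^ p ^ x.1 := by
  calc _ = ∑ x ∈ antidiagonal n, ∑ y ∈ antidiagonal x.1, (p : S) ^ (y.2 + x.2) *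
        hlog p v y.1 * (t y.2 * u x.2 ^ p ^ y.2) ^ p ^ y.1 := by
        refine Finset.sum_congr rfl fun x hx => ?_
        rw [rlog, Finset.mul_sum, Finset.sum_mul]
        refine Finset.sum_congr rfl fun y hy => ?_
        have hy' := mem_antidiagonal.1 hy
        rw [mul_pow, ← pow_mul, ← pow_add, add_comm y.2 y.1, hy', pow_add]; ring
    _ = _ := by
        rw [sum_antidiagonal_assoc n (fun a b c =>
            (p : S) ^ (b + c) * hlog p v a * (t b * u c ^ p ^ b) ^ p ^ a)]
        refine Finset.sum_congr rfl fun x hx => ?_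
        rw [Finset.mul_sum]
        refine Finset.sum_congr rfl fun y hy => ?_
        rw [mem_antidiagonal.1 hy]

lemma p_mul_rlog (hp0 : p ≠ 0) (v t : ℕ → S) (n : ℕ) : (p : S) * rlog p v t n =
    p ^ (n + 1) * t n + ∑ x ∈ antidiagonal n, (p : S) ^ x.2 * hlog p v x.1 *
        ∑ y ∈ antidiagonal x.2, (sh v y.1 * t y.2 ^ p ^ y.1) ^ p ^ x.1 := by
  rw [rlog, Finset.mul_sum]
  calc _ = ∑ x ∈ antidiagonal n, ((if x.1 = 0 then (p : S) ^ (x.2 + 1) * t x.2 else 0) +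
        ∑ y ∈ antidiagonal x.1, (p : S) ^ (y.2 + x.2) * hlog p v y.1 *
          (sh v y.2 * t x.2 ^ p ^ y.2) ^ p ^ y.1) := by
        refine Finset.sum_congr rfl fun x hx => ?_
        have : (p : S) * (p ^ x.2 * hlog p v x.1 * t x.2 ^ p ^ x.1) =
          p ^ x.2 * (p * hlog p v x.1) * t x.2 ^ p ^ x.1 := by ring
        rw [this, p_mul_hlog hp0, mul_add, add_mul, Finset.mul_sum, Finset.sum_mul]
        congr 1
        · split_ifs with h
          · rw [h]; ring
          · ring
        · refine Finset.sum_congr rfl fun y hy => ?_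
          have hy' := mem_antidiagonal.1 hy
          rw [mul_pow, ← pow_mul, ← pow_add, add_comm y.2 y.1, hy']; ring
    _ = _ := by
        rw [Finset.sum_add_distrib, sum_antidiagonal_assoc n (fun a b c =>
            (p : S) ^ (b + c) * hlog p v a * (sh v b * t c ^ p ^ b) ^ p ^ a),
          sum_ite_fst n (fun m => (p : S) ^ (m + 1) * t m)]
        congr 1
        refine Finset.sum_congr rfl fun x hx => ?_
        rw [Finset.mul_sum]
        refine Finset.sum_congr rfl fun y hy => ?_
        rw [mem_antidiagonal.1 hy]

/-- Integrality of the right unit. -/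
lemma exists_hlog_eq_rlog (hp0 : p ≠ 0) (hreg : ∀ x : S, (p : S) * x = 0 → x = 0) (σ : S →+* S)
    (hσ : ∀ x, (p : S) ∣ x ^ p - σ x) (v t : ℕ → S) (hσv : ∀ i, σ (v i) = v i ^ p)
    (ht : t 0 = 1) : ∃ w : ℕ → S, ∀ n, hlog p w n = rlog p v t n := by
  let X' : ℕ → S := fun i => t (i + 1)
  obtain ⟨w, hw⟩ := exists_curve σ v hp0 hreg hσ hσv
    (fun m w a => ∑ x ∈ antidiagonal m, (sh v x.1 * t x.2 ^ p ^ x.1) ^ p ^ a -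
      ∑ x ∈ antidiagonal m, (sh X' x.1 * w x.2 ^ p ^ x.1) ^ p ^ a)
    (fun n w w' h => by
      funext a
      congr 1
      refine Finset.sum_congr rfl fun x hx => ?_
      rcases Nat.eq_zero_or_pos x.1 with h0 | h0
      · simp [h0, sh]
      · have := mem_antidiagonal.1 hx
        rw [h x.2 (by omega)])
    (fun w m e b => by
      have := dvd_sub (sum_pow_dvd σ hσ (antidiagonal m)
        (fun x => sh v x.1 * t x.2 ^ p ^ x.1) e b)
        (sum_pow_dvd σ hσ (antidiagonal m) (fun x => sh X' x.1 * w x.2 ^ p ^ x.1) e b)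
      rw [map_sub]
      convert this using 1
      ring)
    (fun n => - sh X' n)
  have hw0 : w 0 = 0 := by
    have := hw 0
    simpa [sh, hp0, hlog_zero] using this
  have hsh : sh (fun i => w (i + 1)) = w := by
    funext i; cases i with
    | zero => exact hw0.symm
    | succ i => rfl
  have hG : ∀ m a, ∑ x ∈ antidiagonal m, (sh X' x.1 * w x.2 ^ p ^ x.1) ^ p ^ a + w m ^ p ^ a =
      ∑ x ∈ antidiagonal m, (t x.1 * w x.2 ^ p ^ x.1) ^ p ^ a := by
    intro m a
    cases m with
    | zero => simp [sh, ht, hp0]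
    | succ m =>
      rw [sum_antidiagonal_succ, sum_antidiagonal_succ]
      simp [sh, ht, hp0, X', add_comm]
  have I3 : ∀ n, (p : S) * rlog p v t n = (if n = 0 then (p : S) else 0) +
      ∑ x ∈ antidiagonal n, (p : S) ^ x.2 * rlog p v t x.1 * w x.2 ^ p ^ x.1 := by
    intro n
    have h1 : ∑ x ∈ antidiagonal n, (p : S) ^ x.2 * hlog p v x.1 *
        ∑ y ∈ antidiagonal x.2, (sh v y.1 * t y.2 ^ p ^ y.1) ^ p ^ x.1 -
        ∑ x ∈ antidiagonal n, (p : S) ^ x.2 * hlog p v x.1 *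
        ∑ y ∈ antidiagonal x.2, (t y.1 * w y.2 ^ p ^ y.1) ^ p ^ x.1 =
        p ^ (n + 1) * - sh X' n := by
      rw [← hw n, ← Finset.sum_sub_distrib]
      refine Finset.sum_congr rfl fun x hx => ?_
      rw [← hG]; ring
    have h2 : (p : S) ^ (n + 1) * t n - p ^ (n + 1) * sh X' n =
        if n = 0 then (p : S) else 0 := by
      cases n with
      | zero => simp [sh, ht]
      | succ n => simp [sh, X']
    rw [p_mul_rlog hp0, rlog_conv]
    linear_combination h1 + h2
  refine ⟨fun i => w (i + 1), fun n => ?_⟩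
  induction n using Nat.strong_induction_on with
  | _ n ih =>
    rw [← sub_eq_zero]
    apply hreg
    rw [mul_sub, I3, p_mul_hlog hp0, hsh, add_sub_add_left_eq_sub, ← Finset.sum_sub_distrib]
    refine Finset.sum_eq_zero fun x hx => ?_
    have hx' := mem_antidiagonal.1 hx
    rcases Nat.eq_zero_or_pos x.2 with h | h
    · rw [h, hw0, zero_pow (pow_ne_zero _ hp0)]; ring
    · rw [ih x.1 (by omega), sub_self]

/-- Integrality of the comultiplication. -/
lemma exists_rlog_eq (hp0 : p ≠ 0) (hreg : ∀ x : S, (p : S) * x = 0 → x = 0) (σ : S →+* S)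
    (hσ : ∀ x, (p : S) ∣ x ^ p - σ x) (v t t' : ℕ → S) (hσv : ∀ i, σ (v i) = v i ^ p)
    (ht : t 0 = 1) (ht' : t' 0 = 1) : ∃ c : ℕ → S, c 0 = 1 ∧ ∀ n, rlog p v c n =
      ∑ x ∈ antidiagonal n, (p : S) ^ x.2 * rlog p v t x.1 * t' x.2 ^ p ^ x.1 := by
  obtain ⟨c, hc⟩ := exists_curve σ v hp0 hreg hσ hσv
    (fun m _ a => ∑ x ∈ antidiagonal m, (t x.1 * t' x.2 ^ p ^ x.1) ^ p ^ a)
    (fun _ _ _ _ => rfl)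
    (fun _ m e b => sum_pow_dvd σ hσ _ _ e b)
    (fun _ => 0)
  refine ⟨c, ?_, fun n => ?_⟩
  · have := hc 0
    simp [hlog_zero, ht, ht'] at this
    linear_combination -this
  · rw [rlog_conv, rlog, ← sub_eq_zero, ← Finset.sum_sub_distrib]
    have h2 := hc n
    rw [mul_zero] at h2
    rw [← neg_eq_zero, ← h2, ← Finset.sum_neg_distrib]
    refine Finset.sum_congr rfl fun x hx => ?_
    ring

end Integrality

section BP

variable (p : ℕ) [hp : Fact p.Prime]

instance spanIsPrime : (Ideal.span {(p : ℤ)}).IsPrime :=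
  (Ideal.span_singleton_prime (by exact_mod_cast hp.out.ne_zero)).2
    (Nat.prime_iff_prime_int.1 hp.out)

/-- The ring `ℤ_(p)`. -/
abbrev ZLoc : Type := Localization.AtPrime (Ideal.span {(p : ℤ)})

lemma ZLoc.le : (Ideal.span {(p : ℤ)}).primeCompl ≤ nonZeroDivisors ℤ := by
  intro x hx
  rw [mem_nonZeroDivisors_iff_ne_zero]
  rintro rfl
  exact hx (Ideal.zero_mem _)

instance : IsDomain (ZLoc p) := IsLocalization.isDomain_localization (ZLoc.le p)

instance : CharZero (ZLoc p) :=
  charZero_of_injective_algebraMap (R := ℤ) (IsLocalization.injective (ZLoc p) (ZLoc.le p))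

lemma ZLoc.dvd (x : ZLoc p) : (p : ZLoc p) ∣ x ^ p - x := by
  obtain ⟨⟨a, s⟩, h⟩ := IsLocalization.surj (Ideal.span {(p : ℤ)}).primeCompl x
  simp only at h
  have hu : IsUnit (algebraMap ℤ (ZLoc p) s ^ (p + 1)) :=
    (IsLocalization.map_units (ZLoc p) s).pow _
  rw [← hu.dvd_mul_right]
  have e : (x ^ p - x) * algebraMap ℤ (ZLoc p) s ^ (p + 1) =
      algebraMap ℤ (ZLoc p) (s * a ^ p - a * (s : ℤ) ^ p) := by
    rw [map_sub, map_mul, map_mul, map_pow, map_pow, ← h]; ring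
  rw [e]
  have : (p : ℤ) ∣ s * a ^ p - a * (s : ℤ) ^ p := by
    rw [← ZMod.intCast_zmod_eq_zero_iff_dvd]
    push_cast
    rw [ZMod.pow_card, ZMod.pow_card]; ring
  simpa using map_dvd (algebraMap ℤ (ZLoc p)) this

/-- `BP_{2*} = ℤ_(p)[v_1, v_2, …]` (Hazewinkel generators). -/
def BP : Type := MvPolynomial ℕ (ZLoc p)

instance : CommRing (BP p) := inferInstanceAs (CommRing (MvPolynomial ℕ (ZLoc p)))
instance : IsDomain (BP p) := inferInstanceAs (IsDomain (MvPolynomial ℕ (ZLoc p)))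
instance : CharZero (BP p) := inferInstanceAs (CharZero (MvPolynomial ℕ (ZLoc p)))
instance : Algebra (ZLoc p) (BP p) := inferInstanceAs (Algebra (ZLoc p) (MvPolynomial ℕ (ZLoc p)))

/-- The generator `v_{i+1}`. -/
def vgen (i : ℕ) : BP p := (MvPolynomial.X i : MvPolynomial ℕ (ZLoc p))

/-- `BP_{2*}BP = BP_{2*}[t_1, t_2, …]`; its structure of `BP_{2*}`-algebra is the left unit. -/
def BPBP : Type := MvPolynomial ℕ (BP p)

instance : CommRing (BPBP p) := inferInstanceAs (CommRing (MvPolynomial ℕ (BP p)))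
instance : IsDomain (BPBP p) := inferInstanceAs (IsDomain (MvPolynomial ℕ (BP p)))
instance : CharZero (BPBP p) := inferInstanceAs (CharZero (MvPolynomial ℕ (BP p)))
instance : Algebra (BP p) (BPBP p) := inferInstanceAs (Algebra (BP p) (MvPolynomial ℕ (BP p)))
instance : Module.Flat (BP p) (BPBP p) :=
  inferInstanceAs (Module.Flat (BP p) (MvPolynomial ℕ (BP p)))

/-- The sequence `t_0 = 1, t_1, t_2, …` -/
def tgen : ℕ → BPBP p
  | 0 => 1
  | i + 1 => (MvPolynomial.X i : MvPolynomial ℕ (BP p))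

/-- The image of `v_{i+1}` under the left unit. -/
def vL (i : ℕ) : BPBP p := algebraMap (BP p) (BPBP p) (vgen p i)

lemma zloc_hom_ext {S : Type*} [CommRing S] (f g : ZLoc p →+* S) : f = g :=
  IsLocalization.ringHom_ext (Ideal.span {(p : ℤ)}).primeCompl (RingHom.ext_int _ _)

/-- Ring homomorphisms out of `BP_{2*}` from the images of the generators. -/
def BP.lift {S : Type*} [CommRing S] (f : ZLoc p →+* S) (w : ℕ → S) : BP p →+* S :=
  (MvPolynomial.eval₂Hom f w : MvPolynomial ℕ (ZLoc p) →+* S)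

@[simp] lemma BP.lift_vgen {S : Type*} [CommRing S] (f : ZLoc p →+* S) (w : ℕ → S) (i : ℕ) :
    BP.lift p f w (vgen p i) = w i := MvPolynomial.eval₂_X f w i

/-- Ring homomorphisms out of `BP_{2*}BP` from their restriction along the left unit and the images
of the generators. -/
def BPBP.lift {S : Type*} [CommRing S] (f : BP p →+* S) (w : ℕ → S) : BPBP p →+* S :=
  (MvPolynomial.eval₂Hom f w : MvPolynomial ℕ (BP p) →+* S)

@[simp] lemma BPBP.lift_tgen {S : Type*} [CommRing S] (f : BP p →+* S) (w : ℕ → S) (i : ℕ) :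
    BPBP.lift p f w (tgen p (i + 1)) = w i := MvPolynomial.eval₂_X f w i

@[simp] lemma BPBP.lift_left {S : Type*} [CommRing S] (f : BP p →+* S) (w : ℕ → S) (a : BP p) :
    BPBP.lift p f w (algebraMap (BP p) (BPBP p) a) = f a := MvPolynomial.eval₂_C f w a

lemma mul_reg {S : Type*} [CommRing S] [IsDomain S] [CharZero S] (x : S) (h : (p : S) * x = 0) :
    x = 0 :=
  (mul_eq_zero.1 h).resolve_left (by exact_mod_cast hp.out.ne_zero)

lemma bp_hom_ext {S : Type*} [CommRing S] (hreg : ∀ x : S, (p : S) * x = 0 → x = 0)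
    (f g : BP p →+* S)
    (h : ∀ n, f (hlog p (vgen p) n) = g (hlog p (vgen p) n)) : f = g := by
  refine MvPolynomial.ringHom_ext (f := f) (g := g) (fun r => ?_) (fun i => ?_)
  · exact RingHom.congr_fun (zloc_hom_ext p (f.comp MvPolynomial.C) (g.comp MvPolynomial.C)) r
  · refine hlog_injective hp.out.ne_zero hreg (fun i => f (vgen p i))
      (fun i => g (vgen p i)) (fun n => ?_) i
    rw [← map_hlog, ← map_hlog, h]

/-- A lift of Frobenius on `BP_{2*}BP`. -/
lemma exists_frob : ∃ σ : BPBP p →+* BPBP p, (∀ x, (p : BPBP p) ∣ x ^ p - σ x) ∧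
    ∀ i, σ (vL p i) = vL p i ^ p := by
  let σ₀ : BP p →+* BP p := polyLift p ℕ (RingHom.id (ZLoc p))
  have h₀ : ∀ x, (p : BP p) ∣ x ^ p - σ₀ x := polyLift_dvd hp.out ℕ _ (ZLoc.dvd p)
  have hv : ∀ i, σ₀ (vgen p i) = vgen p i ^ p := fun i => MvPolynomial.eval₂_X _ _ i
  refine ⟨polyLift p ℕ σ₀, polyLift_dvd hp.out ℕ _ h₀, fun i => ?_⟩
  refine (MvPolynomial.eval₂_C _ _ (vgen p i)).trans ?_
  change algebraMap (BP p) (BPBP p) (σ₀ (vgen p i)) = _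
  rw [hv, map_pow]
  rfl

lemma exists_etaR : ∃ w : ℕ → BPBP p, ∀ n, hlog p w n = rlog p (vL p) (tgen p) n := by
  obtain ⟨σ, hσ, hv⟩ := exists_frob p
  exact exists_hlog_eq_rlog hp.out.ne_zero (mul_reg p) σ hσ (vL p) (tgen p) hv rfl

/-- The right unit `η_R : BP_{2*} → BP_{2*}BP`. It is determined by
`η_R (ℓ n) = ∑_{i + j = n} ℓ i * t_j ^ (p ^ i)`. -/
def etaR : BP p →+* BPBP p :=
  BP.lift p ((algebraMap (BP p) (BPBP p)).comp (algebraMap (ZLoc p) (BP p))) (exists_etaR p).choose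

lemma etaR_hlog (n : ℕ) : etaR p (hlog p (vgen p) n) = rlog p (vL p) (tgen p) n := by
  rw [map_hlog, ← (exists_etaR p).choose_spec n]
  congr 1
  funext i
  exact BP.lift_vgen p _ _ i

open Finset.HasAntidiagonal Finset.Nat in
lemma bpbp_hom_ext {S : Type*} [CommRing S] (hreg : ∀ x : S, (p : S) * x = 0 → x = 0)
    (f g : BPBP p →+* S) (hL : ∀ a, f (algebraMap (BP p) (BPBP p) a) = g (algebraMap _ _ a))
    (hR : ∀ a, f (etaR p a) = g (etaR p a)) : f = g := by
  have hreg' : ∀ (k : ℕ) (x : S), (p : S) ^ k * x = 0 → x = 0 := by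
    intro k
    induction k with
    | zero => simp
    | succ k ih => intro x hx; rw [pow_succ, mul_assoc] at hx; exact hreg _ (ih _ hx)
  have ht : ∀ n, f (tgen p n) = g (tgen p n) := by
    intro n
    induction n using Nat.strong_induction_on with
    | _ n ih =>
      have h := hR (hlog p (vgen p) n)
      have hv : (fun i => f (vL p i)) = fun i => g (vL p i) := funext fun i => hL _
      rw [etaR_hlog, map_rlog, map_rlog, hv] at h
      cases n with
      | zero => rw [tgen, map_one, map_one]
      | succ n =>
        rw [rlog, rlog, sum_antidiagonal_succ, sum_antidiagonal_succ] at h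
        have h2 : ∀ x ∈ antidiagonal n,
            (p : S) ^ x.2 * hlog p (fun i => g (vL p i)) (x.1 + 1) *
              f (tgen p x.2) ^ p ^ (x.1 + 1) =
            (p : S) ^ x.2 * hlog p (fun i => g (vL p i)) (x.1 + 1) *
              g (tgen p x.2) ^ p ^ (x.1 + 1) := fun x hx => by
          have := mem_antidiagonal.1 hx
          rw [ih x.2 (by omega)]
        rw [Finset.sum_congr rfl h2] at h
        have h3 := add_right_cancel h
        simp only [hlog_zero, pow_zero, pow_one, mul_one] at h3
        rw [← sub_eq_zero]
        apply hreg' (n + 1)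
        linear_combination h3
  exact MvPolynomial.ringHom_ext (f := f) (g := g) hL fun i => ht (i + 1)

/-- The ring of polynomials in `t_1', t_2', …` over `BP_{2*}BP`. -/
def BPBP2 : Type := MvPolynomial ℕ (BPBP p)

instance : CommRing (BPBP2 p) := inferInstanceAs (CommRing (MvPolynomial ℕ (BPBP p)))
instance : IsDomain (BPBP2 p) := inferInstanceAs (IsDomain (MvPolynomial ℕ (BPBP p)))
instance : CharZero (BPBP2 p) := inferInstanceAs (CharZero (MvPolynomial ℕ (BPBP p)))
instance : Algebra (BPBP p) (BPBP2 p) :=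
  inferInstanceAs (Algebra (BPBP p) (MvPolynomial ℕ (BPBP p)))

/-- The sequence `t_0' = 1, t_1', t_2', …` -/
def tgen' : ℕ → BPBP2 p
  | 0 => 1
  | i + 1 => (MvPolynomial.X i : MvPolynomial ℕ (BPBP p))

/-- There are polynomials `c_0 = 1, c_1, c_2, …` with
`∑ ℓ i * c_j ^ (p ^ i) = ∑ ℓ i * t_j ^ (p ^ i) * t'_k ^ (p ^ (i + j))`. -/
lemma exists_comul : ∃ c : ℕ → BPBP2 p, c 0 = 1 ∧ ∀ n,
    rlog p (fun i => algebraMap (BPBP p) (BPBP2 p) (vL p i)) c n =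
      ∑ x ∈ Finset.HasAntidiagonal.antidiagonal n, (p : BPBP2 p) ^ x.2 *
        rlog p (fun i => algebraMap (BPBP p) (BPBP2 p) (vL p i))
          (fun i => algebraMap (BPBP p) (BPBP2 p) (tgen p i)) x.1 * tgen' p x.2 ^ p ^ x.1 := by
  obtain ⟨σ, hσ, hv⟩ := exists_frob p
  let τ : BPBP2 p →+* BPBP2 p := polyLift p ℕ σ
  have hτ : ∀ x, (p : BPBP2 p) ∣ x ^ p - τ x := polyLift_dvd hp.out ℕ _ hσ
  refine exists_rlog_eq hp.out.ne_zero (mul_reg p) τ hτ _ _ (tgen' p) (fun i => ?_)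
    (by rw [tgen, map_one]) rfl
  refine (MvPolynomial.eval₂_C _ _ (vL p i)).trans ?_
  change algebraMap (BPBP p) (BPBP2 p) (σ (vL p i)) = _
  rw [hv, map_pow]

end BP

section Incl

variable {A Γ : Type} [CommRing A] [CommRing Γ] [Algebra A Γ] (η : A →+* Γ)
  (S : Type u) [CommRing S] [Algebra A S]

/-- `γ ↦ 1 ⊗ γ`. -/
def inclΓ : Γ →+* Cofree η S where
  toFun := fun γ => Cofree.mk η γ 1
  map_zero' := Cofree.zero_mk η _
  map_one' := rfl
  map_add' := fun x y => Cofree.add_mk η x y 1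
  map_mul' := fun x y => by rw [Cofree.mk_mul_mk, mul_one]

/-- `s ↦ s ⊗ 1`. -/
def inclS : S →+* Cofree η S where
  toFun := fun s => Cofree.mk η 1 s
  map_zero' := Cofree.mk_zero η _
  map_one' := rfl
  map_add' := fun x y => Cofree.mk_add η 1 x y
  map_mul' := fun x y => by rw [Cofree.mk_mul_mk, mul_one]

lemma cofree_reg [Module.Flat A Γ] (p : ℕ) (hreg : ∀ x : S, (p : S) * x = 0 → x = 0)
    (x : Cofree η S) (hx : (p : Cofree η S) * x = 0) : x = 0 := by
  let f : S →ₗ[A] S := LinearMap.mulLeft A (p : S)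
  have hf : Function.Injective f := by
    rw [injective_iff_map_eq_zero]; exact fun y hy => hreg y hy
  have h := Module.Flat.lTensor_preserves_injective_linearMap (M := Γ) f hf
  have e : ∀ z : Cofree η S, f.lTensor Γ z = (p : Cofree η S) * z := by
    intro z
    induction z using Cofree.induction with
    | h0 => rw [mul_zero]; exact map_zero (f.lTensor Γ)
    | hadd x y hx hy => rw [mul_add, ← hx, ← hy]; exact map_add (f.lTensor Γ) x y
    | hmk γ s =>
      have : ((p : ℕ) : Cofree η S) = Cofree.mk η 1 (p : S) := by
        rw [← map_natCast (inclS η S)]; rfl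
      rw [this, Cofree.mk_mul_mk, one_mul]
      rfl
  refine h (a₁ := x) (a₂ := 0) ?_
  rw [map_zero]
  exact (e x).trans hx

end Incl

section BPHopf

variable (p : ℕ) [hp : Fact p.Prime]

/-- The ring `BP_{2*}BP ⊗ BP_{2*}BP`. -/
abbrev BPT : Type := Cofree (etaR p) (RightUnit (etaR p))

/-- `x ↦ x ⊗ 1`. -/
def tensorL : BPBP p →+* BPT p := (inclS (etaR p) _).comp (RightUnit.of (etaR p))

/-- `x ↦ 1 ⊗ x`. -/
def tensorR : BPBP p →+* BPT p := inclΓ (etaR p) _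

lemma tensorR_left (a : BP p) :
    tensorR p (algebraMap (BP p) (BPBP p) a) = tensorL p (etaR p a) := by
  have := Cofree.mk_smul (etaR p) (M := RightUnit (etaR p)) 1 a 1
  rw [← map_one (RightUnit.of (etaR p)), RightUnit.smul_of, mul_one, mul_one] at this
  exact this.symm

/-- The map sending `t` to `t ⊗ 1` and `t'` to `1 ⊗ t`. -/
def toTensor : BPBP2 p →+* BPT p :=
  (MvPolynomial.eval₂Hom (tensorL p) (fun i => tensorR p (tgen p (i + 1))) :
    MvPolynomial ℕ (BPBP p) →+* BPT p)

lemma toTensor_C (x : BPBP p) :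
    toTensor p (algebraMap (BPBP p) (BPBP2 p) x) = tensorL p x := MvPolynomial.eval₂_C _ _ x

lemma toTensor_tgen' (n : ℕ) : toTensor p (tgen' p n) = tensorR p (tgen p n) := by
  cases n with
  | zero => rw [tgen', tgen, map_one, map_one]
  | succ n => exact MvPolynomial.eval₂_X _ _ n

/-- The comultiplication `Δ : BP_{2*}BP → BP_{2*}BP ⊗ BP_{2*}BP`, determined by
`∑ ℓ i * Δ (t_j) ^ (p ^ i) = ∑ ℓ i * t_j ^ (p ^ i) ⊗ t_k ^ (p ^ (i + j))`. -/
def comulBP : BPBP p →+* BPT p :=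
  BPBP.lift p ((tensorL p).comp (algebraMap (BP p) (BPBP p)))
    fun i => toTensor p ((exists_comul p).choose (i + 1))

lemma comulBP_left (a : BP p) :
    comulBP p (algebraMap (BP p) (BPBP p) a) = tensorL p (algebraMap (BP p) (BPBP p) a) :=
  BPBP.lift_left p _ _ a

lemma comulBP_tgen (n : ℕ) : comulBP p (tgen p n) = toTensor p ((exists_comul p).choose n) := by
  cases n with
  | zero => rw [(exists_comul p).choose_spec.1, tgen, map_one, map_one]
  | succ n => exact BPBP.lift_tgen p _ _ n

lemma reg1 (x : RightUnit (etaR p)) (h : (p : RightUnit (etaR p)) * x = 0) : x = 0 :=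
  mul_reg (S := BPBP p) p x h

lemma reg2 (x : BPT p) (h : (p : BPT p) * x = 0) : x = 0 :=
  cofree_reg (etaR p) _ p (reg1 p) x h

lemma reg3 (x : Cofree (etaR p) (BPT p)) (h : ((p : ℕ) : Cofree (etaR p) (BPT p)) * x = 0) : x = 0 :=
  cofree_reg (etaR p) (BPT p) p (reg2 p) x h

lemma comulBP_right (a : BP p) : comulBP p (etaR p a) = tensorR p (etaR p a) := by
  have : (comulBP p).comp (etaR p) = (tensorR p).comp (etaR p) := by
    refine bp_hom_ext p (reg2 p) _ _ fun n => ?_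
    have h := congrArg (toTensor p) ((exists_comul p).choose_spec.2 n)
    rw [map_rlog, map_sum] at h
    simp only [map_mul, map_pow, map_natCast, map_rlog, toTensor_C, toTensor_tgen'] at h
    rw [RingHom.comp_apply, RingHom.comp_apply, etaR_hlog, map_rlog]
    have e1 : (fun i => comulBP p (vL p i)) = fun i => tensorL p (vL p i) :=
      funext fun i => comulBP_left p _
    have e2 : (fun i => comulBP p (tgen p i)) = fun i => toTensor p ((exists_comul p).choose i) :=
      funext fun i => comulBP_tgen p i
    rw [e1, e2, h, map_rlog, rlog]
    refine Finset.sum_congr rfl fun x _ => ?_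
    congr 2
    rw [← map_rlog (tensorL p), ← etaR_hlog, ← tensorR_left, map_hlog (algebraMap _ _),
      map_hlog (tensorR p)]
    rfl
  exact RingHom.congr_fun this a

/-- The counit of `BP_{2*}BP`, sending all `t_i` with `i > 0` to `0`. -/
def counitBP : BPBP p →ₐ[BP p] BP p :=
  { BPBP.lift p (RingHom.id _) (fun _ => 0) with
    commutes' := fun a => BPBP.lift_left p (RingHom.id _) _ a }

lemma counitBP_tgen (n : ℕ) : counitBP p (tgen p n) = if n = 0 then 1 else 0 := by
  cases n with
  | zero => rw [tgen, map_one]; rfl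
  | succ n => exact BPBP.lift_tgen p _ _ n

lemma counitBP_right (a : BP p) : counitBP p (etaR p a) = a := by
  have : (counitBP p).toRingHom.comp (etaR p) = RingHom.id (BP p) := by
    refine bp_hom_ext p (mul_reg p) _ _ fun n => ?_
    rw [RingHom.comp_apply, etaR_hlog, map_rlog, rlog, Finset.sum_eq_single (n, 0)]
    · have : (fun i => (counitBP p).toRingHom (vL p i)) = vgen p :=
        funext fun i => (counitBP p).commutes _
      rw [this]
      have h2 : counitBP p (tgen p 0) = 1 := map_one _
      simp [h2]
    · rintro ⟨a, b⟩ h h'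
      have h1 := Finset.HasAntidiagonal.mem_antidiagonal.1 h
      have h2 : b ≠ 0 := by
        rintro rfl
        simp at h1
        exact h' (by rw [h1])
      have h3 : counitBP p (tgen p b) = 0 := (counitBP_tgen p b).trans (if_neg h2)
      simp [h3, hp.out.ne_zero]
    · simp
  exact RingHom.congr_fun this a

/-- The structure maps of the Hopf algebroid `(BP_{2*}, BP_{2*}BP)`. -/
def bpData : HopfData (BP p) (BPBP p) where
  ηR := etaR p
  Δ := comulBP p
  ε := counitBP p
  ε_ηR := counitBP_right p
  Δ_ηL := comulBP_left p
  Δ_ηR := comulBP_right p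

section RingMaps

variable {A Γ : Type} [CommRing A] [CommRing Γ] [Algebra A Γ]
  {S : Type u} [CommRing S] [Algebra A S]

/-- `f ⊗ id` is a ring homomorphism when `f` is. -/
def mapRing (η : A →+* Γ) {S' : Type w} [CommRing S'] [Algebra A S'] (f : S →ₗ[A] S')
    (h1 : f 1 = 1) (hmul : ∀ x y, f (x * y) = f x * f y) : Cofree η S →+* Cofree η S' :=
  { (Cofree.map η f).toAddMonoidHom with
    map_one' := by
      change Cofree.map η f (Cofree.mk η 1 1) = Cofree.mk η 1 1
      rw [Cofree.map_mk, h1]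
    map_mul' := fun x y => by
      change Cofree.map η f (x * y) = Cofree.map η f x * Cofree.map η f y
      induction x using Cofree.induction with
      | h0 => rw [zero_mul, map_zero, zero_mul]
      | hadd x y hx hy => rw [add_mul, map_add, map_add, add_mul, hx, hy]
      | hmk γ m =>
        induction y using Cofree.induction with
        | h0 => rw [mul_zero, map_zero, mul_zero]
        | hadd x y hx hy => rw [mul_add, map_add, map_add, mul_add, hx, hy]
        | hmk γ' n =>
          rw [Cofree.mk_mul_mk, Cofree.map_mk, Cofree.map_mk, Cofree.map_mk, Cofree.mk_mul_mk,
            hmul] }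

variable (H : HopfData A Γ)

lemma map_ins_mul (s s' : S) (z z' : Cofree H.ηR (RightUnit H.ηR)) :
    Cofree.map H.ηR (H.ins (s * s')) (z * z') =
      Cofree.map H.ηR (H.ins s) z * Cofree.map H.ηR (H.ins s') z' := by
  induction z using Cofree.induction with
  | h0 => rw [zero_mul, map_zero, map_zero, zero_mul]
  | hadd x y hx hy => rw [add_mul, map_add, map_add, add_mul, hx, hy]
  | hmk a b =>
    obtain ⟨b, rfl⟩ := RightUnit.exists_of _ b
    induction z' using Cofree.induction with
    | h0 => rw [mul_zero, map_zero, map_zero, mul_zero]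
    | hadd x y hx hy => rw [mul_add, map_add, map_add, mul_add, hx, hy]
    | hmk c d =>
      obtain ⟨d, rfl⟩ := RightUnit.exists_of _ d
      rw [Cofree.mk_mul_mk, ← map_mul]
      simp only [Cofree.map_mk, HopfData.ins_of, Cofree.mk_mul_mk]

variable (S) in
/-- `δ` of a ring is a ring homomorphism. -/
def δRing : Cofree H.ηR S →+* Cofree H.ηR (Cofree H.ηR S) :=
  { (H.δ S).toAddMonoidHom with
    map_one' := by
      change H.δ S (Cofree.mk H.ηR 1 1) = 1
      rw [HopfData.δ_mk, map_one]
      rfl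
    map_mul' := fun x y => by
      change H.δ S (x * y) = H.δ S x * H.δ S y
      induction x using Cofree.induction with
      | h0 => rw [zero_mul, map_zero, zero_mul]
      | hadd x y hx hy => rw [add_mul, map_add, map_add, add_mul, hx, hy]
      | hmk γ m =>
        induction y using Cofree.induction with
        | h0 => rw [mul_zero, map_zero, mul_zero]
        | hadd x y hx hy => rw [mul_add, map_add, map_add, mul_add, hx, hy]
        | hmk γ' n =>
          rw [Cofree.mk_mul_mk, HopfData.δ_mk, HopfData.δ_mk, HopfData.δ_mk, map_mul, map_ins_mul] }

variable (S) in
/-- The counit of a ring is a ring homomorphism. -/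
def counitRing : Cofree H.ηR S →+* S :=
  { (H.counit S).toAddMonoidHom with
    map_one' := by
      change H.counit S (Cofree.mk H.ηR 1 1) = 1
      rw [HopfData.counit_mk, map_one, one_smul]
    map_mul' := fun x y => by
      change H.counit S (x * y) = H.counit S x * H.counit S y
      induction x using Cofree.induction with
      | h0 => rw [zero_mul, map_zero, zero_mul]
      | hadd x y hx hy => rw [add_mul, map_add, map_add, add_mul, hx, hy]
      | hmk γ m =>
        induction y using Cofree.induction with
        | h0 => rw [mul_zero, map_zero, mul_zero]
        | hadd x y hx hy => rw [mul_add, map_add, map_add, mul_add, hx, hy]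
        | hmk γ' n =>
          rw [Cofree.mk_mul_mk, HopfData.counit_mk, HopfData.counit_mk, HopfData.counit_mk, map_mul,
            smul_mul_smul_comm] }

end RingMaps

lemma bp_coassoc (x : BPBP p) : Cofree.map (etaR p) (bpData p).Δl (comulBP p x) =
    (bpData p).δ (RightUnit (etaR p)) (comulBP p x) := by
  let F : BPBP p →+* Cofree (etaR p) (BPT p) :=
    (mapRing (etaR p) (bpData p).Δl (map_one (comulBP p)) (map_mul (comulBP p))).comp (comulBP p)
  let G : BPBP p →+* Cofree (etaR p) (BPT p) :=
    (δRing (RightUnit (etaR p)) (bpData p)).comp (comulBP p)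
  have hFG : F = G := by
    refine bpbp_hom_ext p (reg3 p) F G (fun a => ?_) (fun a => ?_)
    · change Cofree.map (etaR p) (bpData p).Δl (comulBP p _) =
        (bpData p).δ (RightUnit (etaR p)) (comulBP p _)
      rw [comulBP_left]
      change Cofree.map (etaR p) (bpData p).Δl (Cofree.one (etaR p) _) =
        (bpData p).δ (RightUnit (etaR p)) (Cofree.one (etaR p) _)
      refine Eq.trans ?_ ((bpData p).δ_one (M := RightUnit (etaR p)) _).symm
      exact congrArg (Cofree.one (etaR p)) (comulBP_left p a)
    · change Cofree.map (etaR p) (bpData p).Δl (comulBP p _) =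
        (bpData p).δ (RightUnit (etaR p)) (comulBP p _)
      rw [comulBP_right]
      refine Eq.trans ?_ ((bpData p).δ_mk (RightUnit (etaR p)) (etaR p a) 1).symm
      refine Eq.trans ?_ (congrArg (Cofree.map (etaR p) ((bpData p).ins (1 : RightUnit (etaR p))))
        (comulBP_right p a)).symm
      exact congrArg (Cofree.mk (etaR p) (etaR p a)) (map_one (comulBP p))
  exact RingHom.congr_fun hFG x

lemma bp_counit (x : BPBP p) :
    (bpData p).counit (RightUnit (etaR p)) (comulBP p x) = RightUnit.of (etaR p) x := by
  let F : BPBP p →+* RightUnit (etaR p) :=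
    (counitRing (RightUnit (etaR p)) (bpData p)).comp (comulBP p)
  have hFG : F = RightUnit.of (etaR p) := by
    refine bpbp_hom_ext p (reg1 p) F _ (fun a => ?_) (fun a => ?_)
    · change (bpData p).counit _ (comulBP p _) = _
      rw [comulBP_left]
      refine ((bpData p).counit_mk (M := RightUnit (etaR p)) _ _).trans ?_
      rw [map_one, one_smul]
    · change (bpData p).counit _ (comulBP p _) = _
      rw [comulBP_right]
      refine ((bpData p).counit_mk (M := RightUnit (etaR p)) _ _).trans ?_
      rw [show (bpData p).ε (etaR p a) = a from counitBP_right p a,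
        ← map_one (RightUnit.of (etaR p)), RightUnit.smul_of, mul_one]
  exact RingHom.congr_fun hFG x

lemma bp_counit' (x : BPBP p) :
    Cofree.map (etaR p) (bpData p).εl (comulBP p x) = Cofree.mk (etaR p) x 1 := by
  let F : BPBP p →+* Cofree (etaR p) (BP p) :=
    (mapRing (etaR p) (bpData p).εl (map_one (counitBP p)) (map_mul (counitBP p))).comp (comulBP p)
  have hFG : F = inclΓ (etaR p) (BP p) := by
    refine bpbp_hom_ext p (cofree_reg (etaR p) (BP p) p (mul_reg p)) F _ (fun a => ?_)
      (fun a => ?_)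
    · change Cofree.map (etaR p) (bpData p).εl (comulBP p _) = Cofree.mk (etaR p) _ 1
      rw [comulBP_left]
      have h1 : (bpData p).εl (RightUnit.of (etaR p) (algebraMap (BP p) (BPBP p) a)) = a • 1 := by
        rw [smul_eq_mul, mul_one]; exact (counitBP p).commutes a
      have h2 := Cofree.mk_smul (etaR p) (1 : BPBP p) a (1 : BP p)
      rw [mul_one] at h2
      rw [← h2]
      exact congrArg (Cofree.mk (etaR p) 1) h1
    · change Cofree.map (etaR p) (bpData p).εl (comulBP p _) = Cofree.mk (etaR p) _ 1
      rw [comulBP_right]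
      exact congrArg (Cofree.mk (etaR p) _) (map_one (counitBP p))
  exact RingHom.congr_fun hFG x

/-- The Hopf algebroid `(BP_{2*}, BP_{2*}BP)` at the prime `p`. -/
def bpHopf : HopfAlgebroid (BP p) (BPBP p) where
  toHopfData := bpData p
  coassoc := bp_coassoc p
  counit_Δ := bp_counit p
  counit_Δ' := bp_counit' p

end BPHopf

section DG

variable {A Γ : Type} [CommRing A] [CommRing Γ] [Algebra A Γ]

/-- A differential comodule over a Hopf algebroid: a right comodule with a square-zero comodule
endomorphism `d` and a sign involution `inv`, which for a chain complex is multiplication by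
`(-1) ^ j` in degree `j`. -/
structure DGComodule (H : HopfAlgebroid A Γ) where
  carrier : Type u
  [addCommGroup : AddCommGroup carrier]
  [module : Module A carrier]
  ψ : carrier →ₗ[A] Cofree H.ηR carrier
  coassoc : Cofree.map H.ηR ψ ∘ₗ ψ = H.δ carrier ∘ₗ ψ
  counit : H.counit carrier ∘ₗ ψ = LinearMap.id
  d : carrier →ₗ[A] carrier
  d_d : d ∘ₗ d = 0
  ψ_d : Cofree.map H.ηR d ∘ₗ ψ = ψ ∘ₗ d
  inv : carrier →ₗ[A] carrier
  inv_inv : inv ∘ₗ inv = LinearMap.id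
  inv_d : inv ∘ₗ d = -(d ∘ₗ inv)
  ψ_inv : Cofree.map H.ηR inv ∘ₗ ψ = ψ ∘ₗ inv

attribute [instance] DGComodule.addCommGroup DGComodule.module

variable {H : HopfAlgebroid A Γ}

/-- Morphisms of differential comodules. -/
structure DGHom (T : DGComodule.{u} H) (T' : DGComodule.{w} H) where
  lin : T.carrier →ₗ[A] T'.carrier
  ψ_lin : Cofree.map H.ηR lin ∘ₗ T.ψ = T'.ψ ∘ₗ lin
  d_lin : lin ∘ₗ T.d = T'.d ∘ₗ lin
  inv_lin : lin ∘ₗ T.inv = T'.inv ∘ₗ lin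

namespace DGComodule

lemma map_map {M : Type u} [AddCommGroup M] [Module A M] {M' : Type u} [AddCommGroup M']
    [Module A M'] {N : Type w} [AddCommGroup N] [Module A N] {N' : Type w} [AddCommGroup N']
    [Module A N'] {M'' : Type u} [AddCommGroup M''] [Module A M''] {N'' : Type w} [AddCommGroup N'']
    [Module A N''] (f : M →ₗ[A] M') (g : N →ₗ[A] N') (f' : M' →ₗ[A] M'') (g' : N' →ₗ[A] N'') :
    TensorProduct.map f' g' ∘ₗ TensorProduct.map f g = TensorProduct.map (f' ∘ₗ f) (g' ∘ₗ g) :=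
  (TensorProduct.map_comp f' g' f g).symm

/-- The coaction of a tensor product of two comodules. -/
def tensorψ (T : DGComodule.{u} H) (R : DGComodule.{0} H) :
    T.carrier ⊗[A] R.carrier →ₗ[A] Cofree H.ηR (T.carrier ⊗[A] R.carrier) :=
  Cofree.mu H.ηR T.carrier R.carrier ∘ₗ TensorProduct.map T.ψ R.ψ

lemma tensorψ_natural {T T' : DGComodule.{u} H} {R R' : DGComodule.{0} H}
    (f : T.carrier →ₗ[A] T'.carrier) (g : R.carrier →ₗ[A] R'.carrier)
    (hf : Cofree.map H.ηR f ∘ₗ T.ψ = T'.ψ ∘ₗ f) (hg : Cofree.map H.ηR g ∘ₗ R.ψ = R'.ψ ∘ₗ g) :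
    Cofree.map H.ηR (TensorProduct.map f g) ∘ₗ tensorψ T R =
      tensorψ T' R' ∘ₗ TensorProduct.map f g := by
  unfold tensorψ
  rw [← LinearMap.comp_assoc, ← Cofree.mu_natural, LinearMap.comp_assoc, LinearMap.comp_assoc,
    map_map, map_map, hf, hg]

/-- The tensor product over `A` of two differential comodules. -/
def tensor (T : DGComodule.{u} H) (R : DGComodule.{0} H) : DGComodule.{u} H where
  carrier := T.carrier ⊗[A] R.carrier
  ψ := tensorψ T R
  coassoc := by
    have h := HopfAlgebroid.δ_mu H T.carrier R.carrier
    unfold tensorψ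
    rw [Cofree.map_comp, ← LinearMap.comp_assoc _ _ (H.δ _), h, LinearMap.comp_assoc,
      LinearMap.comp_assoc, LinearMap.comp_assoc, map_map, ← T.coassoc, ← R.coassoc, ← map_map,
      ← LinearMap.comp_assoc _ _ (Cofree.map H.ηR (TensorProduct.map T.ψ R.ψ)),
      ← Cofree.mu_natural, LinearMap.comp_assoc]
  counit := by
    unfold tensorψ
    rw [← LinearMap.comp_assoc, HopfData.counit_mu, map_map, T.counit, R.counit,
      TensorProduct.map_id]
  d := TensorProduct.map T.d LinearMap.id + TensorProduct.map T.inv R.d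
  d_d := by
    rw [LinearMap.comp_add, LinearMap.add_comp, LinearMap.add_comp, map_map, map_map, map_map,
      map_map, T.d_d, R.d_d, T.inv_d]
    simp
    ext x y
    simp [TensorProduct.neg_tmul]
  ψ_d := by
    rw [Cofree.map_add', LinearMap.add_comp, LinearMap.comp_add,
      tensorψ_natural T.d LinearMap.id T.ψ_d (by rw [Cofree.map_id]; rfl),
      tensorψ_natural T.inv R.d T.ψ_inv R.ψ_d]
  inv := TensorProduct.map T.inv R.inv
  inv_inv := by rw [map_map, T.inv_inv, R.inv_inv, TensorProduct.map_id]
  inv_d := by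
    rw [LinearMap.comp_add, LinearMap.add_comp, map_map, map_map, map_map, map_map, T.inv_d,
      R.inv_d]
    ext x y
    simp [TensorProduct.neg_tmul, TensorProduct.tmul_neg]
    abel
  ψ_inv := tensorψ_natural T.inv R.inv T.ψ_inv R.ψ_inv

/-- A unit for a differential comodule `R`: a primitive cycle of degree zero. Equivalently a
morphism to `R` from the unit comodule. -/
structure Unit (R : DGComodule.{0} H) where
  elt : R.carrier
  ψ_elt : R.ψ elt = Cofree.one H.ηR elt
  d_elt : R.d elt = 0
  inv_elt : R.inv elt = elt

variable {R : DGComodule.{0} H}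

/-- The map `x ↦ x ⊗ 1`. -/
def unitLin (T : DGComodule.{u} H) (e : Unit R) : T.carrier →ₗ[A] T.carrier ⊗[A] R.carrier :=
  (TensorProduct.mk A T.carrier R.carrier).flip e.elt

lemma unitLin_apply (T : DGComodule.{u} H) (e : Unit R) (x : T.carrier) :
    unitLin T e x = x ⊗ₜ[A] e.elt := rfl

lemma unitLin_mu (T : DGComodule.{u} H) (e : Unit R) (z : Cofree H.ηR T.carrier) :
    Cofree.map H.ηR (unitLin T e) z =
      Cofree.mu H.ηR T.carrier R.carrier (z ⊗ₜ Cofree.one H.ηR e.elt) := by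
  induction z using Cofree.induction with
  | h0 => rw [map_zero, TensorProduct.zero_tmul, map_zero]
  | hadd x y hx hy => rw [map_add, TensorProduct.add_tmul, map_add, hx, hy]
  | hmk γ m =>
    refine Eq.trans ?_ (Cofree.mu_mk (η := H.ηR) γ 1 m e.elt).symm
    rw [mul_one, Cofree.map_mk, unitLin_apply]

/-- The morphism `T → T ⊗ R`, `x ↦ x ⊗ 1`. -/
def unitHom (T : DGComodule.{u} H) (e : Unit R) : DGHom T (T.tensor R) where
  lin := unitLin T e
  ψ_lin := by
    refine LinearMap.ext fun x => ?_
    change Cofree.map H.ηR (unitLin T e) (T.ψ x) =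
      Cofree.mu H.ηR T.carrier R.carrier (T.ψ x ⊗ₜ R.ψ e.elt)
    rw [e.ψ_elt, unitLin_mu]
  d_lin := by
    refine LinearMap.ext fun x => ?_
    change T.d x ⊗ₜ e.elt = T.d x ⊗ₜ e.elt + T.inv x ⊗ₜ R.d e.elt
    rw [e.d_elt, TensorProduct.tmul_zero, add_zero]
  inv_lin := by
    refine LinearMap.ext fun x => ?_
    change T.inv x ⊗ₜ e.elt = T.inv x ⊗ₜ R.inv e.elt
    rw [e.inv_elt]

/-- The morphism `f ⊗ id`. -/
def _root_.AlgNov.DGHom.tensorId {T T' : DGComodule.{u} H} (f : DGHom T T')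
    (R : DGComodule.{0} H) : DGHom (T.tensor R) (T'.tensor R) where
  lin := TensorProduct.map f.lin LinearMap.id
  ψ_lin := tensorψ_natural f.lin LinearMap.id f.ψ_lin (by rw [Cofree.map_id]; rfl)
  d_lin := by
    change TensorProduct.map f.lin LinearMap.id ∘ₗ
      (TensorProduct.map T.d LinearMap.id + TensorProduct.map T.inv R.d) =
      (TensorProduct.map T'.d LinearMap.id + TensorProduct.map T'.inv R.d) ∘ₗ
        TensorProduct.map f.lin LinearMap.id
    rw [LinearMap.comp_add, LinearMap.add_comp, map_map, map_map, map_map, map_map, f.d_lin,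
      f.inv_lin]
    rfl
  inv_lin := by
    change TensorProduct.map f.lin LinearMap.id ∘ₗ TensorProduct.map T.inv R.inv =
      TensorProduct.map T'.inv R.inv ∘ₗ TensorProduct.map f.lin LinearMap.id
    rw [map_map, map_map, f.inv_lin]
    rfl

/-- The sum `f + c g` of morphisms, for an integer `c`. -/
def _root_.AlgNov.DGHom.addSMul {T T' : DGComodule.{u} H} (f g : DGHom T T') (c : ℤ) :
    DGHom T T' where
  lin := f.lin + c • g.lin
  ψ_lin := by
    rw [Cofree.map_add', Cofree.map_smul', LinearMap.add_comp, LinearMap.comp_add,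
      LinearMap.smul_comp, LinearMap.comp_smul, f.ψ_lin, g.ψ_lin]
  d_lin := by
    rw [LinearMap.add_comp, LinearMap.comp_add, LinearMap.smul_comp, LinearMap.comp_smul,
      f.d_lin, g.d_lin]
  inv_lin := by
    rw [LinearMap.add_comp, LinearMap.comp_add, LinearMap.smul_comp, LinearMap.comp_smul,
      f.inv_lin, g.inv_lin]

/-- The object `T ⊗ R ⊗ ⋯ ⊗ R` with `m` factors `R`. -/
def power (T : DGComodule.{u} H) (R : DGComodule.{0} H) : ℕ → DGComodule.{u} H
  | 0 => T
  | m + 1 => (power T R m).tensor R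

/-- The alternating sum over `0 ≤ i ≤ m` of the maps `T ⊗ R^{⊗ m} → T ⊗ R^{⊗ (m + 1)}` that insert
the unit of `R` after the first `i` factors `R`. -/
def coface (T : DGComodule.{u} H) (e : Unit R) :
    (m : ℕ) → DGHom (T.power R m) (T.power R (m + 1))
  | 0 => unitHom T e
  | m + 1 => ((coface T e m).tensorId R).addSMul (unitHom (T.power R (m + 1)) e) ((-1) ^ (m + 1))

lemma coface_aux {M : Type u} [AddCommGroup M] [Module A M] {N : Type} [AddCommGroup N]
    [Module A N] (e : N) (f : M →ₗ[A] M ⊗[A] N) (c c' : ℤ) (hc : c' = -c) :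
    let F : M ⊗[A] N →ₗ[A] (M ⊗[A] N) ⊗[A] N :=
      TensorProduct.map f LinearMap.id + c • (TensorProduct.mk A (M ⊗[A] N) N).flip e
    (TensorProduct.map F LinearMap.id + c' •
      (TensorProduct.mk A ((M ⊗[A] N) ⊗[A] N) N).flip e) ∘ₗ F =
      TensorProduct.map (F ∘ₗ f) LinearMap.id := by
  intro F
  refine TensorProduct.ext' fun x r => ?_
  have hF : F (x ⊗ₜ r) = f x ⊗ₜ r + c • ((x ⊗ₜ r) ⊗ₜ e) := rfl
  have hG : TensorProduct.map F LinearMap.id (F (x ⊗ₜ r)) =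
      F (f x) ⊗ₜ r + c • (F (x ⊗ₜ r) ⊗ₜ e) := by
    rw [hF, map_add, map_zsmul, TensorProduct.map_tmul, TensorProduct.map_tmul, hF]
    rfl
  change TensorProduct.map F LinearMap.id (F (x ⊗ₜ r)) + c' • (F (x ⊗ₜ r) ⊗ₜ e) = F (f x) ⊗ₜ r
  rw [hG, add_assoc, hc]
  refine Eq.trans (congrArg (F (f x) ⊗ₜ r + ·) (add_smul c (-c) (F (x ⊗ₜ r) ⊗ₜ e)).symm) ?_
  rw [add_neg_cancel, zero_smul, add_zero]

lemma coface_coface (T : DGComodule.{u} H) (e : Unit R) (m : ℕ) :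
    (coface T e (m + 1)).lin ∘ₗ (coface T e m).lin = 0 := by
  induction m with
  | zero =>
    refine LinearMap.ext fun x => ?_
    change ((x ⊗ₜ[A] e.elt) ⊗ₜ[A] e.elt + ((-1) ^ (0 + 1) : ℤ) • ((x ⊗ₜ[A] e.elt) ⊗ₜ[A] e.elt) :
      (T.carrier ⊗[A] R.carrier) ⊗[A] R.carrier) = 0
    rw [zero_add, pow_one, neg_one_smul, add_neg_cancel]
  | succ m ih =>
    have h := coface_aux e.elt (coface T e m).lin ((-1) ^ (m + 1)) ((-1) ^ (m + 1 + 1))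
      (by rw [pow_succ, mul_neg_one])
    refine Eq.trans h ?_
    refine Eq.trans (congrArg (fun f => TensorProduct.map f LinearMap.id) ih) ?_
    exact TensorProduct.map_zero_left _

end DGComodule

end DG

section Cobar

variable {A Γ : Type} [CommRing A] [CommRing Γ] [Algebra A Γ]

/-- The module `M ⊗_A Γ ⊗_A ⋯ ⊗_A Γ` with `s` factors `Γ`. -/
def Bpow (η : A →+* Γ) (M : Type u) [AddCommGroup M] [Module A M] : ℕ → ModuleCat.{u} A
  | 0 => ModuleCat.of A M
  | s + 1 => ModuleCat.of A (Cofree η (Bpow η M s))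

/-- The map `f ⊗ id`. -/
def Bmap (η : A →+* Γ) {M : Type u} [AddCommGroup M] [Module A M] {N : Type u} [AddCommGroup N]
    [Module A N] (f : M →ₗ[A] N) : (s : ℕ) → Bpow η M s →ₗ[A] Bpow η N s
  | 0 => f
  | s + 1 => Cofree.map η (Bmap η f s)

section

variable (η : A →+* Γ) {M : Type u} [AddCommGroup M] [Module A M] {N : Type u} [AddCommGroup N]
  [Module A N] {P : Type u} [AddCommGroup P] [Module A P]

lemma Bmap_comp (g : N →ₗ[A] P) (f : M →ₗ[A] N) (s : ℕ) :
    Bmap η (g ∘ₗ f) s = Bmap η g s ∘ₗ Bmap η f s := by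
  induction s with
  | zero => rfl
  | succ s ih =>
    change Cofree.map η (Bmap η (g ∘ₗ f) s) = _
    rw [ih, Cofree.map_comp]
    rfl

lemma Bmap_zero (s : ℕ) : Bmap η (0 : M →ₗ[A] N) s = 0 := by
  induction s with
  | zero => rfl
  | succ s ih =>
    change Cofree.map η (Bmap η (0 : M →ₗ[A] N) s) = _
    rw [ih, Cofree.map_zero']
    rfl

end

variable (H : HopfAlgebroid A Γ)

/-- The inductive step in the construction of the cobar differential. -/
def cobarStep {P : Type u} [AddCommGroup P] [Module A P] (D : P →ₗ[A] Cofree H.ηR P) (c : ℤ) :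
    Cofree H.ηR P →ₗ[A] Cofree H.ηR (Cofree H.ηR P) :=
  Cofree.map H.ηR D + c • H.δ P

lemma cobarStep_cobarStep {P : Type u} [AddCommGroup P] [Module A P]
    (D : P →ₗ[A] Cofree H.ηR P) (c c' : ℤ) (hc : c' = -c) :
    cobarStep H (cobarStep H D c) c' ∘ₗ cobarStep H D c =
      Cofree.map H.ηR (cobarStep H D c ∘ₗ D) := by
  have h1 : ∀ z, cobarStep H D c z = Cofree.map H.ηR D z + c • H.δ P z := fun z => rfl
  have h2 : ∀ z, cobarStep H (cobarStep H D c) c' z =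
    Cofree.map H.ηR (cobarStep H D c) z + c' • H.δ _ z := fun z => rfl
  have h3 : Cofree.map H.ηR (cobarStep H D c) =
    Cofree.map H.ηR (Cofree.map H.ηR D) + c • Cofree.map H.ηR (H.δ P) := by
    rw [cobarStep, Cofree.map_add', Cofree.map_smul']
  have h4 : ∀ z, Cofree.map H.ηR (cobarStep H D c) (H.δ P z) =
      H.δ _ (Cofree.map H.ηR D z) + c • H.δ _ (H.δ P z) := fun z => by
    have e1 := LinearMap.congr_fun (HopfData.δ_natural H.toHopfData D) z
    have e2 := LinearMap.congr_fun (HopfAlgebroid.δ_coassoc H P) z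
    rw [LinearMap.comp_apply, LinearMap.comp_apply] at e1 e2
    rw [h3, LinearMap.add_apply, LinearMap.smul_apply, e1, e2]
  refine LinearMap.ext fun z => ?_
  rw [LinearMap.comp_apply, Cofree.map_comp, LinearMap.comp_apply, h2, h1, map_add, map_zsmul, h4,
    hc, map_add, map_zsmul, smul_add, neg_smul, smul_add, add_neg_cancel_right]

/-- The part of the cobar differential that is built from the coaction `ψ` and the comultiplication:
`∑_{i ≤ s} (-1) ^ i d ^ i`, where `d ^ 0 = ψ ⊗ id` and `d ^ i` applies `Δ` to the `i`-th factor. -/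
def cobarD {M : Type u} [AddCommGroup M] [Module A M] (ψ : M →ₗ[A] Cofree H.ηR M) :
    (s : ℕ) → Bpow H.ηR M s →ₗ[A] Cofree H.ηR (Bpow H.ηR M s)
  | 0 => ψ
  | s + 1 => cobarStep H (cobarD ψ s) ((-1) ^ (s + 1))

/-- The differential of the cobar complex of a comodule `M`, whose term in degree `s` is
`M ⊗_A Γ ⊗_A ⋯ ⊗_A Γ` with `s` factors `Γ`. The last coface is `x ↦ x ⊗ 1`. -/
def cobar {M : Type u} [AddCommGroup M] [Module A M] (ψ : M →ₗ[A] Cofree H.ηR M) (s : ℕ) :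
    Bpow H.ηR M s →+ Bpow H.ηR M (s + 1) :=
  (cobarD H ψ s).toAddMonoidHom + ((-1) ^ (s + 1) : ℤ) • Cofree.one H.ηR

variable {M : Type u} [AddCommGroup M] [Module A M] {N : Type u} [AddCommGroup N] [Module A N]

lemma cobarD_cobarD (ψ : M →ₗ[A] Cofree H.ηR M)
    (hψ : Cofree.map H.ηR ψ ∘ₗ ψ = H.δ M ∘ₗ ψ) (s : ℕ) :
    cobarStep H (cobarD H ψ s) ((-1) ^ (s + 1)) ∘ₗ cobarD H ψ s = 0 := by
  induction s with
  | zero =>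
    refine LinearMap.ext fun x => ?_
    change Cofree.map H.ηR ψ (ψ x) + ((-1) ^ (0 + 1) : ℤ) • H.δ M (ψ x) = 0
    have h : Cofree.map H.ηR ψ (ψ x) = H.δ M (ψ x) := LinearMap.congr_fun hψ x
    rw [h, zero_add, pow_one, neg_one_smul, add_neg_cancel]
  | succ s ih =>
    refine (cobarStep_cobarStep H (cobarD H ψ s) ((-1) ^ (s + 1)) ((-1) ^ (s + 1 + 1))
      (by rw [pow_succ, mul_neg_one])).trans ?_
    rw [ih, Cofree.map_zero']
    rfl

lemma cobar_aux {P : Type u} [AddCommGroup P] [Module A P] (D : P →ₗ[A] Cofree H.ηR P) (c c' : ℤ)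
    (hc : c' = -c) (h : cobarStep H D c ∘ₗ D = 0) (x : P) :
    cobarStep H D c (D x + c • Cofree.one H.ηR x) +
      c' • Cofree.one H.ηR (D x + c • Cofree.one H.ηR x) = 0 := by
  have h1 : cobarStep H D c (D x) = 0 := LinearMap.congr_fun h x
  have h2 : cobarStep H D c (Cofree.one H.ηR x) = Cofree.one H.ηR (D x) +
      c • Cofree.one H.ηR (Cofree.one H.ηR x) := by
    rw [← HopfData.δ_one, ← Cofree.map_one]
    rfl
  rw [map_add, map_zsmul, h1, h2, map_add, map_zsmul, hc]
  simp only [smul_add, neg_smul]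
  abel

lemma cobar_cobar (ψ : M →ₗ[A] Cofree H.ηR M)
    (hψ : Cofree.map H.ηR ψ ∘ₗ ψ = H.δ M ∘ₗ ψ) (s : ℕ) (x : Bpow H.ηR M s) :
    cobar H ψ (s + 1) (cobar H ψ s x) = 0 :=
  cobar_aux H (cobarD H ψ s) ((-1) ^ (s + 1)) ((-1) ^ (s + 1 + 1)) (by rw [pow_succ, mul_neg_one])
    (cobarD_cobarD H ψ hψ s) x

lemma cobarStep_natural {P : Type u} [AddCommGroup P] [Module A P] {Q : Type u} [AddCommGroup Q]
    [Module A Q] (D : P →ₗ[A] Cofree H.ηR P) (D' : Q →ₗ[A] Cofree H.ηR Q) (f : P →ₗ[A] Q) (c : ℤ)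
    (h : Cofree.map H.ηR f ∘ₗ D = D' ∘ₗ f) :
    Cofree.map H.ηR (Cofree.map H.ηR f) ∘ₗ cobarStep H D c =
      cobarStep H D' c ∘ₗ Cofree.map H.ηR f := by
  rw [cobarStep, cobarStep, LinearMap.comp_add, LinearMap.add_comp, LinearMap.comp_smul,
    LinearMap.smul_comp, HopfData.δ_natural, ← Cofree.map_comp, ← Cofree.map_comp, h]

lemma cobarD_natural {ψ : M →ₗ[A] Cofree H.ηR M} {ψ' : N →ₗ[A] Cofree H.ηR N} (f : M →ₗ[A] N)
    (hf : Cofree.map H.ηR f ∘ₗ ψ = ψ' ∘ₗ f) (s : ℕ) :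
    Cofree.map H.ηR (Bmap H.ηR f s) ∘ₗ cobarD H ψ s = cobarD H ψ' s ∘ₗ Bmap H.ηR f s := by
  induction s with
  | zero => exact hf
  | succ s ih =>
    exact cobarStep_natural H (cobarD H ψ s) (cobarD H ψ' s) (Bmap H.ηR f s) ((-1) ^ (s + 1)) ih

lemma cobar_natural {ψ : M →ₗ[A] Cofree H.ηR M} {ψ' : N →ₗ[A] Cofree H.ηR N} (f : M →ₗ[A] N)
    (hf : Cofree.map H.ηR f ∘ₗ ψ = ψ' ∘ₗ f) (s : ℕ) (x : Bpow H.ηR M s) :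
    Bmap H.ηR f (s + 1) (cobar H ψ s x) = cobar H ψ' s (Bmap H.ηR f s x) := by
  have h1 : Cofree.map H.ηR (Bmap H.ηR f s) (cobarD H ψ s x) =
    cobarD H ψ' s (Bmap H.ηR f s x) := LinearMap.congr_fun (cobarD_natural H f hf s) x
  change Cofree.map H.ηR (Bmap H.ηR f s) (cobarD H ψ s x + ((-1) ^ (s + 1) : ℤ) •
    Cofree.one H.ηR x) = cobarD H ψ' s (Bmap H.ηR f s x) + ((-1) ^ (s + 1) : ℤ) •
    Cofree.one H.ηR (Bmap H.ηR f s x)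
  rw [map_add, map_zsmul, h1, Cofree.map_one]

end Cobar

section Koszul

variable {A Γ : Type} [CommRing A] [CommRing Γ] [Algebra A Γ]

/-- The underlying algebra of the Koszul complex on a sequence of elements of `A`: the exterior
algebra on generators `e_0, e_1, …`. -/
abbrev Koszul (A : Type) [CommRing A] : Type := ExteriorAlgebra A (ℕ →₀ A)

/-- The Koszul differential: the antiderivation with `d e_i = x i`. -/
def koszulD (x : ℕ → A) : Koszul A →ₗ[A] Koszul A :=
  CliffordAlgebra.contractLeft (Finsupp.linearCombination A x)

/-- The sign involution, multiplication by `(-1) ^ j` on products of `j` generators. -/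
def koszulInv : Koszul A →ₗ[A] Koszul A := CliffordAlgebra.involute.toLinearMap

lemma koszulD_koszulD (x : ℕ → A) : koszulD x ∘ₗ koszulD x = 0 :=
  LinearMap.ext fun y => CliffordAlgebra.contractLeft_contractLeft _ y

lemma koszulInv_koszulInv : (koszulInv : Koszul A →ₗ[A] Koszul A) ∘ₗ koszulInv = LinearMap.id :=
  LinearMap.ext fun y => CliffordAlgebra.involute_involute y

lemma koszulInv_koszulD (x : ℕ → A) : koszulInv ∘ₗ koszulD x = -(koszulD x ∘ₗ koszulInv) := by
  refine LinearMap.ext fun y => ?_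
  change CliffordAlgebra.involute (koszulD x y) = -(koszulD x (CliffordAlgebra.involute y))
  unfold koszulD
  induction y using CliffordAlgebra.left_induction with
  | algebraMap r => simp
  | add y z hy hz => simp only [map_add, hy, hz, neg_add]
  | ι_mul y m hy =>
    rw [CliffordAlgebra.contractLeft_ι_mul, map_sub, map_smul, map_mul, map_mul,
      CliffordAlgebra.involute_ι, neg_mul, neg_mul, map_neg, CliffordAlgebra.contractLeft_ι_mul, hy,
      mul_neg]
    abel

/-- For a sequence `x` in `A`, the differential comodule `K(x) ⊗_A Γ`, where `K(x)` is the Koszul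
complex. When `x` is a regular sequence generating the ideal `I`, it is a resolution of the cofree
comodule algebra `A / I ⊗_A Γ = Γ / I` by flat cofree comodules. -/
def koszulComodule (H : HopfAlgebroid A Γ) (x : ℕ → A) : DGComodule.{0} H where
  carrier := Cofree H.ηR (Koszul A)
  ψ := H.δ (Koszul A)
  coassoc := H.δ_coassoc _
  counit := H.counit_δ _
  d := Cofree.map H.ηR (koszulD x)
  d_d := by rw [← Cofree.map_comp, koszulD_koszulD, Cofree.map_zero']
  ψ_d := H.δ_natural _
  inv := Cofree.map H.ηR koszulInv
  inv_inv := by rw [← Cofree.map_comp, koszulInv_koszulInv, Cofree.map_id]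
  inv_d := by
    rw [← Cofree.map_comp, ← Cofree.map_comp, koszulInv_koszulD, ← neg_one_smul ℤ,
      Cofree.map_smul', neg_one_smul]
  ψ_inv := H.δ_natural _

/-- The unit of the algebra `K(x) ⊗_A Γ`. -/
def koszulUnit (H : HopfAlgebroid A Γ) (x : ℕ → A) : DGComodule.Unit (koszulComodule H x) where
  elt := Cofree.mk H.ηR 1 1
  ψ_elt := H.δ_one _
  d_elt := by
    refine (Cofree.map_mk (η := H.ηR) (koszulD x) 1 1).trans ?_
    rw [koszulD, CliffordAlgebra.contractLeft_one, Cofree.mk_zero]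
    rfl
  inv_elt := by
    refine (Cofree.map_mk (η := H.ηR) koszulInv 1 1).trans ?_
    exact congrArg (Cofree.mk H.ηR 1) (map_one CliffordAlgebra.involute)

end Koszul

section Filtered

/-- A cochain complex with a decreasing filtration. The complex is given by its total object `X`
with the square-zero endomorphism `d`; `gr s k` is the part of cohomological degree `s` and internal
degree `k`, and `F n` is the `n`-th stage of the filtration. -/
structure FilteredComplex where
  X : Type u
  [addCommGroup : AddCommGroup X]
  d : X →+ X
  d_d : ∀ x, d (d x) = 0
  gr : ℤ → ℤ → AddSubgroup X
  F : ℤ → AddSubgroup X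
  F_anti : Antitone F

attribute [instance] FilteredComplex.addCommGroup

namespace FilteredComplex

variable (C : FilteredComplex.{u})

/-- The group `Z_r ^ n` of elements of `F n` whose differential lies in `F (n + r)`, in cohomological
degree `s` and internal degree `k`. -/
def Z (r n s k : ℤ) : AddSubgroup C.X :=
  (C.F n ⊓ C.gr s k) ⊓ (C.F (n + r) ⊓ C.gr (s + 1) k).comap C.d

/-- The group `B_r ^ n = Z_{r - 1} ^ {n + 1} + d Z_{r - 1} ^ {n - r + 1}`. -/
def B (r n s k : ℤ) : AddSubgroup C.X :=
  C.Z (r - 1) (n + 1) s k ⊔ (C.Z (r - 1) (n - r + 1) (s - 1) k).map C.d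

/-- The page `E_r ^ {n, s, k} = Z_r ^ n / B_r ^ n` of the spectral sequence of the filtered complex:
filtration degree `n`, cohomological degree `s`, internal degree `k`. -/
def E (r n s k : ℤ) : Type u := C.Z r n s k ⧸ (C.B r n s k).addSubgroupOf (C.Z r n s k)

instance (r n s k : ℤ) : AddCommGroup (C.E r n s k) :=
  inferInstanceAs (AddCommGroup (C.Z r n s k ⧸ (C.B r n s k).addSubgroupOf (C.Z r n s k)))

/-- The class in `E_r` of an element of `Z_r`. -/
def cls (r n s k : ℤ) : C.Z r n s k →+ C.E r n s k :=
  QuotientAddGroup.mk' ((C.B r n s k).addSubgroupOf (C.Z r n s k))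

lemma d_mem {r n s k : ℤ} {x : C.X} (hx : x ∈ C.Z r n s k) :
    C.d x ∈ C.Z r (n + r) (s + 1) k :=
  AddSubgroup.mem_inf.2 ⟨hx.2, AddSubgroup.mem_comap.2 (by
    rw [C.d_d]
    exact AddSubgroup.zero_mem _)⟩

/-- The differential restricted to `Z_r`. -/
def dZ (r n s k : ℤ) : C.Z r n s k →+ C.Z r (n + r) (s + 1) k :=
  (C.d.comp (C.Z r n s k).subtype).codRestrict _ fun x => C.d_mem x.2

/-- The differential `d_r : E_r ^ {n, s, k} → E_r ^ {n + r, s + 1, k}`, induced by `d`. -/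
def diff (r n s k : ℤ) : C.E r n s k →+ C.E r (n + r) (s + 1) k :=
  QuotientAddGroup.map _ _ (C.dZ r n s k) (by
    intro x hx
    change C.d x ∈ C.B r (n + r) (s + 1) k
    obtain ⟨y, hy, z, hz, hyz⟩ := AddSubgroup.mem_sup.1 (show (x : C.X) ∈ C.B r n s k from hx)
    obtain ⟨w, -, rfl⟩ := hz
    rw [← hyz, map_add, C.d_d, add_zero]
    refine AddSubgroup.mem_sup_right ⟨y, ?_, rfl⟩
    have e1 : n + r - r + 1 = n + 1 := by ring
    have e2 : s + 1 - 1 = s := by ring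
    rw [e1, e2]
    exact hy)

/-- Transport of pages along equalities of indices. -/
def cast {r n s k r' n' s' k' : ℤ} (hr : r = r') (hn : n = n') (hs : s = s') (hk : k = k') :
    C.E r n s k ≃+ C.E r' n' s' k' := by
  subst hr hn hs hk
  exact AddEquiv.refl _

end FilteredComplex

end Filtered

section Gradings

variable {A Γ : Type} [CommRing A] [CommRing Γ] [Algebra A Γ]

/-- The grading of `M ⊗_A Γ`. -/
def cofreeGr (η : A →+* Γ) (Γgr : ℤ → AddSubgroup Γ) {M : Type u} [AddCommGroup M] [Module A M]
    (Mgr : ℤ → AddSubgroup M) (k : ℤ) : AddSubgroup (Cofree η M) :=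
  AddSubgroup.closure {z | ∃ (i j : ℤ) (γ : Γ) (m : M), γ ∈ Γgr i ∧ m ∈ Mgr j ∧ i + j = k ∧
    Cofree.mk η γ m = z}

/-- The grading of `M ⊗_A Γ ⊗_A ⋯ ⊗_A Γ`. -/
def BpowGr (η : A →+* Γ) (Γgr : ℤ → AddSubgroup Γ) {M : Type u} [AddCommGroup M] [Module A M]
    (Mgr : ℤ → AddSubgroup M) : (s : ℕ) → ℤ → AddSubgroup (Bpow η M s)
  | 0 => Mgr
  | s + 1 => cofreeGr η Γgr (BpowGr η Γgr Mgr s)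

/-- The bigrading of a tensor product. -/
def tensorGr {M : Type u} [AddCommGroup M] [Module A M] (Mgr : ℤ → ℤ → AddSubgroup M)
    {N : Type w} [AddCommGroup N] [Module A N] (Ngr : ℤ → ℤ → AddSubgroup N) (j k : ℤ) :
    AddSubgroup (M ⊗[A] N) :=
  AddSubgroup.closure {z | ∃ (j₁ j₂ k₁ k₂ : ℤ) (m : M) (n : N), m ∈ Mgr j₁ k₁ ∧ n ∈ Ngr j₂ k₂ ∧
    j₁ + j₂ = j ∧ k₁ + k₂ = k ∧ m ⊗ₜ[A] n = z}

/-- The bigrading of the Koszul complex by chain degree `j` and internal degree `k`, where the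
generator `e_i` has chain degree `1` and internal degree `deg i`. -/
def koszulGr (Agr : ℤ → AddSubgroup A) (deg : ℕ → ℤ) (j k : ℤ) : AddSubgroup (Koszul A) :=
  AddSubgroup.closure {z | ∃ (l : List ℕ) (c : ℤ) (a : A), a ∈ Agr c ∧ (l.length : ℤ) = j ∧
    c + (l.map deg).sum = k ∧
    a • (l.map fun i => ExteriorAlgebra.ι A (Finsupp.single i (1 : A))).prod = z}

variable {H : HopfAlgebroid A Γ}

/-- The bigrading of `T ⊗ R ⊗ ⋯ ⊗ R`, where `T` is concentrated in chain degree `0`. -/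
def powerGr (T : DGComodule.{u} H) (R : DGComodule.{0} H) (Tgr : ℤ → AddSubgroup T.carrier)
    (Rgr : ℤ → ℤ → AddSubgroup R.carrier) :
    (m : ℕ) → ℤ → ℤ → AddSubgroup (T.power R m).carrier
  | 0 => fun j k => if j = 0 then Tgr k else ⊥
  | m + 1 => tensorGr (powerGr T R Tgr Rgr m) Rgr

end Gradings

section SpectralSequences

variable {A Γ : Type} [CommRing A] [CommRing Γ] [Algebra A Γ] (H : HopfAlgebroid A Γ)
  (Γgr : ℤ → AddSubgroup Γ)

/-- The submodule `I ^ n Y`; it is all of `Y` for `n ≤ 0`. -/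
def powSub (I : Ideal A) (Y : Type u) [AddCommGroup Y] [Module A Y] (n : ℤ) : Submodule A Y :=
  I ^ n.toNat • (⊤ : Submodule A Y)

lemma powSub_anti (I : Ideal A) (Y : Type u) [AddCommGroup Y] [Module A Y] :
    Antitone (powSub I Y) := fun _ _ h =>
  Submodule.smul_mono_left (Ideal.pow_le_pow_right (Int.toNat_le_toNat h))

/-- The total object of the cobar complex of a comodule. -/
abbrev CobarTotal (η : A →+* Γ) (Y : Type u) [AddCommGroup Y] [Module A Y] : Type u :=
  ⨁ s : ℕ, Bpow η Y s

/-- The cobar complex of a comodule `Y`, with the filtration whose `n`-th stage is the image of the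
cobar complex of `I ^ n Y`. -/
def filteredCobar {Y : Type u} [AddCommGroup Y] [Module A Y] (ψ : Y →ₗ[A] Cofree H.ηR Y)
    (hψ : Cofree.map H.ηR ψ ∘ₗ ψ = H.δ Y ∘ₗ ψ) (Ygr : ℤ → AddSubgroup Y) (I : Ideal A) :
    FilteredComplex.{u} where
  X := CobarTotal H.ηR Y
  d := DirectSum.toAddMonoid fun s =>
    (DirectSum.of (fun s => Bpow H.ηR Y s) (s + 1)).comp (cobar H ψ s)
  d_d := by
    intro x
    induction x using DirectSum.induction_on with
    | zero => rw [map_zero, map_zero]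
    | add x y hx hy => rw [map_add, map_add, hx, hy, add_zero]
    | of s x =>
      rw [DirectSum.toAddMonoid_of, AddMonoidHom.comp_apply, DirectSum.toAddMonoid_of,
        AddMonoidHom.comp_apply, cobar_cobar H ψ hψ, map_zero]
  gr s k :=
    { carrier := {x | ∀ i : ℕ, x i ∈ BpowGr H.ηR Γgr Ygr i k ∧ ((i : ℤ) ≠ s → x i = 0)}
      zero_mem' := fun i => ⟨AddSubgroup.zero_mem _, fun _ => rfl⟩
      add_mem' := fun hx hy i => ⟨AddSubgroup.add_mem _ (hx i).1 (hy i).1, fun h => by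
        rw [DirectSum.add_apply, (hx i).2 h, (hy i).2 h, add_zero]⟩
      neg_mem' := fun {x} hx i => by
        have e : (-x) i = -(x i) := rfl
        rw [e]
        exact ⟨AddSubgroup.neg_mem _ (hx i).1, fun h => by rw [(hx i).2 h, neg_zero]⟩ }
  F n :=
    { carrier := {x | ∀ i : ℕ,
        x i ∈ LinearMap.range (Bmap H.ηR (powSub I Y n).subtype i)}
      zero_mem' := fun i => Submodule.zero_mem _
      add_mem' := fun hx hy i => Submodule.add_mem _ (hx i) (hy i)
      neg_mem' := fun hx i => Submodule.neg_mem _ (hx i) }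
  F_anti := fun n n' h x hx i => by
    obtain ⟨y, hy⟩ := hx i
    refine ⟨Bmap H.ηR (Submodule.inclusion (powSub_anti I Y h)) i y, ?_⟩
    rw [← hy, ← LinearMap.comp_apply, ← Bmap_comp]
    rfl

variable {H} {R : DGComodule.{0} H}

/-- The term in bidegree `(n, s)` of the double complex: the term of degree `s` of the cobar complex
of `T ⊗ R ^ {⊗ (n + 1)}`. -/
abbrev totTerm (T : DGComodule.{u} H) (R : DGComodule.{0} H) (q : ℕ × ℕ) : ModuleCat.{u} A :=
  Bpow H.ηR (T.power R (q.1 + 1)).carrier q.2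

/-- The map induced on cobar complexes by the `n`-th differential of the cosimplicial object. -/
def totE (T : DGComodule.{u} H) (e : DGComodule.Unit R) (n s : ℕ) :
    totTerm T R (n, s) →+ totTerm T R (n + 1, s) :=
  (Bmap H.ηR (DGComodule.coface T e (n + 1)).lin s).toAddMonoidHom

/-- The cobar differential. -/
def totC (T : DGComodule.{u} H) (R : DGComodule.{0} H) (n s : ℕ) :
    totTerm T R (n, s) →+ totTerm T R (n, s + 1) := cobar H (T.power R (n + 1)).ψ s

/-- The map induced on cobar complexes by the internal differential. -/
def totI (T : DGComodule.{u} H) (R : DGComodule.{0} H) (n s : ℕ) :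
    totTerm T R (n, s) →+ totTerm T R (n, s) :=
  (Bmap H.ηR (T.power R (n + 1)).d s).toAddMonoidHom

lemma totE_totE (T : DGComodule.{u} H) (e : DGComodule.Unit R) (n s : ℕ) (x : totTerm T R (n, s)) :
    totE T e (n + 1) s (totE T e n s x) = 0 := by
  have h := congrArg (fun f => Bmap H.ηR f s) (DGComodule.coface_coface T e (n + 1))
  beta_reduce at h
  rw [Bmap_comp, Bmap_zero] at h
  exact LinearMap.congr_fun h x

lemma totC_totC (T : DGComodule.{u} H) (n s : ℕ) (x : totTerm T R (n, s)) :
    totC T R n (s + 1) (totC T R n s x) = 0 := cobar_cobar H _ (T.power R (n + 1)).coassoc s x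

lemma totI_totI (T : DGComodule.{u} H) (n s : ℕ) (x : totTerm T R (n, s)) :
    totI T R n s (totI T R n s x) = 0 := by
  have h := congrArg (fun f => Bmap H.ηR f s) (T.power R (n + 1)).d_d
  beta_reduce at h
  rw [Bmap_comp, Bmap_zero] at h
  exact LinearMap.congr_fun h x

lemma totE_totC (T : DGComodule.{u} H) (e : DGComodule.Unit R) (n s : ℕ) (x : totTerm T R (n, s)) :
    totE T e n (s + 1) (totC T R n s x) = totC T R (n + 1) s (totE T e n s x) :=
  cobar_natural H _ (DGComodule.coface T e (n + 1)).ψ_lin s x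

lemma totI_totC (T : DGComodule.{u} H) (n s : ℕ) (x : totTerm T R (n, s)) :
    totI T R n (s + 1) (totC T R n s x) = totC T R n s (totI T R n s x) :=
  cobar_natural H _ (T.power R (n + 1)).ψ_d s x

lemma totE_totI (T : DGComodule.{u} H) (e : DGComodule.Unit R) (n s : ℕ) (x : totTerm T R (n, s)) :
    totE T e n s (totI T R n s x) = totI T R (n + 1) s (totE T e n s x) := by
  have h := congrArg (fun f => Bmap H.ηR f s) (DGComodule.coface T e (n + 1)).d_lin
  beta_reduce at h
  rw [Bmap_comp, Bmap_comp] at h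
  exact LinearMap.congr_fun h x

/-- The differential of the total complex, on the term in bidegree `(n, s)`. -/
def totD (T : DGComodule.{u} H) (e : DGComodule.Unit R) :
    (⨁ q : ℕ × ℕ, totTerm T R q) →+ ⨁ q : ℕ × ℕ, totTerm T R q :=
  DirectSum.toAddMonoid fun q =>
    (DirectSum.of (fun q => totTerm T R q) (q.1 + 1, q.2)).comp (totE T e q.1 q.2) +
    ((-1) ^ q.1 : ℤ) •
      (DirectSum.of (fun q => totTerm T R q) (q.1, q.2 + 1)).comp (totC T R q.1 q.2) +
    ((-1) ^ (q.1 + q.2) : ℤ) • (DirectSum.of (fun q => totTerm T R q) q).comp (totI T R q.1 q.2)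

lemma totD_of (T : DGComodule.{u} H) (e : DGComodule.Unit R) (n s : ℕ) (x : totTerm T R (n, s)) :
    totD T e (DirectSum.of (fun q => totTerm T R q) (n, s) x) =
      DirectSum.of (fun q => totTerm T R q) (n + 1, s) (totE T e n s x) +
      ((-1) ^ n : ℤ) • DirectSum.of (fun q => totTerm T R q) (n, s + 1) (totC T R n s x) +
      ((-1) ^ (n + s) : ℤ) • DirectSum.of (fun q => totTerm T R q) (n, s) (totI T R n s x) := by
  rw [totD, DirectSum.toAddMonoid_of]
  rfl

lemma totD_totD (T : DGComodule.{u} H) (e : DGComodule.Unit R) (x : ⨁ q : ℕ × ℕ, totTerm T R q) :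
    totD T e (totD T e x) = 0 := by
  induction x using DirectSum.induction_on with
  | zero => rw [map_zero, map_zero]
  | add x y hx hy => rw [map_add, map_add, hx, hy, add_zero]
  | of q x =>
    obtain ⟨n, s⟩ := q
    rw [totD_of, map_add, map_add, map_zsmul, map_zsmul, totD_of, totD_of, totD_of, totE_totE,
      totC_totC, totI_totI, totE_totC, totI_totC, totE_totI]
    simp only [map_zero, smul_add, smul_smul, smul_zero, zero_add, add_zero, pow_add, pow_one]
    module

/-- The total complex of the cosimplicial object `n ↦ T ⊗ R ^ {⊗ (n + 1)}`, filtered by the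
cosimplicial degree `n`. The cohomological degree of an element in bidegree `(n, s)` and chain degree
`j` is `n + s - j`. -/
def totComplex (T : DGComodule.{u} H) (e : DGComodule.Unit R) (Tgr : ℤ → AddSubgroup T.carrier)
    (Rgr : ℤ → ℤ → AddSubgroup R.carrier) : FilteredComplex.{u} where
  X := ⨁ q : ℕ × ℕ, totTerm T R q
  d := totD T e
  d_d := totD_totD T e
  gr m k :=
    { carrier := {x | ∀ q : ℕ × ℕ, x q ∈ BpowGr H.ηR Γgr
        (powerGr T R Tgr Rgr (q.1 + 1) ((q.1 : ℤ) + q.2 - m)) q.2 k}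
      zero_mem' := fun q => AddSubgroup.zero_mem _
      add_mem' := fun hx hy q => AddSubgroup.add_mem _ (hx q) (hy q)
      neg_mem' := fun hx q => AddSubgroup.neg_mem _ (hx q) }
  F n :=
    { carrier := {x | ∀ q : ℕ × ℕ, (q.1 : ℤ) < n → x q = 0}
      zero_mem' := fun q _ => rfl
      add_mem' := fun hx hy q h => by rw [DirectSum.add_apply, hx q h, hy q h, add_zero]
      neg_mem' := fun {x} hx q h => by
        have e : (-x) q = -(x q) := rfl
        rw [e, hx q h, neg_zero] }
  F_anti := fun n n' h x hx q hq => hx q (lt_of_lt_of_le hq h)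

/-- The coaugmentation from the cobar complex of `T` to the total complex. -/
def coaug (T : DGComodule.{u} H) (e : DGComodule.Unit R) :
    CobarTotal H.ηR T.carrier →+ ⨁ q : ℕ × ℕ, totTerm T R q :=
  DirectSum.toAddMonoid fun s =>
    (DirectSum.of (fun q => totTerm T R q) (0, s)).comp
      (Bmap H.ηR (DGComodule.unitHom T e).lin s).toAddMonoidHom

end SpectralSequences

section Statement

/-- An equivalence between the spectral sequences of two filtered complexes `C` and `D`, under the
re-indexing `E_r ^ {n, s, k} (C) = E_{r + 1} ^ {n + s, s, k} (D)` for `r ≥ 1`, which is compatible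
with the abutments through a homomorphism `aug` from `C` to `D`. The index `r` below is shifted by
one, so that it starts from `0`. -/
structure Equivalence (C D : FilteredComplex.{u}) (aug : C.X →+ D.X) where
  /-- The isomorphisms of the pages. -/
  iso : ∀ (r : ℕ) (n s k : ℤ), C.E (r + 1) n s k ≃+ D.E (r + 2) (n + s) s k
  /-- The isomorphisms commute with the differentials. -/
  iso_diff : ∀ (r : ℕ) (n s k : ℤ) (x : C.E (r + 1) n s k),
    iso r (n + (r + 1)) (s + 1) k (C.diff (r + 1) n s k x) =
      D.cast rfl (by ring) rfl rfl (D.diff (r + 2) (n + s) s k (iso r n s k x))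
  /-- The isomorphism of each page is the one that the previous isomorphism induces on cohomology:
  if `x` and `y` represent classes of two consecutive pages of `C` and `D` and the classes on the
  first of these pages correspond to each other, then so do those on the next page. -/
  iso_succ : ∀ (r : ℕ) (n s k : ℤ) (x : C.X) (y : D.X)
    (hx : x ∈ C.Z (r + 1) n s k) (hx' : x ∈ C.Z ((r + 1 : ℕ) + 1) n s k)
    (hy : y ∈ D.Z (r + 2) (n + s) s k) (hy' : y ∈ D.Z ((r + 1 : ℕ) + 2) (n + s) s k),
    iso r n s k (C.cls _ _ _ _ ⟨x, hx⟩) = D.cls _ _ _ _ ⟨y, hy⟩ →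
      iso (r + 1) n s k (C.cls _ _ _ _ ⟨x, hx'⟩) = D.cls _ _ _ _ ⟨y, hy'⟩
  /-- The filtrations of the abutments correspond to each other: the class of a cocycle `z` of `C`
  comes from the stage `n` of the filtration if and only if that of `aug z` comes from the stage
  `n + s`. -/
  abut : ∀ (n s k : ℤ) (z : C.X), z ∈ C.gr s k → C.d z = 0 →
    ((∃ x ∈ C.F n ⊓ C.gr s k, ∃ w ∈ C.gr (s - 1) k, z = x + C.d w) ↔
      ∃ y ∈ D.F (n + s) ⊓ D.gr s k, ∃ w ∈ D.gr (s - 1) k, aug z = y + D.d w)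
  /-- On the abutments, the isomorphisms of the pages are those induced by `aug`. -/
  iso_abut : ∀ (r : ℕ) (n s k : ℤ), n + s ≤ r + 1 → ∀ (x : C.X) (y : D.X) (w : D.X)
    (hx : x ∈ C.Z (r + 1) n s k) (hy : y ∈ D.Z (r + 2) (n + s) s k), C.d x = 0 →
    w ∈ D.gr (s - 1) k → aug x = y + D.d w →
      iso r n s k (C.cls _ _ _ _ ⟨x, hx⟩) = D.cls _ _ _ _ ⟨y, hy⟩

variable (p : ℕ) [hp : Fact p.Prime]

/-- The degrees `p ^ (i + 1) - 1` of `v_{i+1}` and `t_{i+1}`. -/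
def genDeg (i : ℕ) : ℤ := (p : ℤ) ^ (i + 1) - 1

/-- The homogeneous elements of degree `k` of `BP_{2*}`. -/
def bpGr (k : ℤ) : AddSubgroup (BP p) :=
  (MvPolynomial.weightedHomogeneousSubmodule (ZLoc p) (genDeg p) k).toAddSubgroup

/-- The homogeneous elements of degree `k` of `BP_{2*}BP`. -/
def bpbpGr (k : ℤ) : AddSubgroup (BPBP p) :=
  AddSubgroup.closure {x | ∃ (c : ℤ) (a : BP p) (α : ℕ →₀ ℕ), a ∈ bpGr p c ∧
    c + Finsupp.weight (genDeg p) α = k ∧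
    (MvPolynomial.monomial α a : MvPolynomial ℕ (BP p)) = x}

/-- The sequence `p, v_1, v_2, …` -/
def vseq : ℕ → BP p
  | 0 => (p : BP p)
  | i + 1 => vgen p i

/-- The degrees of `p, v_1, v_2, …` -/
def vdeg (i : ℕ) : ℤ := (p : ℤ) ^ i - 1

/-- The augmentation ideal `I = (p, v_1, v_2, …)` of `BP_{2*}`. -/
def augIdeal : Ideal (BP p) := Ideal.span (Set.range (vseq p))

/-- A (graded) `BP_{2*}BP`-comodule. -/
structure GradedComodule where
  carrier : Type u
  [addCommGroup : AddCommGroup carrier]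
  [module : Module (BP p) carrier]
  gr : ℤ → AddSubgroup carrier
  isInternal : DirectSum.IsInternal gr
  smul_mem : ∀ (i j : ℤ) (a : BP p) (y : carrier), a ∈ bpGr p i → y ∈ gr j → a • y ∈ gr (i + j)
  /-- The coaction. -/
  ψ : carrier →ₗ[BP p] Cofree (bpHopf p).ηR carrier
  coassoc : Cofree.map (bpHopf p).ηR ψ ∘ₗ ψ = (bpHopf p).δ carrier ∘ₗ ψ
  counit : (bpHopf p).counit carrier ∘ₗ ψ = LinearMap.id
  ψ_mem : ∀ (k : ℤ) (y : carrier), y ∈ gr k → ψ y ∈ cofreeGr (bpHopf p).ηR (bpbpGr p) gr k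

attribute [instance] GradedComodule.addCommGroup GradedComodule.module

variable {p}

/-- A comodule as a differential comodule concentrated in chain degree `0`. -/
def GradedComodule.toDG (Y : GradedComodule.{u} p) : DGComodule.{u} (bpHopf p) where
  carrier := Y.carrier
  ψ := Y.ψ
  coassoc := Y.coassoc
  counit := Y.counit
  d := 0
  d_d := LinearMap.comp_zero _
  ψ_d := by rw [Cofree.map_zero', LinearMap.zero_comp, LinearMap.comp_zero]
  inv := LinearMap.id
  inv_inv := rfl
  inv_d := by rw [LinearMap.comp_zero, LinearMap.zero_comp, neg_zero]
  ψ_inv := by rw [Cofree.map_id]; rfl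

variable (p)

open CategoryTheory Abelian in
/-- A `BP_{2*}`-module `Y` has Levin index 1 if the maps
`Ext (I ^ n Y, 𝔽_p) → Ext (I ^ (n + 1) Y, 𝔽_p)` induced by the inclusions are zero for all `n ≥ 0`.
Here `𝔽_p = BP_{2*} / I`. -/
def HasLevinIndexOne (Y : Type u) [AddCommGroup Y] [Module (BP p) Y] : Prop :=
  ∀ (n q : ℕ) (e : Ext (ModuleCat.of (BP p) (powSub (augIdeal p) Y n))
      (ModuleCat.of (BP p) (ULift.{u} (BP p ⧸ augIdeal p))) q),
    (Ext.mk₀ (ModuleCat.ofHom (Submodule.inclusion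
      (powSub_anti (augIdeal p) Y (Int.le_add_one (le_refl (n : ℤ))))))).comp e (zero_add q) = 0

/-- The comodule algebra `BP_{2*}BP / I`, resolved by the Koszul complex of `p, v_1, v_2, …` -/
abbrev hComodule : DGComodule.{0} (bpHopf p) := koszulComodule (bpHopf p) (vseq p)

/-- Its bigrading. -/
def hGr : ℤ → ℤ → AddSubgroup (hComodule p).carrier :=
  fun j => cofreeGr (bpHopf p).ηR (bpbpGr p) (koszulGr (bpGr p) (vdeg p) j)

variable {p}

/-- The filtered complex of the algebraic Novikov spectral sequence of `Y` that is defined by the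
powers of the augmentation ideal. -/
def adicNovikov (Y : GradedComodule.{u} p) : FilteredComplex.{u} :=
  filteredCobar (bpHopf p) (bpbpGr p) Y.ψ Y.coassoc Y.gr (augIdeal p)

/-- The filtered complex of the algebraic Novikov spectral sequence of `Y` based on `BP_{2*}BP / I`,
that is, of the spectral sequence of the cosimplicial object `Y ⊗ CB (BP_{2*}BP / I)`. -/
def cosimplicialNovikov (Y : GradedComodule.{u} p) : FilteredComplex.{u} :=
  totComplex (bpbpGr p) Y.toDG (koszulUnit (bpHopf p) (vseq p)) Y.gr (hGr p)

/-- The comparison of the abutments of the two spectral sequences. -/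
def novikovAug (Y : GradedComodule.{u} p) : (adicNovikov Y).X →+ (cosimplicialNovikov Y).X :=
  coaug Y.toDG (koszulUnit (bpHopf p) (vseq p))

end Statement

end AlgNov

end

open scoped TensorProduct DirectSum

noncomputable section

namespace AlgNov

universe u w

section FilteredComparison

namespace FilteredComplex

variable {C D : FilteredComplex.{u}}

lemma mem_Z {r n s k : ℤ} {x : C.X} : x ∈ C.Z r n s k ↔
    (x ∈ C.F n ∧ x ∈ C.gr s k) ∧ C.d x ∈ C.F (n + r) ∧ C.d x ∈ C.gr (s + 1) k := Iff.rfl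

lemma mem_B {r n s k : ℤ} {x : C.X} : x ∈ C.B r n s k ↔
    ∃ y ∈ C.Z (r - 1) (n + 1) s k, ∃ z ∈ C.Z (r - 1) (n - r + 1) (s - 1) k, y + C.d z = x := by
  rw [B, AddSubgroup.mem_sup]
  constructor
  · rintro ⟨y, hy, _, ⟨z, hz, rfl⟩, h⟩
    exact ⟨y, hy, z, hz, h⟩
  · rintro ⟨y, hy, z, hz, h⟩
    exact ⟨y, hy, _, ⟨z, hz, rfl⟩, h⟩

lemma cls_surjective (r n s k : ℤ) : Function.Surjective (C.cls r n s k) :=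
  QuotientAddGroup.mk'_surjective _

lemma cls_eq_iff {r n s k : ℤ} (x y : C.Z r n s k) :
    C.cls r n s k x = C.cls r n s k y ↔ (x : C.X) - y ∈ C.B r n s k := by
  rw [← sub_eq_zero, ← map_sub]
  exact (QuotientAddGroup.eq_zero_iff (x - y)).trans AddSubgroup.mem_addSubgroupOf

lemma diff_cls {r n s k : ℤ} (x : C.Z r n s k) :
    C.diff r n s k (C.cls r n s k x) = C.cls r (n + r) (s + 1) k ⟨C.d x, C.d_mem x.2⟩ := rfl

lemma cast_cls {r n s k r' n' s' k' : ℤ} (hr : r = r') (hn : n = n') (hs : s = s') (hk : k = k')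
    (x : C.X) (hx : x ∈ C.Z r n s k) (hx' : x ∈ C.Z r' n' s' k') :
    C.cast hr hn hs hk (C.cls r n s k ⟨x, hx⟩) = C.cls r' n' s' k' ⟨x, hx'⟩ := by
  subst hr hn hs hk
  rfl

lemma d_mem_B {r n s k : ℤ} {x : C.X} (hx : x ∈ C.B r n s k) : C.d x ∈ C.B r (n + r) (s + 1) k := by
  obtain ⟨y, hy, z, -, rfl⟩ := mem_B.1 hx
  refine mem_B.2 ⟨0, AddSubgroup.zero_mem _, y, ?_, ?_⟩
  · rwa [show n + r - r + 1 = n + 1 by ring, show s + 1 - 1 = s by ring]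
  · rw [zero_add, map_add, C.d_d, add_zero]

/-- Elements of `Z_r` and `Z_{r+1}` that vanish on the page `r` vanish on the page `r + 1` after
correction by a boundary. -/
lemma mem_B_succ {r n s k : ℤ} {x : C.X} (hx : x ∈ C.B r n s k) (hd : C.d x ∈ C.F (n + (r + 1))) :
    x ∈ C.B (r + 1) n s k := by
  obtain ⟨y, hy, z, hz, rfl⟩ := mem_B.1 hx
  rw [map_add, C.d_d, add_zero] at hd
  refine mem_B.2 ⟨y, ⟨hy.1, ?_, hy.2.2⟩, z, ⟨⟨C.F_anti (by omega) hz.1.1, hz.1.2⟩, ?_, hz.2.2⟩, rfl⟩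
  · exact C.F_anti (by omega) hd
  · exact C.F_anti (by omega) hz.2.1

/-- The map between two pages that is induced by an additive map. -/
def pageHom {r n r' n' s k : ℤ} (f : C.X →+ D.X)
    (hZ : ∀ x ∈ C.Z r n s k, f x ∈ D.Z r' n' s k)
    (hB : ∀ x ∈ C.Z r n s k, x ∈ C.B r n s k → f x ∈ D.B r' n' s k) :
    C.E r n s k →+ D.E r' n' s k :=
  QuotientAddGroup.map _ _ ((f.comp (C.Z r n s k).subtype).codRestrict (D.Z r' n' s k)
    fun x => hZ x x.2) fun x hx => hB x x.2 hx

lemma pageHom_cls {r n r' n' s k : ℤ} (f : C.X →+ D.X)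
    (hZ : ∀ x ∈ C.Z r n s k, f x ∈ D.Z r' n' s k)
    (hB : ∀ x ∈ C.Z r n s k, x ∈ C.B r n s k → f x ∈ D.B r' n' s k) (x : C.Z r n s k) :
    pageHom f hZ hB (C.cls _ _ _ _ x) = D.cls _ _ _ _ ⟨f x, hZ x x.2⟩ := rfl

/-- An additive map that induces a bijection between two pages. -/
def pageEquiv {r n r' n' s k : ℤ} (f : C.X →+ D.X)
    (hZ : ∀ x ∈ C.Z r n s k, f x ∈ D.Z r' n' s k)
    (hB : ∀ x ∈ C.Z r n s k, x ∈ C.B r n s k ↔ f x ∈ D.B r' n' s k)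
    (hs : ∀ y ∈ D.Z r' n' s k, ∃ x ∈ C.Z r n s k, f x - y ∈ D.B r' n' s k) :
    C.E r n s k ≃+ D.E r' n' s k :=
  AddEquiv.ofBijective (pageHom f hZ fun x hx => (hB x hx).1) (by
    constructor
    · intro x x' h
      obtain ⟨x, rfl⟩ := C.cls_surjective _ _ _ _ x
      obtain ⟨x', rfl⟩ := C.cls_surjective _ _ _ _ x'
      rw [pageHom_cls, pageHom_cls, cls_eq_iff] at h
      rw [cls_eq_iff, hB _ (AddSubgroup.sub_mem _ x.2 x'.2), map_sub]
      exact h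
    · intro y
      obtain ⟨y, rfl⟩ := D.cls_surjective _ _ _ _ y
      obtain ⟨x, hx, h⟩ := hs y y.2
      exact ⟨C.cls _ _ _ _ ⟨x, hx⟩, (cls_eq_iff ⟨f x, hZ x hx⟩ y).2 h⟩)

lemma pageEquiv_cls {r n r' n' s k : ℤ} (f : C.X →+ D.X)
    (hZ : ∀ x ∈ C.Z r n s k, f x ∈ D.Z r' n' s k)
    (hB : ∀ x ∈ C.Z r n s k, x ∈ C.B r n s k ↔ f x ∈ D.B r' n' s k)
    (hs : ∀ y ∈ D.Z r' n' s k, ∃ x ∈ C.Z r n s k, f x - y ∈ D.B r' n' s k) (x : C.Z r n s k) :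
    pageEquiv f hZ hB hs (C.cls _ _ _ _ x) = D.cls _ _ _ _ ⟨f x, hZ x x.2⟩ := rfl

/-- A filtered chain map is tight if the cohomology of each stage of the filtration of its cone,
with a shift by one of the filtration of the source, vanishes in the next larger stage. -/
structure IsTight (C D : FilteredComplex.{u}) (f : C.X →+ D.X) : Prop where
  comm : ∀ x, f (C.d x) = D.d (f x)
  gr : ∀ s k x, x ∈ C.gr s k → f x ∈ D.gr s k
  F : ∀ n s k x, x ∈ C.F n → x ∈ C.gr s k → f x ∈ D.F n
  bound : ∀ m s k y c, y ∈ D.F m → y ∈ D.gr s k → c ∈ C.F (m + 1) → c ∈ C.gr (s + 1) k →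
    C.d c = 0 → D.d y = f c →
      ∃ x w, x ∈ C.F m ∧ x ∈ C.gr s k ∧ w ∈ D.F (m - 1) ∧ w ∈ D.gr (s - 1) k ∧ C.d x = c ∧
        y = f x + D.d w

namespace IsTight

variable {f : C.X →+ D.X} (hf : IsTight C D f)
include hf

lemma map_Z {r n s k : ℤ} {x : C.X} (hx : x ∈ C.Z r n s k) : f x ∈ D.Z r n s k := by
  refine mem_Z.2 ⟨⟨hf.F _ _ _ _ hx.1.1 hx.1.2, hf.gr _ _ _ hx.1.2⟩, ?_⟩
  rw [← hf.comm]
  exact ⟨hf.F _ _ _ _ hx.2.1 hx.2.2, hf.gr _ _ _ hx.2.2⟩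

lemma map_B {r n s k : ℤ} {x : C.X} (hx : x ∈ C.B r n s k) : f x ∈ D.B r n s k := by
  obtain ⟨y, hy, z, hz, rfl⟩ := mem_B.1 hx
  exact mem_B.2 ⟨f y, hf.map_Z hy, f z, hf.map_Z hz, by rw [map_add, hf.comm]⟩

lemma surj {r n s k : ℤ} (hr : 2 ≤ r) (y : D.X) (hy : y ∈ D.Z r n s k) :
    ∃ x ∈ C.Z r n s k, f x - y ∈ D.B r n s k := by
  obtain ⟨x, w, hx, hxg, hw, hwg, hdx, hyw⟩ := hf.bound (n + r) (s + 1) k (D.d y) 0 hy.2.1 hy.2.2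
    (AddSubgroup.zero_mem _) (AddSubgroup.zero_mem _) (map_zero _) (by rw [D.d_d, map_zero])
  rw [show s + 1 - 1 = s by ring] at hwg
  obtain ⟨x', w', hx', hxg', hw', hwg', hdx', hyw'⟩ := hf.bound n s k (y - w) x
    (AddSubgroup.sub_mem _ hy.1.1 (D.F_anti (by omega) hw)) (AddSubgroup.sub_mem _ hy.1.2 hwg)
    (C.F_anti (by omega) hx) hxg hdx (by rw [map_sub, hyw, add_sub_cancel_right])
  refine ⟨x', mem_Z.2 ⟨⟨hx', hxg'⟩, ?_⟩, mem_B.2 ⟨-w, ?_, -w', ?_, ?_⟩⟩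
  · rw [hdx']; exact ⟨hx, hxg⟩
  · have e : D.d (-w) = f x - D.d y := by rw [hyw, map_neg]; abel
    refine mem_Z.2 ⟨⟨AddSubgroup.neg_mem _ (D.F_anti (by omega) hw), AddSubgroup.neg_mem _ hwg⟩, ?_⟩
    rw [e]
    exact ⟨AddSubgroup.sub_mem _ (D.F_anti (by omega) (hf.F _ _ _ _ hx hxg))
      (D.F_anti (by omega) hy.2.1), AddSubgroup.sub_mem _ (hf.gr _ _ _ hxg) hy.2.2⟩
  · have e : D.d (-w') = f x' - (y - w) := by rw [hyw', map_neg]; abel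
    refine mem_Z.2 ⟨⟨AddSubgroup.neg_mem _ (D.F_anti (by omega) hw'), AddSubgroup.neg_mem _ hwg'⟩, ?_⟩
    rw [e, show s - 1 + 1 = s by ring]
    exact ⟨D.F_anti (by omega) (AddSubgroup.sub_mem _ (hf.F _ _ _ _ hx' hxg')
      (AddSubgroup.sub_mem _ hy.1.1 (D.F_anti (by omega : n ≤ n + r - 1) hw))),
      AddSubgroup.sub_mem _ (hf.gr _ _ _ hxg') (AddSubgroup.sub_mem _ hy.1.2 hwg)⟩
  · have e : f x' = y - w - D.d w' := by rw [hyw']; abel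
    rw [e, map_neg]; abel

lemma inj {r n s k : ℤ} (hr : 2 ≤ r) (x : C.X) (hx : x ∈ C.Z r n s k) (h : f x ∈ D.B r n s k) :
    x ∈ C.B r n s k := by
  obtain ⟨b, hb, w, hw, hbw⟩ := mem_B.1 h
  have hdb : D.d b = f (C.d x) := by
    rw [hf.comm, ← hbw, map_add, D.d_d, add_zero]
  obtain ⟨x₁, w₁, hx₁, hxg₁, hw₁, hwg₁, hdx₁, hyw₁⟩ := hf.bound (n + 1) s k b (C.d x) hb.1.1 hb.1.2
    (C.F_anti (by omega) hx.2.1) hx.2.2 (C.d_d _) hdb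
  rw [show n + 1 - 1 = n by ring] at hw₁
  have hxx : x - x₁ ∈ C.F n := AddSubgroup.sub_mem _ hx.1.1 (C.F_anti (by omega) hx₁)
  obtain ⟨x₂, w₂, hx₂, hxg₂, -, -, hdx₂, -⟩ := hf.bound (n - r + 1) (s - 1) k (w + w₁) (x - x₁)
    (AddSubgroup.add_mem _ hw.1.1 (D.F_anti (by omega) hw₁)) (AddSubgroup.add_mem _ hw.1.2 hwg₁)
    (C.F_anti (by omega) hxx) (by
      rw [show s - 1 + 1 = s by ring]; exact AddSubgroup.sub_mem _ hx.1.2 hxg₁)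
    (by rw [map_sub, hdx₁, sub_self]) (by
      rw [map_add, map_sub, ← hbw, hyw₁]; abel)
  refine mem_B.2 ⟨x₁, mem_Z.2 ⟨⟨hx₁, hxg₁⟩, ?_⟩, x₂, mem_Z.2 ⟨⟨hx₂, hxg₂⟩, ?_⟩, by rw [hdx₂]; abel⟩
  · rw [hdx₁]; exact ⟨C.F_anti (by omega) hx.2.1, hx.2.2⟩
  · rw [hdx₂, show s - 1 + 1 = s by ring]
    exact ⟨C.F_anti (by omega) hxx, AddSubgroup.sub_mem _ hx.1.2 hxg₁⟩

end IsTight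

/-- The same complex with another filtration. -/
abbrev refilter (C : FilteredComplex.{u}) (G : ℤ → AddSubgroup C.X) (hG : Antitone G) :
    FilteredComplex.{u} where
  X := C.X
  d := C.d
  d_d := C.d_d
  gr := C.gr
  F := G
  F_anti := hG

variable {G : ℤ → AddSubgroup C.X} {hG : Antitone G}

lemma mem_Z_refilter (h : ∀ m s k x, x ∈ C.gr s k → (x ∈ G m ↔ x ∈ C.F (m - s)))
    {r n s k : ℤ} {x : C.X} :
    x ∈ C.Z r n s k ↔ x ∈ (C.refilter G hG).Z (r + 1) (n + s) s k := by
  rw [mem_Z, mem_Z]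
  refine and_congr (and_congr_left fun hx => ?_) (and_congr_left fun hx => ?_)
  · rw [h _ _ _ _ hx, add_sub_cancel_right]
  · rw [h _ _ _ _ hx]
    rw [show n + s + (r + 1) - (s + 1) = n + r by ring]

lemma mem_B_refilter (h : ∀ m s k x, x ∈ C.gr s k → (x ∈ G m ↔ x ∈ C.F (m - s)))
    {r n s k : ℤ} {x : C.X} :
    x ∈ C.B r n s k ↔ x ∈ (C.refilter G hG).B (r + 1) (n + s) s k := by
  rw [mem_B, mem_B]
  have e1 : (r - 1) + 1 = r + 1 - 1 := by ring
  have e2 : (n + 1) + s = n + s + 1 := by ring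
  have e3 : (n - r + 1) + (s - 1) = n + s - (r + 1) + 1 := by ring
  have h1 : ∀ y, y ∈ C.Z (r - 1) (n + 1) s k ↔
      y ∈ (C.refilter G hG).Z (r + 1 - 1) (n + s + 1) s k := fun y => by
    rw [mem_Z_refilter (hG := hG) h, e1, e2]
  have h2 : ∀ y, y ∈ C.Z (r - 1) (n - r + 1) (s - 1) k ↔
      y ∈ (C.refilter G hG).Z (r + 1 - 1) (n + s - (r + 1) + 1) (s - 1) k := fun y => by
    rw [mem_Z_refilter (hG := hG) h, e1, e3]
  simp only [h1, h2]

end FilteredComplex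

open FilteredComplex

variable {C D : FilteredComplex.{u}}

/-- Tight maps to a common target, one of them after a shift of the filtration by the cohomological
degree, give an equivalence of spectral sequences. -/
theorem equivalence_of_isTight (aug : C.X →+ D.X) (G : ℤ → AddSubgroup C.X) (hG : Antitone G)
    (W : ℤ → AddSubgroup D.X) (hW : Antitone W)
    (hCG : ∀ m s k x, x ∈ C.gr s k → (x ∈ G m ↔ x ∈ C.F (m - s)))
    (hex : ∀ m x, m ≤ 0 → x ∈ C.F m) (hexW : ∀ m x, m ≤ 0 → x ∈ W m)
    (h₁ : IsTight (C.refilter G hG) (D.refilter W hW) aug)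
    (h₂ : IsTight D (D.refilter W hW) (AddMonoidHom.id D.X)) :
    Nonempty (Equivalence C D aug) := by
  have hZ₁ : ∀ (r : ℕ) (n s k : ℤ), ∀ x ∈ C.Z (r + 1) n s k,
      aug x ∈ (D.refilter W hW).Z (r + 2) (n + s) s k := fun r n s k x hx => by
    have := h₁.map_Z ((mem_Z_refilter (hG := hG) hCG).1 hx)
    rwa [add_assoc] at this
  have hB₁ : ∀ (r : ℕ) (n s k : ℤ), ∀ x ∈ C.Z (r + 1) n s k, x ∈ C.B (r + 1) n s k ↔
      aug x ∈ (D.refilter W hW).B (r + 2) (n + s) s k := fun r n s k x hx => by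
    have hx' := (mem_Z_refilter (hG := hG) hCG).1 hx
    rw [mem_B_refilter (hG := hG) hCG]
    rw [add_assoc] at hx' ⊢
    exact ⟨h₁.map_B, h₁.inj (by omega) x hx'⟩
  have hs₁ : ∀ (r : ℕ) (n s k : ℤ), ∀ y ∈ (D.refilter W hW).Z (r + 2) (n + s) s k,
      ∃ x ∈ C.Z (r + 1) n s k, aug x - y ∈ (D.refilter W hW).B (r + 2) (n + s) s k :=
    fun r n s k y hy => by
      obtain ⟨x, hx, hxy⟩ := h₁.surj (by omega) y hy
      refine ⟨x, (mem_Z_refilter (hG := hG) hCG).2 ?_, hxy⟩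
      rwa [add_assoc]
  let i₁ (r : ℕ) (n s k : ℤ) : C.E (r + 1) n s k ≃+ (D.refilter W hW).E (r + 2) (n + s) s k :=
    pageEquiv aug (hZ₁ r n s k) (hB₁ r n s k) (hs₁ r n s k)
  let i₂ (r : ℕ) (m s k : ℤ) : D.E (r + 2) m s k ≃+ (D.refilter W hW).E (r + 2) m s k :=
    pageEquiv (AddMonoidHom.id D.X) (fun x hx => h₂.map_Z hx)
      (fun x hx => ⟨h₂.map_B, h₂.inj (by omega) x hx⟩) (h₂.surj (by omega))
  have key : ∀ (r : ℕ) (n s k : ℤ) (x : C.X) (y : D.X) (hx : x ∈ C.Z (r + 1) n s k)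
      (hy : y ∈ D.Z (r + 2) (n + s) s k),
      (i₁ r n s k).trans (i₂ r (n + s) s k).symm (C.cls _ _ _ _ ⟨x, hx⟩) = D.cls _ _ _ _ ⟨y, hy⟩ ↔
        aug x - y ∈ (D.refilter W hW).B (r + 2) (n + s) s k := fun r n s k x y hx hy => by
    rw [AddEquiv.trans_apply, AddEquiv.symm_apply_eq, pageEquiv_cls, pageEquiv_cls, cls_eq_iff]
    rfl
  refine ⟨⟨fun r n s k => (i₁ r n s k).trans (i₂ r (n + s) s k).symm, ?_, ?_, ?_, ?_⟩⟩
  · intro r n s k x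
    obtain ⟨⟨x, hx⟩, rfl⟩ := C.cls_surjective _ _ _ _ x
    obtain ⟨⟨y, hy⟩, hxy⟩ := D.cls_surjective _ _ _ _
      ((i₁ r n s k).trans (i₂ r (n + s) s k).symm (C.cls _ _ _ _ ⟨x, hx⟩))
    have hB := (key r n s k x y hx hy).1 hxy.symm
    have hy' : D.d y ∈ D.Z (r + 2) (n + (r + 1) + (s + 1)) (s + 1) k := by
      have := D.d_mem hy
      rwa [show n + s + ((r : ℤ) + 2) = n + (r + 1) + (s + 1) by ring] at this
    rw [← hxy, diff_cls, diff_cls, cast_cls rfl _ rfl rfl _ _ hy', key]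
    have := d_mem_B hB
    rw [show n + s + ((r : ℤ) + 2) = n + (r + 1) + (s + 1) by ring] at this
    change D.d (aug x - y) ∈ _ at this
    rw [map_sub] at this
    have e : aug (C.d x) = D.d (aug x) := h₁.comm x
    rwa [e]
  · intro r n s k x y hx hx' hy hy' h
    rw [key] at h ⊢
    push_cast at hx' hy' ⊢
    have hd : (D.refilter W hW).d (aug x - y) ∈ (D.refilter W hW).F (n + s + ((r : ℤ) + 2 + 1)) := by
      rw [map_sub]
      refine AddSubgroup.sub_mem _ ?_ ?_
      · have := (h₁.map_Z ((mem_Z_refilter (hG := hG) hCG).1 hx')).2.1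
        exact (D.refilter W hW).F_anti (by omega) this
      · have := (h₂.map_Z hy').2.1
        exact (D.refilter W hW).F_anti (by omega) this
    have := mem_B_succ h hd
    rwa [show (r : ℤ) + 1 + 2 = r + 2 + 1 by ring]
  · intro n s k z hz hdz
    have hGF : ∀ x, x ∈ C.gr s k → (x ∈ G (n + s) ↔ x ∈ C.F n) := fun x hx => by
      rw [hCG _ _ _ _ hx, add_sub_cancel_right]
    constructor
    · rintro ⟨x, hx, w, hw, rfl⟩
      have hdx : C.d x = 0 := by rwa [map_add, C.d_d, add_zero] at hdz
      have hx' := h₁.F _ _ _ _ ((hGF x hx.2).2 hx.1) hx.2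
      obtain ⟨x', w', hx1, hx2, -, hw2, -, h⟩ := h₂.bound (n + s) s k (aug x) 0 hx'
        (h₁.gr _ _ _ hx.2) (AddSubgroup.zero_mem _) (AddSubgroup.zero_mem _) (map_zero _)
        ((h₁.comm x).symm.trans (by
          change aug (C.d x) = _
          rw [hdx, map_zero, map_zero]))
      have e : aug (C.d w) = D.d (aug w) := h₁.comm w
      refine ⟨x', ⟨hx1, hx2⟩, w' + aug w, AddSubgroup.add_mem _ hw2 (h₁.gr _ _ _ hw), ?_⟩
      change aug x = x' + D.d w' at h
      rw [map_add, map_add, e, h, add_assoc]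
    · rintro ⟨y, hy, w, hw, h⟩
      have e : aug (C.d z) = D.d (aug z) := h₁.comm z
      have hdy : D.d y = 0 := by
        have := congrArg D.d h
        rwa [← e, hdz, map_zero, map_add, D.d_d, add_zero, eq_comm] at this
      obtain ⟨x, w', hx1, hx2, -, hw2, hdx, hy'⟩ := h₁.bound (n + s) s k y 0
        (h₂.F _ _ _ _ hy.1 hy.2) hy.2 (AddSubgroup.zero_mem _) (AddSubgroup.zero_mem _) (map_zero _)
        (hdy.trans (map_zero _).symm)
      change y = aug x + D.d w' at hy'
      have hzx : z - x ∈ C.gr s k := AddSubgroup.sub_mem _ hz hx2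
      obtain ⟨x₂, -, -, hx₂, -, -, hdx₂, -⟩ := h₁.bound (min 0 (s - 1)) (s - 1) k (w' + w) (z - x)
        (hexW _ _ (min_le_left _ _)) (AddSubgroup.add_mem _ hw2 hw)
        ((hCG _ _ _ _ hzx).2 (hex _ _ (by have := min_le_right 0 (s - 1); omega)))
        (by rw [show s - 1 + 1 = s by ring]; exact hzx)
        (by
          change C.d x = 0 at hdx
          change C.d (z - x) = 0
          rw [map_sub, hdz, hdx, sub_zero])
        (by
          change D.d (w' + w) = aug (z - x)
          rw [map_sub, h, hy', map_add]; abel)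
      refine ⟨x, ⟨(hGF x hx2).1 hx1, hx2⟩, x₂, hx₂, ?_⟩
      change C.d x₂ = z - x at hdx₂
      rw [hdx₂]; abel
  · intro r n s k hr x y w hx hy hdx hw h
    rw [key]
    have hyW := h₂.map_Z hy
    have hxW := hZ₁ r n s k x hx
    refine mem_B.2 ⟨0, AddSubgroup.zero_mem _, w, mem_Z.2 ⟨⟨hexW _ _ (by omega), hw⟩, ?_⟩, ?_⟩
    · have e : D.d w = aug x - y := by rw [h]; abel
      change D.d w ∈ W _ ∧ D.d w ∈ D.gr _ k
      rw [e, show s - 1 + 1 = s by ring,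
        show n + s - ((r : ℤ) + 2) + 1 + (r + 2 - 1) = n + s by ring]
      exact AddSubgroup.sub_mem _ hxW.1 hyW.1
    · rw [h, zero_add]
      change D.d w = _
      abel

end FilteredComparison

section Adic

variable {A Γ : Type} [CommRing A] [CommRing Γ] [Algebra A Γ] {I : Ideal A}
  {M : Type u} [AddCommGroup M] [Module A M] {N : Type w} [AddCommGroup N] [Module A N]

lemma powSub_of_nonpos {n : ℤ} (hn : n ≤ 0) (x : M) : x ∈ powSub I M n := by
  rw [powSub, Int.toNat_of_nonpos hn, pow_zero, Ideal.one_eq_top, Submodule.top_smul]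
  trivial

/-- To check that an additive map sends `I ^ n M` to an additive subgroup, it suffices to consider
the elements `a • m` with `a` in `I ^ n`. -/
lemma map_mem_of_powSub {P : Type*} [AddCommGroup P] {n : ℤ} (f : M →+ P) (S : AddSubgroup P)
    (h : ∀ a ∈ I ^ n.toNat, ∀ m : M, f (a • m) ∈ S) {x : M} (hx : x ∈ powSub I M n) : f x ∈ S := by
  refine Submodule.smul_induction_on hx (fun a ha m _ => h a ha m) fun x y hx hy => ?_
  rw [map_add]
  exact S.add_mem hx hy

lemma smul_mem_powSub {n : ℤ} {a : A} (ha : a ∈ I ^ n.toNat) (m : M) : a • m ∈ powSub I M n :=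
  Submodule.smul_mem_smul ha trivial

lemma powSub_map {n : ℤ} (f : M →ₗ[A] N) {x : M} (hx : x ∈ powSub I M n) : f x ∈ powSub I N n :=
  map_mem_of_powSub f.toAddMonoidHom (powSub I N n).toAddSubgroup (fun a ha m => by
    change f (a • m) ∈ powSub I N n
    rw [map_smul]
    exact smul_mem_powSub ha _) hx

lemma smul_mem_powSub_succ {n : ℤ} {a : A} (ha : a ∈ I) {x : M} (hx : x ∈ powSub I M n) :
    a • x ∈ powSub I M (n + 1) := by
  refine map_mem_of_powSub (DistribSMul.toAddMonoidHom M a) (powSub I M (n + 1)).toAddSubgroup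
    (fun b hb m => ?_) hx
  change a • b • m ∈ powSub I M (n + 1)
  rw [smul_smul]
  refine smul_mem_powSub ?_ _
  have h : a * b ∈ I ^ (n.toNat + 1) := by
    rw [pow_succ']
    exact Ideal.mul_mem_mul ha hb
  exact Ideal.pow_le_pow_right (by omega) h

/-- A linear map with values in `I N` raises the `I`-adic filtration. -/
lemma powSub_map_succ {n : ℤ} (f : M →ₗ[A] N) (hf : ∀ x, f x ∈ powSub I N 1) {x : M}
    (hx : x ∈ powSub I M n) : f x ∈ powSub I N (n + 1) := by
  refine map_mem_of_powSub f.toAddMonoidHom (powSub I N (n + 1)).toAddSubgroup (fun a ha m => ?_) hx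
  change f (a • m) ∈ powSub I N (n + 1)
  rw [map_smul]
  refine map_mem_of_powSub (DistribSMul.toAddMonoidHom N a) (powSub I N (n + 1)).toAddSubgroup
    (fun b hb m => ?_) (hf m)
  change a • b • m ∈ powSub I N (n + 1)
  rw [smul_smul, mul_comm]
  refine smul_mem_powSub ?_ _
  have h : b * a ∈ I ^ (n.toNat + 1) := by
    rw [pow_succ']
    refine Ideal.mul_mem_mul ?_ ha
    simpa using hb
  exact Ideal.pow_le_pow_right (by omega) h

/-- An ideal of `A` is invariant if its extensions to `Γ` along the two units agree. -/
def IsInvariant (η : A →+* Γ) (I : Ideal A) : Prop := I.map η = I.map (algebraMap A Γ)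

variable {η : A →+* Γ}

/-- Elements `b γ` with `b` in the extension of an ideal along a ring homomorphism. -/
lemma map_mem_of_mem_map {P : Type*} [AddCommGroup P] (f : A →+* Γ) {J : Ideal A} (g : Γ →+ P)
    (S : AddSubgroup P) (h : ∀ a ∈ J, ∀ γ, g (f a * γ) ∈ S) {b : Γ} (hb : b ∈ J.map f) (γ : Γ) :
    g (b * γ) ∈ S := by
  refine Submodule.span_induction (p := fun b _ => ∀ γ, g (b * γ) ∈ S) ?_ ?_ ?_ ?_ hb γ
  · rintro _ ⟨a, ha, rfl⟩ γ
    exact h a ha γ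
  · intro γ
    rw [zero_mul, map_zero]
    exact S.zero_mem
  · intro x y _ _ hx hy γ
    rw [add_mul, map_add]
    exact S.add_mem (hx γ) (hy γ)
  · intro c x _ hx γ
    rw [smul_eq_mul, mul_comm c, mul_assoc]
    exact hx _

lemma IsInvariant.map_pow (hI : IsInvariant η I) (n : ℕ) :
    (I ^ n).map η = (I ^ n).map (algebraMap A Γ) := by
  rw [Ideal.map_pow, Ideal.map_pow, hI]

namespace Cofree

/-- `γ ↦ m ⊗ γ`. -/
def mkHom (η : A →+* Γ) (m : M) : Γ →+ Cofree η M where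
  toFun := fun γ => mk η γ m
  map_zero' := zero_mk η m
  map_add' := fun x y => add_mk η x y m

/-- `m ↦ m ⊗ γ`. -/
def mkHom' (η : A →+* Γ) (γ : Γ) : M →+ Cofree η M where
  toFun := fun m => mk η γ m
  map_zero' := mk_zero η γ
  map_add' := fun x y => mk_add η γ x y

lemma mk_mem_powSub (hI : IsInvariant η I) {n : ℤ} (γ : Γ) {m : M} (hm : m ∈ powSub I M n) :
    mk η γ m ∈ powSub I (Cofree η M) n := by
  refine map_mem_of_powSub (mkHom' η γ) (powSub I (Cofree η M) n).toAddSubgroup (fun a ha m => ?_) hm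
  change mk η γ (a • m) ∈ powSub I (Cofree η M) n
  rw [mk_smul]
  have h1 : algebraMap A Γ a ∈ (I ^ n.toNat).map η := by
    rw [hI.map_pow]
    exact Ideal.mem_map_of_mem _ ha
  refine map_mem_of_mem_map η (mkHom η m) (powSub I (Cofree η M) n).toAddSubgroup
    (fun a ha γ => ?_) h1 γ
  exact smul_mem_powSub (M := Cofree η M) ha (mk η γ m)

/-- `I ^ n (M ⊗ Γ)` is generated by `m ⊗ γ` with `m` in `I ^ n M`. -/
lemma map_mem_of_powSub' (hI : IsInvariant η I) {n : ℤ} {P : Type*} [AddCommGroup P]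
    (f : Cofree η M →+ P) (S : AddSubgroup P) (h : ∀ γ, ∀ m ∈ powSub I M n, f (mk η γ m) ∈ S)
    {x : Cofree η M} (hx : x ∈ powSub I (Cofree η M) n) : f x ∈ S := by
  refine map_mem_of_powSub f S (fun a ha z => ?_) hx
  induction z using Cofree.induction with
  | h0 => rw [smul_zero, map_zero]; exact S.zero_mem
  | hadd x y hx hy => rw [smul_add, map_add]; exact S.add_mem hx hy
  | hmk γ m =>
    rw [asmul_mk]
    have h1 : η a ∈ (I ^ n.toNat).map (algebraMap A Γ) := by
      rw [← hI.map_pow]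
      exact Ideal.mem_map_of_mem _ ha
    refine map_mem_of_mem_map (algebraMap A Γ) (f.comp (mkHom η m)) S (fun a ha γ => ?_) h1 γ
    change f (mk η _ m) ∈ S
    rw [← mk_smul]
    exact h γ _ (smul_mem_powSub ha m)

lemma one_mem_powSub (hI : IsInvariant η I) {n : ℤ} {m : M} (hm : m ∈ powSub I M n) :
    one η m ∈ powSub I (Cofree η M) n := mk_mem_powSub hI 1 hm

/-- If `f` has values in `I N`, then `f ⊗ id` has values in `I (N ⊗ Γ)`. -/
lemma map_mem_powSub (hI : IsInvariant η I) (f : M →ₗ[A] N) {n : ℤ} (hf : ∀ x, f x ∈ powSub I N n)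
    (z : Cofree η M) : map η f z ∈ powSub I (Cofree η N) n := by
  induction z using Cofree.induction with
  | h0 => rw [_root_.map_zero]; exact Submodule.zero_mem _
  | hadd x y hx hy => rw [_root_.map_add]; exact Submodule.add_mem _ hx hy
  | hmk γ m => rw [map_mk]; exact mk_mem_powSub hI γ (hf m)

end Cofree

variable {N : Type u} [AddCommGroup N] [Module A N]

lemma Bmap_mem_powSub (hI : IsInvariant η I) (f : M →ₗ[A] N) {n : ℤ} (hf : ∀ x, f x ∈ powSub I N n)
    (s : ℕ) (z : Bpow η M s) : Bmap η f s z ∈ powSub I (Bpow η N s) n := by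
  induction s with
  | zero => exact hf z
  | succ s ih => exact Cofree.map_mem_powSub hI (Bmap η f s) ih z

lemma Bmap_id (s : ℕ) : Bmap η (LinearMap.id : M →ₗ[A] M) s = LinearMap.id := by
  induction s with
  | zero => rfl
  | succ s ih =>
    change Cofree.map η (Bmap η (LinearMap.id : M →ₗ[A] M) s) = _
    rw [ih, Cofree.map_id]
    rfl

lemma Bmap_add (f g : M →ₗ[A] N) (s : ℕ) : Bmap η (f + g) s = Bmap η f s + Bmap η g s := by
  induction s with
  | zero => rfl
  | succ s ih =>
    change Cofree.map η (Bmap η (f + g) s) = _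
    rw [ih, Cofree.map_add']
    rfl

/-- The cobar complex of the subcomodule `I ^ n M` has image `I ^ n` times the cobar complex. -/
lemma range_Bmap_powSub (hI : IsInvariant η I) (n : ℤ) (s : ℕ) (x : Bpow η M s) :
    x ∈ LinearMap.range (Bmap η (powSub I M n).subtype s) ↔ x ∈ powSub I (Bpow η M s) n := by
  constructor
  · rintro ⟨y, rfl⟩
    exact Bmap_mem_powSub hI _ (fun x => x.2) s y
  · induction s with
    | zero => exact fun hx => ⟨⟨x, hx⟩, rfl⟩
    | succ s ih =>
      intro hx
      refine Cofree.map_mem_of_powSub' hI (M := Bpow η M s) (AddMonoidHom.id _)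
        (LinearMap.range (Bmap η (powSub I M n).subtype (s + 1))).toAddSubgroup (fun γ m hm => ?_) hx
      obtain ⟨y, rfl⟩ := ih m hm
      exact ⟨Cofree.mk η γ y, rfl⟩

end Adic

section Graded

variable {A Γ : Type} [CommRing A] [CommRing Γ] [Algebra A Γ]

/-- The grading of `Γ`, as an `A`-module through the right unit. -/
def rightGr (η : A →+* Γ) (Γgr : ℤ → AddSubgroup Γ) : ℤ → AddSubgroup (RightUnit η) := Γgr

/-- A grading of a module, compatible with a grading of the ring. -/
def IsGraded (Agr : ℤ → AddSubgroup A) {M : Type u} [AddCommGroup M] [Module A M]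
    (Mgr : ℤ → AddSubgroup M) : Prop :=
  ∀ i k a m, a ∈ Agr i → m ∈ Mgr k → a • m ∈ Mgr (i + k)

/-- The structure maps of a Hopf algebroid respect gradings. -/
structure HopfGrading (H : HopfAlgebroid A Γ) (Agr : ℤ → AddSubgroup A)
    (Γgr : ℤ → AddSubgroup Γ) : Prop where
  amul_mem : ∀ i j a b, a ∈ Agr i → b ∈ Agr j → a * b ∈ Agr (i + j)
  one_mem : 1 ∈ Γgr 0
  mul_mem : ∀ i j x y, x ∈ Γgr i → y ∈ Γgr j → x * y ∈ Γgr (i + j)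
  left_mem : ∀ i a, a ∈ Agr i → algebraMap A Γ a ∈ Γgr i
  right_mem : ∀ i a, a ∈ Agr i → H.ηR a ∈ Γgr i
  ε_mem : ∀ i x, x ∈ Γgr i → H.ε x ∈ Agr i
  Δ_mem : ∀ i x, x ∈ Γgr i → H.Δ x ∈ cofreeGr H.ηR Γgr (rightGr H.ηR Γgr) i

variable {Agr : ℤ → AddSubgroup A} {Γgr : ℤ → AddSubgroup Γ} {η : A →+* Γ}
  {M : Type u} [AddCommGroup M] [Module A M] {Mgr : ℤ → AddSubgroup M}
  {N : Type w} [AddCommGroup N] [Module A N] {Ngr : ℤ → AddSubgroup N}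

lemma mk_mem_cofreeGr {i j k : ℤ} {γ : Γ} {m : M} (hγ : γ ∈ Γgr i) (hm : m ∈ Mgr j)
    (h : i + j = k) : Cofree.mk η γ m ∈ cofreeGr η Γgr Mgr k :=
  AddSubgroup.subset_closure ⟨i, j, γ, m, hγ, hm, h, rfl⟩

lemma map_mem_of_cofreeGr {P : Type*} [AddCommGroup P] {k : ℤ} (f : Cofree η M →+ P)
    (S : AddSubgroup P)
    (h : ∀ i j γ m, γ ∈ Γgr i → m ∈ Mgr j → i + j = k → f (Cofree.mk η γ m) ∈ S) {z : Cofree η M}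
    (hz : z ∈ cofreeGr η Γgr Mgr k) : f z ∈ S := by
  have : cofreeGr η Γgr Mgr k ≤ S.comap f := by
    refine (AddSubgroup.closure_le _).2 ?_
    rintro _ ⟨i, j, γ, m, hγ, hm, hij, rfl⟩
    exact h i j γ m hγ hm hij
  exact this hz

lemma map_mem_cofreeGr (f : M →ₗ[A] N) (hf : ∀ k m, m ∈ Mgr k → f m ∈ Ngr k) {k : ℤ}
    {z : Cofree η M} (hz : z ∈ cofreeGr η Γgr Mgr k) :
    Cofree.map η f z ∈ cofreeGr η Γgr Ngr k :=
  map_mem_of_cofreeGr (Cofree.map η f).toAddMonoidHom _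
    (fun _ _ _ _ hγ hm h => mk_mem_cofreeGr hγ (hf _ _ hm) h) hz

lemma Bmap_mem_BpowGr {N : Type u} [AddCommGroup N] [Module A N] {Ngr : ℤ → AddSubgroup N}
    (f : M →ₗ[A] N) (hf : ∀ k m, m ∈ Mgr k → f m ∈ Ngr k) (s : ℕ) {k : ℤ}
    {z : Bpow η M s} (hz : z ∈ BpowGr η Γgr Mgr s k) : Bmap η f s z ∈ BpowGr η Γgr Ngr s k := by
  induction s generalizing k with
  | zero => exact hf _ _ hz
  | succ s ih => exact map_mem_cofreeGr (Bmap η f s) (fun k m hm => ih hm) hz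

section TensorGr

variable {Mgr : ℤ → ℤ → AddSubgroup M} {Ngr : ℤ → ℤ → AddSubgroup N}

lemma tmul_mem_tensorGr {i j J a b k : ℤ} {m : M} {n : N} (hm : m ∈ Mgr i a) (hn : n ∈ Ngr j b)
    (h : i + j = J) (h' : a + b = k) : m ⊗ₜ[A] n ∈ tensorGr Mgr Ngr J k :=
  AddSubgroup.subset_closure ⟨i, j, a, b, m, n, hm, hn, h, h', rfl⟩

lemma map_mem_of_tensorGr {P : Type*} [AddCommGroup P] {J k : ℤ} (f : M ⊗[A] N →+ P)
    (S : AddSubgroup P)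
    (h : ∀ i j a b m n, m ∈ Mgr i a → n ∈ Ngr j b → i + j = J → a + b = k → f (m ⊗ₜ[A] n) ∈ S)
    {z : M ⊗[A] N} (hz : z ∈ tensorGr Mgr Ngr J k) : f z ∈ S := by
  have : tensorGr Mgr Ngr J k ≤ S.comap f := by
    refine (AddSubgroup.closure_le _).2 ?_
    rintro _ ⟨i, j, a, b, m, n, hm, hn, h1, h2, rfl⟩
    exact h i j a b m n hm hn h1 h2
  exact this hz

lemma tensorMap_mem {M' : Type*} [AddCommGroup M'] [Module A M'] {Mgr' : ℤ → ℤ → AddSubgroup M'}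
    {N' : Type*} [AddCommGroup N'] [Module A N'] {Ngr' : ℤ → ℤ → AddSubgroup N'}
    (f : M →ₗ[A] M') (g : N →ₗ[A] N') (e e' c c' : ℤ)
    (hf : ∀ J k m, m ∈ Mgr J k → f m ∈ Mgr' (J + e) (k + c))
    (hg : ∀ J k n, n ∈ Ngr J k → g n ∈ Ngr' (J + e') (k + c')) {J k J' k' : ℤ} {z : M ⊗[A] N}
    (hz : z ∈ tensorGr Mgr Ngr J k) (hJ : J' = J + e + e') (hk : k' = k + c + c') :
    TensorProduct.map f g z ∈ tensorGr Mgr' Ngr' J' k' :=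
  map_mem_of_tensorGr (TensorProduct.map f g).toAddMonoidHom _ (fun i j a b m n hm hn h1 h2 =>
    tmul_mem_tensorGr (hf _ _ _ hm) (hg _ _ _ hn) (by omega) (by omega)) hz

lemma isGraded_tensorGr (hM : ∀ J, IsGraded Agr (Mgr J)) (J : ℤ) :
    IsGraded Agr (tensorGr (A := A) Mgr Ngr J) := by
  intro i k a z ha hz
  refine map_mem_of_tensorGr (DistribSMul.toAddMonoidHom _ a) _
    (fun j j' b b' m n hm hn h1 h2 => ?_) hz
  change a • (m ⊗ₜ[A] n) ∈ _
  rw [TensorProduct.smul_tmul']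
  exact tmul_mem_tensorGr (hM j i b a m ha hm) hn h1 (by omega)

end TensorGr

variable {H : HopfAlgebroid A Γ} (hH : HopfGrading H Agr Γgr)
include hH

lemma gsmul_mem_cofreeGr {i k l : ℤ} {γ : Γ} (hγ : γ ∈ Γgr i) {z : Cofree H.ηR M}
    (hz : z ∈ cofreeGr H.ηR Γgr Mgr k) (h : i + k = l) : γ • z ∈ cofreeGr H.ηR Γgr Mgr l := by
  refine map_mem_of_cofreeGr (DistribSMul.toAddMonoidHom (Cofree H.ηR M) γ) _
    (fun j b γ m hγ hm h => ?_) hz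
  exact mk_mem_cofreeGr (hH.mul_mem _ _ _ _ ‹_› hγ) hm (by omega)

lemma one_mem_cofreeGr {k : ℤ} {m : M} (hm : m ∈ Mgr k) :
    Cofree.one H.ηR m ∈ cofreeGr H.ηR Γgr Mgr k := mk_mem_cofreeGr hH.one_mem hm (zero_add k)

lemma δ_mem_cofreeGr {k : ℤ} {z : Cofree H.ηR M} (hz : z ∈ cofreeGr H.ηR Γgr Mgr k) :
    H.δ M z ∈ cofreeGr H.ηR Γgr (cofreeGr H.ηR Γgr Mgr) k := by
  refine map_mem_of_cofreeGr (H.δ M).toAddMonoidHom _ (fun i j γ m hγ hm h => ?_) hz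
  change Cofree.map H.ηR (H.ins m) (H.Δ γ) ∈ _
  refine map_mem_of_cofreeGr (Cofree.map H.ηR (H.ins m)).toAddMonoidHom _
    (fun a b x y hx hy h' => ?_) (hH.Δ_mem _ _ hγ)
  exact mk_mem_cofreeGr hx (mk_mem_cofreeGr (k := b + j) hy hm rfl) (by omega)

lemma counit_mem (hM : IsGraded Agr Mgr) {k : ℤ} {z : Cofree H.ηR M}
    (hz : z ∈ cofreeGr H.ηR Γgr Mgr k) : H.counit M z ∈ Mgr k := by
  refine map_mem_of_cofreeGr (H.counit M).toAddMonoidHom _ (fun i j γ m hγ hm h => ?_) hz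
  rw [← h]
  exact hM _ _ _ _ (hH.ε_mem _ _ hγ) hm

lemma cobarD_mem {ψ : M →ₗ[A] Cofree H.ηR M}
    (hψ : ∀ k m, m ∈ Mgr k → ψ m ∈ cofreeGr H.ηR Γgr Mgr k) (s : ℕ) {k : ℤ} {z : Bpow H.ηR M s}
    (hz : z ∈ BpowGr H.ηR Γgr Mgr s k) :
    cobarD H ψ s z ∈ cofreeGr H.ηR Γgr (BpowGr H.ηR Γgr Mgr s) k := by
  induction s generalizing k with
  | zero => exact hψ _ _ hz
  | succ s ih =>
    exact AddSubgroup.add_mem _ (map_mem_cofreeGr (cobarD H ψ s) (fun k m hm => ih hm) hz)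
      (AddSubgroup.zsmul_mem _ (δ_mem_cofreeGr hH hz) _)

lemma cobar_mem {ψ : M →ₗ[A] Cofree H.ηR M}
    (hψ : ∀ k m, m ∈ Mgr k → ψ m ∈ cofreeGr H.ηR Γgr Mgr k) (s : ℕ) {k : ℤ} {z : Bpow H.ηR M s}
    (hz : z ∈ BpowGr H.ηR Γgr Mgr s k) : cobar H ψ s z ∈ BpowGr H.ηR Γgr Mgr (s + 1) k :=
  AddSubgroup.add_mem _ (cobarD_mem hH hψ s hz)
    (AddSubgroup.zsmul_mem _ (one_mem_cofreeGr hH hz) _)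

lemma mu_mem {Mgr : ℤ → ℤ → AddSubgroup M} {Ngr : ℤ → ℤ → AddSubgroup N} {i j J a b k : ℤ}
    {x : Cofree H.ηR M} {y : Cofree H.ηR N} (hx : x ∈ cofreeGr H.ηR Γgr (Mgr i) a)
    (hy : y ∈ cofreeGr H.ηR Γgr (Ngr j) b) (h : i + j = J) (h' : a + b = k) :
    Cofree.mu H.ηR M N (x ⊗ₜ y) ∈ cofreeGr H.ηR Γgr (tensorGr Mgr Ngr J) k := by
  let f : Cofree H.ηR M →+ Cofree H.ηR (M ⊗[A] N) :=
    (Cofree.mu H.ηR M N).toAddMonoidHom.comp ((TensorProduct.mk A _ _).flip y).toAddMonoidHom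
  refine map_mem_of_cofreeGr f _ (fun a₁ a₂ γ m hγ hm e => ?_) hx
  let g : Cofree H.ηR N →+ Cofree H.ηR (M ⊗[A] N) :=
    (Cofree.mu H.ηR M N).toAddMonoidHom.comp
      (TensorProduct.mk A _ _ (Cofree.mk H.ηR γ m)).toAddMonoidHom
  refine map_mem_of_cofreeGr g _ (fun b₁ b₂ γ' n hγ' hn e' => ?_) hy
  exact mk_mem_cofreeGr (hH.mul_mem _ _ _ _ hγ hγ')
    (tmul_mem_tensorGr (k := a₂ + b₂) hm hn h rfl) (by omega)

lemma tensorψ_mem {T : DGComodule.{u} H} {R : DGComodule.{0} H} {Tgr : ℤ → ℤ → AddSubgroup T.carrier}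
    {Rgr : ℤ → ℤ → AddSubgroup R.carrier}
    (hT : ∀ J k m, m ∈ Tgr J k → T.ψ m ∈ cofreeGr H.ηR Γgr (Tgr J) k)
    (hR : ∀ J k m, m ∈ Rgr J k → R.ψ m ∈ cofreeGr H.ηR Γgr (Rgr J) k) {J k : ℤ}
    {x : T.carrier ⊗[A] R.carrier} (hx : x ∈ tensorGr Tgr Rgr J k) :
    DGComodule.tensorψ T R x ∈ cofreeGr H.ηR Γgr (tensorGr Tgr Rgr J) k :=
  map_mem_of_tensorGr (DGComodule.tensorψ T R).toAddMonoidHom _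
    (fun _ _ _ _ _ _ hm hn h1 h2 => mu_mem hH (hT _ _ _ hm) (hR _ _ _ hn) h1 h2) hx

end Graded

section Conjugation

variable {A Γ : Type} [CommRing A] [CommRing Γ] [Algebra A Γ]

/-- Ring homomorphisms out of `Γ ⊗_A Γ`. -/
def tensorLift (η : A →+* Γ) {S : Type*} [CommRing S] (f g : Γ →+* S)
    (h : ∀ a, f (algebraMap A Γ a) = g (η a)) : Cofree η (RightUnit η) →+* S :=
  let F : Cofree η (RightUnit η) →+ S := Cofree.lift
    { toFun := fun γ => (AddMonoidHom.mulLeft (f γ)).comp g.toAddMonoidHom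
      map_zero' := AddMonoidHom.ext fun m =>
        (show ∀ m : Γ, f 0 * g m = 0 from fun m => by rw [map_zero, zero_mul]) m
      map_add' := fun x y => AddMonoidHom.ext fun m =>
        (show ∀ m : Γ, f (x + y) * g m = f x * g m + f y * g m from
          fun m => by rw [map_add, add_mul]) m }
    fun a γ m => (show ∀ m : Γ, f (algebraMap A Γ a * γ) * g m = f γ * g (η a * m) from
      fun m => by rw [map_mul, map_mul, h]; ring) m
  { F with
    map_one' := by
      change f 1 * g 1 = 1
      rw [map_one, map_one, one_mul]
    map_mul' := fun x y => by
      change F (x * y) = F x * F y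
      have hF : ∀ γ (m : RightUnit η), F (Cofree.mk η γ m) = f γ * g m := fun _ _ => rfl
      induction x using Cofree.induction with
      | h0 => rw [zero_mul, map_zero, zero_mul]
      | hadd x y hx hy => rw [add_mul, map_add, map_add, add_mul, hx, hy]
      | hmk γ m =>
        induction y using Cofree.induction with
        | h0 => rw [mul_zero, map_zero, mul_zero]
        | hadd x y hx hy => rw [mul_add, map_add, map_add, mul_add, hx, hy]
        | hmk γ' n =>
          rw [Cofree.mk_mul_mk, hF, hF, hF, map_mul]
          have e : g (m * n) = g m * g n := map_mul g (m : Γ) (n : Γ)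
          rw [e]; ring }

lemma tensorLift_mk (η : A →+* Γ) {S : Type*} [CommRing S] (f g : Γ →+* S)
    (h : ∀ a, f (algebraMap A Γ a) = g (η a)) (γ γ' : Γ) :
    tensorLift η f g h (Cofree.mk η γ (RightUnit.of η γ')) = f γ * g γ' := rfl

/-- A conjugation for a Hopf algebroid. -/
structure Conjugation (H : HopfAlgebroid A Γ) where
  c : Γ →+* Γ
  c_left : ∀ a, c (algebraMap A Γ a) = H.ηR a
  c_right : ∀ a, c (H.ηR a) = algebraMap A Γ a
  antipode : ∀ x, tensorLift H.ηR (RingHom.id Γ) c (fun a => (c_right a).symm) (H.Δ x) =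
    H.ηR (H.ε x)
  comul : ∀ x, tensorLift H.ηR (H.Δ.comp c) (inclΓ H.ηR (RightUnit H.ηR))
    (fun a => by rw [RingHom.comp_apply, c_left, H.Δ_ηR]; rfl) (H.Δ x) =
      Cofree.mk H.ηR 1 (RightUnit.of H.ηR (c x))

section Gact

variable (η : A →+* Γ) (M : Type u) [AddCommGroup M] [Module A M]
  (K : Type w) [AddCommGroup K] [Module A K]

/-- Multiplication by an element of `Γ` on `M ⊗_A Γ`. -/
def gmul (γ : Γ) : Cofree η K →ₗ[A] Cofree η K where
  toFun := fun z => γ • z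
  map_add' := smul_add γ
  map_smul' := fun a z => by
    rw [Cofree.smul_def, smul_comm]; rfl

/-- The action of `Γ` on `M ⊗ (K ⊗ Γ)`. -/
def gact (γ : Γ) : M ⊗[A] Cofree η K →ₗ[A] M ⊗[A] Cofree η K :=
  TensorProduct.map LinearMap.id (gmul η K γ)

lemma gact_tmul (γ γ' : Γ) (m : M) (k : K) :
    gact η M K γ (m ⊗ₜ Cofree.mk η γ' k) = m ⊗ₜ Cofree.mk η (γ * γ') k := rfl

variable {M K}

@[elab_as_elim]
lemma tensor_cofree_induction {P : M ⊗[A] Cofree η K → Prop} (z : M ⊗[A] Cofree η K) (h0 : P 0)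
    (hmk : ∀ m γ k, P (m ⊗ₜ Cofree.mk η γ k)) (hadd : ∀ x y, P x → P y → P (x + y)) : P z := by
  induction z using TensorProduct.induction_on with
  | zero => exact h0
  | add x y hx hy => exact hadd x y hx hy
  | tmul m z =>
    induction z using Cofree.induction with
    | h0 => rw [TensorProduct.tmul_zero]; exact h0
    | hmk γ k => exact hmk m γ k
    | hadd x y hx hy => rw [TensorProduct.tmul_add]; exact hadd _ _ hx hy

lemma gact_gact (γ γ' : Γ) (z : M ⊗[A] Cofree η K) :
    gact η M K γ (gact η M K γ' z) = gact η M K (γ * γ') z := by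
  induction z using tensor_cofree_induction with
  | h0 => simp only [map_zero]
  | hadd x y hx hy => simp only [map_add, hx, hy]
  | hmk m γ'' k => rw [gact_tmul, gact_tmul, gact_tmul, mul_assoc]

lemma gact_right (a : A) (z : M ⊗[A] Cofree η K) : gact η M K (η a) z = a • z := by
  induction z using tensor_cofree_induction with
  | h0 => simp only [map_zero, smul_zero]
  | hadd x y hx hy => simp only [map_add, smul_add, hx, hy]
  | hmk m γ'' k =>
    rw [gact_tmul]
    change m ⊗ₜ (a • Cofree.mk η γ'' k) = _
    rw [TensorProduct.tmul_smul]

lemma gact_one (z : M ⊗[A] Cofree η K) : gact η M K 1 z = z := by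
  induction z using tensor_cofree_induction with
  | h0 => simp only [map_zero]
  | hadd x y hx hy => simp only [map_add, hx, hy]
  | hmk m γ'' k => rw [gact_tmul, one_mul]

lemma gact_add (γ γ' : Γ) (z : M ⊗[A] Cofree η K) :
    gact η M K (γ + γ') z = gact η M K γ z + gact η M K γ' z := by
  induction z using tensor_cofree_induction with
  | h0 => simp only [map_zero, add_zero]
  | hadd x y hx hy => simp only [map_add, hx, hy]; abel
  | hmk m γ'' k =>
    rw [gact_tmul, gact_tmul, gact_tmul, add_mul, Cofree.add_mk, TensorProduct.tmul_add]

/-- `γ ↦ γ z`, which is linear for the right units. -/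
def gactFlip (z : M ⊗[A] Cofree η K) : RightUnit η →ₗ[A] M ⊗[A] Cofree η K where
  toFun := fun γ => gact η M K (γ : Γ) z
  map_add' := fun x y => gact_add η (x : Γ) (y : Γ) z
  map_smul' := fun a x => ((gact_gact η (η a) (x : Γ) z).symm.trans (gact_right η a _) :
    gact η M K (η a * (show Γ from x)) z = a • gact η M K (x : Γ) z)

lemma gactFlip_of (z : M ⊗[A] Cofree η K) (γ : Γ) :
    gactFlip η z (RightUnit.of η γ) = gact η M K γ z := rfl

lemma gactFlip_add (z z' : M ⊗[A] Cofree η K) :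
    gactFlip η (z + z') = gactFlip η z + gactFlip η z' :=
  LinearMap.ext fun γ => map_add (gact η M K (γ : Γ)) z z'

end Gact

variable {H : HopfAlgebroid A Γ} (χ : Conjugation H)

namespace Conjugation

variable {M : Type u} [AddCommGroup M] [Module A M] {K : Type w} [AddCommGroup K] [Module A K]

/-- The map `m ⊗ γ ↦ m ⊗ c(γ) k`. -/
def twist (k : K) : Cofree H.ηR M →+ M ⊗[A] Cofree H.ηR K :=
  Cofree.lift
    { toFun := fun γ =>
        ((TensorProduct.mk A M (Cofree H.ηR K)).flip (Cofree.mk H.ηR (χ.c γ) k)).toAddMonoidHom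
      map_zero' := by
        ext m
        change m ⊗ₜ[A] Cofree.mk H.ηR (χ.c 0) k = 0
        rw [map_zero, Cofree.zero_mk, TensorProduct.tmul_zero]
      map_add' := fun x y => by
        ext m
        change m ⊗ₜ[A] Cofree.mk H.ηR (χ.c (x + y)) k =
          m ⊗ₜ[A] Cofree.mk H.ηR (χ.c x) k + m ⊗ₜ[A] Cofree.mk H.ηR (χ.c y) k
        rw [map_add, Cofree.add_mk, TensorProduct.tmul_add] }
    fun a γ m => by
      change m ⊗ₜ[A] Cofree.mk H.ηR (χ.c (algebraMap A Γ a * γ)) k =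
        (a • m) ⊗ₜ[A] Cofree.mk H.ηR (χ.c γ) k
      rw [map_mul, χ.c_left, TensorProduct.smul_tmul, Cofree.asmul_mk]

lemma twist_mk (k : K) (γ : Γ) (m : M) :
    χ.twist k (Cofree.mk H.ηR γ m) = m ⊗ₜ Cofree.mk H.ηR (χ.c γ) k := rfl

lemma twist_add (k k' : K) (z : Cofree H.ηR M) :
    χ.twist (k + k') z = χ.twist k z + χ.twist k' z := by
  induction z using Cofree.induction with
  | h0 => simp only [map_zero, add_zero]
  | hadd x y hx hy => simp only [map_add, hx, hy]; abel
  | hmk γ m => rw [twist_mk, twist_mk, twist_mk, Cofree.mk_add, TensorProduct.tmul_add]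

lemma twist_smul (a : A) (k : K) (z : Cofree H.ηR M) :
    χ.twist (a • k) z = gact H.ηR M K (algebraMap A Γ a) (χ.twist k z) := by
  induction z using Cofree.induction with
  | h0 => simp only [map_zero]
  | hadd x y hx hy => simp only [map_add, hx, hy]
  | hmk γ m => rw [twist_mk, twist_mk, gact_tmul, Cofree.mk_smul]

lemma twist_smul' (a : A) (k : K) (z : Cofree H.ηR M) :
    χ.twist k (a • z) = χ.twist (a • k) z := by
  induction z using Cofree.induction with
  | h0 => simp only [smul_zero, map_zero]
  | hadd x y hx hy => simp only [smul_add, map_add, hx, hy]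
  | hmk γ m => rw [Cofree.asmul_mk, twist_mk, twist_mk, map_mul, χ.c_right, Cofree.mk_smul]

variable (T : DGComodule.{u} H)

variable (K) in
/-- The map `m ⊗ k ↦ m' ⊗ c(m'') k`, where the coaction of `m` is `m' ⊗ m''`. Its image consists of
primitive elements. -/
def prim : T.carrier ⊗[A] K →+ T.carrier ⊗[A] Cofree H.ηR K :=
  TensorProduct.liftAddHom
    { toFun := fun m =>
        { toFun := fun k => χ.twist k (T.ψ m)
          map_zero' := by
            have := χ.twist_add (0 : K) 0 (T.ψ m)
            rwa [add_zero, left_eq_add] at this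
          map_add' := fun k k' => χ.twist_add k k' _ }
      map_zero' := by
        ext k
        change χ.twist k (T.ψ 0) = 0
        rw [map_zero, map_zero]
      map_add' := fun m m' => by
        ext k
        change χ.twist k (T.ψ (m + m')) = χ.twist k (T.ψ m) + χ.twist k (T.ψ m')
        rw [map_add, map_add] }
    fun a m k => by
      change χ.twist k (T.ψ (a • m)) = χ.twist (a • k) (T.ψ m)
      rw [map_smul, twist_smul']

lemma prim_tmul (m : T.carrier) (k : K) : χ.prim K T (m ⊗ₜ k) = χ.twist k (T.ψ m) := rfl

lemma prim_smul (a : A) (l : T.carrier ⊗[A] K) :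
    χ.prim K T (a • l) = gact H.ηR _ K (algebraMap A Γ a) (χ.prim K T l) := by
  induction l using TensorProduct.induction_on with
  | zero => simp only [smul_zero, map_zero]
  | add x y hx hy => simp only [smul_add, map_add, hx, hy]
  | tmul m k => rw [← TensorProduct.tmul_smul, prim_tmul, prim_tmul, twist_smul]

variable (K) in
/-- The comparison `(T ⊗ K) ⊗ Γ → T ⊗ (K ⊗ Γ)`. -/
def untwist : Cofree H.ηR (T.carrier ⊗[A] K) →ₗ[A] T.carrier ⊗[A] Cofree H.ηR K where
  toFun := Cofree.lift
    { toFun := fun γ => (gact H.ηR T.carrier K γ).toAddMonoidHom.comp (χ.prim K T)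
      map_zero' := by
        ext l
        have := gact_add H.ηR (M := T.carrier) (K := K) 0 0 (χ.prim K T l)
        rwa [add_zero, left_eq_add] at this
      map_add' := fun x y => by
        ext l
        exact gact_add H.ηR x y _ }
    fun a γ l => by
      change gact H.ηR T.carrier K (algebraMap A Γ a * γ) (χ.prim K T l) =
        gact H.ηR T.carrier K γ (χ.prim K T (a • l))
      rw [prim_smul, gact_gact, mul_comm]
  map_add' := fun x y => map_add _ x y
  map_smul' := fun a z => by
    induction z using Cofree.induction with
    | h0 => simp only [smul_zero, map_zero]
    | hadd x y hx hy => simp only [smul_add, map_add, hx, hy]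
    | hmk γ l =>
      rw [Cofree.asmul_mk, Cofree.lift_mk, Cofree.lift_mk, RingHom.id_apply, ← gact_right]
      exact (gact_gact H.ηR _ _ _).symm

lemma untwist_mk (γ : Γ) (l : T.carrier ⊗[A] K) :
    χ.untwist K T (Cofree.mk H.ηR γ l) = gact H.ηR _ K γ (χ.prim K T l) := rfl

lemma untwist_one (l : T.carrier ⊗[A] K) :
    χ.untwist K T (Cofree.one H.ηR l) = χ.prim K T l := gact_one _ _

lemma untwist_gsmul (γ : Γ) (z : Cofree H.ηR (T.carrier ⊗[A] K)) :
    χ.untwist K T (γ • z) = gact H.ηR _ K γ (χ.untwist K T z) := by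
  induction z using Cofree.induction with
  | h0 => simp only [smul_zero, map_zero]
  | hadd x y hx hy => simp only [smul_add, map_add, hx, hy]
  | hmk γ' l => rw [Cofree.smul_mk, untwist_mk, untwist_mk, gact_gact]

/-- The map underlying the antipode identity. -/
def retwist (k : K) : Cofree H.ηR (Cofree H.ηR T.carrier) →+ T.carrier ⊗[A] Cofree H.ηR K :=
  Cofree.lift
    { toFun := fun γ => (gact H.ηR T.carrier K γ).toAddMonoidHom.comp (χ.twist k)
      map_zero' := by
        ext l
        have := gact_add H.ηR (M := T.carrier) (K := K) 0 0 (χ.twist k l)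
        rwa [add_zero, left_eq_add] at this
      map_add' := fun x y => by
        ext l
        exact gact_add H.ηR x y _ }
    fun a γ l => by
      change gact H.ηR T.carrier K (algebraMap A Γ a * γ) (χ.twist k l) =
        gact H.ηR T.carrier K γ (χ.twist k (a • l))
      rw [twist_smul', twist_smul, gact_gact, mul_comm]

lemma retwist_mk (k : K) (γ : Γ) (z : Cofree H.ηR T.carrier) :
    χ.retwist T k (Cofree.mk H.ηR γ z) = gact H.ηR T.carrier K γ (χ.twist k z) := rfl

lemma retwist_map_ψ (k : K) (z : Cofree H.ηR T.carrier) :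
    χ.retwist T k (Cofree.map H.ηR T.ψ z) =
      χ.untwist K T (Cofree.map H.ηR ((TensorProduct.mk A _ _).flip k) z) := by
  induction z using Cofree.induction with
  | h0 => simp only [map_zero]
  | hadd x y hx hy => simp only [map_add, hx, hy]
  | hmk γ m => rfl

lemma retwist_δ (k : K) (z : Cofree H.ηR T.carrier) :
    χ.retwist T k (H.δ _ z) = H.counit _ z ⊗ₜ Cofree.mk H.ηR 1 k := by
  induction z using Cofree.induction with
  | h0 => simp only [map_zero, TensorProduct.zero_tmul]
  | hadd x y hx hy => simp only [map_add, TensorProduct.add_tmul, hx, hy]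
  | hmk γ m =>
    have h : ∀ w, χ.retwist T k (Cofree.map H.ηR (H.ins m) w) = m ⊗ₜ Cofree.mk H.ηR
        (tensorLift H.ηR (RingHom.id Γ) χ.c (fun a => (χ.c_right a).symm) w) k := fun w => by
      induction w using Cofree.induction with
      | h0 => simp only [map_zero, Cofree.zero_mk, TensorProduct.tmul_zero]
      | hadd x y hx hy => simp only [map_add, Cofree.add_mk, TensorProduct.tmul_add, hx, hy]
      | hmk x y =>
        obtain ⟨y, rfl⟩ := RightUnit.exists_of _ y
        rw [Cofree.map_mk, H.ins_of, retwist_mk, twist_mk, gact_tmul, tensorLift_mk]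
        rfl
    rw [HopfData.δ_mk, h, χ.antipode, HopfData.counit_mk, TensorProduct.smul_tmul, Cofree.asmul_mk,
      mul_one]

/-- The projection `T ⊗ (K ⊗ Γ) → T ⊗ K`. -/
abbrev proj (H : HopfAlgebroid A Γ) (M : Type u) [AddCommGroup M] [Module A M]
    (K : Type w) [AddCommGroup K] [Module A K] : M ⊗[A] Cofree H.ηR K →ₗ[A] M ⊗[A] K :=
  TensorProduct.map LinearMap.id (H.counit K)

lemma proj_mu (z : Cofree H.ηR M) (γ : Γ) (k : K) :
    Cofree.map H.ηR (proj H M K) (Cofree.mu H.ηR M _ (z ⊗ₜ H.δ K (Cofree.mk H.ηR γ k))) =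
      γ • Cofree.map H.ηR ((TensorProduct.mk A _ _).flip k) z := by
  induction z using Cofree.induction with
  | h0 => simp only [map_zero, TensorProduct.zero_tmul, smul_zero]
  | hadd x y hx hy => simp only [map_add, TensorProduct.add_tmul, smul_add, hx, hy]
  | hmk g m =>
    have h : ∀ w, Cofree.map H.ηR (proj H M K) (Cofree.mu H.ηR M _
        (Cofree.mk H.ηR g m ⊗ₜ Cofree.map H.ηR (H.ins k) w)) =
        g • Cofree.map H.ηR (LinearMap.toSpanSingleton A _ (m ⊗ₜ[A] k))
          (Cofree.map H.ηR H.εl w) := fun w => by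
      induction w using Cofree.induction with
      | h0 => simp only [map_zero, TensorProduct.tmul_zero, smul_zero]
      | hadd x y hx hy => simp only [map_add, TensorProduct.tmul_add, smul_add, hx, hy]
      | hmk x y =>
        obtain ⟨y, rfl⟩ := RightUnit.exists_of _ y
        rw [Cofree.map_mk, H.ins_of, Cofree.mu_mk, Cofree.map_mk, Cofree.map_mk, Cofree.map_mk,
          Cofree.smul_mk, TensorProduct.map_tmul, HopfData.counit_mk, TensorProduct.tmul_smul]
        rfl
    rw [HopfData.δ_mk, h, H.counit_Δ', Cofree.map_mk, Cofree.map_mk, Cofree.smul_mk, Cofree.smul_mk,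
      LinearMap.toSpanSingleton_apply, one_smul, mul_comm]
    rfl

end Conjugation

variable {K : Type} [AddCommGroup K] [Module A K]

/-- The coaction of `T ⊗ (K ⊗ Γ)`. -/
abbrev cofreeψ (T : DGComodule.{u} H) (K : Type) [AddCommGroup K] [Module A K] :
    T.carrier ⊗[A] Cofree H.ηR K →ₗ[A] Cofree H.ηR (T.carrier ⊗[A] Cofree H.ηR K) :=
  Cofree.mu H.ηR T.carrier _ ∘ₗ TensorProduct.map T.ψ (H.δ K)

namespace Conjugation

variable (T : DGComodule.{u} H)

lemma untwist_proj_ψ (x : T.carrier ⊗[A] Cofree H.ηR K) :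
    χ.untwist K T (Cofree.map H.ηR (proj H _ K) (cofreeψ T K x)) = x := by
  induction x using tensor_cofree_induction with
  | h0 => simp only [map_zero]
  | hadd x y hx hy => simp only [map_add, hx, hy]
  | hmk m γ k =>
    have h1 : cofreeψ T K (m ⊗ₜ Cofree.mk H.ηR γ k) =
      Cofree.mu H.ηR T.carrier _ (T.ψ m ⊗ₜ H.δ K (Cofree.mk H.ηR γ k)) := rfl
    have h2 : Cofree.map H.ηR T.ψ (T.ψ m) = H.δ _ (T.ψ m) := LinearMap.congr_fun T.coassoc m
    have h3 : H.counit _ (T.ψ m) = m := LinearMap.congr_fun T.counit m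
    rw [h1, proj_mu, untwist_gsmul, ← retwist_map_ψ, h2, retwist_δ, h3, gact_tmul, mul_one]

/-- The map underlying the compatibility of the conjugation and the comultiplication. -/
def primAux (γ : Γ) (k : K) : Cofree H.ηR (Cofree H.ηR T.carrier) →+
    Cofree H.ηR (T.carrier ⊗[A] Cofree H.ηR K) :=
  Cofree.lift
    { toFun := fun g => (Cofree.mu H.ηR T.carrier (Cofree H.ηR K)).toAddMonoidHom.comp
        ((TensorProduct.mk A _ _).flip (H.δ K (Cofree.mk H.ηR (γ * χ.c g) k))).toAddMonoidHom
      map_zero' := by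
        ext z
        change Cofree.mu H.ηR _ _ (z ⊗ₜ H.δ K (Cofree.mk H.ηR (γ * χ.c 0) k)) = 0
        rw [map_zero, mul_zero, Cofree.zero_mk, map_zero, TensorProduct.tmul_zero, map_zero]
      map_add' := fun x y => by
        ext z
        change Cofree.mu H.ηR _ _ (z ⊗ₜ H.δ K (Cofree.mk H.ηR (γ * χ.c (x + y)) k)) =
          Cofree.mu H.ηR _ _ (z ⊗ₜ H.δ K (Cofree.mk H.ηR (γ * χ.c x) k)) +
          Cofree.mu H.ηR _ _ (z ⊗ₜ H.δ K (Cofree.mk H.ηR (γ * χ.c y) k))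
        rw [map_add, mul_add, Cofree.add_mk, map_add, TensorProduct.tmul_add, map_add] }
    fun a g z => by
      change Cofree.mu H.ηR _ _ (z ⊗ₜ H.δ K (Cofree.mk H.ηR (γ * χ.c (algebraMap A Γ a * g)) k)) =
        Cofree.mu H.ηR _ _ ((a • z) ⊗ₜ H.δ K (Cofree.mk H.ηR (γ * χ.c g) k))
      rw [TensorProduct.smul_tmul, ← map_smul, Cofree.asmul_mk, map_mul, χ.c_left, mul_left_comm]

lemma primAux_mk (γ g : Γ) (k : K) (z : Cofree H.ηR T.carrier) :
    χ.primAux T γ k (Cofree.mk H.ηR g z) =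
      Cofree.mu H.ηR _ _ (z ⊗ₜ H.δ K (Cofree.mk H.ηR (γ * χ.c g) k)) := rfl

lemma primAux_map_ψ (γ : Γ) (k : K) (z : Cofree H.ηR T.carrier) :
    χ.primAux T γ k (Cofree.map H.ηR T.ψ z) = cofreeψ T K (gact H.ηR _ K γ (χ.twist k z)) := by
  induction z using Cofree.induction with
  | h0 => simp only [map_zero]
  | hadd x y hx hy => simp only [map_add, hx, hy]
  | hmk g m => rfl

lemma mu_map_ins (m : T.carrier) (k : K) (w : Cofree H.ηR (RightUnit H.ηR)) (a : Γ) :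
    Cofree.mu H.ηR T.carrier _ (Cofree.mk H.ηR a m ⊗ₜ Cofree.map H.ηR (H.ins k) w) =
      Cofree.map H.ηR (gactFlip H.ηR (m ⊗ₜ Cofree.mk H.ηR 1 k))
        (inclΓ H.ηR (RightUnit H.ηR) a * w) := by
  induction w using Cofree.induction with
  | h0 => simp only [map_zero, TensorProduct.tmul_zero, mul_zero]
  | hadd x y hx hy => simp only [map_add, TensorProduct.tmul_add, mul_add, hx, hy]
  | hmk x y =>
    obtain ⟨y, rfl⟩ := RightUnit.exists_of _ y
    have e : inclΓ H.ηR (RightUnit H.ηR) a * Cofree.mk H.ηR x (RightUnit.of H.ηR y) =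
        Cofree.mk H.ηR (a * x) (RightUnit.of H.ηR y) :=
      (Cofree.mk_mul_mk _ _ _ _).trans (by rw [one_mul])
    rw [e, Cofree.map_mk, Cofree.map_mk, H.ins_of, Cofree.mu_mk, gactFlip_of, gact_tmul, mul_one]

lemma primAux_δ (γ : Γ) (k : K) (z : Cofree H.ηR T.carrier) :
    χ.primAux T γ k (H.δ _ z) =
      Cofree.map H.ηR (gactFlip H.ηR (χ.twist k z)) (H.Δ γ) := by
  induction z using Cofree.induction with
  | h0 =>
    have : gactFlip H.ηR (0 : T.carrier ⊗[A] Cofree H.ηR K) = 0 :=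
      LinearMap.ext fun γ => map_zero (gact H.ηR _ K (γ : Γ))
    rw [map_zero, map_zero, map_zero, this, Cofree.map_zero', LinearMap.zero_apply]
  | hadd x y hx hy =>
    rw [map_add, map_add, map_add, hx, hy, gactFlip_add, Cofree.map_add', LinearMap.add_apply]
  | hmk h m =>
    have e : ∀ w, χ.primAux T γ k (Cofree.map H.ηR (H.ins m) w) =
        Cofree.map H.ηR (gactFlip H.ηR (m ⊗ₜ Cofree.mk H.ηR 1 k))
          (tensorLift H.ηR (H.Δ.comp χ.c) (inclΓ H.ηR (RightUnit H.ηR))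
            (fun a => by rw [RingHom.comp_apply, χ.c_left, H.Δ_ηR]; rfl) w * H.Δ γ) := fun w => by
      induction w using Cofree.induction with
      | h0 => simp only [map_zero, zero_mul]
      | hadd x y hx hy => simp only [map_add, add_mul, hx, hy]
      | hmk b a =>
        obtain ⟨a, rfl⟩ := RightUnit.exists_of _ a
        have e2 : H.Δ (γ * χ.c b) = H.Δ γ * H.Δ (χ.c b) := map_mul _ _ _
        rw [Cofree.map_mk, H.ins_of, primAux_mk, HopfData.δ_mk, mu_map_ins, tensorLift_mk, e2,
          RingHom.comp_apply]
        congr 1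
        ring
    rw [HopfData.δ_mk, e, χ.comul, twist_mk]
    generalize H.Δ γ = w
    induction w using Cofree.induction with
    | h0 => simp only [map_zero, mul_zero]
    | hadd x y hx hy => simp only [map_add, mul_add, hx, hy]
    | hmk x y =>
      obtain ⟨y, rfl⟩ := RightUnit.exists_of _ y
      rw [Cofree.mk_mul_mk, one_mul, ← map_mul, Cofree.map_mk, Cofree.map_mk, gactFlip_of,
        gactFlip_of, gact_tmul, gact_tmul, mul_one, mul_comm]

lemma cofreeψ_gact_prim (γ : Γ) (l : T.carrier ⊗[A] K) :
    cofreeψ T K (gact H.ηR _ K γ (χ.prim K T l)) =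
      Cofree.map H.ηR (gactFlip H.ηR (χ.prim K T l)) (H.Δ γ) := by
  induction l using TensorProduct.induction_on with
  | zero =>
    have : gactFlip H.ηR (0 : T.carrier ⊗[A] Cofree H.ηR K) = 0 :=
      LinearMap.ext fun γ => map_zero (gact H.ηR _ K (γ : Γ))
    rw [map_zero, map_zero, map_zero, this, Cofree.map_zero', LinearMap.zero_apply]
  | add x y hx hy =>
    rw [map_add, map_add, map_add, hx, hy, gactFlip_add, Cofree.map_add', LinearMap.add_apply]
  | tmul m k =>
    have h2 : Cofree.map H.ηR T.ψ (T.ψ m) = H.δ _ (T.ψ m) := LinearMap.congr_fun T.coassoc m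
    rw [prim_tmul, ← primAux_map_ψ, h2, primAux_δ]

lemma ψ_untwist : cofreeψ T K ∘ₗ χ.untwist K T =
    Cofree.map H.ηR (χ.untwist K T) ∘ₗ H.δ _ := by
  refine Cofree.lin_ext fun γ l => ?_
  rw [LinearMap.comp_apply, untwist_mk]
  refine (χ.cofreeψ_gact_prim T γ l).trans ?_
  rw [LinearMap.comp_apply, HopfData.δ_mk, ← LinearMap.comp_apply (Cofree.map H.ηR (χ.untwist K T)), ← Cofree.map_comp]
  rfl

lemma untwist_natural {T' : DGComodule.{u} H} (f : T.carrier →ₗ[A] T'.carrier)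
    (hf : Cofree.map H.ηR f ∘ₗ T.ψ = T'.ψ ∘ₗ f) (g : K →ₗ[A] K)
    (z : Cofree H.ηR (T.carrier ⊗[A] K)) :
    χ.untwist K T' (Cofree.map H.ηR (TensorProduct.map f g) z) =
      TensorProduct.map f (Cofree.map H.ηR g) (χ.untwist K T z) := by
  have h1 : ∀ k (z : Cofree H.ηR T.carrier), χ.twist (g k) (Cofree.map H.ηR f z) =
      TensorProduct.map f (Cofree.map H.ηR g) (χ.twist k z) := fun k z => by
    induction z using Cofree.induction with
    | h0 => simp only [map_zero]
    | hadd x y hx hy => simp only [map_add, hx, hy]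
    | hmk γ m => rfl
  have h2 : ∀ γ (z : T.carrier ⊗[A] Cofree H.ηR K), TensorProduct.map f (Cofree.map H.ηR g)
      (gact H.ηR _ K γ z) = gact H.ηR _ K γ (TensorProduct.map f (Cofree.map H.ηR g) z) :=
    fun γ z => by
      induction z using tensor_cofree_induction with
      | h0 => simp only [map_zero]
      | hadd x y hx hy => simp only [map_add, hx, hy]
      | hmk m γ' k => rfl
  induction z using Cofree.induction with
  | h0 => simp only [map_zero]
  | hadd x y hx hy => simp only [map_add, hx, hy]
  | hmk γ l =>
    rw [Cofree.map_mk, untwist_mk, untwist_mk, h2]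
    congr 1
    induction l using TensorProduct.induction_on with
    | zero => simp only [map_zero]
    | add x y hx hy => simp only [map_add, hx, hy]
    | tmul m k =>
      have e : Cofree.map H.ηR f (T.ψ m) = T'.ψ (f m) := LinearMap.congr_fun hf m
      rw [TensorProduct.map_tmul, prim_tmul, prim_tmul, ← e, h1]

section Filtrations

lemma untwist_mem {Agr : ℤ → AddSubgroup A} {Γgr : ℤ → AddSubgroup Γ} (hH : HopfGrading H Agr Γgr)
    (hc : ∀ k x, x ∈ Γgr k → χ.c x ∈ Γgr k) {Tgr : ℤ → ℤ → AddSubgroup T.carrier}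
    {Kgr : ℤ → ℤ → AddSubgroup K}
    (hT : ∀ J k m, m ∈ Tgr J k → T.ψ m ∈ cofreeGr H.ηR Γgr (Tgr J) k) {J k : ℤ}
    {z : Cofree H.ηR (T.carrier ⊗[A] K)} (hz : z ∈ cofreeGr H.ηR Γgr (tensorGr Tgr Kgr J) k) :
    χ.untwist K T z ∈ tensorGr Tgr (fun j => cofreeGr H.ηR Γgr (Kgr j)) J k := by
  have hg : ∀ (i k l : ℤ) γ (z : T.carrier ⊗[A] Cofree H.ηR K), γ ∈ Γgr i →
      z ∈ tensorGr Tgr (fun j => cofreeGr H.ηR Γgr (Kgr j)) J k → i + k = l →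
      gact H.ηR _ K γ z ∈ tensorGr Tgr (fun j => cofreeGr H.ηR Γgr (Kgr j)) J l :=
    fun i k l γ z hγ hz h => tensorMap_mem LinearMap.id (gmul H.ηR K γ) 0 0 0 i
      (fun J k m hm => by simpa using hm)
      (fun J k z hz => by rw [add_zero]; exact gsmul_mem_cofreeGr hH hγ hz (add_comm _ _)) hz
      (by omega) (by omega)
  refine map_mem_of_cofreeGr (χ.untwist K T).toAddMonoidHom _ (fun i j γ l hγ hl h => ?_) hz
  refine hg i j k γ (χ.prim K T l) hγ ?_ h
  refine map_mem_of_tensorGr (χ.prim K T) _ (fun J₁ J₂ a b m κ hm hκ h1 h2 => ?_) hl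
  rw [prim_tmul]
  refine map_mem_of_cofreeGr (χ.twist κ) _ (fun i' j' γ m hγ hm h' => ?_) (hT _ _ _ hm)
  exact tmul_mem_tensorGr (b := i' + b) hm (mk_mem_cofreeGr (hc _ _ hγ) hκ rfl) h1 (by omega)

end Filtrations

end Conjugation

end Conjugation

section Contraction

variable {A Γ : Type} [CommRing A] [CommRing Γ] [Algebra A Γ] {H : HopfAlgebroid A Γ}
  {M : Type u} [AddCommGroup M] [Module A M]

/-- The contraction of the cobar complex of a comodule that is induced by a retraction `r` of its
coaction. -/
def cobarContr (η : A →+* Γ) (r : Cofree η M →ₗ[A] M) : (s : ℕ) → Cofree η (Bpow η M s) →ₗ[A] Bpow η M s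
  | 0 => r
  | s + 1 => Cofree.map η (cobarContr η r s)

variable (r : Cofree H.ηR M →ₗ[A] M) (ψ : M →ₗ[A] Cofree H.ηR M)

lemma cobarContr_step {P : Type u} [AddCommGroup P] [Module A P] (D : P →ₗ[A] Cofree H.ηR P)
    (G : Cofree H.ηR P →ₗ[A] P) (c c' : ℤ) (hc : c' = -c)
    (h : ∀ z, Cofree.map H.ηR G (cobarStep H D c z) + D (G z) = z) (z : Cofree H.ηR (Cofree H.ηR P)) :
    Cofree.map H.ηR (Cofree.map H.ηR G) (cobarStep H (cobarStep H D c) c' z) +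
      cobarStep H D c (Cofree.map H.ηR G z) = z := by
  have e : Cofree.map H.ηR (Cofree.map H.ηR G) (H.δ _ z) = H.δ _ (Cofree.map H.ηR G z) :=
    LinearMap.congr_fun (HopfData.δ_natural H.toHopfData G) z
  have e' : Cofree.map H.ηR (Cofree.map H.ηR G) (Cofree.map H.ηR (cobarStep H D c) z) +
      Cofree.map H.ηR D (Cofree.map H.ηR G z) = z := by
    have h' : Cofree.map H.ηR G ∘ₗ cobarStep H D c + D ∘ₗ G = LinearMap.id := LinearMap.ext h
    have := congrArg (Cofree.map H.ηR) h'
    rw [Cofree.map_add', Cofree.map_id, Cofree.map_comp, Cofree.map_comp] at this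
    exact LinearMap.congr_fun this z
  have e1 : ∀ z, cobarStep H (cobarStep H D c) c' z =
    Cofree.map H.ηR (cobarStep H D c) z + c' • H.δ _ z := fun _ => rfl
  have e2 : ∀ z, cobarStep H D c z = Cofree.map H.ηR D z + c • H.δ P z := fun _ => rfl
  rw [e1, e2, map_add, map_zsmul, e, hc]
  refine Eq.trans ?_ e'
  module

lemma cobarContr_cobarD (h₁ : r ∘ₗ ψ = LinearMap.id) (h₂ : Cofree.map H.ηR r ∘ₗ H.δ M = ψ ∘ₗ r)
    (s : ℕ) (z : Cofree H.ηR (Bpow H.ηR M s)) : Cofree.map H.ηR (cobarContr H.ηR r s)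
      (cobarStep H (cobarD H ψ s) ((-1) ^ (s + 1)) z) + cobarD H ψ s (cobarContr H.ηR r s z) = z := by
  induction s with
  | zero =>
    revert z
    change ∀ z : Cofree H.ηR M, Cofree.map H.ηR r (cobarStep H ψ ((-1) ^ (0 + 1)) z) + ψ (r z) = z
    intro z
    have e1 : Cofree.map H.ηR r (Cofree.map H.ηR ψ z) = z := by
      have := congrArg (Cofree.map H.ηR) h₁
      rw [Cofree.map_id, Cofree.map_comp] at this
      exact LinearMap.congr_fun this z
    have e2 : Cofree.map H.ηR r (H.δ M z) = ψ (r z) := LinearMap.congr_fun h₂ z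
    have e : cobarStep H ψ ((-1) ^ (0 + 1)) z =
      Cofree.map H.ηR ψ z + ((-1) ^ (0 + 1) : ℤ) • H.δ M z := rfl
    rw [e, map_add, map_zsmul, e1, e2, zero_add, pow_one, neg_one_smul, neg_add_cancel_right]
  | succ s ih =>
    exact cobarContr_step (cobarD H ψ s) (cobarContr H.ηR r s) ((-1) ^ (s + 1))
      ((-1) ^ (s + 1 + 1)) (by rw [pow_succ, mul_neg_one]) ih z

lemma cobarContr_cobar (h₁ : r ∘ₗ ψ = LinearMap.id) (h₂ : Cofree.map H.ηR r ∘ₗ H.δ M = ψ ∘ₗ r)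
    (s : ℕ) (x : Bpow H.ηR M (s + 1)) :
    cobarContr H.ηR r (s + 1) (cobar H ψ (s + 1) x) + cobar H ψ s (cobarContr H.ηR r s x) = x := by
  have key : ∀ (P : Type u) [AddCommGroup P] [Module A P] (D : P →ₗ[A] Cofree H.ηR P)
      (G : Cofree H.ηR P →ₗ[A] P) (c c' : ℤ) (z : Cofree H.ηR P), c' = -c →
      Cofree.map H.ηR G (cobarStep H D c z) + D (G z) = z →
      Cofree.map H.ηR G (cobarStep H D c z + c' • Cofree.one H.ηR z) +
        (D (G z) + c • Cofree.one H.ηR (G z)) = z := by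
    intro P _ _ D G c c' z hc h
    refine Eq.trans ?_ h
    rw [map_add, map_zsmul, Cofree.map_one, hc]
    module
  exact key _ (cobarD H ψ s) (cobarContr H.ηR r s) _ _ x (by rw [pow_succ _ (s + 1), mul_neg_one])
    (cobarContr_cobarD r ψ h₁ h₂ s x)

lemma cobarContr_cobar_zero (h₁ : r ∘ₗ ψ = LinearMap.id) (x : M) :
    cobarContr H.ηR r 0 (cobar H ψ 0 x) = x - r (Cofree.one H.ηR x) := by
  have h : r (ψ x) = x := LinearMap.congr_fun h₁ x
  change r (ψ x + ((-1) ^ (0 + 1) : ℤ) • Cofree.one H.ηR x) = _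
  rw [map_add, h, map_zsmul, zero_add, pow_one, neg_one_smul, sub_eq_add_neg]

lemma cobarContr_natural (f : M →ₗ[A] M) (hf : r ∘ₗ Cofree.map H.ηR f = f ∘ₗ r) (s : ℕ)
    (x : Bpow H.ηR M (s + 1)) : cobarContr H.ηR r s (Bmap H.ηR f (s + 1) x) =
      Bmap H.ηR f s (cobarContr H.ηR r s x) := by
  have : cobarContr H.ηR r s ∘ₗ Bmap H.ηR f (s + 1) = Bmap H.ηR f s ∘ₗ cobarContr H.ηR r s := by
    induction s with
    | zero => exact hf
    | succ s ih =>
      refine (Cofree.map_comp _ _).symm.trans ?_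
      refine (congrArg (Cofree.map H.ηR) (ih 0)).trans ?_
      exact Cofree.map_comp _ _
  exact LinearMap.congr_fun this x

lemma cobarContr_mem {Γgr : ℤ → AddSubgroup Γ} {Mgr : ℤ → AddSubgroup M}
    (hr : ∀ k m, m ∈ cofreeGr H.ηR Γgr Mgr k → r m ∈ Mgr k) (s : ℕ) {k : ℤ}
    {x : Bpow H.ηR M (s + 1)} (hx : x ∈ BpowGr H.ηR Γgr Mgr (s + 1) k) :
    cobarContr H.ηR r s x ∈ BpowGr H.ηR Γgr Mgr s k := by
  induction s generalizing k with
  | zero => exact hr _ _ hx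
  | succ s ih => exact map_mem_cofreeGr (cobarContr H.ηR r s) (fun _ _ hz => ih hz) hx

end Contraction

section Retraction

variable {A Γ : Type} [CommRing A] [CommRing Γ] [Algebra A Γ] {H : HopfAlgebroid A Γ}
  (χ : Conjugation H) (T : DGComodule.{u} H) (K : Type) [AddCommGroup K] [Module A K]

/-- The retraction of the coaction of `T ⊗ (K ⊗ Γ)`. -/
def Conjugation.retr : Cofree H.ηR (T.carrier ⊗[A] Cofree H.ηR K) →ₗ[A] T.carrier ⊗[A] Cofree H.ηR K :=
  χ.untwist K T ∘ₗ Cofree.map H.ηR (Conjugation.proj H _ K)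

lemma Conjugation.retr_ψ : χ.retr T K ∘ₗ cofreeψ T K = LinearMap.id :=
  LinearMap.ext fun x => χ.untwist_proj_ψ T x

lemma Conjugation.map_retr_δ :
    Cofree.map H.ηR (χ.retr T K) ∘ₗ H.δ _ = cofreeψ T K ∘ₗ χ.retr T K := by
  unfold retr
  rw [Cofree.map_comp, LinearMap.comp_assoc, HopfData.δ_natural, ← LinearMap.comp_assoc,
    ← LinearMap.comp_assoc, χ.ψ_untwist]

lemma Conjugation.retr_one (x : T.carrier ⊗[A] Cofree H.ηR K) :
    χ.retr T K (Cofree.one H.ηR x) = χ.prim K T (Conjugation.proj H _ K x) := χ.untwist_one T _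

variable {K} in
lemma proj_natural {M M' : Type u} [AddCommGroup M] [Module A M] [AddCommGroup M'] [Module A M']
    (f : M →ₗ[A] M') (g : K →ₗ[A] K) :
    Conjugation.proj H M' K ∘ₗ TensorProduct.map f (Cofree.map H.ηR g) =
      TensorProduct.map f g ∘ₗ Conjugation.proj H M K := by
  unfold Conjugation.proj
  rw [← TensorProduct.map_comp, ← TensorProduct.map_comp, HopfData.counit_natural]
  rfl

lemma Conjugation.retr_natural (f : T.carrier →ₗ[A] T.carrier)
    (hf : Cofree.map H.ηR f ∘ₗ T.ψ = T.ψ ∘ₗ f) (g : K →ₗ[A] K) :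
    χ.retr T K ∘ₗ Cofree.map H.ηR (TensorProduct.map f (Cofree.map H.ηR g)) =
      TensorProduct.map f (Cofree.map H.ηR g) ∘ₗ χ.retr T K := by
  refine LinearMap.ext fun z => ?_
  refine Eq.trans ?_ (χ.untwist_natural T f hf g (Cofree.map H.ηR (Conjugation.proj H _ K) z))
  change χ.untwist K T (Cofree.map H.ηR (Conjugation.proj H _ K) (Cofree.map H.ηR _ z)) = _
  have e := congrArg (Cofree.map H.ηR) (proj_natural (H := H) f g)
  rw [Cofree.map_comp, Cofree.map_comp] at e
  exact congrArg (χ.untwist K T) (LinearMap.congr_fun e z)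

/-- The differential of `M ⊗ K` for a differential module `M` and the Koszul complex `K`. -/
def koszulTensorD (T : DGComodule.{u} H) (x : ℕ → A) :
    T.carrier ⊗[A] Koszul A →ₗ[A] T.carrier ⊗[A] Koszul A :=
  TensorProduct.map T.d LinearMap.id + TensorProduct.map T.inv (koszulD x)

lemma proj_d (x : ℕ → A) (z : T.carrier ⊗[A] Cofree H.ηR (Koszul A)) :
    Conjugation.proj H T.carrier (Koszul A) ((T.tensor (koszulComodule H x)).d z) =
      koszulTensorD T x (Conjugation.proj H T.carrier (Koszul A) z) := by
  have h1 := LinearMap.congr_fun (proj_natural (H := H) T.d (LinearMap.id : Koszul A →ₗ[A] _)) z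
  have h2 := LinearMap.congr_fun (proj_natural (H := H) T.inv (koszulD x)) z
  rw [Cofree.map_id] at h1
  exact (map_add (Conjugation.proj H T.carrier (Koszul A)) _ _).trans (congrArg₂ (· + ·) h1 h2)

lemma Conjugation.retr_d (x : ℕ → A) : χ.retr T (Koszul A) ∘ₗ
    Cofree.map H.ηR (T.tensor (koszulComodule H x)).d =
      (T.tensor (koszulComodule H x)).d ∘ₗ χ.retr T (Koszul A) := by
  have h1 := χ.retr_natural T (Koszul A) T.d T.ψ_d LinearMap.id
  have h2 := χ.retr_natural T (Koszul A) T.inv T.ψ_inv (koszulD x)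
  rw [Cofree.map_id] at h1
  have key : ∀ F G : T.carrier ⊗[A] Cofree H.ηR (Koszul A) →ₗ[A] T.carrier ⊗[A] Cofree H.ηR (Koszul A),
      χ.retr T (Koszul A) ∘ₗ Cofree.map H.ηR F = F ∘ₗ χ.retr T (Koszul A) →
      χ.retr T (Koszul A) ∘ₗ Cofree.map H.ηR G = G ∘ₗ χ.retr T (Koszul A) →
      χ.retr T (Koszul A) ∘ₗ Cofree.map H.ηR (F + G) = (F + G) ∘ₗ χ.retr T (Koszul A) :=
    fun F G hF hG => by
      rw [Cofree.map_add', LinearMap.comp_add, LinearMap.add_comp, hF, hG]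
  exact key _ _ h1 h2

lemma Conjugation.untwist_d (x : ℕ → A) (z : Cofree H.ηR (T.carrier ⊗[A] Koszul A)) :
    χ.untwist _ T (Cofree.map H.ηR (koszulTensorD T x) z) =
      (T.tensor (koszulComodule H x)).d (χ.untwist _ T z) := by
  have h1 := χ.untwist_natural T T.d T.ψ_d (LinearMap.id : Koszul A →ₗ[A] _) z
  have h2 := χ.untwist_natural T T.inv T.ψ_inv (koszulD x) z
  rw [Cofree.map_id] at h1
  unfold koszulTensorD
  rw [Cofree.map_add', LinearMap.add_apply, map_add, h1, h2]
  rfl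

variable {Agr : ℤ → AddSubgroup A} {Γgr : ℤ → AddSubgroup Γ} (hH : HopfGrading H Agr Γgr)
include hH

variable {T K} {Tgr Kgr} in
lemma proj_mem (hK : ∀ J, IsGraded Agr (Kgr J)) {J k : ℤ} {z : T.carrier ⊗[A] Cofree H.ηR K}
    (hz : z ∈ tensorGr Tgr (fun j => cofreeGr H.ηR Γgr (Kgr j)) J k) :
    Conjugation.proj H T.carrier K z ∈ tensorGr Tgr Kgr J k :=
  tensorMap_mem LinearMap.id (H.counit K) 0 0 0 0 (fun J k m hm => by simpa using hm)
    (fun J k z hz => by simpa using counit_mem hH (hK J) hz) hz (by simp) (by simp)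

variable {T K} in
lemma Conjugation.retr_mem (hc : ∀ k x, x ∈ Γgr k → χ.c x ∈ Γgr k)
    {Tgr : ℤ → ℤ → AddSubgroup T.carrier} {Kgr : ℤ → ℤ → AddSubgroup K}
    (hK : ∀ J, IsGraded Agr (Kgr J))
    (hT : ∀ J k m, m ∈ Tgr J k → T.ψ m ∈ cofreeGr H.ηR Γgr (Tgr J) k) (J k : ℤ)
    (z : Cofree H.ηR (T.carrier ⊗[A] Cofree H.ηR K))
    (hz : z ∈ cofreeGr H.ηR Γgr (tensorGr Tgr (fun j => cofreeGr H.ηR Γgr (Kgr j)) J) k) :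
    χ.retr T K z ∈ tensorGr Tgr (fun j => cofreeGr H.ηR Γgr (Kgr j)) J k :=
  χ.untwist_mem T hH hc hT (map_mem_cofreeGr (Conjugation.proj H T.carrier K) (fun _ _ hm => proj_mem hH hK hm) hz)

end Retraction

section KoszulGrading

variable {A : Type} [CommRing A] {Agr : ℤ → AddSubgroup A} {x : ℕ → A} {deg : ℕ → ℤ}

/-- The product of the generators of the Koszul complex with indices in a list. -/
def koszulProd (A : Type) [CommRing A] (l : List ℕ) : Koszul A :=
  (l.map fun i => ExteriorAlgebra.ι A (Finsupp.single i (1 : A))).prod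

lemma koszulProd_nil : koszulProd A [] = 1 := rfl

lemma koszulProd_cons (i : ℕ) (l : List ℕ) : koszulProd A (i :: l) =
    ExteriorAlgebra.ι A (Finsupp.single i (1 : A)) * koszulProd A l := by
  rw [koszulProd, List.map_cons, List.prod_cons]
  rfl

lemma smul_koszulProd_mem {c j k : ℤ} {a : A} {l : List ℕ} (ha : a ∈ Agr c) (hj : (l.length : ℤ) = j)
    (hk : c + (l.map deg).sum = k) : a • koszulProd A l ∈ koszulGr Agr deg j k :=
  AddSubgroup.subset_closure ⟨l, c, a, ha, hj, hk, rfl⟩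

lemma map_mem_of_koszulGr {P : Type*} [AddCommGroup P] {j k : ℤ} (f : Koszul A →+ P)
    (S : AddSubgroup P) (h : ∀ c a (l : List ℕ), a ∈ Agr c → (l.length : ℤ) = j →
      c + (l.map deg).sum = k → f (a • koszulProd A l) ∈ S) {z : Koszul A}
    (hz : z ∈ koszulGr Agr deg j k) : f z ∈ S := by
  have : koszulGr Agr deg j k ≤ S.comap f := by
    refine (AddSubgroup.closure_le _).2 ?_
    rintro _ ⟨l, c, a, ha, hj, hk, rfl⟩
    exact h c a l ha hj hk
  exact this hz

lemma koszulD_cons (i : ℕ) (z : Koszul A) :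
    koszulD x (ExteriorAlgebra.ι A (Finsupp.single i (1 : A)) * z) =
      x i • z - ExteriorAlgebra.ι A (Finsupp.single i (1 : A)) * koszulD x z := by
  refine (CliffordAlgebra.contractLeft_ι_mul _ _ _).trans ?_
  rw [Finsupp.linearCombination_single, one_smul]
  rfl

lemma koszulInv_cons (i : ℕ) (z : Koszul A) :
    koszulInv (ExteriorAlgebra.ι A (Finsupp.single i (1 : A)) * z) =
      -(ExteriorAlgebra.ι A (Finsupp.single i (1 : A)) * koszulInv z) := by
  change CliffordAlgebra.involute (ExteriorAlgebra.ι A (Finsupp.single i (1 : A)) * z) = _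
  rw [map_mul]
  erw [CliffordAlgebra.involute_ι]
  rw [neg_mul]
  rfl

lemma koszulInv_prod (l : List ℕ) : koszulInv (koszulProd A l) = ((-1) ^ l.length : ℤ) • koszulProd A l := by
  induction l with
  | nil => exact (map_one CliffordAlgebra.involute).trans (one_smul _ _).symm
  | cons i l ih =>
    rw [koszulProd_cons, koszulInv_cons, ih, List.length_cons, pow_succ, mul_smul_comm]
    module

lemma koszulInv_mem {j k : ℤ} {z : Koszul A} (hz : z ∈ koszulGr Agr deg j k) :
    koszulInv z ∈ koszulGr Agr deg j k := by
  refine map_mem_of_koszulGr koszulInv.toAddMonoidHom _ (fun c a l ha hj hk => ?_) hz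
  change koszulInv (a • koszulProd A l) ∈ _
  rw [map_smul, koszulInv_prod, smul_comm]
  exact AddSubgroup.zsmul_mem _ (smul_koszulProd_mem ha hj hk) _

lemma one_mem_koszulGr (h1 : (1 : A) ∈ Agr 0) : (1 : Koszul A) ∈ koszulGr Agr deg 0 0 := by
  have := smul_koszulProd_mem (deg := deg) (l := []) (j := 0) (k := 0) h1 rfl rfl
  rwa [koszulProd_nil, one_smul] at this

variable (hA : ∀ i j a b, a ∈ Agr i → b ∈ Agr j → a * b ∈ Agr (i + j))
include hA

lemma isGraded_koszulGr (J : ℤ) : IsGraded Agr (koszulGr Agr deg J) := by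
  intro i k a z ha hz
  refine map_mem_of_koszulGr (DistribSMul.toAddMonoidHom _ a) _ (fun c b l hb hj hk => ?_) hz
  change a • b • koszulProd A l ∈ _
  rw [smul_smul]
  exact smul_koszulProd_mem (hA _ _ _ _ ha hb) hj (by omega)

omit hA in
lemma ι_mul_mem {j k j' k' : ℤ} {z : Koszul A} (i : ℕ) (hz : z ∈ koszulGr Agr deg j k)
    (hj : j + 1 = j') (hk : k + deg i = k') :
    ExteriorAlgebra.ι A (Finsupp.single i (1 : A)) * z ∈ koszulGr Agr deg j' k' := by
  refine map_mem_of_koszulGr (AddMonoidHom.mulLeft _) _ (fun c a l ha hl hk' => ?_) hz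
  change ExteriorAlgebra.ι A (Finsupp.single i (1 : A)) * (a • koszulProd A l) ∈ _
  rw [mul_smul_comm, ← koszulProd_cons]
  refine smul_koszulProd_mem ha ?_ ?_
  · rw [List.length_cons]; push_cast; omega
  · rw [List.map_cons, List.sum_cons]; omega

lemma koszulD_mem (hx : ∀ i, x i ∈ Agr (deg i)) {j k j' : ℤ} {z : Koszul A}
    (hz : z ∈ koszulGr Agr deg j k) (hj : j' + 1 = j) : koszulD x z ∈ koszulGr Agr deg j' k := by
  refine map_mem_of_koszulGr (koszulD x).toAddMonoidHom _ (fun c a l ha hl hk => ?_) hz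
  change koszulD x (a • koszulProd A l) ∈ _
  clear hz
  induction l generalizing c a j k j' with
  | nil =>
    have : koszulD x (koszulProd A []) = 0 := CliffordAlgebra.contractLeft_one (Q := (0 : QuadraticForm A (ℕ →₀ A))) _
    rw [map_smul, this, smul_zero]
    exact AddSubgroup.zero_mem _
  | cons i l ih =>
    rw [List.length_cons] at hl
    rw [List.map_cons, List.sum_cons] at hk
    push_cast at hl
    rw [map_smul, koszulProd_cons, koszulD_cons, smul_sub, smul_smul, ← mul_smul_comm, ← map_smul]
    exact AddSubgroup.sub_mem _ (smul_koszulProd_mem (hA _ _ _ _ ha (hx i)) (by omega) (by omega))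
      (ι_mul_mem i (ih (j' := j' - 1) (k := k - deg i) (j := j - 1) (by omega) c a ha (by omega) (by omega)) (by omega) (by omega))

end KoszulGrading

section KoszulAugmentation

variable {A : Type} [CommRing A] {I : Ideal A} {x : ℕ → A}

lemma koszulD_mem_powSub (hx : ∀ i, x i ∈ I) (z : Koszul A) :
    koszulD x z ∈ powSub I (Koszul A) 1 := by
  have hI : ∀ v : ℕ →₀ A, Finsupp.linearCombination A x v ∈ I := fun v => by
    rw [Finsupp.linearCombination_apply]
    exact Submodule.sum_mem _ fun i _ => I.mul_mem_left _ (hx i)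
  have h1 : ∀ a ∈ I, a ∈ I ^ (1 : ℤ).toNat := fun a ha => by simpa using ha
  change CliffordAlgebra.contractLeft _ z ∈ _
  induction z using CliffordAlgebra.left_induction with
  | algebraMap r =>
    rw [CliffordAlgebra.contractLeft_algebraMap]
    exact Submodule.zero_mem _
  | add y z hy hz =>
    rw [map_add]
    exact Submodule.add_mem _ hy hz
  | ι_mul y v hy =>
    rw [CliffordAlgebra.contractLeft_ι_mul]
    exact Submodule.sub_mem _ (smul_mem_powSub (h1 _ (hI v)) _)
      (powSub_map (LinearMap.mulLeft A (CliffordAlgebra.ι (0 : QuadraticForm A (ℕ →₀ A)) v)) hy)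

/-- The projection of the Koszul complex to chain degree `0`. -/
def koszulAug (A : Type) [CommRing A] : Koszul A →ₗ[A] A := ExteriorAlgebra.algebraMapInv.toLinearMap

lemma koszulAug_one : koszulAug A 1 = 1 := map_one ExteriorAlgebra.algebraMapInv

lemma koszulAug_cons (i : ℕ) (l : List ℕ) : koszulAug A (koszulProd A (i :: l)) = 0 := by
  rw [koszulProd_cons]
  change ExteriorAlgebra.algebraMapInv _ = _
  rw [map_mul]
  have : ExteriorAlgebra.algebraMapInv (ExteriorAlgebra.ι A (Finsupp.single i (1 : A))) = 0 := by
    simp [ExteriorAlgebra.algebraMapInv]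
  rw [this, zero_mul]

lemma koszulAug_mem {Agr : ℤ → AddSubgroup A} {deg : ℕ → ℤ} {j k : ℤ} {z : Koszul A}
    (hz : z ∈ koszulGr Agr deg j k) :
    koszulAug A z ∈ (if j = 0 then Agr k else ⊥ : AddSubgroup A) := by
  refine map_mem_of_koszulGr (koszulAug A).toAddMonoidHom _ (fun c a l ha hl hk => ?_) hz
  change koszulAug A (a • koszulProd A l) ∈ _
  rw [map_smul]
  cases l with
  | nil =>
    rw [if_pos (by rw [← hl]; rfl), koszulProd_nil, koszulAug_one, smul_eq_mul, mul_one, ← hk]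
    simpa using ha
  | cons i l =>
    rw [koszulAug_cons, smul_zero]
    exact AddSubgroup.zero_mem _

end KoszulAugmentation

section Concentrated

variable {A Γ : Type} [CommRing A] [CommRing Γ] [Algebra A Γ] {η : A →+* Γ}
  {M : Type u} [AddCommGroup M] [Module A M] {N : Type w} [AddCommGroup N] [Module A N]

/-- The bigrading of a graded module concentrated in chain degree `0`. -/
def concGr (Mgr : ℤ → AddSubgroup M) (j k : ℤ) : AddSubgroup M := if j = 0 then Mgr k else ⊥

lemma concGr_cases {Mgr : ℤ → AddSubgroup M} {j k : ℤ} {m : M} (hm : m ∈ concGr Mgr j k) :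
    (j = 0 ∧ m ∈ Mgr k) ∨ m = 0 := by
  unfold concGr at hm
  split_ifs at hm with h
  · exact Or.inl ⟨h, hm⟩
  · exact Or.inr hm

lemma mem_concGr {Mgr : ℤ → AddSubgroup M} {k : ℤ} {m : M} (hm : m ∈ Mgr k) :
    m ∈ concGr Mgr 0 k := by
  rwa [concGr, if_pos rfl]

lemma isGraded_concGr {Agr : ℤ → AddSubgroup A} {Mgr : ℤ → AddSubgroup M} (h : IsGraded Agr Mgr) (J : ℤ) :
    IsGraded Agr (concGr Mgr J) := by
  intro i k a m ha hm
  rcases concGr_cases hm with ⟨rfl, hm⟩ | rfl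
  · exact mem_concGr (h _ _ _ _ ha hm)
  · rw [smul_zero]
    exact AddSubgroup.zero_mem _

lemma concGr_ψ_mem {Γgr : ℤ → AddSubgroup Γ} {Mgr : ℤ → AddSubgroup M} (ψ : M →ₗ[A] Cofree η M)
    (h : ∀ k m, m ∈ Mgr k → ψ m ∈ cofreeGr η Γgr Mgr k) (J k : ℤ) (m : M) (hm : m ∈ concGr Mgr J k) :
    ψ m ∈ cofreeGr η Γgr (concGr Mgr J) k := by
  rcases concGr_cases hm with ⟨rfl, hm⟩ | rfl
  · have : concGr Mgr 0 = Mgr := funext fun k => if_pos rfl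
    rw [this]
    exact h _ _ hm
  · rw [map_zero]
    exact AddSubgroup.zero_mem _

lemma tensorD_powSub {I : Ideal A} (f g : M →ₗ[A] M) (e : N →ₗ[A] N) (hf : ∀ m, f m ∈ powSub I M 1)
    (he : ∀ n, e n ∈ powSub I N 1) (z : M ⊗[A] N) :
    (TensorProduct.map f LinearMap.id + TensorProduct.map g e : M ⊗[A] N →ₗ[A] M ⊗[A] N) z ∈ powSub I (M ⊗[A] N) 1 := by
  induction z using TensorProduct.induction_on with
  | zero => rw [map_zero]; exact Submodule.zero_mem _
  | add y z hy hz => rw [map_add]; exact Submodule.add_mem _ hy hz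
  | tmul m n =>
    exact Submodule.add_mem _ (powSub_map ((TensorProduct.mk A M N).flip n) (hf m))
      (powSub_map (TensorProduct.mk A M N (g m)) (he n))

end Concentrated

section Setting

variable {A Γ : Type} [CommRing A] [CommRing Γ] [Algebra A Γ] {H : HopfAlgebroid A Γ}

/-- The gradings and filtrations of the Hopf algebroid, the sequence and the comodule that enter the
comparison of spectral sequences. -/
structure Setting (χ : Conjugation H) (Agr : ℤ → AddSubgroup A) (Γgr : ℤ → AddSubgroup Γ)
    (x : ℕ → A) (deg : ℕ → ℤ) (I : Ideal A) (T : DGComodule.{u} H) (Tgr : ℤ → AddSubgroup T.carrier) :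
    Prop where
  hopf : HopfGrading H Agr Γgr
  one_mem : (1 : A) ∈ Agr 0
  conj : ∀ k y, y ∈ Γgr k → χ.c y ∈ Γgr k
  invariant : IsInvariant H.ηR I
  x_mem : ∀ i, x i ∈ Agr (deg i)
  x_mem_ideal : ∀ i, x i ∈ I
  graded : IsGraded Agr Tgr
  ψ_mem : ∀ k y, y ∈ Tgr k → T.ψ y ∈ cofreeGr H.ηR Γgr Tgr k
  d_eq : T.d = 0
  inv_eq : T.inv = LinearMap.id

variable {χ : Conjugation H} {Agr : ℤ → AddSubgroup A} {Γgr : ℤ → AddSubgroup Γ}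
    {x : ℕ → A} {deg : ℕ → ℤ} {I : Ideal A} {T : DGComodule.{u} H} {Tgr : ℤ → AddSubgroup T.carrier}

/-- The bigrading of `K ⊗ Γ`. -/
abbrev koszulCofreeGr (H : HopfAlgebroid A Γ) (Agr : ℤ → AddSubgroup A) (Γgr : ℤ → AddSubgroup Γ)
    (deg : ℕ → ℤ) : ℤ → ℤ → AddSubgroup (Cofree H.ηR (Koszul A)) :=
  fun j => cofreeGr H.ηR Γgr (koszulGr Agr deg j)

/-- The bigrading of the powers. -/
abbrev powGr (T : DGComodule.{u} H) (x : ℕ → A) (Agr : ℤ → AddSubgroup A) (Γgr : ℤ → AddSubgroup Γ)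
    (deg : ℕ → ℤ) (Tgr : ℤ → AddSubgroup T.carrier) (n : ℕ) :
    ℤ → ℤ → AddSubgroup (T.power (koszulComodule H x) n).carrier :=
  powerGr T (koszulComodule H x) Tgr (koszulCofreeGr H Agr Γgr deg) n

namespace Setting

variable (h : Setting χ Agr Γgr x deg I T Tgr)
include h

lemma Rψ_mem (J k : ℤ) (z : Cofree H.ηR (Koszul A)) (hz : z ∈ koszulCofreeGr H Agr Γgr deg J k) :
    (koszulComodule H x).ψ z ∈ cofreeGr H.ηR Γgr (koszulCofreeGr H Agr Γgr deg J) k :=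
  δ_mem_cofreeGr h.hopf hz

lemma Rd_mem (J J' k : ℤ) (z : Cofree H.ηR (Koszul A)) (hz : z ∈ koszulCofreeGr H Agr Γgr deg J k)
    (hJ : J' + 1 = J) : (koszulComodule H x).d z ∈ koszulCofreeGr H Agr Γgr deg J' k :=
  map_mem_cofreeGr (koszulD x) (fun _ _ hm => koszulD_mem h.hopf.amul_mem h.x_mem hm hJ) hz

omit h in
lemma Rinv_mem (J k : ℤ) (z : Cofree H.ηR (Koszul A)) (hz : z ∈ koszulCofreeGr H Agr Γgr deg J k) :
    (koszulComodule H x).inv z ∈ koszulCofreeGr H Agr Γgr deg J k :=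
  map_mem_cofreeGr koszulInv (fun _ _ hm => koszulInv_mem hm) hz

lemma elt_mem : (koszulUnit H x).elt ∈ koszulCofreeGr H Agr Γgr deg 0 0 :=
  mk_mem_cofreeGr h.hopf.one_mem (one_mem_koszulGr h.one_mem) rfl

lemma Rd_powSub (z : (koszulComodule H x).carrier) :
    (koszulComodule H x).d z ∈ powSub I (koszulComodule H x).carrier 1 :=
  Cofree.map_mem_powSub h.invariant (koszulD x) (koszulD_mem_powSub h.x_mem_ideal) z

lemma pow_graded (n : ℕ) (J : ℤ) : IsGraded Agr (powGr T x Agr Γgr deg Tgr n J) := by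
  induction n generalizing J with
  | zero => exact isGraded_concGr h.graded J
  | succ n ih => exact isGraded_tensorGr ih J

lemma pow_ψ_mem (n : ℕ) (J k : ℤ) (z) (hz : z ∈ powGr T x Agr Γgr deg Tgr n J k) :
    (T.power (koszulComodule H x) n).ψ z ∈ cofreeGr H.ηR Γgr (powGr T x Agr Γgr deg Tgr n J) k := by
  induction n generalizing J k with
  | zero => exact concGr_ψ_mem T.ψ h.ψ_mem J k z hz
  | succ n ih => exact tensorψ_mem (T := T.power (koszulComodule H x) n) (R := koszulComodule H x) h.hopf ih h.Rψ_mem hz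

lemma pow_inv_mem (n : ℕ) (J k : ℤ) (z) (hz : z ∈ powGr T x Agr Γgr deg Tgr n J k) :
    (T.power (koszulComodule H x) n).inv z ∈ powGr T x Agr Γgr deg Tgr n J k := by
  induction n generalizing J k with
  | zero =>
    change T.inv z ∈ _
    rw [h.inv_eq]
    exact hz
  | succ n ih =>
    exact tensorMap_mem (T.power (koszulComodule H x) n).inv (koszulComodule H x).inv 0 0 0 0
      (fun J k m hm => by simpa using ih J k m hm) (fun J k m hm => by rw [add_zero, add_zero]; exact Rinv_mem J k m hm)
      hz (by simp) (by simp)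

lemma pow_d_mem (n : ℕ) (J J' k : ℤ) (z) (hz : z ∈ powGr T x Agr Γgr deg Tgr n J k) (hJ : J' + 1 = J) :
    (T.power (koszulComodule H x) n).d z ∈ powGr T x Agr Γgr deg Tgr n J' k := by
  induction n generalizing J J' k with
  | zero =>
    change T.d z ∈ _
    rw [h.d_eq]
    exact AddSubgroup.zero_mem _
  | succ n ih =>
    exact AddSubgroup.add_mem _
      (tensorMap_mem (T.power (koszulComodule H x) n).d LinearMap.id (-1) 0 0 0
        (fun J k m hm => by simpa using ih J (J + -1) k m hm (by ring)) (fun J k m hm => by simpa using hm)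
        hz (by omega) (by simp))
      (tensorMap_mem (T.power (koszulComodule H x) n).inv (koszulComodule H x).d 0 (-1) 0 0
        (fun J k m hm => by simpa using h.pow_inv_mem n J k m hm)
        (fun J k m hm => by rw [add_zero]; exact h.Rd_mem J (J + -1) k m hm (by ring)) hz (by omega) (by simp))

lemma pow_d_powSub (n : ℕ) (z : (T.power (koszulComodule H x) n).carrier) :
    (T.power (koszulComodule H x) n).d z ∈ powSub I (T.power (koszulComodule H x) n).carrier 1 := by
  induction n with
  | zero =>
    change T.d z ∈ _
    rw [h.d_eq]
    exact Submodule.zero_mem _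
  | succ n ih =>
    exact tensorD_powSub (T.power (koszulComodule H x) n).d _ (koszulComodule H x).d ih h.Rd_powSub z

lemma coface_mem (n : ℕ) (J k : ℤ) (z) (hz : z ∈ powGr T x Agr Γgr deg Tgr n J k) :
    (DGComodule.coface T (koszulUnit H x) n).lin z ∈ powGr T x Agr Γgr deg Tgr (n + 1) J k := by
  have hu : ∀ n J k z, z ∈ powGr T x Agr Γgr deg Tgr n J k →
      DGComodule.unitLin (T.power (koszulComodule H x) n) (koszulUnit H x) z ∈
        powGr T x Agr Γgr deg Tgr (n + 1) J k := fun n J k z hz =>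
    tmul_mem_tensorGr hz h.elt_mem (add_zero _) (add_zero _)
  induction n generalizing J k with
  | zero => exact hu 0 J k z hz
  | succ n ih =>
    exact AddSubgroup.add_mem _
      (tensorMap_mem (DGComodule.coface T (koszulUnit H x) n).lin LinearMap.id 0 0 0 0
        (fun J k m hm => by simpa using ih J k m hm) (fun J k m hm => by simpa using hm) hz
        (by simp) (by simp))
      (AddSubgroup.zsmul_mem _ (hu (n + 1) J k z hz) _)

end Setting

end Setting

section CofaceContraction

variable {A Γ : Type} [CommRing A] [CommRing Γ] [Algebra A Γ] {H : HopfAlgebroid A Γ}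

/-- The augmentation of `K ⊗ Γ`. -/
def cofreeAug (H : HopfAlgebroid A Γ) : Cofree H.ηR (Koszul A) →ₗ[A] A := koszulAug A ∘ₗ H.counit _

lemma cofreeAug_elt (x : ℕ → A) : cofreeAug H (koszulUnit H x).elt = 1 := by
  have e : H.ε 1 = 1 := map_one H.ε
  change koszulAug A (H.counit _ (Cofree.mk H.ηR 1 1)) = 1
  rw [HopfData.counit_mk, e, one_smul, koszulAug_one]

/-- The contraction of the cosimplicial object that evaluates the first factor `R`. -/
def cofaceContr (T : DGComodule.{u} H) (x : ℕ → A) : (n : ℕ) →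
    (T.power (koszulComodule H x) n).carrier ⊗[A] Cofree H.ηR (Koszul A) →ₗ[A]
      (T.power (koszulComodule H x) n).carrier
  | 0 => (TensorProduct.rid A T.carrier).toLinearMap ∘ₗ TensorProduct.map LinearMap.id (cofreeAug H)
  | n + 1 => TensorProduct.map (cofaceContr T x n) LinearMap.id

lemma cofaceContr_aux {P : Type u} [AddCommGroup P] [Module A P] {N : Type} [AddCommGroup N]
    [Module A N] (e : N) (f : P →ₗ[A] P ⊗[A] N) (c : P ⊗[A] N →ₗ[A] P) (s s' : ℤ) (hs : s' = -s)
    (h : ∀ y : P ⊗[A] N, TensorProduct.map c LinearMap.id ((TensorProduct.map f LinearMap.id +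
      s • (TensorProduct.mk A (P ⊗[A] N) N).flip e : P ⊗[A] N →ₗ[A] (P ⊗[A] N) ⊗[A] N) y) + f (c y) = y)
    (z : (P ⊗[A] N) ⊗[A] N) :
    TensorProduct.map (TensorProduct.map c LinearMap.id) LinearMap.id
      ((TensorProduct.map (TensorProduct.map f LinearMap.id +
        s • (TensorProduct.mk A (P ⊗[A] N) N).flip e : P ⊗[A] N →ₗ[A] (P ⊗[A] N) ⊗[A] N)
          LinearMap.id + s' • (TensorProduct.mk A ((P ⊗[A] N) ⊗[A] N) N).flip e :
            (P ⊗[A] N) ⊗[A] N →ₗ[A] ((P ⊗[A] N) ⊗[A] N) ⊗[A] N) z) +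
      (TensorProduct.map f LinearMap.id + s • (TensorProduct.mk A (P ⊗[A] N) N).flip e :
        P ⊗[A] N →ₗ[A] (P ⊗[A] N) ⊗[A] N) (TensorProduct.map c LinearMap.id z) = z := by
  induction z using TensorProduct.induction_on with
  | zero => simp only [map_zero, add_zero]
  | add y z hy hz =>
    rw [map_add, map_add, map_add, map_add]
    exact (add_add_add_comm _ _ _ _).trans (congrArg₂ (· + ·) hy hz)
  | tmul y r =>
    have h' := congrArg (fun y => y ⊗ₜ[A] r) (h y)
    beta_reduce at h'
    rw [TensorProduct.add_tmul] at h'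
    refine Eq.trans ?_ h'
    have e1 : (TensorProduct.map (TensorProduct.map f LinearMap.id +
        s • (TensorProduct.mk A (P ⊗[A] N) N).flip e : P ⊗[A] N →ₗ[A] (P ⊗[A] N) ⊗[A] N)
          LinearMap.id + s' • (TensorProduct.mk A ((P ⊗[A] N) ⊗[A] N) N).flip e :
            (P ⊗[A] N) ⊗[A] N →ₗ[A] ((P ⊗[A] N) ⊗[A] N) ⊗[A] N) (y ⊗ₜ[A] r) =
        (TensorProduct.map f LinearMap.id +
        s • (TensorProduct.mk A (P ⊗[A] N) N).flip e : P ⊗[A] N →ₗ[A] (P ⊗[A] N) ⊗[A] N) y ⊗ₜ[A] r +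
        s' • ((y ⊗ₜ[A] r) ⊗ₜ[A] e) := rfl
    have e2 : (TensorProduct.map f LinearMap.id + s • (TensorProduct.mk A (P ⊗[A] N) N).flip e :
        P ⊗[A] N →ₗ[A] (P ⊗[A] N) ⊗[A] N) (c y ⊗ₜ[A] r) =
        f (c y) ⊗ₜ[A] r + s • ((c y ⊗ₜ[A] r) ⊗ₜ[A] e) := rfl
    rw [e1, map_add, map_zsmul]
    simp only [TensorProduct.map_tmul, LinearMap.id_apply]
    rw [e2, hs]
    module

lemma cofaceContr_base {P : Type u} [AddCommGroup P] [Module A P] {N : Type} [AddCommGroup N]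
    [Module A N] (e : N) (ε : N →ₗ[A] A) (hε : ε e = 1) (z : P ⊗[A] N) :
    TensorProduct.map ((TensorProduct.rid A P).toLinearMap ∘ₗ TensorProduct.map LinearMap.id ε)
      LinearMap.id ((TensorProduct.map ((TensorProduct.mk A P N).flip e) LinearMap.id +
        ((-1) ^ (0 + 1) : ℤ) • (TensorProduct.mk A (P ⊗[A] N) N).flip e :
          P ⊗[A] N →ₗ[A] (P ⊗[A] N) ⊗[A] N) z) +
      (TensorProduct.mk A P N).flip e
        (TensorProduct.rid A P (TensorProduct.map LinearMap.id ε z)) = z := by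
  induction z using TensorProduct.induction_on with
  | zero => simp only [map_zero, add_zero]
  | add y z hy hz =>
    rw [map_add, map_add, map_add, map_add, map_add]
    exact (add_add_add_comm _ _ _ _).trans (congrArg₂ (· + ·) hy hz)
  | tmul y r =>
    have e1 : (TensorProduct.map ((TensorProduct.mk A P N).flip e) LinearMap.id +
        ((-1) ^ (0 + 1) : ℤ) • (TensorProduct.mk A (P ⊗[A] N) N).flip e :
          P ⊗[A] N →ₗ[A] (P ⊗[A] N) ⊗[A] N) (y ⊗ₜ[A] r) =
        (y ⊗ₜ[A] e) ⊗ₜ[A] r + ((-1) ^ (0 + 1) : ℤ) • ((y ⊗ₜ[A] r) ⊗ₜ[A] e) := rfl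
    rw [e1, map_add, map_zsmul]
    simp [hε, TensorProduct.smul_tmul']

variable (T : DGComodule.{u} H) (x : ℕ → A)

lemma cofaceContr_coface_zero (z : T.carrier) :
    cofaceContr T x 0 ((DGComodule.coface T (koszulUnit H x) 0).lin z) = z := by
  change TensorProduct.rid A T.carrier (z ⊗ₜ cofreeAug H (koszulUnit H x).elt) = z
  rw [cofreeAug_elt, TensorProduct.rid_tmul, one_smul]

lemma cofaceContr_coface (n : ℕ) (z : (T.power (koszulComodule H x) (n + 1)).carrier) :
    cofaceContr T x (n + 1) ((DGComodule.coface T (koszulUnit H x) (n + 1)).lin z) +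
      (DGComodule.coface T (koszulUnit H x) n).lin (cofaceContr T x n z) = z := by
  induction n with
  | zero =>
    exact cofaceContr_base (koszulUnit H x).elt (cofreeAug H) (cofreeAug_elt x) z
  | succ n ih =>
    exact cofaceContr_aux (koszulUnit H x).elt (DGComodule.coface T (koszulUnit H x) n).lin
      (cofaceContr T x n) _ _ (by rw [pow_succ _ (n + 1), mul_neg_one]) ih z

lemma cofreeAug_mem {Agr : ℤ → AddSubgroup A} {Γgr : ℤ → AddSubgroup Γ} (hH : HopfGrading H Agr Γgr)
    {deg : ℕ → ℤ} {J k : ℤ} {z : Cofree H.ηR (Koszul A)} (hz : z ∈ koszulCofreeGr H Agr Γgr deg J k) :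
    cofreeAug H z ∈ concGr Agr J k :=
  koszulAug_mem (counit_mem hH (isGraded_koszulGr hH.amul_mem J) hz)

lemma rid_mem {Agr : ℤ → AddSubgroup A} {Γgr : ℤ → AddSubgroup Γ} (hH : HopfGrading H Agr Γgr)
    {deg : ℕ → ℤ} {M : Type u} [AddCommGroup M] [Module A M] {Mgr : ℤ → AddSubgroup M}
    (hM : IsGraded Agr Mgr) {J k : ℤ} {z : M ⊗[A] Cofree H.ηR (Koszul A)}
    (hz : z ∈ tensorGr (concGr Mgr) (koszulCofreeGr H Agr Γgr deg) J k) :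
    TensorProduct.rid A M (TensorProduct.map LinearMap.id (cofreeAug H) z) ∈ concGr Mgr J k := by
  refine map_mem_of_tensorGr ((TensorProduct.rid A M).toLinearMap ∘ₗ
    TensorProduct.map LinearMap.id (cofreeAug H)).toAddMonoidHom _
    (fun i j a b m r hm hr h1 h2 => ?_) hz
  change TensorProduct.rid A M (m ⊗ₜ cofreeAug H r) ∈ concGr Mgr J k
  rw [TensorProduct.rid_tmul]
  rcases concGr_cases (cofreeAug_mem hH hr) with ⟨rfl, hr'⟩ | hr'
  · have := isGraded_concGr hM i b a _ _ hr' hm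
    rwa [← h1, ← h2, add_zero, add_comm a]
  · rw [hr', zero_smul]
    exact AddSubgroup.zero_mem _

lemma cofaceContr_mem {χ : Conjugation H} {Agr : ℤ → AddSubgroup A} {Γgr : ℤ → AddSubgroup Γ}
    {deg : ℕ → ℤ} {I : Ideal A} {Tgr : ℤ → AddSubgroup T.carrier} {x : ℕ → A}
    (h : Setting χ Agr Γgr x deg I T Tgr) (n : ℕ) (J k : ℤ) (z)
    (hz : z ∈ powGr T x Agr Γgr deg Tgr (n + 1) J k) :
    cofaceContr T x n z ∈ powGr T x Agr Γgr deg Tgr n J k := by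
  induction n generalizing J k with
  | zero => exact rid_mem h.hopf h.graded hz
  | succ n ih =>
    exact tensorMap_mem (cofaceContr T x n) LinearMap.id 0 0 0 0
      (fun J k m hm => by simpa using ih J k m hm) (fun J k m hm => by simpa using hm) hz
      (by simp) (by simp)

end CofaceContraction

section DirectSumMaps

variable {ι : Type*} [DecidableEq ι] {X : ι → Type*} [∀ i, AddCommGroup (X i)]

/-- The additive map on a direct sum that is given by maps `X i → X (σ i)`. -/
def sumMap (σ : ι → ι) (f : ∀ i, X i →+ X (σ i)) : (⨁ i, X i) →+ ⨁ i, X i :=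
  DirectSum.toAddMonoid fun i => (DirectSum.of X (σ i)).comp (f i)

lemma sumMap_apply {σ : ι → ι} (hσ : Function.Injective σ) (f : ∀ i, X i →+ X (σ i)) (x : ⨁ i, X i)
    (i : ι) : sumMap σ f x (σ i) = f i (x i) := by
  induction x using DirectSum.induction_on with
  | zero => rw [map_zero, DirectSum.zero_apply, DirectSum.zero_apply, map_zero]
  | add x y hx hy => rw [map_add, DirectSum.add_apply, DirectSum.add_apply, map_add, hx, hy]
  | of j x =>
    rw [sumMap, DirectSum.toAddMonoid_of, AddMonoidHom.comp_apply]
    by_cases h : i = j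
    · subst h
      rw [DirectSum.of_eq_same, DirectSum.of_eq_same]
    · rw [DirectSum.of_eq_of_ne _ _ _ (fun e => h (hσ e)), DirectSum.of_eq_of_ne _ _ _ h, map_zero]

lemma sumMap_apply_of_ne {σ : ι → ι} (f : ∀ i, X i →+ X (σ i)) (x : ⨁ i, X i) (j : ι)
    (hj : ∀ i, σ i ≠ j) : sumMap σ f x j = 0 := by
  induction x using DirectSum.induction_on with
  | zero => rw [map_zero, DirectSum.zero_apply]
  | add x y hx hy => rw [map_add, DirectSum.add_apply, hx, hy, add_zero]
  | of i x =>
    rw [sumMap, DirectSum.toAddMonoid_of, AddMonoidHom.comp_apply,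
      DirectSum.of_eq_of_ne _ _ _ (fun e => hj i e.symm)]

end DirectSumMaps

section Components

variable {A Γ : Type} [CommRing A] [CommRing Γ] [Algebra A Γ] {H : HopfAlgebroid A Γ}
  (T : DGComodule.{u} H) {R : DGComodule.{0} H} (e : DGComodule.Unit R)
  (y : ⨁ q : ℕ × ℕ, totTerm T R q)

lemma totD_eq : totD T e y = sumMap (fun q : ℕ × ℕ => (q.1 + 1, q.2)) (fun q => totE T e q.1 q.2) y +
    sumMap (fun q : ℕ × ℕ => (q.1, q.2 + 1)) (fun q => ((-1) ^ q.1 : ℤ) • totC T R q.1 q.2) y +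
    sumMap (fun q : ℕ × ℕ => q) (fun q => ((-1) ^ (q.1 + q.2) : ℤ) • totI T R q.1 q.2) y := by
  induction y using DirectSum.induction_on with
  | zero => simp only [map_zero, add_zero]
  | add x y hx hy => rw [map_add, map_add, map_add, map_add, hx, hy]; abel
  | of q x =>
    obtain ⟨n, s⟩ := q
    rw [totD_of]
    simp only [sumMap, DirectSum.toAddMonoid_of, AddMonoidHom.comp_apply]
    rw [AddMonoidHom.smul_apply, AddMonoidHom.smul_apply, map_zsmul, map_zsmul]

lemma sumE_succ (n s : ℕ) : sumMap (fun q : ℕ × ℕ => (q.1 + 1, q.2)) (fun q => totE T e q.1 q.2) y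
    (n + 1, s) = totE T e n s (y (n, s)) :=
  sumMap_apply (X := fun q => totTerm T R q) (σ := fun q : ℕ × ℕ => (q.1 + 1, q.2))
    (fun a b h => by simpa [Prod.ext_iff] using h) (fun q => totE T e q.1 q.2) y (n, s)

lemma sumE_zero (s : ℕ) : sumMap (fun q : ℕ × ℕ => (q.1 + 1, q.2)) (fun q => totE T e q.1 q.2) y
    (0, s) = 0 :=
  sumMap_apply_of_ne (X := fun q => totTerm T R q) _ y _ (fun q h => by simp [Prod.ext_iff] at h)

lemma sumC_succ (n s : ℕ) : sumMap (fun q : ℕ × ℕ => (q.1, q.2 + 1))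
    (fun q => ((-1) ^ q.1 : ℤ) • totC T R q.1 q.2) y (n, s + 1) =
      ((-1) ^ n : ℤ) • totC T R n s (y (n, s)) :=
  sumMap_apply (X := fun q => totTerm T R q) (σ := fun q : ℕ × ℕ => (q.1, q.2 + 1))
    (fun a b h => by simpa [Prod.ext_iff] using h) (fun q => ((-1) ^ q.1 : ℤ) • totC T R q.1 q.2) y (n, s)

lemma sumC_zero (n : ℕ) : sumMap (fun q : ℕ × ℕ => (q.1, q.2 + 1))
    (fun q => ((-1) ^ q.1 : ℤ) • totC T R q.1 q.2) y (n, 0) = 0 :=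
  sumMap_apply_of_ne (X := fun q => totTerm T R q) _ y _ (fun q h => by simp [Prod.ext_iff] at h)

lemma sumI_apply (n s : ℕ) : sumMap (fun q : ℕ × ℕ => q)
    (fun q => ((-1) ^ (q.1 + q.2) : ℤ) • totI T R q.1 q.2) y (n, s) =
      ((-1) ^ (n + s) : ℤ) • totI T R n s (y (n, s)) :=
  sumMap_apply (X := fun q => totTerm T R q) (σ := fun q : ℕ × ℕ => q)
    (fun _ _ h => h) (fun q => ((-1) ^ (q.1 + q.2) : ℤ) • totI T R q.1 q.2) y (n, s)

/-- A family of additive subgroups that is compatible with the three parts of the differential is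
compatible with the differential. -/
lemma totD_mem (P Q : ∀ q : ℕ × ℕ, AddSubgroup (totTerm T R q))
    (hE : ∀ n s x, x ∈ P (n, s) → totE T e n s x ∈ Q (n + 1, s))
    (hC : ∀ n s x, x ∈ P (n, s) → totC T R n s x ∈ Q (n, s + 1))
    (hI : ∀ n s x, x ∈ P (n, s) → totI T R n s x ∈ Q (n, s))
    (hy : ∀ q, y q ∈ P q) (q : ℕ × ℕ) : totD T e y q ∈ Q q := by
  obtain ⟨n, s⟩ := q
  rw [totD_eq, DirectSum.add_apply, DirectSum.add_apply, sumI_apply]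
  refine AddSubgroup.add_mem _ (AddSubgroup.add_mem _ ?_ ?_)
    (AddSubgroup.zsmul_mem _ (hI n s _ (hy (n, s))) _)
  · cases n with
    | zero => rw [sumE_zero]; exact AddSubgroup.zero_mem _
    | succ n => rw [sumE_succ]; exact hE n s _ (hy (n, s))
  · cases s with
    | zero => rw [sumC_zero]; exact AddSubgroup.zero_mem _
    | succ s => rw [sumC_succ]; exact AddSubgroup.zsmul_mem _ (hC n s _ (hy (n, s))) _

lemma of_mem {ι : Type*} [DecidableEq ι] {X : ι → Type*} [∀ i, AddCommGroup (X i)]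
    (P : ∀ i, AddSubgroup (X i)) (i : ι) {x : X i} (hx : x ∈ P i) (j : ι) :
    DirectSum.of X i x j ∈ P j := by
  by_cases h : j = i
  · subst h; rwa [DirectSum.of_eq_same]
  · rw [DirectSum.of_eq_of_ne _ _ _ h]; exact AddSubgroup.zero_mem _

end Components

section TotalFiltration

variable {A Γ : Type} [CommRing A] [CommRing Γ] [Algebra A Γ] {H : HopfAlgebroid A Γ}

/-- The filtration of the total complex by the powers of an ideal and the total degree. -/
def totW (T : DGComodule.{u} H) (R : DGComodule.{0} H) (I : Ideal A) (m : ℤ) :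
    AddSubgroup (⨁ q : ℕ × ℕ, totTerm T R q) where
  carrier := {y | ∀ q : ℕ × ℕ, y q ∈ powSub I (totTerm T R q) (m - q.1 - q.2)}
  zero_mem' := fun _ => Submodule.zero_mem _
  add_mem' := fun hx hy q => Submodule.add_mem _ (hx q) (hy q)
  neg_mem' := fun hx q => Submodule.neg_mem _ (hx q)

lemma totW_anti (T : DGComodule.{u} H) (R : DGComodule.{0} H) (I : Ideal A) :
    Antitone (totW T R I) := fun m m' h y hy q => powSub_anti I _ (by omega) (hy q)

/-- The filtration of the cobar complex by the powers of an ideal and the cobar degree. -/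
def cobarW (η : A →+* Γ) (M : Type u) [AddCommGroup M] [Module A M] (I : Ideal A) (m : ℤ) :
    AddSubgroup (CobarTotal η M) where
  carrier := {y | ∀ s : ℕ, y s ∈ powSub I (Bpow η M s) (m - s)}
  zero_mem' := fun _ => Submodule.zero_mem _
  add_mem' := fun hx hy q => Submodule.add_mem _ (hx q) (hy q)
  neg_mem' := fun hx q => Submodule.neg_mem _ (hx q)

lemma cobarW_anti (η : A →+* Γ) (M : Type u) [AddCommGroup M] [Module A M] (I : Ideal A) :
    Antitone (cobarW η M I) := fun m m' h y hy q => powSub_anti I _ (by omega) (hy q)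

lemma cobarD_eq_sub_mem {M : Type u} [AddCommGroup M] [Module A M] {I : Ideal A}
    (hI : IsInvariant H.ηR I) (ψ : M →ₗ[A] Cofree H.ηR M) (s : ℕ) {n : ℤ} {x : Bpow H.ηR M s}
    (hx : x ∈ powSub I (Bpow H.ηR M s) n) :
    cobar H ψ s x ∈ powSub I (Bpow H.ηR M (s + 1)) n :=
  Submodule.add_mem (powSub I (Cofree H.ηR (Bpow H.ηR M s)) n) (powSub_map (cobarD H ψ s) hx)
    (AddSubgroup.zsmul_mem (powSub I (Cofree H.ηR (Bpow H.ηR M s)) n).toAddSubgroup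
      (Cofree.one_mem_powSub hI hx) _)

variable {χ : Conjugation H} {Agr : ℤ → AddSubgroup A} {Γgr : ℤ → AddSubgroup Γ}
  {x : ℕ → A} {deg : ℕ → ℤ} {I : Ideal A} {T : DGComodule.{u} H} {Tgr : ℤ → AddSubgroup T.carrier}
  (h : Setting χ Agr Γgr x deg I T Tgr)
include h

namespace Setting

/-- The differential raises the filtration by one. -/
lemma totD_mem_totW {m m' : ℤ} (hm : m' = m + 1) {y} (hy : y ∈ totW T (koszulComodule H x) I m) :
    totD T (koszulUnit H x) y ∈ totW T (koszulComodule H x) I m' := by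
  subst hm
  refine totD_mem T (koszulUnit H x) y
    (fun q => (powSub I (totTerm T (koszulComodule H x) q) (m - q.1 - q.2)).toAddSubgroup)
    (fun q => (powSub I (totTerm T (koszulComodule H x) q) (m + 1 - q.1 - q.2)).toAddSubgroup)
    (fun n s z hz => ?_) (fun n s z hz => ?_) (fun n s z hz => ?_) hy
  · have e : m + 1 - ((n + 1 : ℕ) : ℤ) - s = m - n - s := by push_cast; ring
    change _ ∈ powSub I _ (m + 1 - ((n + 1 : ℕ) : ℤ) - s)
    rw [e]
    exact powSub_map _ hz
  · have e : m + 1 - n - ((s + 1 : ℕ) : ℤ) = m - n - s := by push_cast; ring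
    change _ ∈ powSub I _ (m + 1 - n - ((s + 1 : ℕ) : ℤ))
    rw [e]
    exact cobarD_eq_sub_mem h.invariant _ s hz
  · have e : m + 1 - n - s = (m - n - s) + 1 := by ring
    change _ ∈ powSub I _ (m + 1 - n - s)
    rw [e]
    exact powSub_map_succ _ (Bmap_mem_powSub h.invariant _ (h.pow_d_powSub (n + 1)) s) hz

/-- The grading of the total complex. -/
lemma totD_mem_gr {s₀ s₁ k : ℤ} (hs : s₁ = s₀ + 1) {y : ⨁ q, totTerm T (koszulComodule H x) q}
    (hy : ∀ q, y q ∈ BpowGr H.ηR Γgr (powGr T x Agr Γgr deg Tgr (q.1 + 1) ((q.1 : ℤ) + q.2 - s₀)) q.2 k)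
    (q : ℕ × ℕ) : totD T (koszulUnit H x) y q ∈
      BpowGr H.ηR Γgr (powGr T x Agr Γgr deg Tgr (q.1 + 1) ((q.1 : ℤ) + q.2 - s₁)) q.2 k := by
  subst hs
  refine totD_mem T (koszulUnit H x) y
    (fun q => BpowGr H.ηR Γgr (powGr T x Agr Γgr deg Tgr (q.1 + 1) ((q.1 : ℤ) + q.2 - s₀)) q.2 k)
    (fun q => BpowGr H.ηR Γgr (powGr T x Agr Γgr deg Tgr (q.1 + 1) ((q.1 : ℤ) + q.2 - (s₀ + 1))) q.2 k)
    (fun n s z hz => ?_) (fun n s z hz => ?_) (fun n s z hz => ?_) hy q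
  · have e : ((n + 1 : ℕ) : ℤ) + s - (s₀ + 1) = n + s - s₀ := by push_cast; ring
    dsimp only
    rw [e]
    exact Bmap_mem_BpowGr _ (fun k m hm => h.coface_mem (n + 1) _ k m hm) s hz
  · have e : (n : ℤ) + ((s + 1 : ℕ) : ℤ) - (s₀ + 1) = n + s - s₀ := by push_cast; ring
    dsimp only
    rw [e]
    exact cobar_mem h.hopf (fun k m hm => h.pow_ψ_mem (n + 1) _ k m hm) s hz
  · exact Bmap_mem_BpowGr _ (fun k m hm => h.pow_d_mem (n + 1) _ _ k m hm (by ring)) s hz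

end Setting

end TotalFiltration

section Pull

variable {ι κ : Type*} {X : κ → Type*} {Y : ι → Type*} [∀ i, AddCommGroup (X i)]
  [∀ i, AddCommGroup (Y i)]

/-- The element of a direct sum whose components are the images of components of another element. -/
def pull (σ : ι → κ) (hσ : Function.Injective σ) (f : ∀ i, X (σ i) →+ Y i) (x : ⨁ i, X i) :
    ⨁ i, Y i :=
  DFinsupp.mapRange (fun i => f i) (fun i => map_zero (f i)) (DFinsupp.comapDomain σ hσ x)

lemma pull_apply (σ : ι → κ) (hσ : Function.Injective σ) (f : ∀ i, X (σ i) →+ Y i) (x : ⨁ i, X i)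
    (i : ι) : pull σ hσ f x i = f i (x (σ i)) := by
  refine (DFinsupp.mapRange_apply _ _ _ _).trans ?_
  rw [DFinsupp.comapDomain_apply]

end Pull

section Coaugmentation

variable {A Γ : Type} [CommRing A] [CommRing Γ] [Algebra A Γ] {H : HopfAlgebroid A Γ}

section Components

variable (T : DGComodule.{u} H) {R : DGComodule.{0} H} (e : DGComodule.Unit R)

/-- The coaugmentation in cobar degree `s`. -/
def coaugTerm (s : ℕ) : Bpow H.ηR T.carrier s →+ totTerm T R (0, s) :=
  (Bmap H.ηR (DGComodule.unitHom T e).lin s).toAddMonoidHom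

lemma coaug_of (s : ℕ) (z : Bpow H.ηR T.carrier s) :
    coaug T e (DirectSum.of (fun s => Bpow H.ηR T.carrier s) s z) =
      DirectSum.of (fun q => totTerm T R q) (0, s) (coaugTerm T e s z) :=
  DirectSum.toAddMonoid_of _ _ _

lemma coaug_apply_zero (c : CobarTotal H.ηR T.carrier) (s : ℕ) :
    coaug T e c (0, s) = coaugTerm T e s (c s) := by
  induction c using DirectSum.induction_on with
  | zero => rw [map_zero, DirectSum.zero_apply, DirectSum.zero_apply, map_zero]
  | add x y hx hy => rw [map_add, DirectSum.add_apply, DirectSum.add_apply, map_add, hx, hy]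
  | of j z =>
    rw [coaug_of]
    by_cases h : s = j
    · subst h
      rw [DirectSum.of_eq_same, DirectSum.of_eq_same]
    · rw [DirectSum.of_eq_of_ne _ _ _ (fun e => h (Prod.ext_iff.1 e).2),
        DirectSum.of_eq_of_ne _ _ _ h, map_zero]

lemma coaug_apply_succ (c : CobarTotal H.ηR T.carrier) (n s : ℕ) :
    coaug T e c (n + 1, s) = 0 := by
  induction c using DirectSum.induction_on with
  | zero => rw [map_zero, DirectSum.zero_apply]
  | add x y hx hy => rw [map_add, DirectSum.add_apply, hx, hy, add_zero]
  | of j z =>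
    rw [coaug_of, DirectSum.of_eq_of_ne _ _ _ (fun e => by simp [Prod.ext_iff] at e)]

lemma totD_coaug (hd : T.d = 0) (Γgr : ℤ → AddSubgroup Γ) (Tgr : ℤ → AddSubgroup T.carrier)
    (I : Ideal A) (c : CobarTotal H.ηR T.carrier) : totD T e (coaug T e c) =
      coaug T e ((filteredCobar H Γgr T.ψ T.coassoc Tgr I).d c) := by
  induction c using DirectSum.induction_on with
  | zero => rw [map_zero]; exact (map_zero _).trans (map_zero _).symm
  | add x y hx hy =>
    rw [map_add, map_add, hx, hy]
    refine (map_add (coaug T e) _ _).symm.trans (congrArg _ ?_)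
    exact (map_add (filteredCobar H Γgr T.ψ T.coassoc Tgr I).d x y).symm
  | of s z =>
    have e0 : (filteredCobar H Γgr T.ψ T.coassoc Tgr I).d
        (DirectSum.of (fun s => Bpow H.ηR T.carrier s) s z) =
        DirectSum.of (fun s => Bpow H.ηR T.carrier s) (s + 1) (cobar H T.ψ s z) :=
      DirectSum.toAddMonoid_of _ _ _
    have e1 : totE T e 0 s (coaugTerm T e s z) = 0 := by
      have h := congrArg (fun f => Bmap H.ηR f s) (DGComodule.coface_coface T e 0)
      beta_reduce at h
      rw [Bmap_comp, Bmap_zero] at h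
      exact LinearMap.congr_fun h z
    have e2 : totC T R 0 s (coaugTerm T e s z) = coaugTerm T e (s + 1) (cobar H T.ψ s z) :=
      (cobar_natural H _ (DGComodule.unitHom T e).ψ_lin s z).symm
    have e3 : totI T R 0 s (coaugTerm T e s z) = 0 := by
      have h := congrArg (fun f => Bmap H.ηR f s) (DGComodule.unitHom T e).d_lin
      beta_reduce at h
      rw [hd, LinearMap.comp_zero, Bmap_zero, Bmap_comp] at h
      exact (LinearMap.congr_fun h z).symm
    rw [coaug_of, totD_of, e0, coaug_of, e1, e2, e3, map_zero, map_zero, pow_zero, one_smul,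
      smul_zero, zero_add, add_zero]

end Components

variable (T : DGComodule.{u} H) (x : ℕ → A)

/-- The contraction of the cosimplicial direction of the total complex. -/
def totContr (n s : ℕ) : totTerm T (koszulComodule H x) (n + 1, s) →+
    totTerm T (koszulComodule H x) (n, s) :=
  (Bmap H.ηR (cofaceContr T x (n + 1)) s).toAddMonoidHom

/-- The contraction of the coaugmentation. -/
def coaugContr (s : ℕ) : totTerm T (koszulComodule H x) (0, s) →+ Bpow H.ηR T.carrier s :=
  (Bmap H.ηR (cofaceContr T x 0) s).toAddMonoidHom

lemma Bmap_comp_eq {M N P : Type u} [AddCommGroup M] [Module A M] [AddCommGroup N] [Module A N]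
    [AddCommGroup P] [Module A P] (η : A →+* Γ) (g : N →ₗ[A] P) (f : M →ₗ[A] N) (k : M →ₗ[A] P)
    (h : ∀ z, g (f z) = k z) (s : ℕ) (z : Bpow η M s) :
    Bmap η g s (Bmap η f s z) = Bmap η k s z := by
  rw [← LinearMap.comp_apply, ← Bmap_comp, (LinearMap.ext h : g ∘ₗ f = k)]

lemma Bmap_homotopy {M N P : Type u} [AddCommGroup M] [Module A M] [AddCommGroup N] [Module A N]
    [AddCommGroup P] [Module A P] (η : A →+* Γ) (g : N →ₗ[A] M) (f : M →ₗ[A] N) (g' : P →ₗ[A] M)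
    (f' : M →ₗ[A] P) (h : ∀ z, g (f z) + g' (f' z) = z) (s : ℕ) (z : Bpow η M s) :
    Bmap η g s (Bmap η f s z) + Bmap η g' s (Bmap η f' s z) = z := by
  have := congrArg (fun f => Bmap η f s) (LinearMap.ext h : g ∘ₗ f + g' ∘ₗ f' = LinearMap.id)
  beta_reduce at this
  rw [Bmap_add, Bmap_comp, Bmap_comp, Bmap_id] at this
  exact LinearMap.congr_fun this z

lemma coaugContr_coaugTerm (s : ℕ) (z : Bpow H.ηR T.carrier s) :
    coaugContr T x s (coaugTerm T (koszulUnit H x) s z) = z := by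
  have h := Bmap_comp_eq H.ηR (cofaceContr T x 0) (DGComodule.coface T (koszulUnit H x) 0).lin
    LinearMap.id (cofaceContr_coface_zero T x) s z
  rw [Bmap_id] at h
  exact h

lemma totContr_totE_zero (s : ℕ) (z : totTerm T (koszulComodule H x) (0, s)) :
    totContr T x 0 s (totE T (koszulUnit H x) 0 s z) +
      coaugTerm T (koszulUnit H x) s (coaugContr T x s z) = z :=
  Bmap_homotopy H.ηR _ _ _ _ (cofaceContr_coface T x 0) s z

lemma totContr_totE (n s : ℕ) (z : totTerm T (koszulComodule H x) (n + 1, s)) :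
    totContr T x (n + 1) s (totE T (koszulUnit H x) (n + 1) s z) +
      totE T (koszulUnit H x) n s (totContr T x n s z) = z :=
  Bmap_homotopy H.ηR _ _ _ _ (cofaceContr_coface T x (n + 1)) s z

end Coaugmentation

section TightCoaug

variable {A Γ : Type} [CommRing A] [CommRing Γ] [Algebra A Γ] {H : HopfAlgebroid A Γ}

lemma concGr_Bpow {Γgr : ℤ → AddSubgroup Γ} {η : A →+* Γ} {M : Type u} [AddCommGroup M] [Module A M]
    {Mgr : ℤ → AddSubgroup M} {J k : ℤ} (s : ℕ) {z : Bpow η M s}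
    (hz : z ∈ BpowGr η Γgr (concGr Mgr J) s k) :
    z ∈ BpowGr η Γgr Mgr s k ∧ (J ≠ 0 → z = 0) := by
  constructor
  · have := Bmap_mem_BpowGr (η := η) (Ngr := Mgr) (LinearMap.id : M →ₗ[A] M) (fun k m hm => by
      rcases concGr_cases hm with ⟨rfl, hm⟩ | rfl
      · exact hm
      · exact AddSubgroup.zero_mem _) s hz
    rwa [Bmap_id] at this
  · intro hJ
    have := Bmap_mem_BpowGr (η := η) (Ngr := fun _ => (⊥ : AddSubgroup M))
      (LinearMap.id : M →ₗ[A] M) (fun k m hm => by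
      rcases concGr_cases hm with ⟨h, hm⟩ | rfl
      · exact absurd h hJ
      · exact AddSubgroup.zero_mem _) s hz
    rw [Bmap_id] at this
    change z ∈ BpowGr η Γgr (fun _ => (⊥ : AddSubgroup M)) s k at this
    clear hz
    induction s generalizing k with
    | zero => exact this
    | succ s ih =>
      have := map_mem_of_cofreeGr (AddMonoidHom.id (Cofree η (Bpow η M s))) ⊥ (fun i j γ m hγ hm _ => by
        have e : m = 0 := ih hm
        rw [e, AddMonoidHom.id_apply, Cofree.mk_zero]
        exact AddSubgroup.zero_mem _) this
      exact this

variable {χ : Conjugation H} {Agr : ℤ → AddSubgroup A} {Γgr : ℤ → AddSubgroup Γ}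
  {x : ℕ → A} {deg : ℕ → ℤ} {I : Ideal A} {T : DGComodule.{u} H} {Tgr : ℤ → AddSubgroup T.carrier}

namespace Setting

variable (h : Setting χ Agr Γgr x deg I T Tgr)
include h

lemma sub_totD_mem {s k m : ℤ} {y w : ⨁ q, totTerm T (koszulComodule H x) q}
    (hy : y ∈ totW T (koszulComodule H x) I m)
    (hg : y ∈ (totComplex Γgr T (koszulUnit H x) Tgr (koszulCofreeGr H Agr Γgr deg)).gr s k)
    (hw : w ∈ totW T (koszulComodule H x) I (m - 1))
    (hwg : w ∈ (totComplex Γgr T (koszulUnit H x) Tgr (koszulCofreeGr H Agr Γgr deg)).gr (s - 1) k) :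
    y - totD T (koszulUnit H x) w ∈ totW T (koszulComodule H x) I m ∧
    y - totD T (koszulUnit H x) w ∈
      (totComplex Γgr T (koszulUnit H x) Tgr (koszulCofreeGr H Agr Γgr deg)).gr s k :=
  ⟨AddSubgroup.sub_mem _ hy (h.totD_mem_totW (by ring) hw),
    AddSubgroup.sub_mem _ hg (fun q => h.totD_mem_gr (by ring) hwg q)⟩

lemma coaug_lift (N : ℕ) {s k m : ℤ} (y : ⨁ q, totTerm T (koszulComodule H x) q)
    (c : CobarTotal H.ηR T.carrier)
    (hy : y ∈ totW T (koszulComodule H x) I m)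
    (hg : y ∈ (totComplex Γgr T (koszulUnit H x) Tgr (koszulCofreeGr H Agr Γgr deg)).gr s k)
    (hN : ∀ q : ℕ × ℕ, N ≤ q.1 → y q = 0)
    (hc : totD T (koszulUnit H x) y = coaug T (koszulUnit H x) c) :
    ∃ (z : CobarTotal H.ηR T.carrier) (w : ⨁ q, totTerm T (koszulComodule H x) q),
      z ∈ cobarW H.ηR T.carrier I m ∧
      z ∈ (filteredCobar H Γgr T.ψ T.coassoc Tgr I).gr s k ∧
      w ∈ totW T (koszulComodule H x) I (m - 1) ∧
      w ∈ (totComplex Γgr T (koszulUnit H x) Tgr (koszulCofreeGr H Agr Γgr deg)).gr (s - 1) k ∧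
      y = coaug T (koszulUnit H x) z + totD T (koszulUnit H x) w := by
  induction N generalizing y with
  | zero =>
    have e : y = 0 := DFinsupp.ext fun q => hN q (Nat.zero_le _)
    exact ⟨0, 0, AddSubgroup.zero_mem _, AddSubgroup.zero_mem _, AddSubgroup.zero_mem _,
      AddSubgroup.zero_mem _, by rw [e, map_zero, map_zero, add_zero]⟩
  | succ N ih =>
    have hE : ∀ t, totE T (koszulUnit H x) N t (y (N, t)) = 0 := fun t => by
      have e := DFinsupp.ext_iff.1 hc (N + 1, t)
      have e' := coaug_apply_succ T (koszulUnit H x) c N t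
      have e1 : y (N + 1, t) = 0 := hN (N + 1, t) le_rfl
      have e2 : (sumMap (fun q : ℕ × ℕ => (q.1, q.2 + 1))
          (fun q => ((-1) ^ q.1 : ℤ) • totC T (koszulComodule H x) q.1 q.2) y :
            ⨁ q, totTerm T (koszulComodule H x) q) (N + 1, t) = 0 := by
        cases t with
        | zero => exact sumC_zero T y _
        | succ t =>
          rw [sumC_succ, hN (N + 1, t) le_rfl, map_zero, smul_zero]
      have e3 : totD T (koszulUnit H x) y (N + 1, t) = 0 := e.trans e'
      rwa [totD_eq, DirectSum.add_apply, DirectSum.add_apply, sumE_succ, e2, sumI_apply, e1, map_zero,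
        smul_zero, add_zero, add_zero] at e3
    cases N with
    | zero =>
      let z : CobarTotal H.ηR T.carrier :=
        pull (fun s : ℕ => ((0, s) : ℕ × ℕ)) (fun a b e => (Prod.ext_iff.1 e).2)
          (fun s => coaugContr T x s) y
      have hz : ∀ t, z t = coaugContr T x t (y (0, t)) := fun t => pull_apply _ _ _ _ _
      have e : y = coaug T (koszulUnit H x) z := by
        refine DFinsupp.ext fun q => ?_
        obtain ⟨n, t⟩ := q
        cases n with
        | zero =>
          have e1 := totContr_totE_zero T x t (y (0, t))
          rw [hE, map_zero, zero_add] at e1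
          refine Eq.trans ?_ (coaug_apply_zero T (koszulUnit H x) z t).symm
          rw [hz]
          exact e1.symm
        | succ n =>
          refine (hN (n + 1, t) (by simp)).trans ?_
          exact (coaug_apply_succ T (koszulUnit H x) z n t).symm
      refine ⟨z, 0, fun t => ?_, fun t => ?_, AddSubgroup.zero_mem _, AddSubgroup.zero_mem _,
        by rw [map_zero, add_zero]; exact e⟩
      · rw [hz]
        have := hy (0, t)
        simp only [Nat.cast_zero, sub_zero] at this
        exact powSub_map (Bmap H.ηR (cofaceContr T x 0) t) this
      · rw [hz]
        have h1 : coaugContr T x t (y (0, t)) ∈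
            BpowGr H.ηR Γgr (concGr Tgr (((0 : ℕ) : ℤ) + t - s)) t k :=
          Bmap_mem_BpowGr (cofaceContr T x 0) (fun k m hm => cofaceContr_mem T h 0 _ k m hm) t
            (hg (0, t))
        exact ⟨(concGr_Bpow t h1).1, fun ht => (concGr_Bpow t h1).2 (by push_cast; omega)⟩
    | succ N =>
      let w : ⨁ q, totTerm T (koszulComodule H x) q :=
        pull (fun q : ℕ × ℕ => (q.1 + 1, q.2)) (fun a b e => by simpa [Prod.ext_iff] using e)
          (fun q => totContr T x q.1 q.2) y
      have hw : ∀ n t, w (n, t) = totContr T x n t (y (n + 1, t)) := fun n t => pull_apply _ _ _ _ _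
      have hwW : w ∈ totW T (koszulComodule H x) I (m - 1) := by
        rintro ⟨n, t⟩
        rw [hw]
        have := hy (n + 1, t)
        have e : m - ((n + 1 : ℕ) : ℤ) - t = m - 1 - n - t := by push_cast; ring
        dsimp only at this
        rw [e] at this
        exact powSub_map (Bmap H.ηR (cofaceContr T x (n + 1)) t) this
      have hwg : w ∈ (totComplex Γgr T (koszulUnit H x) Tgr (koszulCofreeGr H Agr Γgr deg)).gr
          (s - 1) k := by
        rintro ⟨n, t⟩
        rw [hw]
        have := hg (n + 1, t)
        have e : ((n + 1 : ℕ) : ℤ) + t - s = n + t - (s - 1) := by push_cast; ring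
        dsimp only at this
        rw [e] at this
        exact Bmap_mem_BpowGr (cofaceContr T x (n + 1)) (fun k m hm => cofaceContr_mem T h _ _ k m hm)
          t this
      obtain ⟨h1, h2⟩ := h.sub_totD_mem hy hg hwW hwg
      have hw0 : ∀ n t, N + 1 ≤ n → w (n, t) = 0 := fun n t hn => by
        rw [hw, hN (n + 1, t) (by simpa using hn), map_zero]
      obtain ⟨z, w', hz, hzg, hw', hwg', e⟩ := ih _ h1 h2 (fun q hq => by
        obtain ⟨n, t⟩ := q
        obtain ⟨n, rfl⟩ : ∃ n', n = n' + 1 := ⟨n - 1, by simp only at hq; omega⟩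
        have e1 : totD T (koszulUnit H x) w (n + 1, t) = totE T (koszulUnit H x) n t (w (n, t)) := by
          have e2 : (sumMap (fun q : ℕ × ℕ => (q.1, q.2 + 1))
              (fun q => ((-1) ^ q.1 : ℤ) • totC T (koszulComodule H x) q.1 q.2) w :
                ⨁ q, totTerm T (koszulComodule H x) q) (n + 1, t) = 0 := by
            cases t with
            | zero => exact sumC_zero T w _
            | succ t => rw [sumC_succ, hw0 (n + 1) t hq, map_zero, smul_zero]
          rw [totD_eq, DirectSum.add_apply, DirectSum.add_apply, sumE_succ, e2, sumI_apply,
            hw0 (n + 1) t hq, map_zero, smul_zero, add_zero, add_zero]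
        have e3 : totE T (koszulUnit H x) n t (w (n, t)) = y (n + 1, t) := by
          rw [hw]
          have e4 := totContr_totE T x n t (y (n + 1, t))
          have e5 : totE T (koszulUnit H x) (n + 1) t (y (n + 1, t)) = 0 := by
            rcases (show N ≤ n by simpa using hq).eq_or_lt with rfl | hlt
            · exact hE t
            · rw [hN (n + 1, t) (by simp only; omega), map_zero]
          rwa [e5, map_zero, zero_add] at e4
        rw [DirectSum.sub_apply, e1, e3, sub_self]) (by
        rw [map_sub, totD_totD, sub_zero, hc])
      refine ⟨z, w + w', hz, hzg, AddSubgroup.add_mem _ hwW hw', AddSubgroup.add_mem _ hwg hwg', ?_⟩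
      rw [map_add, add_left_comm, ← e, add_sub_cancel]

omit h in
lemma coaug_injective {c c' : CobarTotal H.ηR T.carrier}
    (e : coaug T (koszulUnit H x) c = coaug T (koszulUnit H x) c') : c = c' := by
  refine DFinsupp.ext fun s => ?_
  have := congrArg (coaugContr T x s) (DFinsupp.ext_iff.1 e (0, s))
  have h1 := coaug_apply_zero T (koszulUnit H x) c s
  have h2 := coaug_apply_zero T (koszulUnit H x) c' s
  change coaugContr T x s (coaug T (koszulUnit H x) c (0, s)) =
    coaugContr T x s (coaug T (koszulUnit H x) c' (0, s)) at this
  rwa [h1, h2, coaugContr_coaugTerm, coaugContr_coaugTerm] at this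

/-- The coaugmentation is tight for the filtrations by the powers of the ideal. -/
theorem isTight_coaug : FilteredComplex.IsTight
    ((filteredCobar H Γgr T.ψ T.coassoc Tgr I).refilter (cobarW H.ηR T.carrier I)
      (cobarW_anti H.ηR T.carrier I))
    ((totComplex Γgr T (koszulUnit H x) Tgr (koszulCofreeGr H Agr Γgr deg)).refilter
      (totW T (koszulComodule H x) I) (totW_anti T (koszulComodule H x) I))
    (coaug T (koszulUnit H x)) where
  comm c := (totD_coaug T (koszulUnit H x) h.d_eq Γgr Tgr I c).symm
  gr := fun s k (c : CobarTotal H.ηR T.carrier) hc q => by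
    obtain ⟨n, t⟩ := q
    cases n with
    | zero =>
      have e := coaug_apply_zero T (koszulUnit H x) c t
      have h1 : coaugTerm T (koszulUnit H x) t (c t) ∈
          BpowGr H.ηR Γgr (powGr T x Agr Γgr deg Tgr 1 (((0 : ℕ) : ℤ) + t - s)) t k := by
        by_cases ht : (t : ℤ) = s
        · have hm : c t ∈ BpowGr H.ηR Γgr (concGr Tgr (((0 : ℕ) : ℤ) + t - s)) t k := by
            have : concGr Tgr (((0 : ℕ) : ℤ) + t - s) = Tgr := funext fun k => if_pos (by simp [ht])
            rw [this]
            exact (hc t).1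
          exact Bmap_mem_BpowGr (DGComodule.coface T (koszulUnit H x) 0).lin
            (fun k m hm => h.coface_mem 0 _ k m hm) t hm
        · rw [(hc t).2 ht, map_zero]
          exact AddSubgroup.zero_mem _
      rw [← e] at h1
      exact h1
    | succ n =>
      have e := coaug_apply_succ T (koszulUnit H x) c n t
      have h1 := AddSubgroup.zero_mem (BpowGr H.ηR Γgr (powGr T x Agr Γgr deg Tgr (n + 1 + 1)
        (((n + 1 : ℕ) : ℤ) + t - s)) t k)
      rw [← e] at h1
      exact h1
  F := fun m s k (c : CobarTotal H.ηR T.carrier) hc _ q => by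
    obtain ⟨n, t⟩ := q
    cases n with
    | zero =>
      have e := coaug_apply_zero T (koszulUnit H x) c t
      have h1 : coaugTerm T (koszulUnit H x) t (c t) ∈
          powSub I (totTerm T (koszulComodule H x) (0, t)) (m - ((0 : ℕ) : ℤ) - t) := by
        rw [Nat.cast_zero, sub_zero]
        exact powSub_map (Bmap H.ηR (DGComodule.unitHom T (koszulUnit H x)).lin t) (hc t)
      rw [← e] at h1
      exact h1
    | succ n =>
      have e := coaug_apply_succ T (koszulUnit H x) c n t
      have h1 := Submodule.zero_mem (powSub I (totTerm T (koszulComodule H x) (n + 1, t))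
        (m - ((n + 1 : ℕ) : ℤ) - t))
      rw [← e] at h1
      exact h1
  bound := fun m s k (y : ⨁ q, totTerm T (koszulComodule H x) q)
      (c : CobarTotal H.ηR T.carrier) hy hg hc hcg hdc hyc => by
    have hfin : ∃ N : ℕ, ∀ q : ℕ × ℕ, N ≤ q.1 → y q = 0 := by
      classical
      refine ⟨(DFinsupp.support y).sup Prod.fst + 1, fun q hq => ?_⟩
      by_contra hne
      have := Finset.le_sup (f := Prod.fst) (DFinsupp.mem_support_iff.2 hne)
      omega
    obtain ⟨N, hN⟩ := hfin
    obtain ⟨z, w, hz, hzg, hw, hwg, e⟩ := h.coaug_lift N y c hy hg hN hyc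
    refine ⟨z, w, hz, hzg, hw, hwg, ?_, e⟩
    refine coaug_injective (x := x) ?_
    refine (totD_coaug T (koszulUnit H x) h.d_eq Γgr Tgr I z).symm.trans ?_
    refine Eq.trans ?_ hyc
    change _ = totD T (koszulUnit H x) y
    rw [e, map_add, totD_totD, add_zero]

end Setting

end TightCoaug

/-- Homogeneous cycles in `I ^ j N`, for `j ≥ 1`, bound in `I ^ (j - 1) N`. -/
def AdicAcyclic {A : Type} [CommRing A] (I : Ideal A) {N : Type u} [AddCommGroup N] [Module A N]
    (d : N →ₗ[A] N) (Ngr : ℤ → ℤ → AddSubgroup N) : Prop :=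
  ∀ j : ℤ, 1 ≤ j → ∀ J k u, u ∈ powSub I N j → u ∈ Ngr J k → d u = 0 →
    ∃ v ∈ powSub I N (j - 1), v ∈ Ngr (J + 1) k ∧ d v = u

section Rows

variable {A Γ : Type} [CommRing A] [CommRing Γ] [Algebra A Γ] {H : HopfAlgebroid A Γ}
  (χ : Conjugation H) (T : DGComodule.{u} H) (x : ℕ → A)

/-- The retraction of the coaction of a power. -/
def rowRetr (n : ℕ) : Cofree H.ηR (T.power (koszulComodule H x) (n + 1)).carrier →ₗ[A]
    (T.power (koszulComodule H x) (n + 1)).carrier :=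
  χ.retr (T.power (koszulComodule H x) n) (Koszul A)

/-- The contraction of the rows of the total complex. -/
def rowContr (n s : ℕ) : totTerm T (koszulComodule H x) (n, s + 1) →ₗ[A]
    totTerm T (koszulComodule H x) (n, s) :=
  cobarContr H.ηR (rowRetr χ T x n) s

/-- The primitive elements of a power. -/
def rowPrim (n : ℕ) : (T.power (koszulComodule H x) n).carrier ⊗[A] Koszul A →+
    totTerm T (koszulComodule H x) (n, 0) :=
  χ.prim (Koszul A) (T.power (koszulComodule H x) n)

/-- The projection of a power to its primitive elements. -/
def rowProj (n : ℕ) : totTerm T (koszulComodule H x) (n, 0) →ₗ[A]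
    (T.power (koszulComodule H x) n).carrier ⊗[A] Koszul A :=
  Conjugation.proj H (T.power (koszulComodule H x) n).carrier (Koszul A)

lemma rowRetr_ψ (n : ℕ) : rowRetr χ T x n ∘ₗ (T.power (koszulComodule H x) (n + 1)).ψ =
    LinearMap.id := χ.retr_ψ (T.power (koszulComodule H x) n) (Koszul A)

lemma rowContr_totC (n s : ℕ) (z : totTerm T (koszulComodule H x) (n, s + 1)) :
    rowContr χ T x n (s + 1) (totC T _ n (s + 1) z) + totC T _ n s (rowContr χ T x n s z) = z :=
  cobarContr_cobar (rowRetr χ T x n) _ (rowRetr_ψ χ T x n)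
    (χ.map_retr_δ (T.power (koszulComodule H x) n) (Koszul A)) s z

lemma rowContr_totC_zero (n : ℕ) (z : totTerm T (koszulComodule H x) (n, 0)) :
    rowContr χ T x n 0 (totC T _ n 0 z) = z - rowPrim χ T x n (rowProj T x n z) :=
  (cobarContr_cobar_zero (rowRetr χ T x n) _ (rowRetr_ψ χ T x n) z).trans
    (congrArg (fun t => (show totTerm T (koszulComodule H x) (n, 0) from z) - t)
      (χ.retr_one (T.power (koszulComodule H x) n) (Koszul A) z))

lemma rowContr_totI (n s : ℕ) (z : totTerm T (koszulComodule H x) (n, s + 1)) :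
    rowContr χ T x n s (totI T _ n (s + 1) z) = totI T _ n s (rowContr χ T x n s z) :=
  cobarContr_natural (rowRetr χ T x n) _ (χ.retr_d (T.power (koszulComodule H x) n) x) s z

lemma totC_rowPrim (n : ℕ) (z) : totC T (koszulComodule H x) n 0 (rowPrim χ T x n z) = 0 := by
  have h := χ.cofreeψ_gact_prim (T.power (koszulComodule H x) n) 1 z
  have e : H.Δ 1 = Cofree.mk H.ηR 1 (RightUnit.of H.ηR 1) := map_one H.Δ
  rw [gact_one, e, Cofree.map_mk, gactFlip_of, gact_one] at h
  have e2 : ∀ (a b : Cofree H.ηR (T.power (koszulComodule H x) (n + 1)).carrier), a = b →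
      a + ((-1) ^ (0 + 1) : ℤ) • b = 0 := fun a b h => by rw [h]; simp
  exact e2 _ _ h

lemma totI_rowPrim (n : ℕ) (z) : totI T (koszulComodule H x) n 0 (rowPrim χ T x n z) =
    rowPrim χ T x n (koszulTensorD (T.power (koszulComodule H x) n) x z) := by
  have h := χ.untwist_d (T.power (koszulComodule H x) n) x (Cofree.one H.ηR z)
  rw [Cofree.map_one, χ.untwist_one, χ.untwist_one] at h
  exact h.symm

lemma rowProj_totI (n : ℕ) (z : totTerm T (koszulComodule H x) (n, 0)) :
    rowProj T x n (totI T _ n 0 z) =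
      koszulTensorD (T.power (koszulComodule H x) n) x (rowProj T x n z) :=
  proj_d (T.power (koszulComodule H x) n) x z

variable {T x}

lemma rowPrim_powSub {I : Ideal A} (hI : IsInvariant H.ηR I) (n : ℕ) {j : ℤ} {z}
    (hz : z ∈ powSub I ((T.power (koszulComodule H x) n).carrier ⊗[A] Koszul A) j) :
    rowPrim χ T x n z ∈ powSub I (totTerm T (koszulComodule H x) (n, 0)) j := by
  have h := powSub_map (χ.untwist (Koszul A) (T.power (koszulComodule H x) n))
    (Cofree.one_mem_powSub hI hz)
  rw [χ.untwist_one] at h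
  exact h

end Rows

section TightRefilter

variable {A Γ : Type} [CommRing A] [CommRing Γ] [Algebra A Γ] {H : HopfAlgebroid A Γ}
  {χ : Conjugation H} {Agr : ℤ → AddSubgroup A} {Γgr : ℤ → AddSubgroup Γ}
  {x : ℕ → A} {deg : ℕ → ℤ} {I : Ideal A} {T : DGComodule.{u} H} {Tgr : ℤ → AddSubgroup T.carrier}

namespace Setting

variable (h : Setting χ Agr Γgr x deg I T Tgr)
include h

lemma rowContr_mem (n s : ℕ) {J k : ℤ} {z : totTerm T (koszulComodule H x) (n, s + 1)}
    (hz : z ∈ BpowGr H.ηR Γgr (powGr T x Agr Γgr deg Tgr (n + 1) J) (s + 1) k) :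
    rowContr χ T x n s z ∈ BpowGr H.ηR Γgr (powGr T x Agr Γgr deg Tgr (n + 1) J) s k :=
  cobarContr_mem (rowRetr χ T x n) (fun k m hm => χ.retr_mem h.hopf h.conj
    (isGraded_koszulGr h.hopf.amul_mem) (h.pow_ψ_mem n) J k m hm) s hz

lemma rowPrim_mem (n : ℕ) {J k : ℤ} {z}
    (hz : z ∈ tensorGr (powGr T x Agr Γgr deg Tgr n) (koszulGr Agr deg) J k) :
    rowPrim χ T x n z ∈ BpowGr H.ηR Γgr (powGr T x Agr Γgr deg Tgr (n + 1) J) 0 k := by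
  have h1 := χ.untwist_mem (T.power (koszulComodule H x) n) h.hopf h.conj (h.pow_ψ_mem n)
    (one_mem_cofreeGr h.hopf hz)
  rw [χ.untwist_one] at h1
  exact h1

lemma rowProj_mem (n : ℕ) {J k : ℤ} {z : totTerm T (koszulComodule H x) (n, 0)}
    (hz : z ∈ BpowGr H.ηR Γgr (powGr T x Agr Γgr deg Tgr (n + 1) J) 0 k) :
    rowProj T x n z ∈ tensorGr (powGr T x Agr Γgr deg Tgr n) (koszulGr Agr deg) J k :=
  proj_mem h.hopf (isGraded_koszulGr h.hopf.amul_mem) hz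

/-- A cochain of high filtration whose differential lies in a smaller stage of the filtration by rows
can be pushed to a lower row. -/
lemma push_row (hS : ∀ n, AdicAcyclic I (koszulTensorD (T.power (koszulComodule H x) n) x)
      (tensorGr (powGr T x Agr Γgr deg Tgr n) (koszulGr Agr deg)))
    (a : ℕ) {s₀ k m : ℤ} (ha : (a : ℤ) < m) (y : ⨁ q, totTerm T (koszulComodule H x) q)
    (hy : y ∈ totW T (koszulComodule H x) I m)
    (hg : y ∈ (totComplex Γgr T (koszulUnit H x) Tgr (koszulCofreeGr H Agr Γgr deg)).gr s₀ k)
    (hya : ∀ q : ℕ × ℕ, q.1 < a → y q = 0)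
    (hdy : ∀ q : ℕ × ℕ, q.1 ≤ a → totD T (koszulUnit H x) y q = 0) :
    ∃ w : ⨁ q, totTerm T (koszulComodule H x) q,
      w ∈ totW T (koszulComodule H x) I (m - 1) ∧
      w ∈ (totComplex Γgr T (koszulUnit H x) Tgr (koszulCofreeGr H Agr Γgr deg)).gr (s₀ - 1) k ∧
      ∀ q : ℕ × ℕ, q.1 < a + 1 → (y - totD T (koszulUnit H x) w) q = 0 := by
  have hEy : ∀ s, sumMap (fun q : ℕ × ℕ => (q.1 + 1, q.2)) (fun q => totE T (koszulUnit H x) q.1 q.2) y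
      (a, s) = 0 := fun s => by
    cases a with
    | zero => exact sumE_zero T _ y s
    | succ a => rw [sumE_succ, hya (a, s) (by simp), map_zero]
  have hrow : ∀ s, sumMap (fun q : ℕ × ℕ => (q.1, q.2 + 1))
      (fun q => ((-1) ^ q.1 : ℤ) • totC T (koszulComodule H x) q.1 q.2) y (a, s) +
      ((-1) ^ (a + s) : ℤ) • totI T (koszulComodule H x) a s (y (a, s)) = 0 := fun s => by
    have e := hdy (a, s) le_rfl
    rwa [totD_eq, DirectSum.add_apply, DirectSum.add_apply, hEy, zero_add, sumI_apply] at e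
  have hsq : ∀ n : ℕ, ((-1) ^ n * (-1) ^ n : ℤ) = 1 := fun n => by
    rw [← mul_pow]; norm_num
  have hI0 : totI T (koszulComodule H x) a 0 (y (a, 0)) = 0 := by
    have e := hrow 0
    rw [sumC_zero, zero_add] at e
    have e' := congrArg (fun t => ((-1) ^ (a + 0) : ℤ) • t) e
    beta_reduce at e'
    rwa [smul_smul, hsq, one_smul, smul_zero] at e'
  have hIC : ∀ s, ((-1) ^ s : ℤ) • totI T (koszulComodule H x) a (s + 1) (y (a, s + 1)) =
      totC T (koszulComodule H x) a s (y (a, s)) := fun s => by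
    have e := hrow (s + 1)
    rw [sumC_succ] at e
    have e' := congrArg (fun t => ((-1) ^ a : ℤ) • t) e
    beta_reduce at e'
    rw [smul_add, smul_smul, smul_smul, hsq, one_smul, smul_zero, pow_add _ a, ← mul_assoc, hsq,
      one_mul, pow_succ, mul_neg_one, neg_smul] at e'
    exact (sub_eq_zero.1 ((sub_eq_add_neg _ _).trans e')).symm
  obtain ⟨v, hv, hvg, hdv⟩ := hS a (m - a) (by omega) ((a : ℤ) - s₀) k (rowProj T x a (y (a, 0)))
    (powSub_map _ (by
      have := hy (a, 0)
      simpa using this))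
    (h.rowProj_mem a (by
      have := hg (a, 0)
      simpa using this))
    (by rw [← rowProj_totI, hI0, map_zero])
  let w₁ : ⨁ q, totTerm T (koszulComodule H x) q :=
    pull (fun q : ℕ × ℕ => (q.1, q.2 + 1)) (fun a b e => by simpa [Prod.ext_iff] using e)
      (fun q => ((-1) ^ q.1 : ℤ) • (rowContr χ T x q.1 q.2).toAddMonoidHom) y
  have hw₁ : ∀ n s, w₁ (n, s) = ((-1) ^ n : ℤ) • rowContr χ T x n s (y (n, s + 1)) :=
    fun n s => pull_apply _ _ _ _ _
  let w₂ : ⨁ q, totTerm T (koszulComodule H x) q :=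
    DirectSum.of (fun q => totTerm T (koszulComodule H x) q) (a, 0)
      (((-1) ^ a : ℤ) • rowPrim χ T x a v)
  refine ⟨w₁ + w₂, AddSubgroup.add_mem _ ?_ ?_, AddSubgroup.add_mem _ ?_ ?_, ?_⟩
  · rintro ⟨n, s⟩
    rw [hw₁]
    have := hy (n, s + 1)
    have e : m - n - ((s + 1 : ℕ) : ℤ) = m - 1 - n - s := by push_cast; ring
    dsimp only at this
    rw [e] at this
    exact AddSubgroup.zsmul_mem (powSub I (totTerm T (koszulComodule H x) (n, s)) _).toAddSubgroup
      (powSub_map (rowContr χ T x n s) this) _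
  · refine fun q => of_mem (X := fun q => totTerm T (koszulComodule H x) q)
      (fun q => (powSub I (totTerm T (koszulComodule H x) q) (m - 1 - q.1 - q.2)).toAddSubgroup) (a, 0) ?_ q
    refine AddSubgroup.zsmul_mem _ ?_ _
    have := rowPrim_powSub χ h.invariant a hv
    have e : m - a - 1 = m - 1 - a - ((0 : ℕ) : ℤ) := by push_cast; ring
    rw [e] at this
    exact this
  · rintro ⟨n, s⟩
    rw [hw₁]
    have := hg (n, s + 1)
    have e : (n : ℤ) + ((s + 1 : ℕ) : ℤ) - s₀ = n + s - (s₀ - 1) := by push_cast; ring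
    dsimp only at this
    rw [e] at this
    exact AddSubgroup.zsmul_mem _ (h.rowContr_mem n s this) _
  · refine fun q => of_mem (X := fun q => totTerm T (koszulComodule H x) q)
      (fun q => BpowGr H.ηR Γgr (powGr T x Agr Γgr deg Tgr (q.1 + 1) ((q.1 : ℤ) + q.2 - (s₀ - 1))) q.2 k)
      (a, 0) ?_ q
    refine AddSubgroup.zsmul_mem _ ?_ _
    have := h.rowPrim_mem a hvg
    have e : (a : ℤ) - s₀ + 1 = a + ((0 : ℕ) : ℤ) - (s₀ - 1) := by push_cast; ring
    rw [e] at this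
    exact this
  · rintro ⟨n, s⟩ hn
    have hw₁0 : ∀ n' s', n' < a → w₁ (n', s') = 0 := fun n' s' hn' => by
      rw [hw₁, hya (n', s' + 1) hn', map_zero, smul_zero]
    have hw₂0 : ∀ n' s', (n', s') ≠ (a, 0) → w₂ (n', s') = 0 := fun n' s' hn' =>
      DirectSum.of_eq_of_ne _ _ _ hn'
    have hw0 : ∀ n' s', n' < a → (w₁ + w₂) (n', s') = 0 := fun n' s' hn' => by
      rw [DirectSum.add_apply, hw₁0 _ _ hn', hw₂0 _ _ (fun e => hn'.ne (Prod.ext_iff.1 e).1), add_zero]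
    have hEw : ∀ n s, n ≤ a → sumMap (fun q : ℕ × ℕ => (q.1 + 1, q.2))
        (fun q => totE T (koszulUnit H x) q.1 q.2) (w₁ + w₂) (n, s) = 0 := fun n s hn => by
      cases n with
      | zero => exact sumE_zero T _ _ s
      | succ n => rw [sumE_succ, hw0 n s (by omega), map_zero]
    have hDw : totD T (koszulUnit H x) (w₁ + w₂) (n, s) = sumMap (fun q : ℕ × ℕ => (q.1, q.2 + 1))
      (fun q => ((-1) ^ q.1 : ℤ) • totC T (koszulComodule H x) q.1 q.2) (w₁ + w₂) (n, s) +
      ((-1) ^ (n + s) : ℤ) • totI T (koszulComodule H x) n s ((w₁ + w₂) (n, s)) := by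
      rw [totD_eq, DirectSum.add_apply, DirectSum.add_apply, hEw n s (by simpa using Nat.lt_succ_iff.1 hn),
        zero_add, sumI_apply]
    rw [DirectSum.sub_apply, hDw, sub_eq_zero]
    rcases (Nat.lt_succ_iff.1 hn : n ≤ a).lt_or_eq with hn' | rfl
    · rw [hya (n, s) hn', hw0 n s hn', map_zero, smul_zero, add_zero]
      cases s with
      | zero => exact (sumC_zero T _ n).symm
      | succ s => rw [sumC_succ, hw0 n s hn', map_zero, smul_zero]
    · have hIw₁ : ((-1) ^ (n + s) : ℤ) • totI T (koszulComodule H x) n s (w₁ (n, s)) =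
          rowContr χ T x n s (totC T (koszulComodule H x) n s (y (n, s))) := by
        rw [hw₁, map_zsmul, smul_smul, pow_add, mul_right_comm, hsq, one_mul, ← rowContr_totI,
          ← hIC, map_zsmul]
      cases s with
      | zero =>
        have e2 : w₂ (n, 0) = ((-1) ^ n : ℤ) • rowPrim χ T x n v := DirectSum.of_eq_same _ _
        rw [sumC_zero, zero_add, DirectSum.add_apply, map_add, smul_add, hIw₁, rowContr_totC_zero, e2,
          map_zsmul, smul_smul, add_zero, hsq, one_smul, totI_rowPrim, hdv, sub_add_cancel]
      | succ s =>
        have e2 : w₂ (n, s + 1) = 0 := hw₂0 _ _ (by simp)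
        have e3 : totC T (koszulComodule H x) n s (w₂ (n, s)) = 0 := by
          cases s with
          | zero =>
            have e2 : w₂ (n, 0) = ((-1) ^ n : ℤ) • rowPrim χ T x n v := DirectSum.of_eq_same _ _
            rw [e2, map_zsmul, totC_rowPrim, smul_zero]
          | succ s => rw [hw₂0 _ _ (by simp), map_zero]
        rw [sumC_succ, DirectSum.add_apply, DirectSum.add_apply, e2, add_zero, hIw₁, map_add, e3,
          add_zero, hw₁, map_zsmul, smul_smul, hsq, one_smul]
        exact ((add_comm _ _).trans (rowContr_totC χ T x n s _)).symm

/-- The filtration of the total complex by rows and that by the powers of the ideal are tightly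
related if the rows are acyclic. -/
theorem isTight_id (hS : ∀ n, AdicAcyclic I (koszulTensorD (T.power (koszulComodule H x) n) x)
      (tensorGr (powGr T x Agr Γgr deg Tgr n) (koszulGr Agr deg))) :
    FilteredComplex.IsTight (totComplex Γgr T (koszulUnit H x) Tgr (koszulCofreeGr H Agr Γgr deg))
    ((totComplex Γgr T (koszulUnit H x) Tgr (koszulCofreeGr H Agr Γgr deg)).refilter
      (totW T (koszulComodule H x) I) (totW_anti T (koszulComodule H x) I))
    (AddMonoidHom.id _) where
  comm _ := rfl
  gr _ _ _ hy := hy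
  F := fun m s k (y : ⨁ q, totTerm T (koszulComodule H x) q) hy _ => fun q => by
    by_cases hq : (q.1 : ℤ) < m
    · have e : y q = 0 := hy q hq
      have := Submodule.zero_mem (powSub I (totTerm T (koszulComodule H x) q) (m - q.1 - q.2))
      rw [← e] at this
      exact this
    · exact powSub_of_nonpos (by omega) _
  bound := fun m s k (y : ⨁ q, totTerm T (koszulComodule H x) q)
      (c : ⨁ q, totTerm T (koszulComodule H x) q) hy hg hc hcg hdc hyc => by
    have key : ∀ a : ℕ, a ≤ m.toNat → ∃ w : ⨁ q, totTerm T (koszulComodule H x) q,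
        w ∈ totW T (koszulComodule H x) I (m - 1) ∧
        w ∈ (totComplex Γgr T (koszulUnit H x) Tgr (koszulCofreeGr H Agr Γgr deg)).gr (s - 1) k ∧
        ∀ q : ℕ × ℕ, q.1 < a → (y - totD T (koszulUnit H x) w) q = 0 := by
      intro a
      induction a with
      | zero =>
        exact fun _ => ⟨0, AddSubgroup.zero_mem _, AddSubgroup.zero_mem _, fun q hq => absurd hq (by omega)⟩
      | succ a ih =>
        intro ha
        obtain ⟨w, hw, hwg, hwa⟩ := ih (by omega)
        obtain ⟨h1, h2⟩ := h.sub_totD_mem hy hg hw hwg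
        obtain ⟨w', hw', hwg', hwa'⟩ := h.push_row hS a (by omega) _ h1 h2 hwa (fun q hq => by
          rw [map_sub, totD_totD, sub_zero]
          have e : totD T (koszulUnit H x) y = c := hyc
          rw [e]
          exact hc q (by omega))
        refine ⟨w + w', AddSubgroup.add_mem _ hw hw', AddSubgroup.add_mem _ hwg hwg', fun q hq => ?_⟩
        rw [map_add, ← sub_sub]
        exact hwa' q hq
    obtain ⟨w, hw, hwg, hwa⟩ := key m.toNat le_rfl
    obtain ⟨h1, h2⟩ := h.sub_totD_mem hy hg hw hwg
    refine ⟨y - totD T (koszulUnit H x) w, w, fun q hq => hwa q (by omega), h2, hw, hwg, ?_, ?_⟩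
    · change totD T (koszulUnit H x) (y - totD T (koszulUnit H x) w) = c
      rw [map_sub, totD_totD, sub_zero]
      exact hyc
    · change y = y - totD T (koszulUnit H x) w + totD T (koszulUnit H x) w
      rw [sub_add_cancel]

end Setting

end TightRefilter

section KoszulInduction

variable {A : Type} [CommRing A]

/-- Multiplication by a generator of the Koszul complex. -/
def koszulMul (A : Type) [CommRing A] (i : ℕ) : Koszul A →ₗ[A] Koszul A :=
  LinearMap.mulLeft A (ExteriorAlgebra.ι A (Finsupp.single i (1 : A)))

lemma koszulMul_apply (i : ℕ) (z : Koszul A) :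
    koszulMul A i z = ExteriorAlgebra.ι A (Finsupp.single i (1 : A)) * z := rfl

lemma koszulMul_prod (i : ℕ) (l : List ℕ) : koszulMul A i (koszulProd A l) = koszulProd A (i :: l) :=
  (koszulProd_cons i l).symm

/-- The derivative with respect to a generator of the Koszul complex. -/
def koszulDer (A : Type) [CommRing A] (i : ℕ) : Koszul A →ₗ[A] Koszul A :=
  koszulD (Pi.single i 1)

lemma koszulDer_mul (i j : ℕ) (z : Koszul A) : koszulDer A i (koszulMul A j z) =
    (Pi.single i 1 : ℕ → A) j • z - koszulMul A j (koszulDer A i z) := koszulD_cons j z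

lemma koszulDer_mul_same (i : ℕ) (z : Koszul A) : koszulDer A i (koszulMul A i z) =
    z - koszulMul A i (koszulDer A i z) := by
  rw [koszulDer_mul, Pi.single_eq_same, one_smul]

lemma koszulDer_mul_ne {i j : ℕ} (h : j ≠ i) (z : Koszul A) : koszulDer A i (koszulMul A j z) =
    - koszulMul A j (koszulDer A i z) := by
  rw [koszulDer_mul, Pi.single_eq_of_ne h, zero_smul, zero_sub]

lemma koszulDer_one (i : ℕ) : koszulDer A i 1 = 0 :=
  CliffordAlgebra.contractLeft_one (Q := (0 : QuadraticForm A (ℕ →₀ A))) _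

lemma koszulMul_mul (i : ℕ) (z : Koszul A) : koszulMul A i (koszulMul A i z) = 0 := by
  rw [koszulMul_apply, koszulMul_apply, ← mul_assoc, ExteriorAlgebra.ι_sq_zero, zero_mul]

lemma koszulMul_comm (i j : ℕ) (z : Koszul A) :
    koszulMul A i (koszulMul A j z) = -koszulMul A j (koszulMul A i z) := by
  rw [koszulMul_apply, koszulMul_apply, koszulMul_apply, koszulMul_apply, ← mul_assoc, ← mul_assoc,
    ← neg_mul]
  congr 1
  exact eq_neg_of_add_eq_zero_left (ExteriorAlgebra.ι_add_mul_swap _ _)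

lemma koszulD_mul (x : ℕ → A) (i : ℕ) (z : Koszul A) :
    koszulD x (koszulMul A i z) = x i • z - koszulMul A i (koszulD x z) := koszulD_cons i z

lemma koszulD_der (x : ℕ → A) (i : ℕ) (z : Koszul A) :
    koszulD x (koszulDer A i z) = -koszulDer A i (koszulD x z) :=
  CliffordAlgebra.contractLeft_comm _ _ z

lemma koszulProd_span : Submodule.span A (Set.range (koszulProd A)) = ⊤ := by
  rw [eq_top_iff]
  rintro z -
  induction z using CliffordAlgebra.left_induction with
  | algebraMap r =>
    rw [Algebra.algebraMap_eq_smul_one]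
    exact Submodule.smul_mem _ _ (Submodule.subset_span ⟨[], rfl⟩)
  | add y z hy hz => exact Submodule.add_mem _ hy hz
  | ι_mul y v hy =>
    have h1 : ∀ i, koszulMul A i y ∈ Submodule.span A (Set.range (koszulProd A)) := fun i => by
      refine Submodule.span_induction (p := fun y _ => koszulMul A i y ∈
        Submodule.span A (Set.range (koszulProd A))) ?_ ?_ ?_ ?_ hy
      · rintro _ ⟨l, rfl⟩
        rw [koszulMul_prod]
        exact Submodule.subset_span ⟨_, rfl⟩
      · rw [map_zero]; exact Submodule.zero_mem _
      · intro y z _ _ hy hz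
        rw [map_add]; exact Submodule.add_mem _ hy hz
      · intro a y _ hy
        rw [map_smul]; exact Submodule.smul_mem _ _ hy
    induction v using Finsupp.induction_linear with
    | zero => rw [map_zero, zero_mul]; exact Submodule.zero_mem _
    | add v w hv hw => rw [map_add, add_mul]; exact Submodule.add_mem _ hv hw
    | single i a =>
      have e : (Finsupp.single i a : ℕ →₀ A) = a • Finsupp.single i 1 := by simp
      rw [e, map_smul, smul_mul_assoc]
      exact Submodule.smul_mem _ _ (h1 i)

/-- The Koszul complex on the first `n` generators. -/
def koszulSub (A : Type) [CommRing A] (n : ℕ) : Submodule A (Koszul A) :=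
  Submodule.span A {z | ∃ l : List ℕ, (∀ i ∈ l, i < n) ∧ koszulProd A l = z}

lemma koszulSub_mono : Monotone (koszulSub A) := fun _ _ hnm =>
  Submodule.span_mono fun _ ⟨l, hl, e⟩ => ⟨l, fun i hi => (hl i hi).trans_le hnm, e⟩

lemma koszulMul_mem_sub {n i : ℕ} (hi : i < n) {z : Koszul A} (hz : z ∈ koszulSub A n) :
    koszulMul A i z ∈ koszulSub A n := by
  have : koszulSub A n ≤ (koszulSub A n).comap (koszulMul A i) := by
    refine Submodule.span_le.2 ?_
    rintro _ ⟨l, hl, rfl⟩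
    refine Submodule.subset_span ⟨i :: l, ?_, (koszulMul_prod i l).symm⟩
    intro j hj
    rcases List.mem_cons.1 hj with rfl | hj
    · exact hi
    · exact hl j hj
  exact this hz

lemma koszulDer_mem_sub {n : ℕ} {z : Koszul A} (hz : z ∈ koszulSub A (n + 1)) :
    koszulDer A n z ∈ koszulSub A n ∧ z - koszulMul A n (koszulDer A n z) ∈ koszulSub A n := by
  let f : Koszul A →ₗ[A] Koszul A := LinearMap.id - koszulMul A n ∘ₗ koszulDer A n
  have : koszulSub A (n + 1) ≤ (koszulSub A n).comap (koszulDer A n) ⊓ (koszulSub A n).comap f := by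
    refine Submodule.span_le.2 ?_
    rintro _ ⟨l, hl, rfl⟩
    change koszulDer A n (koszulProd A l) ∈ koszulSub A n ∧
      koszulProd A l - koszulMul A n (koszulDer A n (koszulProd A l)) ∈ koszulSub A n
    induction l with
    | nil =>
      rw [koszulProd_nil, koszulDer_one, map_zero, sub_zero]
      exact ⟨Submodule.zero_mem _, Submodule.subset_span ⟨[], by simp, rfl⟩⟩
    | cons i l ih =>
      obtain ⟨h1, h2⟩ := ih (fun j hj => hl j (List.mem_cons_of_mem _ hj))
      rw [← koszulMul_prod]
      by_cases hi : i = n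
      · subst hi
        rw [koszulDer_mul_same, map_sub, koszulMul_mul, sub_zero, sub_self]
        exact ⟨h2, Submodule.zero_mem _⟩
      · have hi' : i < n := by have := hl i List.mem_cons_self; omega
        rw [koszulDer_mul_ne hi, map_neg, koszulMul_comm n i, neg_neg, ← map_sub]
        exact ⟨Submodule.neg_mem _ (koszulMul_mem_sub hi' h1), koszulMul_mem_sub hi' h2⟩
  exact this hz

lemma exists_mem_koszulSub (z : Koszul A) : ∃ n, z ∈ koszulSub A n := by
  have hz : z ∈ Submodule.span A (Set.range (koszulProd A)) := by rw [koszulProd_span]; trivial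
  refine Submodule.span_induction (p := fun z _ => ∃ n, z ∈ koszulSub A n) ?_ ?_ ?_ ?_ hz
  · rintro _ ⟨l, rfl⟩
    refine ⟨l.sum + 1, Submodule.subset_span ⟨l, fun i hi => ?_, rfl⟩⟩
    exact Nat.lt_succ_of_le (List.single_le_sum (by simp) i hi)
  · exact ⟨0, Submodule.zero_mem _⟩
  · rintro y z _ _ ⟨n, hn⟩ ⟨m, hm⟩
    exact ⟨max n m, Submodule.add_mem _ (koszulSub_mono (le_max_left _ _) hn)
      (koszulSub_mono (le_max_right _ _) hm)⟩
  · rintro a z _ ⟨n, hn⟩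
    exact ⟨n, Submodule.smul_mem _ _ hn⟩

variable {N : Type u} [AddCommGroup N] [Module A N]

/-- The image of `N ⊗ V` in `N ⊗ K`. -/
def tensorSub (N : Type u) [AddCommGroup N] [Module A N] (V : Submodule A (Koszul A)) :
    AddSubgroup (N ⊗[A] Koszul A) :=
  AddSubgroup.closure {z | ∃ n, ∃ κ ∈ V, n ⊗ₜ[A] κ = z}

lemma tmul_mem_tensorSub {V : Submodule A (Koszul A)} (n : N) {κ : Koszul A} (hκ : κ ∈ V) :
    n ⊗ₜ[A] κ ∈ tensorSub N V := AddSubgroup.subset_closure ⟨n, κ, hκ, rfl⟩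

lemma map_mem_of_tensorSub {V : Submodule A (Koszul A)} {P : Type*} [AddCommGroup P]
    (f : N ⊗[A] Koszul A →+ P) (S : AddSubgroup P) (h : ∀ n, ∀ κ ∈ V, f (n ⊗ₜ κ) ∈ S) {z}
    (hz : z ∈ tensorSub N V) : f z ∈ S := by
  have : tensorSub N V ≤ S.comap f := by
    refine (AddSubgroup.closure_le _).2 ?_
    rintro _ ⟨n, κ, hκ, rfl⟩
    exact h n κ hκ
  exact this hz

lemma exists_mem_tensorSub (z : N ⊗[A] Koszul A) : ∃ n, z ∈ tensorSub N (koszulSub A n) := by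
  have mono : ∀ {n m : ℕ}, n ≤ m → tensorSub N (koszulSub A n) ≤ tensorSub N (koszulSub A m) :=
    fun h => AddSubgroup.closure_mono fun _ ⟨y, κ, hκ, e⟩ => ⟨y, κ, koszulSub_mono h hκ, e⟩
  induction z using TensorProduct.induction_on with
  | zero => exact ⟨0, AddSubgroup.zero_mem _⟩
  | add y z hy hz =>
    obtain ⟨n, hn⟩ := hy
    obtain ⟨m, hm⟩ := hz
    exact ⟨max n m, AddSubgroup.add_mem _ (mono (le_max_left _ _) hn) (mono (le_max_right _ _) hm)⟩
  | tmul y κ =>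
    obtain ⟨n, hn⟩ := exists_mem_koszulSub κ
    exact ⟨n, tmul_mem_tensorSub y hn⟩

/-- The projection of `N ⊗ K` to chain degree `0` of `K`. -/
def tensorAug (N : Type u) [AddCommGroup N] [Module A N] : N ⊗[A] Koszul A →ₗ[A] N :=
  (TensorProduct.rid A N).toLinearMap ∘ₗ TensorProduct.map LinearMap.id (koszulAug A)

lemma tensorAug_tmul (n : N) (κ : Koszul A) : tensorAug N (n ⊗ₜ κ) = koszulAug A κ • n :=
  TensorProduct.rid_tmul _ _

lemma eq_tensorAug {z : N ⊗[A] Koszul A} (hz : z ∈ tensorSub N (koszulSub A 0)) :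
    z = tensorAug N z ⊗ₜ 1 := by
  let f : N ⊗[A] Koszul A →+ N ⊗[A] Koszul A := AddMonoidHom.id _ -
    ((TensorProduct.mk A N (Koszul A)).flip 1 ∘ₗ tensorAug N).toAddMonoidHom
  have : f z ∈ (⊥ : AddSubgroup (N ⊗[A] Koszul A)) := by
    refine map_mem_of_tensorSub f ⊥ (fun n κ hκ => ?_) hz
    obtain ⟨a, rfl⟩ : ∃ a : A, κ = a • 1 := by
      refine Submodule.span_induction (p := fun κ _ => ∃ a : A, κ = a • 1) ?_ ?_ ?_ ?_ hκ
      · rintro _ ⟨l, hl, rfl⟩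
        cases l with
        | nil => exact ⟨1, (one_smul _ _).symm⟩
        | cons i l => exact absurd (hl i List.mem_cons_self) (by omega)
      · exact ⟨0, (zero_smul _ _).symm⟩
      · rintro _ _ _ _ ⟨a, rfl⟩ ⟨b, rfl⟩
        exact ⟨a + b, (add_smul _ _ _).symm⟩
      · rintro c _ _ ⟨a, rfl⟩
        exact ⟨c * a, (mul_smul _ _ _).symm⟩
    change n ⊗ₜ[A] (a • (1 : Koszul A)) - tensorAug N (n ⊗ₜ (a • 1)) ⊗ₜ[A] 1 = 0
    rw [tensorAug_tmul, map_smul, koszulAug_one, smul_eq_mul, mul_one, TensorProduct.smul_tmul, sub_self]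
  exact sub_eq_zero.1 this

lemma tensorAug_mem {Agr : ℤ → AddSubgroup A} {deg : ℕ → ℤ} {Ngr : ℤ → ℤ → AddSubgroup N}
    (hN : ∀ J, IsGraded Agr (Ngr J)) {J k : ℤ} {z : N ⊗[A] Koszul A}
    (hz : z ∈ tensorGr Ngr (koszulGr Agr deg) J k) : tensorAug N z ∈ Ngr J k := by
  refine map_mem_of_tensorGr (tensorAug N).toAddMonoidHom _ (fun i j a b n κ hn hκ h1 h2 => ?_) hz
  change tensorAug N (n ⊗ₜ κ) ∈ _
  rw [tensorAug_tmul]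
  rcases concGr_cases (koszulAug_mem hκ) with ⟨rfl, h⟩ | h
  · have := hN i b a _ _ h hn
    rwa [← h1, ← h2, add_zero, add_comm a]
  · rw [h, zero_smul]
    exact AddSubgroup.zero_mem _

end KoszulInduction

section TensorKoszul

variable {A Γ : Type} [CommRing A] [CommRing Γ] [Algebra A Γ] {H : HopfAlgebroid A Γ}
  {T : DGComodule.{u} H} {x : ℕ → A}

lemma koszulDer_mem {Agr : ℤ → AddSubgroup A} {deg : ℕ → ℤ} (n : ℕ) {j k j' k' : ℤ} {z : Koszul A} (hz : z ∈ koszulGr Agr deg j k)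
    (hj : j' + 1 = j) (hk : k' + deg n = k) : koszulDer A n z ∈ koszulGr Agr deg j' k' := by
  refine map_mem_of_koszulGr (koszulDer A n).toAddMonoidHom _ (fun c a l ha hl hk => ?_) hz
  change koszulDer A n (a • koszulProd A l) ∈ _
  subst hk
  clear hz
  induction l generalizing c a j k' j' with
  | nil =>
    rw [map_smul, koszulProd_nil, koszulDer_one, smul_zero]
    exact AddSubgroup.zero_mem _
  | cons i l ih =>
    rw [List.length_cons] at hl
    rename_i hk
    rw [List.map_cons, List.sum_cons] at hk
    push_cast at hl
    rw [map_smul, ← koszulMul_prod, koszulDer_mul, smul_sub, ← map_smul (koszulMul A i), ← map_smul (koszulDer A n)]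
    refine AddSubgroup.sub_mem _ ?_ (ι_mul_mem i (ih (j' := j' - 1) (k' := k' - deg i) (j := j - 1)
      (by omega) c a ha (by omega) (by omega)) (by omega) (by omega))
    by_cases hi : i = n
    · subst hi
      rw [Pi.single_eq_same, one_smul]
      exact smul_koszulProd_mem ha (by omega) (by omega)
    · rw [Pi.single_eq_of_ne hi, zero_smul, smul_zero]
      exact AddSubgroup.zero_mem _

/-- If homogeneous cycles of `T` bound with a loss of one power of the ideal and multiplication by
each `x n` is null-homotopic on `T`, then homogeneous cycles of the Koszul complex of `T` bound with a
loss of one power of the ideal. -/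
theorem AdicAcyclic.tensorKoszul {I : Ideal A} {Agr : ℤ → AddSubgroup A} {deg : ℕ → ℤ}
    {Tgr : ℤ → ℤ → AddSubgroup T.carrier} (hT : AdicAcyclic I T.d Tgr)
    (h1 : (1 : A) ∈ Agr 0) (hTgr : ∀ J, IsGraded Agr (Tgr J)) (hinv : ∀ J k m, m ∈ Tgr J k → T.inv m ∈ Tgr J k)
    (E : ℕ → T.carrier →ₗ[A] T.carrier) (hE : ∀ n m, T.d (E n m) + E n (T.d m) = x n • m)
    (hEinv : ∀ n m, T.inv (E n m) = -E n (T.inv m))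
    (hEgr : ∀ n J k m, m ∈ Tgr J k → E n m ∈ Tgr (J + 1) (k + deg n)) :
    AdicAcyclic I (koszulTensorD T x) (tensorGr Tgr (koszulGr Agr deg)) := by
  have main : ∀ n : ℕ, ∀ j : ℤ, 1 ≤ j → ∀ J k u, u ∈ powSub I (T.carrier ⊗[A] Koszul A) j →
      u ∈ tensorGr Tgr (koszulGr Agr deg) J k → koszulTensorD T x u = 0 →
      u ∈ tensorSub T.carrier (koszulSub A n) →
      ∃ v ∈ powSub I (T.carrier ⊗[A] Koszul A) (j - 1),
        v ∈ tensorGr Tgr (koszulGr Agr deg) (J + 1) k ∧ koszulTensorD T x v = u := by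
    intro n
    induction n with
    | zero =>
      intro j hj J k u hu hg hd hs
      have e := eq_tensorAug hs
      set m := tensorAug T.carrier u with hm
      have hD1 : ∀ m : T.carrier, koszulTensorD T x (m ⊗ₜ 1) = T.d m ⊗ₜ 1 := fun m => by
        have : koszulD x 1 = 0 :=
          CliffordAlgebra.contractLeft_one (Q := (0 : QuadraticForm A (ℕ →₀ A))) _
        change T.d m ⊗ₜ[A] 1 + T.inv m ⊗ₜ[A] koszulD x 1 = _
        rw [this, TensorProduct.tmul_zero, add_zero]
      have hdm : T.d m = 0 := by
        have := congrArg (tensorAug T.carrier) hd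
        rwa [e, hD1, tensorAug_tmul, koszulAug_one, one_smul, map_zero] at this
      obtain ⟨v, hv, hvg, hdv⟩ := hT j hj J k m (powSub_map _ hu) (tensorAug_mem hTgr hg) hdm
      refine ⟨v ⊗ₜ 1, powSub_map ((TensorProduct.mk A _ (Koszul A)).flip 1) hv,
        tmul_mem_tensorGr hvg (one_mem_koszulGr h1) (add_zero _) (add_zero _), ?_⟩
      rw [hD1, hdv, ← e]
    | succ n ih =>
      intro j hj J k u hu hg hd hs
      let D := koszulTensorD T x
      let P : T.carrier ⊗[A] Koszul A →ₗ[A] T.carrier ⊗[A] Koszul A :=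
        TensorProduct.map T.inv (koszulDer A n)
      let Q : T.carrier ⊗[A] Koszul A →ₗ[A] T.carrier ⊗[A] Koszul A :=
        TensorProduct.map T.inv (koszulMul A n)
      let F : T.carrier ⊗[A] Koszul A →ₗ[A] T.carrier ⊗[A] Koszul A :=
        TensorProduct.map (E n) LinearMap.id
      have hii : ∀ m, T.inv (T.inv m) = m := fun m => LinearMap.congr_fun T.inv_inv m
      have hid : ∀ m, T.inv (T.d m) = -T.d (T.inv m) := fun m => LinearMap.congr_fun T.inv_d m
      have hDP : ∀ z, D (P z) = -P (D z) := fun z => by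
        induction z using TensorProduct.induction_on with
        | zero => simp only [map_zero, neg_zero]
        | add y z hy hz => simp only [map_add, hy, hz, neg_add]
        | tmul m κ =>
          change T.d (T.inv m) ⊗ₜ[A] koszulDer A n κ + T.inv (T.inv m) ⊗ₜ[A] koszulD x (koszulDer A n κ) =
            -P (T.d m ⊗ₜ[A] κ + T.inv m ⊗ₜ[A] koszulD x κ)
          rw [map_add]
          change _ = -(T.inv (T.d m) ⊗ₜ[A] koszulDer A n κ + T.inv (T.inv m) ⊗ₜ[A] koszulDer A n (koszulD x κ))
          rw [hid, koszulD_der, TensorProduct.neg_tmul, TensorProduct.tmul_neg]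
          abel
      have hDQ : ∀ z, D (Q z) + Q (D z) = x n • z := fun z => by
        induction z using TensorProduct.induction_on with
        | zero => simp only [map_zero, smul_zero, add_zero]
        | add y z hy hz =>
          simp only [map_add, smul_add, ← hy, ← hz]; abel
        | tmul m κ =>
          change T.d (T.inv m) ⊗ₜ[A] koszulMul A n κ + T.inv (T.inv m) ⊗ₜ[A] koszulD x (koszulMul A n κ) +
            Q (T.d m ⊗ₜ[A] κ + T.inv m ⊗ₜ[A] koszulD x κ) = _
          rw [map_add]
          change _ + (T.inv (T.d m) ⊗ₜ[A] koszulMul A n κ + T.inv (T.inv m) ⊗ₜ[A] koszulMul A n (koszulD x κ)) = _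
          rw [hid, koszulD_mul, TensorProduct.neg_tmul, TensorProduct.tmul_sub, hii, TensorProduct.tmul_smul]
          abel
      have hDF : ∀ z, D (F z) + F (D z) = x n • z := fun z => by
        induction z using TensorProduct.induction_on with
        | zero => simp only [map_zero, smul_zero, add_zero]
        | add y z hy hz =>
          simp only [map_add, smul_add, ← hy, ← hz]; abel
        | tmul m κ =>
          change T.d (E n m) ⊗ₜ[A] κ + T.inv (E n m) ⊗ₜ[A] koszulD x κ +
            F (T.d m ⊗ₜ[A] κ + T.inv m ⊗ₜ[A] koszulD x κ) = _
          rw [map_add]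
          change _ + (E n (T.d m) ⊗ₜ[A] κ + E n (T.inv m) ⊗ₜ[A] koszulD x κ) = _
          rw [hEinv, TensorProduct.neg_tmul, TensorProduct.smul_tmul', ← hE, TensorProduct.add_tmul]
          abel
      have hP : P u ∈ tensorSub T.carrier (koszulSub A n) :=
        map_mem_of_tensorSub P.toAddMonoidHom _ (fun m κ hκ =>
          tmul_mem_tensorSub (T.inv m) (koszulDer_mem_sub hκ).1) hs
      have hQ : u - Q (P u) ∈ tensorSub T.carrier (koszulSub A n) :=
        map_mem_of_tensorSub (LinearMap.id - Q ∘ₗ P).toAddMonoidHom _ (fun m κ hκ => by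
          have := tmul_mem_tensorSub m (koszulDer_mem_sub hκ).2
          rw [TensorProduct.tmul_sub] at this
          change m ⊗ₜ[A] κ - T.inv (T.inv m) ⊗ₜ[A] koszulMul A n (koszulDer A n κ) ∈ _
          rwa [hii]) hs
      have hF : F (P u) ∈ tensorSub T.carrier (koszulSub A n) :=
        map_mem_of_tensorSub F.toAddMonoidHom _ (fun m κ hκ => tmul_mem_tensorSub (E n m) hκ) hP
      have hPg : P u ∈ tensorGr Tgr (koszulGr Agr deg) (J - 1) (k - deg n) :=
        tensorMap_mem T.inv (koszulDer A n) 0 (-1) 0 (-deg n)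
          (fun J k m hm => by simpa using hinv J k m hm)
          (fun J k κ hκ => koszulDer_mem n hκ (by ring) (by ring)) hg (by ring) (by ring)
      have hQg : ∀ J k z, z ∈ tensorGr Tgr (koszulGr Agr deg) J k →
          Q z ∈ tensorGr Tgr (koszulGr Agr deg) (J + 1) (k + deg n) := fun J k z hz =>
        tensorMap_mem T.inv (koszulMul A n) 0 1 0 (deg n)
          (fun J k m hm => by simpa using hinv J k m hm)
          (fun J k κ hκ => ι_mul_mem n hκ rfl rfl) hz (by ring) (by ring)
      have hFg : ∀ J k z, z ∈ tensorGr Tgr (koszulGr Agr deg) J k →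
          F z ∈ tensorGr Tgr (koszulGr Agr deg) (J + 1) (k + deg n) := fun J k z hz =>
        tensorMap_mem (E n) LinearMap.id 1 0 (deg n) 0 (fun J k m hm => hEgr n J k m hm)
          (fun J k κ hκ => by simpa using hκ) hz (by ring) (by ring)
      have hdP : D (P u) = 0 := by
        have hd' : D u = 0 := hd
        rw [hDP, hd', map_zero, neg_zero]
      obtain ⟨v', hv', hvg', hdv'⟩ := ih j hj _ _ (P u) (powSub_map P hu) hPg hdP hP
      have hQg' := hQg _ _ _ hPg
      have hFg' := hFg _ _ _ hPg
      rw [sub_add_cancel, sub_add_cancel] at hQg' hFg'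
      obtain ⟨w, hw, hwg, hdw⟩ := ih j hj J k (u - Q (P u) + F (P u))
        (Submodule.add_mem _ (Submodule.sub_mem _ hu (powSub_map Q (powSub_map P hu)))
          (powSub_map F (powSub_map P hu)))
        (AddSubgroup.add_mem _ (AddSubgroup.sub_mem _ hg hQg') hFg') (by
          have e1 := hDQ (P u)
          have e2 := hDF (P u)
          have hd' : D u = 0 := hd
          rw [hdP, map_zero, add_zero] at e1 e2
          change D _ = 0
          rw [map_add, map_sub, e1, e2, hd', zero_sub, neg_add_cancel])
        (AddSubgroup.add_mem _ hQ hF)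
      have hdv'' : D v' = P u := hdv'
      have hdw' : D w = u - Q (P u) + F (P u) := hdw
      have e1 := hDQ v'
      have e2 := hDF v'
      rw [hdv''] at e1 e2
      rw [sub_add_cancel] at hvg'
      have hg1 := hQg _ _ _ hvg'
      have hg2 := hFg _ _ _ hvg'
      rw [sub_add_cancel] at hg1 hg2
      refine ⟨w + F v' - Q v', Submodule.sub_mem _ (Submodule.add_mem _ hw (powSub_map F hv'))
        (powSub_map Q hv'), AddSubgroup.sub_mem _ (AddSubgroup.add_mem _ hwg hg2) hg1, ?_⟩
      change D (w + F v' - Q v') = u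
      rw [map_sub, map_add, hdw', eq_sub_of_add_eq e1, eq_sub_of_add_eq e2]
      abel
  intro j hj J k u hu hg hd
  obtain ⟨n, hn⟩ := exists_mem_tensorSub u
  exact main n j hj J k u hu hg hd hn

end TensorKoszul

section CofreeAcyclic

variable {A Γ : Type} [CommRing A] [CommRing Γ] [Algebra A Γ] {H : HopfAlgebroid A Γ}

/-- A homogeneous basis of `Γ` as a left module. -/
structure HomogeneousBasis (Agr : ℤ → AddSubgroup A) (Γgr : ℤ → AddSubgroup Γ) where
  ι : Type
  basis : Module.Basis ι A Γ
  wt : ι → ℤ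
  basis_mem : ∀ i, basis i ∈ Γgr (wt i)
  repr_mem : ∀ k γ, γ ∈ Γgr k → ∀ i, basis.repr γ i ∈ Agr (k - wt i)

variable {Agr : ℤ → AddSubgroup A} {Γgr : ℤ → AddSubgroup Γ} (B : HomogeneousBasis Agr Γgr)
  {η : A →+* Γ} {N : Type u} [AddCommGroup N] [Module A N] {I : Ideal A}

namespace HomogeneousBasis

open Classical in
/-- The coordinates of an element of a cofree comodule. -/
def coord (η : A →+* Γ) (N : Type u) [AddCommGroup N] [Module A N] : Cofree η N →+ (B.ι →₀ N) :=
  (TensorProduct.equivFinsuppOfBasisLeft B.basis (N := N)).toLinearMap.toAddMonoidHom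

lemma coord_mk (γ : Γ) (n : N) (i : B.ι) :
    B.coord η N (Cofree.mk η γ n) i = B.basis.repr γ i • n := by
  classical
  exact TensorProduct.equivFinsuppOfBasisLeft_apply_tmul_apply _ _ _ _

lemma sum_coord (z : Cofree η N) :
    ((B.coord η N z).sum fun i n => Cofree.mk η (B.basis i) n) = z := by
  classical
  have e := (TensorProduct.equivFinsuppOfBasisLeft B.basis (N := N)).symm_apply_apply z
  rwa [TensorProduct.equivFinsuppOfBasisLeft_symm_apply] at e

lemma coord_map {N' : Type u} [AddCommGroup N'] [Module A N'] (f : N →ₗ[A] N') (z : Cofree η N)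
    (i : B.ι) : B.coord η N' (Cofree.map η f z) i = f (B.coord η N z i) := by
  induction z using Cofree.induction with
  | h0 => simp only [map_zero, Finsupp.zero_apply]
  | hadd x y hx hy => simp only [map_add, Finsupp.add_apply, hx, hy]
  | hmk γ n => rw [Cofree.map_mk, coord_mk, coord_mk, map_smul]

lemma coord_mem_powSub (hI : IsInvariant η I) {j : ℤ} {z : Cofree η N}
    (hz : z ∈ powSub I (Cofree η N) j) (i : B.ι) : B.coord η N z i ∈ powSub I N j := by
  refine Cofree.map_mem_of_powSub' hI ((Finsupp.applyAddHom i).comp (B.coord η N))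
    (powSub I N j).toAddSubgroup (fun γ n hn => ?_) hz
  change B.coord η N (Cofree.mk η γ n) i ∈ powSub I N j
  rw [coord_mk]
  exact Submodule.smul_mem _ _ hn

lemma coord_mem {Ngr : ℤ → AddSubgroup N} (hN : IsGraded Agr Ngr) {k : ℤ} {z : Cofree η N}
    (hz : z ∈ cofreeGr η Γgr Ngr k) (i : B.ι) : B.coord η N z i ∈ Ngr (k - B.wt i) := by
  refine map_mem_of_cofreeGr ((Finsupp.applyAddHom i).comp (B.coord η N)) _
    (fun a b γ n hγ hn h => ?_) hz
  change B.coord η N (Cofree.mk η γ n) i ∈ _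
  rw [coord_mk]
  have := hN _ _ _ _ (B.repr_mem _ _ hγ i) hn
  rwa [show a - B.wt i + b = k - B.wt i by omega] at this

end HomogeneousBasis

include B in
/-- Acyclicity passes to cofree comodules. -/
theorem AdicAcyclic.cofree (hI : IsInvariant η I) {d : N →ₗ[A] N} {Ngr : ℤ → ℤ → AddSubgroup N}
    (hN : ∀ J, IsGraded Agr (Ngr J)) (hd : AdicAcyclic I d Ngr) :
    AdicAcyclic I (Cofree.map η d) fun J => cofreeGr η Γgr (Ngr J) := by
  intro j hj J k u hu hg hdu
  have key : ∀ i, ∃ v ∈ powSub I N (j - 1), v ∈ Ngr (J + 1) (k - B.wt i) ∧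
      d v = B.coord η N u i := fun i =>
    hd j hj J _ _ (B.coord_mem_powSub hI hu i) (B.coord_mem (hN J) hg i) (by
      rw [← B.coord_map, hdu, map_zero, Finsupp.zero_apply])
  choose v hv hvg hdv using key
  refine ⟨(B.coord η N u).sum fun i _ => Cofree.mk η (B.basis i) (v i), ?_, ?_, ?_⟩
  · exact Submodule.sum_mem _ fun i _ => Cofree.mk_mem_powSub hI _ (hv i)
  · exact AddSubgroup.sum_mem _ fun i _ => mk_mem_cofreeGr (B.basis_mem i) (hvg i) (by omega)
  · rw [Finsupp.sum, map_sum]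
    refine Eq.trans (Finset.sum_congr rfl fun i _ => ?_) (B.sum_coord u)
    rw [Cofree.map_mk, hdv]

include B in
/-- Acyclicity of `T ⊗ K` implies that of `T ⊗ (K ⊗ Γ)`. -/
theorem AdicAcyclic.tensorCofree {χ : Conjugation H} (hH : HopfGrading H Agr Γgr)
    (hc : ∀ k y, y ∈ Γgr k → χ.c y ∈ Γgr k) (hI : IsInvariant H.ηR I) {T : DGComodule.{u} H}
    {x : ℕ → A} {deg : ℕ → ℤ} {Tgr : ℤ → ℤ → AddSubgroup T.carrier}
    (hTgr : ∀ J, IsGraded Agr (Tgr J))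
    (hψ : ∀ J k m, m ∈ Tgr J k → T.ψ m ∈ cofreeGr H.ηR Γgr (Tgr J) k)
    (hT : AdicAcyclic I (koszulTensorD T x) (tensorGr Tgr (koszulGr Agr deg))) :
    AdicAcyclic I (T.tensor (koszulComodule H x)).d (tensorGr Tgr (koszulCofreeGr H Agr Γgr deg)) := by
  intro j hj J k u hu hg hdu
  let p := Conjugation.proj H T.carrier (Koszul A)
  let ψ := (T.tensor (koszulComodule H x)).ψ
  have hD : Cofree.map H.ηR (koszulTensorD T x) (Cofree.map H.ηR p (ψ u)) = 0 := by
    have e1 : ∀ {M M' : Type u} [AddCommGroup M] [AddCommGroup M'] [Module A M] [Module A M']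
        (f : M →ₗ[A] M) (g : M' →ₗ[A] M') (p : M →ₗ[A] M'), (∀ z, p (f z) = g (p z)) → ∀ z,
        Cofree.map H.ηR g (Cofree.map H.ηR p z) = Cofree.map H.ηR p (Cofree.map H.ηR f z) := by
      intro M M' _ _ _ _ f g p h z
      have e : g ∘ₗ p = p ∘ₗ f := LinearMap.ext fun z => (h z).symm
      rw [← LinearMap.comp_apply, ← Cofree.map_comp, e, Cofree.map_comp, LinearMap.comp_apply]
    have e2 := LinearMap.congr_fun (T.tensor (koszulComodule H x)).ψ_d u
    have e3 := e1 (T.tensor (koszulComodule H x)).d (koszulTensorD T x) p (proj_d T x) (ψ u)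
    refine e3.trans ((congrArg (Cofree.map H.ηR p) e2).trans ?_)
    refine (congrArg (fun z => Cofree.map H.ηR p (ψ z)) hdu).trans ?_
    exact (congrArg (Cofree.map H.ηR p) (map_zero ψ)).trans (map_zero (Cofree.map H.ηR p))
  have hψR : ∀ J k z, z ∈ koszulCofreeGr H Agr Γgr deg J k →
      (koszulComodule H x).ψ z ∈ cofreeGr H.ηR Γgr (koszulCofreeGr H Agr Γgr deg J) k :=
    fun J k z hz => δ_mem_cofreeGr hH hz
  obtain ⟨v, hv, hvg, hdv⟩ := (hT.cofree B hI (fun J => isGraded_tensorGr hTgr J)) j hj J k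
    (Cofree.map H.ηR p (ψ u)) (powSub_map (Cofree.map H.ηR p ∘ₗ ψ) hu)
    (map_mem_cofreeGr p (fun _ _ hm => proj_mem hH (isGraded_koszulGr hH.amul_mem) hm)
      (tensorψ_mem (T := T) (R := koszulComodule H x) hH hψ hψR hg)) hD
  refine ⟨χ.untwist _ T v, powSub_map (χ.untwist _ T) hv, χ.untwist_mem T hH hc hψ hvg, ?_⟩
  refine (χ.untwist_d T x v).symm.trans ((congrArg _ hdv).trans ?_)
  exact χ.untwist_proj_ψ T u

end CofreeAcyclic

section NullHomotopy

variable {A Γ : Type} [CommRing A] [CommRing Γ] [Algebra A Γ] {H : HopfAlgebroid A Γ} {x : ℕ → A}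

/-- The homotopy of the Koszul comodule given by a formal combination of generators. -/
def koszulHomotopy (η : A →+* Γ) (c : ℕ →₀ Γ) : Cofree η (Koszul A) →ₗ[A] Cofree η (Koszul A) :=
  c.sum fun j g => gmul η _ g ∘ₗ Cofree.map η (koszulMul A j)

lemma koszulHomotopy_mk (η : A →+* Γ) (c : ℕ →₀ Γ) (γ : Γ) (κ : Koszul A) :
    koszulHomotopy η c (Cofree.mk η γ κ) = c.sum fun j g => Cofree.mk η (g * γ) (koszulMul A j κ) := by
  unfold koszulHomotopy
  rw [Finsupp.sum, LinearMap.sum_apply]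
  rfl

lemma koszulHomotopy_d {η : A →+* Γ} {a : A} {c : ℕ →₀ Γ}
    (hc : η a = c.sum fun j g => g * algebraMap A Γ (x j)) (z : Cofree η (Koszul A)) :
    Cofree.map η (koszulD x) (koszulHomotopy η c z) +
      koszulHomotopy η c (Cofree.map η (koszulD x) z) = a • z := by
  induction z using Cofree.induction with
  | h0 => simp only [map_zero, smul_zero, add_zero]
  | hadd y z hy hz =>
    simp only [map_add, smul_add, ← hy, ← hz]; abel
  | hmk γ κ =>
    rw [Cofree.map_mk, koszulHomotopy_mk, koszulHomotopy_mk, Cofree.asmul_mk, hc, Finsupp.sum,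
      Finsupp.sum, Finsupp.sum, map_sum, ← Finset.sum_add_distrib, Finset.sum_mul]
    have e : ∀ s : Finset ℕ, Cofree.mk η (∑ j ∈ s, c j * algebraMap A Γ (x j) * γ) κ =
        ∑ j ∈ s, Cofree.mk η (c j * algebraMap A Γ (x j) * γ) κ := fun s =>
      map_sum (Cofree.mkHom η κ) _ _
    rw [e]
    refine Finset.sum_congr rfl fun j _ => ?_
    rw [Cofree.map_mk, ← Cofree.mk_add, koszulD_mul, sub_add_cancel, Cofree.mk_smul]
    congr 1; ring

lemma koszulHomotopy_inv {η : A →+* Γ} (c : ℕ →₀ Γ) (z : Cofree η (Koszul A)) :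
    Cofree.map η koszulInv (koszulHomotopy η c z) =
      -koszulHomotopy η c (Cofree.map η koszulInv z) := by
  induction z using Cofree.induction with
  | h0 => simp only [map_zero, neg_zero]
  | hadd y z hy hz => simp only [map_add, hy, hz, neg_add]
  | hmk γ κ =>
    rw [Cofree.map_mk, koszulHomotopy_mk, koszulHomotopy_mk, Finsupp.sum, Finsupp.sum, map_sum,
      ← Finset.sum_neg_distrib]
    refine Finset.sum_congr rfl fun j _ => ?_
    have e : koszulInv (koszulMul A j κ) = -koszulMul A j (koszulInv κ) := koszulInv_cons j κ
    rw [Cofree.map_mk, e]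
    exact map_neg (Cofree.mkHom' η (c j * γ)) _

lemma koszulHomotopy_mem {Agr : ℤ → AddSubgroup A} {Γgr : ℤ → AddSubgroup Γ}
    (hH : HopfGrading H Agr Γgr) {deg : ℕ → ℤ} {c : ℕ →₀ Γ} {e : ℤ}
    (hc : ∀ j, c j ∈ Γgr (e - deg j)) {J k : ℤ} {z : Cofree H.ηR (Koszul A)}
    (hz : z ∈ koszulCofreeGr H Agr Γgr deg J k) :
    koszulHomotopy H.ηR c z ∈ koszulCofreeGr H Agr Γgr deg (J + 1) (k + e) := by
  unfold koszulHomotopy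
  rw [Finsupp.sum, LinearMap.sum_apply]
  refine AddSubgroup.sum_mem _ fun j _ => ?_
  refine map_mem_of_cofreeGr ((gmul H.ηR _ (c j)) ∘ₗ
    Cofree.map H.ηR (koszulMul A j)).toAddMonoidHom _ (fun a b γ κ hγ hκ h => ?_) hz
  exact mk_mem_cofreeGr (hH.mul_mem _ _ _ _ (hc j) hγ) (ι_mul_mem j hκ rfl rfl) (by omega)

/-- Multiplication by `x n` is null-homotopic on the product of a differential comodule with the
Koszul comodule. -/
def tensorHomotopy (T : DGComodule.{u} H) (x : ℕ → A) (c : ℕ →₀ Γ) :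
    (T.tensor (koszulComodule H x)).carrier →ₗ[A] (T.tensor (koszulComodule H x)).carrier :=
  TensorProduct.map T.inv (koszulHomotopy H.ηR c)

lemma tensorHomotopy_d (T : DGComodule.{u} H) {a : A} {c : ℕ →₀ Γ}
    (hc : H.ηR a = c.sum fun j g => g * algebraMap A Γ (x j)) (z) :
    (T.tensor (koszulComodule H x)).d (tensorHomotopy T x c z) +
      tensorHomotopy T x c ((T.tensor (koszulComodule H x)).d z) = a • z := by
  have key : ∀ {M N : Type _} [AddCommGroup M] [AddCommGroup N] [Module A M] [Module A N]
      (d i : M →ₗ[A] M) (δ E : N →ₗ[A] N), (∀ m, i (i m) = m) → (∀ m, i (d m) = -d (i m)) →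
      (∀ n, δ (E n) + E (δ n) = a • n) → ∀ z : M ⊗[A] N,
      (TensorProduct.map d LinearMap.id + TensorProduct.map i δ : M ⊗[A] N →ₗ[A] M ⊗[A] N)
        (TensorProduct.map i E z) + TensorProduct.map i E
        ((TensorProduct.map d LinearMap.id + TensorProduct.map i δ : M ⊗[A] N →ₗ[A] M ⊗[A] N) z)
        = a • z := by
    intro M N _ _ _ _ d i δ E h1 h2 h3 z
    induction z using TensorProduct.induction_on with
    | zero => simp only [map_zero, smul_zero, add_zero]
    | add y z hy hz => simp only [map_add, smul_add, ← hy, ← hz]; abel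
    | tmul m n =>
      simp only [LinearMap.add_apply, TensorProduct.map_tmul, map_add, LinearMap.id_apply]
      rw [h2, h1, TensorProduct.neg_tmul, ← TensorProduct.tmul_smul, ← h3, TensorProduct.tmul_add]
      abel
  exact key T.d T.inv (koszulComodule H x).d (koszulHomotopy H.ηR c)
    (fun m => LinearMap.congr_fun T.inv_inv m) (fun m => LinearMap.congr_fun T.inv_d m)
    (koszulHomotopy_d hc) z

lemma tensorHomotopy_inv (T : DGComodule.{u} H) (c : ℕ →₀ Γ) (z) :
    (T.tensor (koszulComodule H x)).inv (tensorHomotopy T x c z) =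
      -tensorHomotopy T x c ((T.tensor (koszulComodule H x)).inv z) := by
  have key : ∀ {M N : Type _} [AddCommGroup M] [AddCommGroup N] [Module A M] [Module A N]
      (i : M →ₗ[A] M) (δ E : N →ₗ[A] N), (∀ n, δ (E n) = -E (δ n)) → ∀ z : M ⊗[A] N,
      TensorProduct.map i δ (TensorProduct.map i E z) =
        -TensorProduct.map i E (TensorProduct.map i δ z) := by
    intro M N _ _ _ _ i δ E h z
    induction z using TensorProduct.induction_on with
    | zero => simp only [map_zero, neg_zero]
    | add y z hy hz => simp only [map_add, hy, hz, neg_add]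
    | tmul m n => rw [TensorProduct.map_tmul, TensorProduct.map_tmul, h, TensorProduct.tmul_neg]; rfl
  exact key T.inv (koszulComodule H x).inv (koszulHomotopy H.ηR c) (koszulHomotopy_inv c) z

end NullHomotopy

section Powers

variable {A Γ : Type} [CommRing A] [CommRing Γ] [Algebra A Γ] {H : HopfAlgebroid A Γ}
  {χ : Conjugation H} {Agr : ℤ → AddSubgroup A} {Γgr : ℤ → AddSubgroup Γ}
  {x : ℕ → A} {deg : ℕ → ℤ} {I : Ideal A} {T : DGComodule.{u} H} {Tgr : ℤ → AddSubgroup T.carrier}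

/-- Acyclicity of `T ⊗ K` implies that of `T ⊗ R ^ n ⊗ K` for all `n`. -/
theorem Setting.adicAcyclic_power (h : Setting χ Agr Γgr x deg I T Tgr)
    (B : HomogeneousBasis Agr Γgr)
    (hx : ∀ n, ∃ c : ℕ →₀ Γ, (∀ j, c j ∈ Γgr (deg n - deg j)) ∧
      H.ηR (x n) = c.sum fun j g => g * algebraMap A Γ (x j))
    (hT : AdicAcyclic I (koszulTensorD T x) (tensorGr (concGr Tgr) (koszulGr Agr deg))) (n : ℕ) :
    AdicAcyclic I (koszulTensorD (T.power (koszulComodule H x) n) x)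
      (tensorGr (powGr T x Agr Γgr deg Tgr n) (koszulGr Agr deg)) := by
  choose c hcg hc using hx
  induction n with
  | zero => exact hT
  | succ n ih =>
    exact AdicAcyclic.tensorKoszul (T := (T.power (koszulComodule H x) n).tensor (koszulComodule H x))
      (ih.tensorCofree B h.hopf h.conj h.invariant (h.pow_graded n) (h.pow_ψ_mem n)) h.one_mem
      (h.pow_graded (n + 1)) (h.pow_inv_mem (n + 1))
      (fun m => tensorHomotopy (T.power (koszulComodule H x) n) x (c m))
      (fun m => tensorHomotopy_d _ (hc m)) (fun m => tensorHomotopy_inv _ (c m))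
      (fun m J k z hz => tensorMap_mem _ _ 0 1 0 (deg m)
        (fun J k z hz => by rw [add_zero, add_zero]; exact h.pow_inv_mem n J k z hz)
        (fun J k z hz => koszulHomotopy_mem h.hopf (hcg m) hz) hz (by ring) (by ring))

end Powers

section

open Finset.HasAntidiagonal Finset.Nat

section Conjugation

variable {p : ℕ} {S : Type*} [CommRing S]

/-- Integrality of the conjugation. -/
lemma exists_sum_rlog_eq_hlog (hp0 : p ≠ 0) (hreg : ∀ x : S, (p : S) * x = 0 → x = 0) (σ : S →+* S)
    (hσ : ∀ x, (p : S) ∣ x ^ p - σ x) (v t : ℕ → S) (hσv : ∀ i, σ (v i) = v i ^ p) (ht : t 0 = 1) :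
    ∃ c : ℕ → S, ∀ n, ∑ x ∈ antidiagonal n, (p : S) ^ x.2 * rlog p v t x.1 * c x.2 ^ p ^ x.1 =
      hlog p v n := by
  let X' : ℕ → S := fun i => t (i + 1)
  let u : ℕ → S := fun m => if m = 0 then 1 else 0
  obtain ⟨c, hc⟩ := exists_curve σ v hp0 hreg hσ hσv
    (fun m w a => ∑ _i ∈ (Finset.univ : Finset Unit), u m ^ p ^ a -
      ∑ x ∈ antidiagonal m, (sh X' x.1 * w x.2 ^ p ^ x.1) ^ p ^ a)
    (fun n w w' h => by
      funext a
      congr 1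
      refine Finset.sum_congr rfl fun x hx => ?_
      rcases Nat.eq_zero_or_pos x.1 with h0 | h0
      · simp [h0, sh]
      · have := mem_antidiagonal.1 hx
        rw [h x.2 (by omega)])
    (fun w m e b => by
      have := dvd_sub (sum_pow_dvd σ hσ Finset.univ (fun _ : Unit => u m) e b)
        (sum_pow_dvd σ hσ (antidiagonal m) (fun x => sh X' x.1 * w x.2 ^ p ^ x.1) e b)
      rw [map_sub]
      convert this using 1
      ring)
    (fun _ => 0)
  refine ⟨c, fun n => ?_⟩
  have hG : ∀ m a, ∑ x ∈ antidiagonal m, (sh X' x.1 * c x.2 ^ p ^ x.1) ^ p ^ a + c m ^ p ^ a =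
      ∑ x ∈ antidiagonal m, (t x.1 * c x.2 ^ p ^ x.1) ^ p ^ a := by
    intro m a
    cases m with
    | zero => simp [sh, ht, hp0]
    | succ m =>
      rw [sum_antidiagonal_succ, sum_antidiagonal_succ]
      simp [sh, ht, hp0, X', add_comm]
  have hu : ∑ x ∈ antidiagonal n, (p : S) ^ x.2 * hlog p v x.1 * u x.2 ^ p ^ x.1 = hlog p v n := by
    rw [Finset.sum_eq_single (n, 0)]
    · simp [u]
    · rintro ⟨a, b⟩ h h'
      have := mem_antidiagonal.1 h
      have hb : b ≠ 0 := by
        rintro rfl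
        simp at this; exact h' (by rw [this])
      simp [u, hb, hp0]
    · simp
  rw [rlog_conv, ← hu, ← sub_eq_zero, ← Finset.sum_sub_distrib]
  have h2 := hc n
  rw [mul_zero] at h2
  rw [← neg_eq_zero, ← h2, ← Finset.sum_neg_distrib]
  refine Finset.sum_congr rfl fun x _ => ?_
  rw [← hG, Finset.univ_unique, Finset.sum_singleton]
  ring

variable (p) [hp : Fact p.Prime]

lemma exists_conj : ∃ c : ℕ → BPBP p, ∀ n, ∑ x ∈ antidiagonal n,
    (p : BPBP p) ^ x.2 * rlog p (vL p) (tgen p) x.1 * c x.2 ^ p ^ x.1 = hlog p (vL p) n := by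
  obtain ⟨σ, hσ, hv⟩ := exists_frob p
  exact exists_sum_rlog_eq_hlog hp.out.ne_zero (mul_reg p) σ hσ (vL p) (tgen p) hv rfl

/-- The images of the generators `t_n` under the conjugation. -/
def conjSeq : ℕ → BPBP p := (exists_conj p).choose

lemma conjSeq_spec (n : ℕ) : ∑ x ∈ antidiagonal n,
    (p : BPBP p) ^ x.2 * rlog p (vL p) (tgen p) x.1 * conjSeq p x.2 ^ p ^ x.1 = hlog p (vL p) n :=
  (exists_conj p).choose_spec n

lemma conjSeq_zero : conjSeq p 0 = 1 := by
  have h := conjSeq_spec p 0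
  simpa [rlog, hlog_zero, tgen] using h

/-- The conjugation of `BP_{2*}BP`. -/
def conjBP : BPBP p →+* BPBP p := BPBP.lift p (etaR p) fun i => conjSeq p (i + 1)

lemma conjBP_left (a : BP p) : conjBP p (algebraMap (BP p) (BPBP p) a) = etaR p a :=
  BPBP.lift_left p _ _ a

lemma conjBP_tgen (n : ℕ) : conjBP p (tgen p n) = conjSeq p n := by
  cases n with
  | zero => rw [conjSeq_zero, tgen, map_one]
  | succ n => exact BPBP.lift_tgen p _ _ n

lemma conjBP_right (a : BP p) : conjBP p (etaR p a) = algebraMap (BP p) (BPBP p) a := by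
  have : (conjBP p).comp (etaR p) = algebraMap (BP p) (BPBP p) := by
    refine bp_hom_ext p (mul_reg p) _ _ fun n => ?_
    have e1 : (fun i => conjBP p (vL p i)) = fun i => etaR p (vgen p i) :=
      funext fun i => conjBP_left p _
    have e2 : (fun i => conjBP p (tgen p i)) = conjSeq p := funext (conjBP_tgen p)
    have e3 : hlog p (vL p) n = algebraMap (BP p) (BPBP p) (hlog p (vgen p) n) :=
      (map_hlog _ p _ n).symm
    rw [RingHom.comp_apply, etaR_hlog, map_rlog, e1, e2, ← e3, ← conjSeq_spec, rlog]
    refine Finset.sum_congr rfl fun x _ => ?_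
    rw [← map_hlog, etaR_hlog]
  exact RingHom.congr_fun this a

/-- The conjugation of the Hopf algebroid `(BP_{2*}, BP_{2*}BP)`. -/
def bpConj : Conjugation (bpHopf p) where
  c := conjBP p
  c_left := conjBP_left p
  c_right := conjBP_right p
  antipode := fun x => by
    let τ := tensorLift (etaR p) (RingHom.id _) (conjBP p) (fun a => (conjBP_right p a).symm)
    let F : BPBP p →+* BPBP p := τ.comp (comulBP p)
    have : F = (etaR p).comp (counitBP p).toRingHom := by
      refine bpbp_hom_ext p (mul_reg p) F _ (fun a => ?_) (fun a => ?_)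
      · change τ (comulBP p _) = etaR p (counitBP p _)
        rw [comulBP_left, AlgHom.commutes]
        exact (one_mul _).trans (conjBP_left p a)
      · change τ (comulBP p _) = etaR p (counitBP p _)
        rw [comulBP_right, counitBP_right]
        exact (congrArg (etaR p a * ·) (map_one (conjBP p))).trans (mul_one _)
    exact RingHom.congr_fun this x
  comul := fun x => by
    let τ := tensorLift (etaR p) ((comulBP p).comp (conjBP p)) (tensorR p)
      (fun a => (congrArg (comulBP p) (conjBP_left p a)).trans (comulBP_right p a))
    let F : BPBP p →+* BPT p := τ.comp (comulBP p)
    have : F = (tensorL p).comp (conjBP p) := by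
      refine bpbp_hom_ext p (reg2 p) F _ (fun a => ?_) (fun a => ?_)
      · change τ (comulBP p _) =
          tensorL p (conjBP p _)
        rw [comulBP_left, conjBP_left, ← tensorR_left]
        refine (tensorLift_mk (etaR p) ((comulBP p).comp (conjBP p)) (tensorR p)
          (fun a => (congrArg (comulBP p) (conjBP_left p a)).trans (comulBP_right p a)) 1 _).trans ?_
        rw [map_one, one_mul]
      · change τ (comulBP p _) =
          tensorL p (conjBP p _)
        rw [comulBP_right, conjBP_right, ← comulBP_left]
        refine (tensorLift_mk (etaR p) ((comulBP p).comp (conjBP p)) (tensorR p)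
          (fun a => (congrArg (comulBP p) (conjBP_left p a)).trans (comulBP_right p a))
          (etaR p a) 1).trans ?_
        rw [map_one, mul_one, RingHom.comp_apply, conjBP_right]
    exact RingHom.congr_fun this x

end Conjugation

section RingGrading

variable (p : ℕ)

/-- A grading of a ring. -/
structure IsRingGrading {S : Type*} [CommRing S] (Sgr : ℤ → AddSubgroup S) : Prop where
  one_mem : (1 : S) ∈ Sgr 0
  mul_mem : ∀ i j x y, x ∈ Sgr i → y ∈ Sgr j → x * y ∈ Sgr (i + j)

namespace IsRingGrading

variable {p} {S : Type*} [CommRing S] {Sgr : ℤ → AddSubgroup S} (h : IsRingGrading Sgr)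
include h

lemma natCast_mem (n : ℕ) : (n : S) ∈ Sgr 0 := by
  rw [← nsmul_one]
  exact AddSubgroup.nsmul_mem _ h.one_mem n

lemma pow_mem {x : S} {i : ℤ} (hx : x ∈ Sgr i) (n : ℕ) : x ^ n ∈ Sgr (n * i) := by
  induction n with
  | zero => simpa using h.one_mem
  | succ n ih =>
    have := h.mul_mem _ _ _ _ ih hx
    rw [pow_succ]
    convert this using 2
    push_cast; ring

lemma natCast_pow_mul_mem (a n : ℕ) {x : S} {i : ℤ} (hx : x ∈ Sgr i) : (a : S) ^ n * x ∈ Sgr i := by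
  have := h.mul_mem _ _ _ _ (h.pow_mem (h.natCast_mem a) n) hx
  simpa using this

lemma term_mem {L c : ℕ → S} {i j e : ℕ} {a : ℕ} (hL : L i ∈ Sgr ((p : ℤ) ^ i - 1))
    (hc : c j ∈ Sgr ((p : ℤ) ^ (j + e) - 1)) :
    (p : S) ^ a * L i * c j ^ p ^ i ∈ Sgr ((p : ℤ) ^ (i + j + e) - 1) := by
  have := h.natCast_pow_mul_mem p a (h.mul_mem _ _ _ _ hL (h.pow_mem hc (p ^ i)))
  rw [mul_assoc]
  convert this using 2
  push_cast
  ring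

lemma hlog_mem {v : ℕ → S} (n : ℕ) (hv : ∀ i < n, v i ∈ Sgr ((p : ℤ) ^ (i + 1) - 1)) :
    hlog p v n ∈ Sgr ((p : ℤ) ^ n - 1) := by
  induction n using Nat.strong_induction_on with
  | _ n ih =>
    cases n with
    | zero => simpa [hlog_zero] using h.one_mem
    | succ n =>
      rw [hlog_succ]
      refine AddSubgroup.sum_mem _ fun x hx => ?_
      have hx' := mem_antidiagonal.1 hx
      rw [← hx']
      exact h.term_mem (ih x.1 (by omega) fun i hi => hv i (by omega)) (hv x.2 (by omega))

lemma rlog_mem {v t : ℕ → S} (n : ℕ) (hv : ∀ i, v i ∈ Sgr ((p : ℤ) ^ (i + 1) - 1))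
    (ht : ∀ i, t i ∈ Sgr ((p : ℤ) ^ i - 1)) : rlog p v t n ∈ Sgr ((p : ℤ) ^ n - 1) := by
  refine AddSubgroup.sum_mem _ fun x hx => ?_
  rw [← mem_antidiagonal.1 hx]
  exact h.term_mem (e := 0) (h.hlog_mem x.1 fun i _ => hv i) (ht x.2)

/-- Homogeneity of the solutions of recursive equations. -/
lemma solution_mem (hsat : ∀ k x, (p : S) * x ∈ Sgr k → x ∈ Sgr k) {L c : ℕ → S} (n e : ℕ)
    (hL0 : L 0 = 1) (hL : ∀ i ≤ n, L i ∈ Sgr ((p : ℤ) ^ i - 1))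
    (hc : ∀ j < n, c j ∈ Sgr ((p : ℤ) ^ (j + e) - 1))
    (hn : ∑ x ∈ antidiagonal n, (p : S) ^ x.2 * L x.1 * c x.2 ^ p ^ x.1 ∈
      Sgr ((p : ℤ) ^ (n + e) - 1)) : c n ∈ Sgr ((p : ℤ) ^ (n + e) - 1) := by
  have hsat' : ∀ (a : ℕ) k x, (p : S) ^ a * x ∈ Sgr k → x ∈ Sgr k := by
    intro a
    induction a with
    | zero => intro k x hx; simpa using hx
    | succ a ih => intro k x hx; rw [pow_succ, mul_assoc] at hx; exact hsat _ _ (ih _ _ hx)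
  refine hsat' n _ _ ?_
  have hmem : (0, n) ∈ antidiagonal n := mem_antidiagonal.2 (zero_add n)
  rw [← Finset.add_sum_erase _ _ hmem] at hn
  have h2 := AddSubgroup.sub_mem _ hn (AddSubgroup.sum_mem _ (fun x hx => ?_ :
    ∀ x ∈ (antidiagonal n).erase (0, n), (p : S) ^ x.2 * L x.1 * c x.2 ^ p ^ x.1 ∈ _))
  · rw [add_sub_cancel_right] at h2
    simpa [hL0] using h2
  · obtain ⟨hne, hx⟩ := Finset.mem_erase.1 hx
    have hx' := mem_antidiagonal.1 hx
    have : x.2 < n := by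
      rcases Nat.eq_zero_or_pos x.1 with h0 | h0
      · exact absurd (Prod.ext h0 (by omega : x.2 = n)) hne
      · omega
    rw [← hx']
    exact h.term_mem (hL x.1 (by omega)) (hc x.2 this)

end IsRingGrading

/-- The grading of a polynomial ring over a graded ring, where the `i`-th variable has degree
`p ^ (i + 1) - 1`. -/
def polyGr {R : Type*} [CommRing R] (Rgr : ℤ → AddSubgroup R) (k : ℤ) :
    AddSubgroup (MvPolynomial ℕ R) where
  carrier := {f | ∀ α, f.coeff α ∈ Rgr (k - Finsupp.weight (genDeg p) α)}
  zero_mem' := fun α => by rw [MvPolynomial.coeff_zero]; exact AddSubgroup.zero_mem _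
  add_mem' := fun hf hg α => by
    rw [MvPolynomial.coeff_add]; exact AddSubgroup.add_mem _ (hf α) (hg α)
  neg_mem' := fun hf α => by rw [MvPolynomial.coeff_neg]; exact AddSubgroup.neg_mem _ (hf α)

section Poly

variable {p} {R : Type*} [CommRing R] {Rgr : ℤ → AddSubgroup R}

lemma monomial_mem_polyGr {c k : ℤ} {a : R} {α : ℕ →₀ ℕ} (ha : a ∈ Rgr c)
    (h : c + Finsupp.weight (genDeg p) α = k) : MvPolynomial.monomial α a ∈ polyGr p Rgr k := by
  classical
  intro β
  rw [MvPolynomial.coeff_monomial]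
  split_ifs with hβ
  · subst hβ
    rwa [← h, add_sub_cancel_right]
  · exact AddSubgroup.zero_mem _

lemma C_mem_polyGr {k : ℤ} {a : R} (ha : a ∈ Rgr k) : MvPolynomial.C a ∈ polyGr p Rgr k :=
  monomial_mem_polyGr ha (by rw [map_zero, add_zero])

lemma X_mem_polyGr (h : IsRingGrading Rgr) (i : ℕ) :
    (MvPolynomial.X i : MvPolynomial ℕ R) ∈ polyGr p Rgr (genDeg p i) :=
  monomial_mem_polyGr h.one_mem (by simp [Finsupp.weight_single])

lemma isRingGrading_polyGr (h : IsRingGrading Rgr) : IsRingGrading (polyGr p Rgr) where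
  one_mem := C_mem_polyGr h.one_mem
  mul_mem := fun i j f g hf hg α => by
    classical
    rw [MvPolynomial.coeff_mul]
    refine AddSubgroup.sum_mem _ fun x hx => ?_
    have := h.mul_mem _ _ _ _ (hf x.1) (hg x.2)
    rw [← mem_antidiagonal.1 hx, map_add]
    convert this using 2
    ring

lemma polyGr_saturated (hsat : ∀ k x, (p : R) * x ∈ Rgr k → x ∈ Rgr k) (k : ℤ)
    (f : MvPolynomial ℕ R) (hf : (p : MvPolynomial ℕ R) * f ∈ polyGr p Rgr k) : f ∈ polyGr p Rgr k := by
  intro α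
  have := hf α
  rw [← map_natCast MvPolynomial.C, MvPolynomial.coeff_C_mul] at this
  exact hsat _ _ this

/-- A homomorphism out of a graded polynomial ring preserves degrees if it does so on coefficients
and variables. -/
lemma map_mem_of_polyGr {S : Type*} [CommRing S] {Sgr : ℤ → AddSubgroup S} (hS : IsRingGrading Sgr)
    (f : MvPolynomial ℕ R →+* S) (hC : ∀ k a, a ∈ Rgr k → f (MvPolynomial.C a) ∈ Sgr k)
    (hX : ∀ i, f (MvPolynomial.X i) ∈ Sgr (genDeg p i)) {k : ℤ} {F : MvPolynomial ℕ R}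
    (hF : F ∈ polyGr p Rgr k) : f F ∈ Sgr k := by
  have hm : ∀ α : ℕ →₀ ℕ, f (MvPolynomial.monomial α 1) ∈ Sgr (Finsupp.weight (genDeg p) α) := by
    intro α
    induction α using Finsupp.induction_linear with
    | zero => simpa using hS.one_mem
    | add α β hα hβ =>
      rw [map_add, ← one_mul (1 : R), ← MvPolynomial.monomial_mul, map_mul]
      exact hS.mul_mem _ _ _ _ hα hβ
    | single i n =>
      rw [← MvPolynomial.X_pow_eq_monomial, map_pow, Finsupp.weight_single, nsmul_eq_mul]
      exact hS.pow_mem (hX i) n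
  rw [← MvPolynomial.support_sum_monomial_coeff F, map_sum]
  refine AddSubgroup.sum_mem _ fun α _ => ?_
  have := hS.mul_mem _ _ _ _ (hC _ _ (hF α)) (hm α)
  rwa [← map_mul, MvPolynomial.C_mul_monomial, mul_one, sub_add_cancel] at this

end Poly

end RingGrading

end

section

open Finset.HasAntidiagonal Finset.Nat

section CofreeRing

variable {A Γ : Type} [CommRing A] [CommRing Γ] [Algebra A Γ] {η : A →+* Γ}
  {Γgr : ℤ → AddSubgroup Γ} {S : Type u} [CommRing S] [Algebra A S] {Sgr : ℤ → AddSubgroup S}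

lemma isRingGrading_cofreeGr (hΓ : IsRingGrading Γgr) (hS : IsRingGrading Sgr) :
    IsRingGrading (cofreeGr η Γgr Sgr) where
  one_mem := mk_mem_cofreeGr hΓ.one_mem hS.one_mem rfl
  mul_mem := fun i j x y hx hy => by
    refine map_mem_of_cofreeGr (AddMonoidHom.mulRight y) _ (fun a b γ s hγ hs h => ?_) hx
    change Cofree.mk η γ s * y ∈ _
    refine map_mem_of_cofreeGr (AddMonoidHom.mulLeft (Cofree.mk η γ s)) _
      (fun a' b' γ' s' hγ' hs' h' => ?_) hy
    change Cofree.mk η γ s * Cofree.mk η γ' s' ∈ _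
    rw [Cofree.mk_mul_mk]
    exact mk_mem_cofreeGr (hΓ.mul_mem _ _ _ _ hγ hγ') (hS.mul_mem _ _ _ _ hs hs') (by omega)

end CofreeRing

section BPGradings

variable (p : ℕ) [hp : Fact p.Prime]

/-- The grading of `ℤ_(p)`. -/
def zlocGr (k : ℤ) : AddSubgroup (ZLoc p) := if k = 0 then ⊤ else ⊥

lemma mem_zlocGr {k : ℤ} {x : ZLoc p} : x ∈ zlocGr p k ↔ (x ≠ 0 → k = 0) := by
  unfold zlocGr
  split_ifs with h
  · simp [h]
  · rw [AddSubgroup.mem_bot]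
    constructor
    · intro hx hx'; exact absurd hx hx'
    · intro hx; by_contra hx'; exact h (hx hx')

lemma isRingGrading_zlocGr : IsRingGrading (zlocGr p) where
  one_mem := (mem_zlocGr p).2 fun _ => rfl
  mul_mem := fun i j x y hx hy => (mem_zlocGr p).2 fun h => by
    rw [(mem_zlocGr p).1 hx (left_ne_zero_of_mul h), (mem_zlocGr p).1 hy (right_ne_zero_of_mul h),
      add_zero]

lemma bpGr_eq (k : ℤ) : bpGr p k = polyGr p (zlocGr p) k := by
  ext f
  have e : ∀ α, f.coeff α ∈ zlocGr p (k - Finsupp.weight (genDeg p) α) ↔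
      (f.coeff α ≠ 0 → Finsupp.weight (genDeg p) α = k) := fun α => by
    rw [mem_zlocGr, sub_eq_zero, eq_comm]
  constructor
  · intro hf α
    exact (e α).2 fun h => hf h
  · intro hf α h
    exact (e α).1 (hf α) h

lemma isRingGrading_bpGr : IsRingGrading (bpGr p) := by
  have : bpGr p = polyGr p (zlocGr p) := funext (bpGr_eq p)
  rw [this]
  exact isRingGrading_polyGr (isRingGrading_zlocGr p)

lemma bpGr_saturated (k : ℤ) (x : BP p) (hx : (p : BP p) * x ∈ bpGr p k) : x ∈ bpGr p k := by
  rw [bpGr_eq] at hx ⊢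
  refine polyGr_saturated (fun k x hx => ?_) k x hx
  rw [mem_zlocGr] at hx ⊢
  exact fun h => hx (mul_ne_zero (by exact_mod_cast hp.out.ne_zero) h)

lemma bpbpGr_eq (k : ℤ) : bpbpGr p k = polyGr p (bpGr p) k := by
  refine le_antisymm ((AddSubgroup.closure_le _).2 ?_) fun f hf => ?_
  · rintro _ ⟨c, a, α, ha, h, rfl⟩
    exact monomial_mem_polyGr ha h
  · have e := MvPolynomial.support_sum_monomial_coeff (f : MvPolynomial ℕ (BP p))
    rw [← e]
    exact AddSubgroup.sum_mem _ fun α _ =>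
      AddSubgroup.subset_closure ⟨_, _, α, hf α, sub_add_cancel _ _, rfl⟩

lemma isRingGrading_bpbpGr : IsRingGrading (bpbpGr p) := by
  have : bpbpGr p = polyGr p (bpGr p) := funext (bpbpGr_eq p)
  rw [this]
  exact isRingGrading_polyGr (isRingGrading_bpGr p)

lemma bpbpGr_saturated (k : ℤ) (x : BPBP p) (hx : (p : BPBP p) * x ∈ bpbpGr p k) :
    x ∈ bpbpGr p k := by
  rw [bpbpGr_eq] at hx ⊢
  exact polyGr_saturated (bpGr_saturated p) k x hx

lemma vgen_mem (i : ℕ) : vgen p i ∈ bpGr p (genDeg p i) := by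
  rw [bpGr_eq]
  exact X_mem_polyGr (isRingGrading_zlocGr p) i

lemma left_mem {k : ℤ} {a : BP p} (ha : a ∈ bpGr p k) :
    algebraMap (BP p) (BPBP p) a ∈ bpbpGr p k := by
  rw [bpbpGr_eq]
  exact C_mem_polyGr ha

lemma tgen_mem (i : ℕ) : tgen p i ∈ bpbpGr p ((p : ℤ) ^ i - 1) := by
  cases i with
  | zero => simpa [tgen] using (isRingGrading_bpbpGr p).one_mem
  | succ i =>
    rw [bpbpGr_eq]
    exact X_mem_polyGr (isRingGrading_bpGr p) i

lemma vL_mem (i : ℕ) : vL p i ∈ bpbpGr p ((p : ℤ) ^ (i + 1) - 1) := left_mem p (vgen_mem p i)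

/-- A homomorphism out of `BP_{2*}` preserves degrees if it does so on generators. -/
lemma map_mem_of_bpGr {S : Type*} [CommRing S] {Sgr : ℤ → AddSubgroup S} (hS : IsRingGrading Sgr)
    (f : BP p →+* S) (hC : ∀ r, f (algebraMap (ZLoc p) (BP p) r) ∈ Sgr 0)
    (hv : ∀ i, f (vgen p i) ∈ Sgr (genDeg p i)) {k : ℤ} {a : BP p} (ha : a ∈ bpGr p k) :
    f a ∈ Sgr k := by
  rw [bpGr_eq] at ha
  refine map_mem_of_polyGr hS f (fun k r hr => ?_) hv ha
  by_cases h : r = 0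
  · subst h
    have e : f (algebraMap (ZLoc p) (BP p) 0) = 0 := by rw [map_zero, map_zero]
    exact (congrArg (· ∈ Sgr k) e).mpr (AddSubgroup.zero_mem _)
  · rw [(mem_zlocGr p).1 hr h]; exact hC r

/-- A homomorphism out of `BP_{2*}BP` preserves degrees if it does so on the left unit and on
generators. -/
lemma map_mem_of_bpbpGr {S : Type*} [CommRing S] {Sgr : ℤ → AddSubgroup S} (hS : IsRingGrading Sgr)
    (f : BPBP p →+* S) (hC : ∀ k a, a ∈ bpGr p k → f (algebraMap (BP p) (BPBP p) a) ∈ Sgr k)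
    (ht : ∀ i, f (tgen p (i + 1)) ∈ Sgr (genDeg p i)) {k : ℤ} {x : BPBP p} (hx : x ∈ bpbpGr p k) :
    f x ∈ Sgr k := by
  rw [bpbpGr_eq] at hx
  exact map_mem_of_polyGr hS f hC ht hx

lemma etaR_vgen_mem (n : ℕ) : etaR p (vgen p n) ∈ bpbpGr p ((p : ℤ) ^ (n + 1) - 1) := by
  have hspec : ∀ n, hlog p (fun i => etaR p (vgen p i)) n = rlog p (vL p) (tgen p) n := fun n => by
    rw [← map_hlog, etaR_hlog]
  induction n using Nat.strong_induction_on with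
  | _ n ih =>
    have h := isRingGrading_bpbpGr p
    refine h.solution_mem (bpbpGr_saturated p) (L := hlog p fun i => etaR p (vgen p i))
      (c := fun i => etaR p (vgen p i)) n 1 (hlog_zero _ _)
      (fun i hi => h.hlog_mem i fun j hj => ih j (by omega)) ih ?_
    rw [← hlog_succ, hspec]
    exact h.rlog_mem (n + 1) (vL_mem p) (tgen_mem p)

lemma etaR_mem {k : ℤ} {a : BP p} (ha : a ∈ bpGr p k) : etaR p a ∈ bpbpGr p k := by
  refine map_mem_of_bpGr p (isRingGrading_bpbpGr p) (etaR p) (fun r => ?_) (etaR_vgen_mem p) ha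
  have e : etaR p (algebraMap (ZLoc p) (BP p) r) =
      algebraMap (BP p) (BPBP p) (algebraMap (ZLoc p) (BP p) r) :=
    RingHom.congr_fun (zloc_hom_ext p ((etaR p).comp (algebraMap (ZLoc p) (BP p)))
      ((algebraMap (BP p) (BPBP p)).comp (algebraMap (ZLoc p) (BP p)))) r
  rw [e]
  refine left_mem p ?_
  rw [bpGr_eq]
  exact C_mem_polyGr ((mem_zlocGr p).2 fun _ => rfl)

lemma conjSeq_mem (n : ℕ) : conjSeq p n ∈ bpbpGr p ((p : ℤ) ^ n - 1) := by
  induction n using Nat.strong_induction_on with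
  | _ n ih =>
    have h := isRingGrading_bpbpGr p
    refine h.solution_mem (bpbpGr_saturated p) (L := rlog p (vL p) (tgen p)) (c := conjSeq p) n 0
      (by simp [rlog, hlog_zero, tgen]) (fun i _ => h.rlog_mem i (vL_mem p) (tgen_mem p)) ih ?_
    rw [conjSeq_spec]
    exact h.hlog_mem n fun i _ => vL_mem p i

lemma conj_mem (k : ℤ) (x : BPBP p) (hx : x ∈ bpbpGr p k) : (bpConj p).c x ∈ bpbpGr p k := by
  refine map_mem_of_bpbpGr p (isRingGrading_bpbpGr p) (conjBP p) (fun k a ha => ?_) (fun i => ?_) hx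
  · rw [conjBP_left]
    exact etaR_mem p ha
  · rw [conjBP_tgen]
    exact conjSeq_mem p (i + 1)

lemma counitBP_mem (k : ℤ) (x : BPBP p) (hx : x ∈ bpbpGr p k) : counitBP p x ∈ bpGr p k := by
  refine map_mem_of_bpbpGr p (isRingGrading_bpGr p) (counitBP p).toRingHom (fun k a ha => ?_)
    (fun i => ?_) hx
  · have e : (counitBP p).toRingHom (algebraMap (BP p) (BPBP p) a) = a := (counitBP p).commutes a
    rwa [e]
  · have e : (counitBP p).toRingHom (tgen p (i + 1)) = 0 :=
      (counitBP_tgen p (i + 1)).trans (if_neg (Nat.succ_ne_zero i))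
    rw [e]
    exact AddSubgroup.zero_mem _

lemma comulBP_mem (k : ℤ) (x : BPBP p) (hx : x ∈ bpbpGr p k) :
    comulBP p x ∈ cofreeGr (etaR p) (bpbpGr p) (rightGr (etaR p) (bpbpGr p)) k := by
  have hΓ := isRingGrading_bpbpGr p
  have hR : IsRingGrading (rightGr (etaR p) (bpbpGr p)) := ⟨hΓ.one_mem, hΓ.mul_mem⟩
  have hT := isRingGrading_cofreeGr (η := etaR p) hΓ hR
  have hL : ∀ k x, x ∈ bpbpGr p k →
      tensorL p x ∈ cofreeGr (etaR p) (bpbpGr p) (rightGr (etaR p) (bpbpGr p)) k :=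
    fun k x hx => mk_mem_cofreeGr hΓ.one_mem (Mgr := rightGr (etaR p) (bpbpGr p)) hx (zero_add k)
  have hR' : ∀ k x, x ∈ bpbpGr p k →
      tensorR p x ∈ cofreeGr (etaR p) (bpbpGr p) (rightGr (etaR p) (bpbpGr p)) k :=
    fun k x hx => mk_mem_cofreeGr hx hR.one_mem (add_zero k)
  have h2 : IsRingGrading (S := BPBP2 p) (polyGr p (bpbpGr p)) := isRingGrading_polyGr hΓ
  have hsat : ∀ k (x : BPBP2 p), (p : BPBP2 p) * x ∈ polyGr p (bpbpGr p) k →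
      x ∈ polyGr p (bpbpGr p) k := polyGr_saturated (bpbpGr_saturated p)
  have hv : ∀ i, algebraMap (BPBP p) (BPBP2 p) (vL p i) ∈
      polyGr p (bpbpGr p) ((p : ℤ) ^ (i + 1) - 1) := fun i => C_mem_polyGr (vL_mem p i)
  have hcom : ∀ n, (exists_comul p).choose n ∈ polyGr p (bpbpGr p) ((p : ℤ) ^ n - 1) := by
    intro n
    induction n using Nat.strong_induction_on with
    | _ n ih =>
      refine h2.solution_mem hsat
        (L := hlog p (fun i => algebraMap (BPBP p) (BPBP2 p) (vL p i))) n 0 (hlog_zero _ _)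
        (fun i _ => h2.hlog_mem i fun i _ => hv i) ih ?_
      refine (congrArg (· ∈ polyGr p (bpbpGr p) ((p : ℤ) ^ (n + 0) - 1))
        ((exists_comul p).choose_spec.2 n)).mpr ?_
      refine AddSubgroup.sum_mem _ fun x hx => ?_
      rw [← mem_antidiagonal.1 hx]
      refine h2.term_mem (L := rlog p _ _) (c := tgen' p) (e := 0)
        (h2.rlog_mem x.1 hv fun i => C_mem_polyGr (tgen_mem p i)) ?_
      rcases x with ⟨a, b⟩
      cases b with
      | zero => simpa [tgen'] using h2.one_mem
      | succ b => exact X_mem_polyGr hΓ b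
  refine map_mem_of_bpbpGr p hT (comulBP p) (fun k a ha => ?_) (fun i => ?_) hx
  · rw [comulBP_left]
    exact hL _ _ (left_mem p ha)
  · rw [comulBP_tgen]
    exact map_mem_of_polyGr hT (toTensor p)
      (fun k a ha => (congrArg (· ∈ cofreeGr (etaR p) (bpbpGr p) (rightGr (etaR p) (bpbpGr p)) k)
        (toTensor_C p a)).mpr (hL k a ha))
      (fun i => (congrArg (· ∈ cofreeGr (etaR p) (bpbpGr p) (rightGr (etaR p) (bpbpGr p))
        (genDeg p i)) (toTensor_tgen' p (i + 1))).mpr (hR' _ _ (tgen_mem p (i + 1)))) (hcom (i + 1))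

lemma hopfGrading_bp : HopfGrading (bpHopf p) (bpGr p) (bpbpGr p) where
  amul_mem := (isRingGrading_bpGr p).mul_mem
  one_mem := (isRingGrading_bpbpGr p).one_mem
  mul_mem := (isRingGrading_bpbpGr p).mul_mem
  left_mem := fun _ _ ha => left_mem p ha
  right_mem := fun _ _ ha => etaR_mem p ha
  ε_mem := counitBP_mem p
  Δ_mem := comulBP_mem p

/-- The monomial basis of `BP_{2*}BP`. -/
def bpBasis : HomogeneousBasis (bpGr p) (bpbpGr p) where
  ι := ℕ →₀ ℕ
  basis := MvPolynomial.basisMonomials ℕ (BP p)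
  wt := Finsupp.weight (genDeg p)
  basis_mem := fun α => by
    rw [bpbpGr_eq]
    refine (congrArg (· ∈ polyGr p (bpGr p) (Finsupp.weight (genDeg p) α))
      (congrFun (MvPolynomial.coe_basisMonomials ℕ (BP p)) α)).mpr ?_
    exact monomial_mem_polyGr (isRingGrading_bpGr p).one_mem (zero_add _)
  repr_mem := fun k γ hγ α => by
    rw [bpbpGr_eq] at hγ
    exact hγ α

end BPGradings

section Invariance

variable (p : ℕ) [hp : Fact p.Prime]

lemma vseq_mem (i : ℕ) : vseq p i ∈ bpGr p (vdeg p i) := by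
  cases i with
  | zero => simpa [vseq, vdeg] using (isRingGrading_bpGr p).natCast_mem p
  | succ i => exact vgen_mem p i

lemma vseq_mem_augIdeal (i : ℕ) : vseq p i ∈ augIdeal p := Ideal.subset_span ⟨i, rfl⟩

/-- The map `BP_{2*}BP → ℤ_(p)[t_1, t_2, …]` that sends all `v_i` to `0`. -/
def killV : BPBP p →+* MvPolynomial ℕ (ZLoc p) :=
  BPBP.lift p (BP.lift p MvPolynomial.C fun _ => 0) MvPolynomial.X

lemma hlog_zero_seq {S : Type*} [CommRing S] (n : ℕ) :
    hlog p (fun _ => (0 : S)) (n + 1) = 0 := by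
  rw [hlog_succ]
  refine Finset.sum_eq_zero fun x _ => ?_
  rw [zero_pow (pow_ne_zero _ hp.out.ne_zero), mul_zero]

lemma dvd_killV_etaR (n : ℕ) : (p : MvPolynomial ℕ (ZLoc p)) ∣ killV p (etaR p (vgen p n)) := by
  have hv : (fun i => killV p (vL p i)) = fun _ => 0 := funext fun i =>
    (BPBP.lift_left p _ _ _).trans (BP.lift_vgen p _ _ i)
  have hspec : ∀ n, hlog p (fun i => killV p (etaR p (vgen p i))) n =
      p ^ n * killV p (tgen p n) := fun n => by
    rw [← map_hlog (killV p), ← map_hlog (etaR p), etaR_hlog, map_rlog, hv, rlog,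
      Finset.sum_eq_single (0, n)]
    · rw [hlog_zero, mul_one, pow_zero, pow_one]
    · rintro ⟨a, b⟩ h h'
      have := mem_antidiagonal.1 h
      cases a with
      | zero =>
        simp only [zero_add] at this
        exact absurd (by rw [this]) h'
      | succ a => simp only [hlog_zero_seq, mul_zero, zero_mul]
    · intro h
      exact absurd (mem_antidiagonal.2 (zero_add n)) h
  have hreg' : ∀ (k : ℕ) (x : MvPolynomial ℕ (ZLoc p)), (p : MvPolynomial ℕ (ZLoc p)) ^ k * x = 0 → x = 0 := by
    intro k x hx
    refine (mul_eq_zero.1 hx).resolve_left (pow_ne_zero _ ?_)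
    exact_mod_cast hp.out.ne_zero
  induction n using Nat.strong_induction_on with
  | _ n ih =>
    have h := hspec (n + 1)
    rw [hlog_succ] at h
    have e : ∀ x ∈ antidiagonal n, (p : MvPolynomial ℕ (ZLoc p)) ^ x.2 *
        hlog p (fun i => killV p (etaR p (vgen p i))) x.1 * killV p (etaR p (vgen p x.2)) ^ p ^ x.1 =
        p ^ n * (killV p (tgen p x.1) * killV p (etaR p (vgen p x.2)) ^ p ^ x.1) := fun x hx => by
      rw [hspec, ← mem_antidiagonal.1 hx, pow_add]
      ring
    rw [Finset.sum_congr rfl e, ← Finset.mul_sum] at h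
    have h' : ∑ x ∈ antidiagonal n, killV p (tgen p x.1) * killV p (etaR p (vgen p x.2)) ^ p ^ x.1 =
        p * killV p (tgen p (n + 1)) := by
      rw [← sub_eq_zero]
      refine hreg' n _ ?_
      rw [mul_sub, h]; ring
    have hmem : (0, n) ∈ antidiagonal n := mem_antidiagonal.2 (zero_add n)
    rw [← Finset.add_sum_erase _ _ hmem] at h'
    have h2 : (p : MvPolynomial ℕ (ZLoc p)) ∣ ∑ x ∈ (antidiagonal n).erase (0, n),
        killV p (tgen p x.1) * killV p (etaR p (vgen p x.2)) ^ p ^ x.1 := by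
      refine Finset.dvd_sum fun x hx => Dvd.dvd.mul_left (dvd_pow (ih x.2 ?_) ?_) _
      · obtain ⟨hne, hx⟩ := Finset.mem_erase.1 hx
        have hx' := mem_antidiagonal.1 hx
        rcases Nat.eq_zero_or_pos x.1 with h0 | h0
        · exact absurd (Prod.ext h0 (by omega : x.2 = n)) hne
        · omega
      · exact pow_ne_zero _ hp.out.ne_zero
    have h3 := (Dvd.intro _ rfl : (p : MvPolynomial ℕ (ZLoc p)) ∣ p * killV p (tgen p (n + 1)))
    rw [← h', dvd_add_left h2] at h3
    simpa [tgen] using h3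

/-- The extension of the augmentation ideal along the left unit. -/
abbrev leftIdeal : Ideal (BPBP p) := (augIdeal p).map (algebraMap (BP p) (BPBP p))

/-- The section of `killV`. -/
def constV : MvPolynomial ℕ (ZLoc p) →+* BPBP p :=
  (MvPolynomial.map (algebraMap (ZLoc p) (BP p)) : _ →+* MvPolynomial ℕ (BP p))

lemma sub_killV_mem (f : BPBP p) : f - constV p (killV p f) ∈ leftIdeal p := by
  let s := constV p
  have hs : ∀ i, s (MvPolynomial.X i) = tgen p (i + 1) := fun i => MvPolynomial.map_X _ i
  have key : Ideal.Quotient.mk (leftIdeal p) =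
      (Ideal.Quotient.mk (leftIdeal p)).comp (s.comp (killV p)) := by
    have hL : (Ideal.Quotient.mk (leftIdeal p)).comp (algebraMap (BP p) (BPBP p)) =
        ((Ideal.Quotient.mk (leftIdeal p)).comp (s.comp (killV p))).comp
          (algebraMap (BP p) (BPBP p)) := by
      refine MvPolynomial.ringHom_ext (fun r => ?_) fun i => ?_
      · exact RingHom.congr_fun (zloc_hom_ext p
          (((Ideal.Quotient.mk (leftIdeal p)).comp (algebraMap (BP p) (BPBP p))).comp
            (algebraMap (ZLoc p) (BP p)))
          ((((Ideal.Quotient.mk (leftIdeal p)).comp (s.comp (killV p))).comp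
            (algebraMap (BP p) (BPBP p))).comp (algebraMap (ZLoc p) (BP p)))) r
      · change Ideal.Quotient.mk (leftIdeal p) (vL p i) =
          Ideal.Quotient.mk (leftIdeal p) (s (killV p (vL p i)))
        have e : killV p (vL p i) = 0 := (BPBP.lift_left p _ _ _).trans (BP.lift_vgen p _ _ i)
        rw [e, map_zero, map_zero, Ideal.Quotient.eq_zero_iff_mem]
        exact Ideal.mem_map_of_mem _ (vseq_mem_augIdeal p (i + 1))
    refine MvPolynomial.ringHom_ext (RingHom.congr_fun hL) fun i => ?_
    change Ideal.Quotient.mk (leftIdeal p) (tgen p (i + 1)) =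
      Ideal.Quotient.mk (leftIdeal p) (s (killV p (tgen p (i + 1))))
    have e : killV p (tgen p (i + 1)) = MvPolynomial.X i := BPBP.lift_tgen p _ _ i
    rw [e, hs]
  exact Ideal.Quotient.eq.1 (RingHom.congr_fun key f)

lemma etaR_vseq_mem (i : ℕ) : etaR p (vseq p i) ∈ leftIdeal p := by
  have hp' : (p : BPBP p) ∈ leftIdeal p := by
    have := Ideal.mem_map_of_mem (algebraMap (BP p) (BPBP p)) (vseq_mem_augIdeal p 0)
    rwa [vseq, map_natCast] at this
  cases i with
  | zero => rwa [vseq, map_natCast]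
  | succ i =>
    obtain ⟨g, hg⟩ := dvd_killV_etaR p i
    have h := sub_killV_mem p (etaR p (vgen p i))
    rw [hg, map_mul, map_natCast] at h
    have h2 := Ideal.add_mem _ h (Ideal.mul_mem_right (constV p g) _ hp')
    rwa [sub_add_cancel] at h2

lemma isInvariant_augIdeal : IsInvariant (etaR p) (augIdeal p) := by
  have h : (augIdeal p).map (etaR p) ≤ leftIdeal p := by
    rw [augIdeal, Ideal.map_span, Ideal.span_le]
    rintro _ ⟨_, ⟨i, rfl⟩, rfl⟩
    exact etaR_vseq_mem p i
  refine le_antisymm h ?_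
  have e1 : (conjBP p).comp (etaR p) = algebraMap (BP p) (BPBP p) := RingHom.ext (conjBP_right p)
  have e2 : (conjBP p).comp (algebraMap (BP p) (BPBP p)) = etaR p := RingHom.ext (conjBP_left p)
  have := Ideal.map_mono (f := conjBP p) h
  rwa [Ideal.map_map, Ideal.map_map, e1, e2] at this

end Invariance

end

section Components

/-- If an ideal is generated by elements `y j` such that multiplication by `y j` shifts homogeneous
components, then homogeneous elements of the ideal have homogeneous coefficients. -/
lemma exists_homogeneous_coeff {S : Type*} [CommRing S] {Sgr : ℤ → AddSubgroup S}
    (pr : ℤ → S →+ S) (hmem : ∀ k x, pr k x ∈ Sgr k) (hid : ∀ k x, x ∈ Sgr k → pr k x = x)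
    (y : ℕ → S) (e : ℕ → ℤ) (hy : ∀ k j x, pr k (x * y j) = pr (k - e j) x * y j) {k : ℤ} {x : S}
    (hx : x ∈ Ideal.span (Set.range y)) (hk : x ∈ Sgr k) :
    ∃ c : ℕ →₀ S, (∀ j, c j ∈ Sgr (k - e j)) ∧ x = c.sum fun j g => g * y j := by
  classical
  obtain ⟨c, hc⟩ := Finsupp.mem_span_range_iff_exists_finsupp.1 hx
  refine ⟨Finsupp.onFinset c.support (fun j => pr (k - e j) (c j)) fun j hj => ?_, fun j => ?_, ?_⟩
  · rw [Finsupp.mem_support_iff]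
    intro h
    exact hj (by rw [h, map_zero])
  · exact hmem _ _
  · rw [Finsupp.onFinset_sum _ (fun j => zero_mul _), ← hid k x hk, ← hc, Finsupp.sum, map_sum]
    refine Finset.sum_congr rfl fun j _ => ?_
    rw [smul_eq_mul, hy]

variable (p : ℕ) {R : Type*} [CommRing R]

/-- Homogeneous components in a polynomial ring over a graded ring. -/
def polyProjFun (pr : ℤ → R →+ R) (k : ℤ) (f : MvPolynomial ℕ R) : MvPolynomial ℕ R :=
  ∑ α ∈ f.support, MvPolynomial.monomial α (pr (k - Finsupp.weight (genDeg p) α) (f.coeff α))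

lemma coeff_polyProjFun (pr : ℤ → R →+ R) (k : ℤ) (f : MvPolynomial ℕ R) (α : ℕ →₀ ℕ) :
    (polyProjFun p pr k f).coeff α = pr (k - Finsupp.weight (genDeg p) α) (f.coeff α) := by
  classical
  rw [polyProjFun, MvPolynomial.coeff_sum]
  simp only [MvPolynomial.coeff_monomial]
  rw [Finset.sum_ite_eq']
  split_ifs with h
  · rfl
  · rw [MvPolynomial.notMem_support_iff.1 h, map_zero]

/-- Homogeneous components in a polynomial ring over a graded ring, as additive maps. -/
def polyProj (pr : ℤ → R →+ R) (k : ℤ) : MvPolynomial ℕ R →+ MvPolynomial ℕ R where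
  toFun := polyProjFun p pr k
  map_zero' := by
    ext α
    rw [coeff_polyProjFun, MvPolynomial.coeff_zero, map_zero]
  map_add' f g := by
    ext α
    simp only [coeff_polyProjFun, MvPolynomial.coeff_add, map_add]

variable {p}

lemma coeff_polyProj (pr : ℤ → R →+ R) (k : ℤ) (f : MvPolynomial ℕ R) (α : ℕ →₀ ℕ) :
    MvPolynomial.coeff α (polyProj p pr k f) =
      pr (k - Finsupp.weight (genDeg p) α) (MvPolynomial.coeff α f) := coeff_polyProjFun p pr k f α

lemma polyProj_mem {Rgr : ℤ → AddSubgroup R} {pr : ℤ → R →+ R} (h : ∀ k x, pr k x ∈ Rgr k) (k : ℤ)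
    (f : MvPolynomial ℕ R) : polyProj p pr k f ∈ polyGr p Rgr k := fun _ => by
  rw [coeff_polyProj]
  exact h _ _

lemma polyProj_of_mem {Rgr : ℤ → AddSubgroup R} {pr : ℤ → R →+ R}
    (h : ∀ k x, x ∈ Rgr k → pr k x = x) (k : ℤ)
    (f : MvPolynomial ℕ R) (hf : f ∈ polyGr p Rgr k) : polyProj p pr k f = f := by
  ext α
  rw [coeff_polyProj]
  exact h _ _ (hf α)

lemma polyProj_mul_C {pr : ℤ → R →+ R} {y : R} {e : ℤ} (hy : ∀ k x, pr k (x * y) = pr (k - e) x * y)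
    (k : ℤ) (f : MvPolynomial ℕ R) :
    polyProj p pr k (f * MvPolynomial.C y) = polyProj p pr (k - e) f * MvPolynomial.C y := by
  ext α
  rw [mul_comm, mul_comm _ (MvPolynomial.C y), coeff_polyProj, MvPolynomial.coeff_C_mul,
    MvPolynomial.coeff_C_mul, coeff_polyProj, mul_comm, hy, sub_right_comm, mul_comm]

lemma polyProj_mul_X (pr : ℤ → R →+ R) (i : ℕ) (k : ℤ) (f : MvPolynomial ℕ R) :
    polyProj p pr k (f * MvPolynomial.X i) =
      polyProj p pr (k - genDeg p i) f * MvPolynomial.X i := by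
  classical
  ext α
  rw [coeff_polyProj, MvPolynomial.coeff_mul_X', MvPolynomial.coeff_mul_X', coeff_polyProj]
  split_ifs with h
  · have e : Finsupp.weight (genDeg p) α =
        Finsupp.weight (genDeg p) (α - Finsupp.single i 1) + genDeg p i := by
      conv_lhs => rw [← Finsupp.sub_add_single_one_cancel (Finsupp.mem_support_iff.1 h)]
      rw [map_add, Finsupp.weight_single, one_smul]
    rw [e, sub_add_eq_sub_sub_swap]
  · exact map_zero _

variable (p) [hp : Fact p.Prime]

/-- Homogeneous components in `ℤ_(p)`. -/
def zlocProj (k : ℤ) : ZLoc p →+ ZLoc p := if k = 0 then AddMonoidHom.id _ else 0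

lemma zlocProj_mem (k : ℤ) (x : ZLoc p) : zlocProj p k x ∈ zlocGr p k := by
  unfold zlocProj zlocGr
  split_ifs
  · trivial
  · exact AddSubgroup.zero_mem _

lemma zlocProj_of_mem (k : ℤ) (x : ZLoc p) (hx : x ∈ zlocGr p k) : zlocProj p k x = x := by
  unfold zlocProj
  split_ifs with h
  · rfl
  · rw [mem_zlocGr] at hx
    by_contra hx'
    exact h (hx fun h0 => hx' (by rw [h0, map_zero]))

/-- Homogeneous components in `BP_{2*}`. -/
def bpProj (k : ℤ) : BP p →+ BP p := polyProj p (zlocProj p) k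

lemma bpProj_mem (k : ℤ) (x : BP p) : bpProj p k x ∈ bpGr p k := by
  rw [bpGr_eq]
  exact polyProj_mem (zlocProj_mem p) k x

lemma bpProj_of_mem (k : ℤ) (x : BP p) (hx : x ∈ bpGr p k) : bpProj p k x = x := by
  rw [bpGr_eq] at hx
  exact polyProj_of_mem (zlocProj_of_mem p) k x hx

lemma bpProj_mul_vseq (k : ℤ) (j : ℕ) (x : BP p) :
    bpProj p k (x * vseq p j) = bpProj p (k - vdeg p j) x * vseq p j := by
  cases j with
  | zero =>
    change bpProj p k (x * (p : BP p)) = bpProj p (k - vdeg p 0) x * (p : BP p)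
    have e : k - vdeg p 0 = k := by simp [vdeg]
    rw [e, mul_comm, mul_comm _ (p : BP p), ← nsmul_eq_mul, ← nsmul_eq_mul, map_nsmul]
  | succ j => exact polyProj_mul_X (zlocProj p) j k x

/-- Homogeneous components in `BP_{2*}BP`. -/
def bpbpProj (k : ℤ) : BPBP p →+ BPBP p := polyProj p (bpProj p) k

lemma exists_homogeneous_coeff_etaR (n : ℕ) : ∃ c : ℕ →₀ BPBP p,
    (∀ j, c j ∈ bpbpGr p (vdeg p n - vdeg p j)) ∧
      etaR p (vseq p n) = c.sum fun j g => g * algebraMap (BP p) (BPBP p) (vseq p j) := by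
  refine exists_homogeneous_coeff (bpbpProj p) (fun k x => ?_) (fun k x hx => ?_) _ (vdeg p)
    (fun k j x => polyProj_mul_C (fun k x => bpProj_mul_vseq p k j x) k x) ?_
    (etaR_mem p (vseq_mem p n))
  · rw [bpbpGr_eq]
    exact polyProj_mem (bpProj_mem p) k x
  · rw [bpbpGr_eq] at hx
    exact polyProj_of_mem (bpProj_of_mem p) k x hx
  · have h := etaR_vseq_mem p n
    rwa [leftIdeal, augIdeal, Ideal.map_span, ← Set.range_comp] at h

end Components

section Regular

variable (p : ℕ) [hp : Fact p.Prime]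

/-- The ideal generated by the first `n` elements of `p, v_1, v_2, …`. -/
def initIdeal {A : Type} [CommRing A] (x : ℕ → A) (n : ℕ) : Ideal A := Ideal.span {a | ∃ i < n, x i = a}

lemma mem_initIdeal_vseq (n : ℕ) (f : BP p) : f ∈ initIdeal (vseq p) (n + 1) ↔
    ∀ α : ℕ →₀ ℕ, (∀ i < n, α i = 0) →
      (p : ZLoc p) ∣ MvPolynomial.coeff α (f : MvPolynomial ℕ (ZLoc p)) := by
  classical
  constructor
  · intro hf
    refine Submodule.span_induction (p := fun (f : BP p) _ => ∀ α : ℕ →₀ ℕ, (∀ i < n, α i = 0) →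
      (p : ZLoc p) ∣ MvPolynomial.coeff α (f : MvPolynomial ℕ (ZLoc p))) ?_ ?_ ?_ ?_ hf
    · rintro _ ⟨i, hi, rfl⟩ α hα
      cases i with
      | zero =>
        have e : MvPolynomial.coeff α (vseq p 0 : MvPolynomial ℕ (ZLoc p)) =
            MvPolynomial.coeff α (MvPolynomial.C (p : ZLoc p)) :=
          congrArg _ (map_natCast MvPolynomial.C p).symm
        rw [e, MvPolynomial.coeff_C]
        split_ifs
        · exact dvd_rfl
        · exact dvd_zero _
      | succ i =>
        change _ ∣ MvPolynomial.coeff α (MvPolynomial.X i : MvPolynomial ℕ (ZLoc p))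
        rw [MvPolynomial.coeff_X, if_neg]
        · exact dvd_zero _
        · rintro rfl
          have := hα i (by omega)
          simp at this
    · intro α _
      exact dvd_zero _
    · intro f g _ _ hf hg α hα
      exact dvd_add (hf α hα) (hg α hα)
    · intro a f _ hf α hα
      have e : MvPolynomial.coeff α (show MvPolynomial ℕ (ZLoc p) from a • f) =
          MvPolynomial.coeff α ((show MvPolynomial ℕ (ZLoc p) from a) * (show MvPolynomial ℕ (ZLoc p) from f)) := rfl
      rw [e, MvPolynomial.coeff_mul]
      refine Finset.dvd_sum fun x hx => Dvd.dvd.mul_left (hf x.2 fun i hi => ?_) _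
      have := DFunLike.congr_fun (Finset.HasAntidiagonal.mem_antidiagonal.1 hx) i
      rw [Finsupp.add_apply, hα i hi] at this
      omega
  · intro hf
    have e := MvPolynomial.support_sum_monomial_coeff (f : MvPolynomial ℕ (ZLoc p))
    refine (congrArg (· ∈ initIdeal (vseq p) (n + 1)) e).mp
      ((initIdeal (vseq p) (n + 1)).sum_mem fun α _ => ?_)
    by_cases hα : ∀ i < n, α i = 0
    · obtain ⟨c, hc⟩ := hf α hα
      have e : MvPolynomial.monomial α (MvPolynomial.coeff α (f : MvPolynomial ℕ (ZLoc p))) =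
          MvPolynomial.monomial α c * (p : MvPolynomial ℕ (ZLoc p)) := by
        rw [hc, ← MvPolynomial.C_mul_monomial, map_natCast MvPolynomial.C, mul_comm]
      rw [e]
      exact Ideal.mul_mem_left _ (MvPolynomial.monomial α c : BP p)
        (Ideal.subset_span ⟨0, Nat.succ_pos n, rfl⟩)
    · push Not at hα
      obtain ⟨i, hi, hαi⟩ := hα
      have e : MvPolynomial.monomial α (MvPolynomial.coeff α (f : MvPolynomial ℕ (ZLoc p))) =
          MvPolynomial.monomial (α - Finsupp.single i 1)
            (MvPolynomial.coeff α (f : MvPolynomial ℕ (ZLoc p))) * MvPolynomial.X i := by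
        rw [MvPolynomial.X, MvPolynomial.monomial_mul, mul_one,
          Finsupp.sub_add_single_one_cancel hαi]
      rw [e]
      exact Ideal.mul_mem_left _ (MvPolynomial.monomial (α - Finsupp.single i 1)
        (MvPolynomial.coeff α (f : MvPolynomial ℕ (ZLoc p))) : BP p)
        (Ideal.subset_span ⟨i + 1, by omega, rfl⟩)

/-- The sequence `p, v_1, v_2, …` is regular. -/
lemma vseq_regular (n : ℕ) (a : BP p) (ha : vseq p n * a ∈ initIdeal (vseq p) n) :
    a ∈ initIdeal (vseq p) n := by
  cases n with
  | zero =>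
    have h0 : initIdeal (vseq p) 0 = ⊥ := by
      refine (Submodule.eq_bot_iff _).2 fun x hx => ?_
      refine Submodule.span_induction (p := fun x _ => x = 0) ?_ rfl ?_ ?_ hx
      · rintro _ ⟨i, hi, -⟩
        omega
      · rintro _ _ _ _ rfl rfl
        exact add_zero _
      · rintro a _ _ rfl
        exact smul_zero _
    rw [h0, Ideal.mem_bot] at ha ⊢
    refine (mul_eq_zero.1 ha).resolve_left ?_
    change (p : BP p) ≠ 0
    exact_mod_cast hp.out.ne_zero
  | succ n =>
    rw [mem_initIdeal_vseq] at ha ⊢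
    intro α hα
    have := ha (Finsupp.single n 1 + α) fun i hi => by
      rw [Finsupp.add_apply, hα i hi, Finsupp.single_eq_of_ne (by omega)]
    have e : MvPolynomial.coeff (Finsupp.single n 1 + α)
        ((MvPolynomial.X n : MvPolynomial ℕ (ZLoc p)) * (show MvPolynomial ℕ (ZLoc p) from a)) =
          MvPolynomial.coeff α (show MvPolynomial ℕ (ZLoc p) from a) :=
      MvPolynomial.coeff_X_mul _ _ _
    rwa [← e]

lemma mem_smul_top_finsupp {A : Type} [CommRing A] (I : Ideal A) (ι : Type*) (f : ι →₀ A) :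
    f ∈ I • (⊤ : Submodule A (ι →₀ A)) ↔ ∀ i, f i ∈ I := by
  constructor
  · intro hf i
    refine Submodule.smul_induction_on (p := fun f => f i ∈ I) hf (fun a ha g _ => ?_)
      fun f g hf hg => I.add_mem hf hg
    rw [Finsupp.smul_apply, smul_eq_mul]
    exact I.mul_mem_right _ ha
  · intro hf
    rw [← Finsupp.sum_single f]
    refine Submodule.sum_mem _ fun i _ => ?_
    have e : Finsupp.single i (f i) = f i • Finsupp.single i (1 : A) := by
      rw [Finsupp.smul_single, smul_eq_mul, mul_one]
    change Finsupp.single i (f i) ∈ _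
    rw [e]
    exact Submodule.smul_mem_smul (hf i) trivial

end Regular

section KoszulDegree

variable {A : Type} [CommRing A]

/-- The projection of the Koszul complex to chain degree `q`. -/
def koszulProj (A : Type) [CommRing A] (q : ℕ) : Koszul A →ₗ[A] Koszul A :=
  GradedAlgebra.proj (fun i : ℕ => ⋀[A]^i (ℕ →₀ A)) q

lemma ι_mem_exteriorPower_one (v : ℕ →₀ A) :
    ExteriorAlgebra.ι A v ∈ (fun i : ℕ => ⋀[A]^i (ℕ →₀ A)) 1 := by
  change _ ∈ LinearMap.range (ExteriorAlgebra.ι A) ^ 1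
  rw [pow_one]
  exact LinearMap.mem_range_self _ _

lemma koszulProj_succ_mul (q i : ℕ) (z : Koszul A) :
    koszulProj A (q + 1) (koszulMul A i z) = koszulMul A i (koszulProj A q z) := by
  rw [add_comm]
  exact DirectSum.coe_decompose_mul_add_of_left_mem (fun i : ℕ => ⋀[A]^i (ℕ →₀ A))
    (ι_mem_exteriorPower_one _)

lemma koszulProj_zero_mul (i : ℕ) (z : Koszul A) : koszulProj A 0 (koszulMul A i z) = 0 :=
  DirectSum.coe_decompose_mul_of_left_mem_of_not_le (fun i : ℕ => ⋀[A]^i (ℕ →₀ A))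
    (ι_mem_exteriorPower_one _) (by omega)

lemma koszulProj_zero_one : koszulProj A 0 1 = 1 :=
  DirectSum.decompose_of_mem_same (fun i : ℕ => ⋀[A]^i (ℕ →₀ A)) (SetLike.GradedOne.one_mem)

lemma koszulProj_succ_one (q : ℕ) : koszulProj A (q + 1) 1 = 0 :=
  DirectSum.decompose_of_mem_ne (fun i : ℕ => ⋀[A]^i (ℕ →₀ A)) (SetLike.GradedOne.one_mem)
    (by omega)

lemma koszul_lin_ext {P : Type*} [AddCommGroup P] [Module A P] {f g : Koszul A →ₗ[A] P}
    (h : ∀ l, f (koszulProd A l) = g (koszulProd A l)) : f = g :=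
  LinearMap.ext_on_range koszulProd_span h

lemma koszulProj_prod (l : List ℕ) : koszulProj A l.length (koszulProd A l) = koszulProd A l := by
  induction l with
  | nil => exact koszulProj_zero_one
  | cons i l ih => rw [← koszulMul_prod, List.length_cons, koszulProj_succ_mul, ih]

lemma koszulProj_prod_ne (l : List ℕ) {q : ℕ} (h : l.length ≠ q) :
    koszulProj A q (koszulProd A l) = 0 := by
  induction l generalizing q with
  | nil =>
    cases q with
    | zero => exact absurd rfl h
    | succ q => exact koszulProj_succ_one q
  | cons i l ih =>
    rw [← koszulMul_prod]
    cases q with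
    | zero => exact koszulProj_zero_mul _ _
    | succ q => rw [koszulProj_succ_mul, ih (by simpa using h), map_zero]

lemma koszulProj_proj (q : ℕ) : koszulProj A q ∘ₗ koszulProj A q = koszulProj A q := by
  refine koszul_lin_ext fun l => ?_
  rw [LinearMap.comp_apply]
  by_cases h : l.length = q
  · subst h
    rw [koszulProj_prod, koszulProj_prod]
  · rw [koszulProj_prod_ne l h, map_zero]

lemma koszulD_one (x : ℕ → A) : koszulD x 1 = 0 :=
  CliffordAlgebra.contractLeft_one (Q := (0 : QuadraticForm A (ℕ →₀ A))) _

lemma koszulD_proj (x : ℕ → A) (q : ℕ) :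
    koszulD x ∘ₗ koszulProj A (q + 1) = koszulProj A q ∘ₗ koszulD x := by
  refine koszul_lin_ext fun l => ?_
  rw [LinearMap.comp_apply, LinearMap.comp_apply]
  induction l generalizing q with
  | nil => rw [koszulProd_nil, koszulProj_succ_one, koszulD_one, map_zero, map_zero]
  | cons i l ih =>
    rw [← koszulMul_prod, koszulProj_succ_mul, koszulD_mul, koszulD_mul, map_sub, map_smul]
    congr 1
    cases q with
    | zero =>
      rw [koszulProj_zero_mul]
      by_cases h : l.length = 0
      · rw [List.length_eq_zero_iff.1 h, koszulProd_nil, koszulProj_zero_one, koszulD_one, map_zero]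
      · rw [koszulProj_prod_ne l h, map_zero, map_zero]
    | succ q => rw [ih, koszulProj_succ_mul]

lemma koszulAug_mul (i : ℕ) (z : Koszul A) : koszulAug A (koszulMul A i z) = 0 := by
  have : koszulAug A ∘ₗ koszulMul A i = 0 := koszul_lin_ext fun l => by
    rw [LinearMap.comp_apply, koszulMul_prod, koszulAug_cons, LinearMap.zero_apply]
  exact LinearMap.congr_fun this z

lemma koszulAug_proj_succ (q : ℕ) : koszulAug A ∘ₗ koszulProj A (q + 1) = 0 := by
  refine koszul_lin_ext fun l => ?_
  rw [LinearMap.comp_apply, LinearMap.zero_apply]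
  cases l with
  | nil => rw [koszulProd_nil, koszulProj_succ_one, map_zero]
  | cons i l => rw [← koszulMul_prod, koszulProj_succ_mul, koszulAug_mul]

lemma koszulProj_zero (z : Koszul A) : koszulProj A 0 z = koszulAug A z • 1 := by
  have : koszulProj A 0 = (koszulAug A).smulRight 1 := koszul_lin_ext fun l => by
    cases l with
    | nil => rw [koszulProd_nil, koszulProj_zero_one, LinearMap.smulRight_apply, koszulAug_one, one_smul]
    | cons i l =>
      rw [LinearMap.smulRight_apply, koszulAug_cons, zero_smul, ← koszulMul_prod, koszulProj_zero_mul]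
  exact LinearMap.congr_fun this z

lemma koszulAug_D_mem (x : ℕ → A) (n : ℕ) {z : Koszul A} (hz : z ∈ koszulSub A n) :
    koszulAug A (koszulD x z) ∈ initIdeal x n := by
  have : koszulSub A n ≤ Submodule.comap (koszulAug A ∘ₗ koszulD x) (initIdeal x n) := by
    refine Submodule.span_le.2 ?_
    rintro _ ⟨l, hl, rfl⟩
    change koszulAug A (koszulD x (koszulProd A l)) ∈ initIdeal x n
    cases l with
    | nil => rw [koszulProd_nil, koszulD_one, map_zero]; exact Ideal.zero_mem _
    | cons i l =>
      rw [← koszulMul_prod, koszulD_mul, map_sub, koszulAug_mul, sub_zero, map_smul]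
      exact Ideal.mul_mem_right _ _ (Ideal.subset_span ⟨i, hl i List.mem_cons_self, rfl⟩)
  exact this hz

end KoszulDegree

section Coefficients

variable {A : Type} [CommRing A] {M : Type u} [AddCommGroup M] [Module A M]
  {N : Type u} [AddCommGroup N] [Module A N]

/-- The coefficients of an element of `M ⊗ K`, up to sign. -/
def tensorCoef (M : Type u) [AddCommGroup M] [Module A M] : List ℕ → M ⊗[A] Koszul A →ₗ[A] M
  | [] => tensorAug M
  | i :: l => tensorCoef M l ∘ₗ (koszulDer A i).lTensor M

lemma tensorAug_rTensor (f : M →ₗ[A] N) (z : M ⊗[A] Koszul A) :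
    tensorAug N (f.rTensor _ z) = f (tensorAug M z) := by
  induction z using TensorProduct.induction_on with
  | zero => simp only [map_zero]
  | add y z hy hz => simp only [map_add, hy, hz]
  | tmul m κ => rw [LinearMap.rTensor_tmul, tensorAug_tmul, tensorAug_tmul, map_smul]

lemma lTensor_rTensor (f : M →ₗ[A] N) (g : Koszul A →ₗ[A] Koszul A) (z : M ⊗[A] Koszul A) :
    g.lTensor N (f.rTensor _ z) = f.rTensor _ (g.lTensor M z) := by
  rw [← LinearMap.comp_apply, ← LinearMap.comp_apply, LinearMap.lTensor_comp_rTensor,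
    LinearMap.rTensor_comp_lTensor]

lemma tensorCoef_rTensor (f : M →ₗ[A] N) (l : List ℕ) (z : M ⊗[A] Koszul A) :
    tensorCoef N l (f.rTensor _ z) = f (tensorCoef M l z) := by
  induction l generalizing z with
  | nil => exact tensorAug_rTensor f z
  | cons i l ih =>
    exact (congrArg (tensorCoef N l) (lTensor_rTensor f _ z)).trans (ih _)

lemma lTensor_der_mem {n : ℕ} {z : M ⊗[A] Koszul A} (hz : z ∈ tensorSub M (koszulSub A (n + 1))) :
    (koszulDer A n).lTensor M z ∈ tensorSub M (koszulSub A n) ∧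
      z - (koszulMul A n).lTensor M ((koszulDer A n).lTensor M z) ∈ tensorSub M (koszulSub A n) := by
  constructor
  · exact map_mem_of_tensorSub ((koszulDer A n).lTensor M).toAddMonoidHom _ (fun m κ hκ =>
      tmul_mem_tensorSub m (koszulDer_mem_sub hκ).1) hz
  · refine map_mem_of_tensorSub (LinearMap.id - (koszulMul A n).lTensor M ∘ₗ
      (koszulDer A n).lTensor M).toAddMonoidHom _ (fun m κ hκ => ?_) hz
    have := tmul_mem_tensorSub m (koszulDer_mem_sub hκ).2
    rw [TensorProduct.tmul_sub] at this
    exact this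

lemma lTensor_mul_mem {n : ℕ} {z : M ⊗[A] Koszul A} (hz : z ∈ tensorSub M (koszulSub A n)) :
    (koszulMul A n).lTensor M z ∈ tensorSub M (koszulSub A (n + 1)) :=
  map_mem_of_tensorSub ((koszulMul A n).lTensor M).toAddMonoidHom _ (fun m _ hκ =>
    tmul_mem_tensorSub m (koszulMul_mem_sub (Nat.lt_succ_self n)
      (koszulSub_mono (Nat.le_succ n) hκ))) hz

lemma tensorSub_mono {n m : ℕ} (h : n ≤ m) :
    tensorSub M (koszulSub A n) ≤ tensorSub M (koszulSub A m) :=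
  AddSubgroup.closure_mono fun _ ⟨y, κ, hκ, e⟩ => ⟨y, κ, koszulSub_mono h hκ, e⟩

/-- An element of `M ⊗ K` all of whose coefficients vanish is zero. -/
lemma eq_zero_of_tensorCoef {z : M ⊗[A] Koszul A} (h : ∀ l, tensorCoef M l z = 0) : z = 0 := by
  obtain ⟨n, hn⟩ := exists_mem_tensorSub z
  induction n generalizing z with
  | zero =>
    have e := eq_tensorAug hn
    have h0 : tensorAug M z = 0 := h []
    rw [e, h0, TensorProduct.zero_tmul]
  | succ n ih =>
    obtain ⟨h1, h2⟩ := lTensor_der_mem hn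
    have e := ih (fun l => h (n :: l)) h1
    rw [e, map_zero, sub_zero] at h2
    exact ih h h2

/-- The Koszul complex is flat. -/
lemma rTensor_koszul_injective {f : M →ₗ[A] N} (hf : Function.Injective f) :
    Function.Injective (f.rTensor (Koszul A)) := by
  rw [← LinearMap.ker_eq_bot, LinearMap.ker_eq_bot']
  intro z hz
  refine eq_zero_of_tensorCoef fun l => hf ?_
  rw [← tensorCoef_rTensor, hz, map_zero, map_zero]

end Coefficients

section Acyclicity

variable {A : Type} [CommRing A] (x : ℕ → A) {M : Type u} [AddCommGroup M] [Module A M]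

lemma lTensor_D_mul (n : ℕ) (z : M ⊗[A] Koszul A) :
    (koszulD x).lTensor M ((koszulMul A n).lTensor M z) =
      x n • z - (koszulMul A n).lTensor M ((koszulD x).lTensor M z) := by
  have e : koszulD x ∘ₗ koszulMul A n = x n • LinearMap.id - koszulMul A n ∘ₗ koszulD x :=
    LinearMap.ext fun z => koszulD_mul x n z
  have := congrArg (fun f => LinearMap.lTensor M f z) e
  simp only [LinearMap.lTensor_comp, LinearMap.lTensor_sub, LinearMap.lTensor_smul,
    LinearMap.lTensor_id] at this
  exact this

lemma lTensor_D_der (n : ℕ) (z : M ⊗[A] Koszul A) :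
    (koszulD x).lTensor M ((koszulDer A n).lTensor M z) =
      -(koszulDer A n).lTensor M ((koszulD x).lTensor M z) := by
  have e : koszulD x ∘ₗ koszulDer A n = -(koszulDer A n ∘ₗ koszulD x) :=
    LinearMap.ext fun z => koszulD_der x n z
  have := congrArg (fun f => LinearMap.lTensor M f z) e
  simp only [LinearMap.lTensor_comp, LinearMap.lTensor_neg] at this
  exact this

lemma lTensor_D_one (m : M) : (koszulD x).lTensor M (m ⊗ₜ 1) = 0 := by
  rw [LinearMap.lTensor_tmul, koszulD_one, TensorProduct.tmul_zero]

lemma tensorAug_D_mem {n : ℕ} {z : M ⊗[A] Koszul A} (hz : z ∈ tensorSub M (koszulSub A n)) :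
    tensorAug M ((koszulD x).lTensor M z) ∈ initIdeal x n • (⊤ : Submodule A M) := by
  refine map_mem_of_tensorSub (tensorAug M ∘ₗ (koszulD x).lTensor M).toAddMonoidHom
    (initIdeal x n • (⊤ : Submodule A M)).toAddSubgroup (fun m κ hκ => ?_) hz
  change tensorAug M (m ⊗ₜ koszulD x κ) ∈ initIdeal x n • (⊤ : Submodule A M)
  rw [tensorAug_tmul]
  exact Submodule.smul_mem_smul (koszulAug_D_mem x n hκ) trivial

lemma tensorAug_mul (n : ℕ) (z : M ⊗[A] Koszul A) :
    tensorAug M ((koszulMul A n).lTensor M z) = 0 := by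
  induction z using TensorProduct.induction_on with
  | zero => simp only [map_zero]
  | add y z hy hz => simp only [map_add, hy, hz, add_zero]
  | tmul m κ => rw [LinearMap.lTensor_tmul, tensorAug_tmul, koszulAug_mul, zero_smul]

lemma exists_of_mem_initIdeal_succ {n : ℕ} {m : M}
    (hm : m ∈ initIdeal x (n + 1) • (⊤ : Submodule A M)) :
    ∃ m₀ ∈ initIdeal x n • (⊤ : Submodule A M), ∃ m₁, m = m₀ + x n • m₁ := by
  have e : initIdeal x (n + 1) = initIdeal x n ⊔ Ideal.span {x n} := by
    rw [initIdeal, initIdeal, ← Ideal.span_union]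
    congr 1
    ext a
    constructor
    · rintro ⟨i, hi, rfl⟩
      rcases Nat.lt_succ_iff_lt_or_eq.1 hi with h | rfl
      · exact Or.inl ⟨i, h, rfl⟩
      · exact Or.inr rfl
    · rintro (⟨i, hi, rfl⟩ | rfl)
      · exact ⟨i, by omega, rfl⟩
      · exact ⟨n, by omega, rfl⟩
  rw [e, Submodule.sup_smul, Submodule.mem_sup] at hm
  obtain ⟨m₀, h₀, m', h', rfl⟩ := hm
  rw [Submodule.ideal_span_singleton_smul] at h'
  obtain ⟨m₁, -, rfl⟩ := h'
  exact ⟨m₀, h₀, m₁, rfl⟩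

lemma koszul_acyclic_sub
    (hreg : ∀ n (m : M), x n • m ∈ initIdeal x n • (⊤ : Submodule A M) →
      m ∈ initIdeal x n • (⊤ : Submodule A M)) (n : ℕ) (u : M ⊗[A] Koszul A)
    (hu : u ∈ tensorSub M (koszulSub A n)) (hd : (koszulD x).lTensor M u = 0)
    (ha : tensorAug M u ∈ initIdeal x n • (⊤ : Submodule A M)) :
    ∃ w ∈ tensorSub M (koszulSub A n), (koszulD x).lTensor M w = u := by
  induction n generalizing u with
  | zero =>
    have h0 : initIdeal x 0 = ⊥ := by
      have : {a | ∃ i < 0, x i = a} = (∅ : Set A) := by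
        ext a
        simp
      rw [initIdeal, this, Ideal.span_empty]
    rw [h0, Submodule.bot_smul, Submodule.mem_bot] at ha
    have e := eq_tensorAug hu
    rw [ha, TensorProduct.zero_tmul] at e
    exact ⟨0, AddSubgroup.zero_mem _, by rw [map_zero, e]⟩
  | succ n ih =>
    obtain ⟨hb, hc⟩ := lTensor_der_mem hu
    set b := (koszulDer A n).lTensor M u with hbdef
    have hDb : (koszulD x).lTensor M b = 0 := by
      rw [hbdef, lTensor_D_der, hd, map_zero, neg_zero]
    have hDc : (koszulD x).lTensor M (u - (koszulMul A n).lTensor M b) = -(x n • b) := by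
      rw [map_sub, hd, lTensor_D_mul, hDb, map_zero, sub_zero, zero_sub]
    have hba : tensorAug M b ∈ initIdeal x n • (⊤ : Submodule A M) := by
      refine hreg n _ ?_
      have := tensorAug_D_mem x hc
      rw [hDc, map_neg, map_smul] at this
      exact neg_mem_iff.1 this
    obtain ⟨w, hw, hDw⟩ := ih b hb hDb hba
    have hu₁ : tensorAug M (u + (koszulD x).lTensor M ((koszulMul A n).lTensor M w)) ∈
        initIdeal x (n + 1) • (⊤ : Submodule A M) := by
      rw [lTensor_D_mul, map_add, map_sub, tensorAug_mul, sub_zero, map_smul]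
      exact Submodule.add_mem _ ha
        (Submodule.smul_mem_smul (Ideal.subset_span ⟨n, Nat.lt_succ_self n, rfl⟩) trivial)
    obtain ⟨m₀, hm₀, m₁, hm⟩ := exists_of_mem_initIdeal_succ x hu₁
    have h1 : m₁ ⊗ₜ[A] 1 ∈ tensorSub M (koszulSub A n) :=
      tmul_mem_tensorSub m₁ (Submodule.subset_span ⟨[], by simp, rfl⟩)
    have hsmul : ∀ z ∈ tensorSub M (koszulSub A n), x n • z ∈ tensorSub M (koszulSub A n) :=
      fun z hz => map_mem_of_tensorSub (x n • LinearMap.id : M ⊗[A] Koszul A →ₗ[A] _).toAddMonoidHom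
        _ (fun m κ hκ => tmul_mem_tensorSub (x n • m) hκ) hz
    have e : u + (koszulD x).lTensor M ((koszulMul A n).lTensor M w) -
        (koszulD x).lTensor M ((koszulMul A n).lTensor M (m₁ ⊗ₜ 1)) =
        u - (koszulMul A n).lTensor M b + x n • w - x n • (m₁ ⊗ₜ[A] 1) := by
      rw [lTensor_D_mul, lTensor_D_mul, hDw, lTensor_D_one, map_zero, sub_zero]
      abel
    have hdd : ∀ z : M ⊗[A] Koszul A,
        (koszulD x).lTensor M ((koszulD x).lTensor M ((koszulMul A n).lTensor M z)) = 0 := fun z => by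
      have h2 : koszulD x ∘ₗ koszulD x = 0 := LinearMap.ext fun z =>
        CliffordAlgebra.contractLeft_contractLeft (Q := (0 : QuadraticForm A (ℕ →₀ A))) _ z
      rw [← LinearMap.comp_apply, ← LinearMap.lTensor_comp, h2, LinearMap.lTensor_zero,
        LinearMap.zero_apply]
    obtain ⟨w₂, hw₂, hDw₂⟩ := ih _ (e ▸ AddSubgroup.sub_mem _ (AddSubgroup.add_mem _ hc (hsmul w hw))
      (hsmul _ h1)) (by rw [map_sub, map_add, hd, hdd, hdd, add_zero, sub_zero])
      (by
        rw [map_sub, hm, lTensor_D_mul, map_sub, tensorAug_mul, sub_zero, map_smul, tensorAug_tmul,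
          koszulAug_one, one_smul, add_sub_cancel_right]
        exact hm₀)
    refine ⟨w₂ - (koszulMul A n).lTensor M w + (koszulMul A n).lTensor M (m₁ ⊗ₜ 1),
      AddSubgroup.add_mem _ (AddSubgroup.sub_mem _ (tensorSub_mono (Nat.le_succ n) hw₂)
        (lTensor_mul_mem hw)) (lTensor_mul_mem h1), ?_⟩
    rw [map_add, map_sub, hDw₂]
    abel

/-- The Koszul complex of a sequence that is regular on `M` is acyclic in positive degrees. -/
theorem koszul_acyclic (hreg : ∀ n (m : M), x n • m ∈ initIdeal x n • (⊤ : Submodule A M) →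
      m ∈ initIdeal x n • (⊤ : Submodule A M)) (u : M ⊗[A] Koszul A)
    (hd : (koszulD x).lTensor M u = 0) (ha : tensorAug M u = 0) :
    ∃ w, (koszulD x).lTensor M w = u := by
  obtain ⟨n, hn⟩ := exists_mem_tensorSub u
  obtain ⟨w, -, hw⟩ := koszul_acyclic_sub x hreg n u hn hd (by rw [ha]; exact Submodule.zero_mem _)
  exact ⟨w, hw⟩

/-- Elements of `I M` bound in the Koszul complex. -/
lemma exists_D_eq_of_mem {m : M}
    (hm : m ∈ Ideal.span (Set.range x) • (⊤ : Submodule A M)) :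
    ∃ w, (koszulD x).lTensor M w = m ⊗ₜ 1 := by
  let S : Submodule A M := (LinearMap.range ((koszulD x).lTensor M)).comap
    ((TensorProduct.mk A M (Koszul A)).flip 1)
  have : Ideal.span (Set.range x) • (⊤ : Submodule A M) ≤ S := by
    refine Submodule.smul_le.2 fun a ha m _ => ?_
    refine Submodule.span_induction (p := fun a _ => a • m ∈ S) ?_ ?_ ?_ ?_ ha
    · rintro _ ⟨i, rfl⟩
      refine ⟨(koszulMul A i).lTensor M (m ⊗ₜ 1), ?_⟩
      rw [lTensor_D_mul, lTensor_D_one, map_zero, sub_zero]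
      rfl
    · rw [zero_smul]; exact S.zero_mem
    · intro a b _ _ ha hb
      rw [add_smul]; exact S.add_mem ha hb
    · intro c a _ ha
      rw [smul_assoc]; exact S.smul_mem c ha
  exact this hm

lemma initIdeal_le (n : ℕ) : initIdeal x n ≤ Ideal.span (Set.range x) :=
  Ideal.span_mono fun _ ⟨i, _, e⟩ => ⟨i, e⟩

lemma tensorAug_D_mem_span (z : M ⊗[A] Koszul A) :
    tensorAug M ((koszulD x).lTensor M z) ∈ Ideal.span (Set.range x) • (⊤ : Submodule A M) := by
  obtain ⟨n, hn⟩ := exists_mem_tensorSub z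
  exact Submodule.smul_mono_left (initIdeal_le x n) (tensorAug_D_mem x hn)

end Acyclicity

section Residue

variable {A : Type} [CommRing A] {I : Ideal A} {N : Type u} [AddCommGroup N] [Module A N]

/-- An element on which all functionals to the residue field vanish is divisible. -/
lemma mem_smul_top_of_functionals (hI : I.IsMaximal) (n : N)
    (h : ∀ g : N →ₗ[A] A ⧸ I, g n = 0) : n ∈ I • (⊤ : Submodule A N) := by
  let : Field (A ⧸ I) := Ideal.Quotient.field I
  rw [← Submodule.Quotient.mk_eq_zero]
  refine (Module.forall_dual_apply_eq_zero_iff (A ⧸ I) _).1 fun φ => ?_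
  exact h ((φ.restrictScalars A) ∘ₗ (I • (⊤ : Submodule A N)).mkQ)

lemma functional_eq_zero (g : N →ₗ[A] A ⧸ I) {n : N} (hn : n ∈ I • (⊤ : Submodule A N)) :
    g n = 0 := by
  refine Submodule.smul_induction_on (p := fun n => g n = 0) hn (fun a ha n _ => ?_)
    fun n m hn hm => by rw [map_add, hn, hm, add_zero]
  rw [map_smul, Algebra.smul_def, Ideal.Quotient.algebraMap_eq, Ideal.Quotient.eq_zero_iff_mem.2 ha,
    zero_mul]

end Residue

section Cover

variable {A : Type} [CommRing A] {M : Type u} [AddCommGroup M] [Module A M]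
  {N : Type u} [AddCommGroup N] [Module A N]

/-- The free cover of a module by its elements. -/
def freeCover (A : Type) [CommRing A] (M : Type u) [AddCommGroup M] [Module A M] :
    (M →₀ A) →ₗ[A] M := Finsupp.linearCombination A id

lemma freeCover_surjective : Function.Surjective (freeCover A M) :=
  Finsupp.linearCombination_id_surjective A M

/-- The map of free covers. -/
def freeCoverMap (f : M →ₗ[A] N) : (M →₀ A) →ₗ[A] (N →₀ A) := Finsupp.lmapDomain A A f

lemma freeCover_comp (f : M →ₗ[A] N) :
    freeCover A N ∘ₗ freeCoverMap f = f ∘ₗ freeCover A M := by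
  refine Finsupp.lhom_ext fun m a => ?_
  simp [freeCover, freeCoverMap, Finsupp.mapDomain_single]

/-- The kernel of the free cover. -/
def Syzygy (A : Type) [CommRing A] (M : Type u) [AddCommGroup M] [Module A M] : Type u :=
  LinearMap.ker (freeCover A M)

instance : AddCommGroup (Syzygy A M) := inferInstanceAs (AddCommGroup (LinearMap.ker (freeCover A M)))
instance : Module A (Syzygy A M) := inferInstanceAs (Module A (LinearMap.ker (freeCover A M)))

/-- The inclusion of the kernel of the free cover. -/
def syzygyIncl (A : Type) [CommRing A] (M : Type u) [AddCommGroup M] [Module A M] :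
    Syzygy A M →ₗ[A] (M →₀ A) := (LinearMap.ker (freeCover A M)).subtype

lemma syzygyIncl_injective : Function.Injective (syzygyIncl A M) :=
  (LinearMap.ker (freeCover A M)).injective_subtype

lemma syzygyIncl_exact : Function.Exact (syzygyIncl A M) (freeCover A M) :=
  LinearMap.exact_subtype_ker_map (freeCover A M)

/-- The map of kernels of free covers. -/
def syzygyMap (f : M →ₗ[A] N) : Syzygy A M →ₗ[A] Syzygy A N :=
  (freeCoverMap f).restrict (p := LinearMap.ker (freeCover A M)) (q := LinearMap.ker (freeCover A N))
    fun z hz => by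
      have := LinearMap.congr_fun (freeCover_comp f) z
      rw [LinearMap.comp_apply, LinearMap.comp_apply, LinearMap.mem_ker.1 hz, map_zero] at this
      exact this

lemma syzygyIncl_comp (f : M →ₗ[A] N) :
    syzygyIncl A N ∘ₗ syzygyMap f = freeCoverMap f ∘ₗ syzygyIncl A M := rfl

lemma rTensor_comp_eq {P Q : Type u} [AddCommGroup P] [Module A P] [AddCommGroup Q] [Module A Q]
    {f : M →ₗ[A] N} {g : N →ₗ[A] Q} {f' : M →ₗ[A] P} {g' : P →ₗ[A] Q} (h : g ∘ₗ f = g' ∘ₗ f')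
    (z : M ⊗[A] Koszul A) :
    g.rTensor _ (f.rTensor _ z) = g'.rTensor _ (f'.rTensor _ z) := by
  rw [← LinearMap.comp_apply, ← LinearMap.comp_apply, ← LinearMap.rTensor_comp,
    ← LinearMap.rTensor_comp, h]

lemma rTensor_cover_ker (z) : (freeCover A M).rTensor (Koszul A)
    ((syzygyIncl A M).rTensor _ z) = 0 := by
  have h : freeCover A M ∘ₗ (syzygyIncl A M) = 0 :=
    LinearMap.ext fun z => Subtype.prop (show LinearMap.ker (freeCover A M) from z)
  rw [← LinearMap.comp_apply, ← LinearMap.rTensor_comp, h, LinearMap.rTensor_zero,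
    LinearMap.zero_apply]

/-- Dimension shifting for Koszul cycles. -/
lemma exists_syzygy_cycle (x : ℕ → A)
    (hx : ∀ n a, x n * a ∈ initIdeal x n → a ∈ initIdeal x n) {q : ℕ} (f : M →ₗ[A] N)
    (z : M ⊗[A] Koszul A) (hz : (koszulProj A (q + 1)).lTensor M z = z)
    (hd : (koszulD x).lTensor M z = 0) :
    ∃ (y : Syzygy A M ⊗[A] Koszul A) (z' : (M →₀ A) ⊗[A] Koszul A),
      (koszulProj A q).lTensor _ y = y ∧ (koszulD x).lTensor _ y = 0 ∧
      (syzygyIncl A M).rTensor _ y = (koszulD x).lTensor _ z' ∧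
      ((∃ w, (koszulD x).lTensor _ w = (syzygyMap f).rTensor _ y) →
        ∃ v, (koszulD x).lTensor N v = f.rTensor _ z) := by
  obtain ⟨z₀, hz₀⟩ := LinearMap.rTensor_surjective (Koszul A) (freeCover_surjective (A := A) (M := M)) z
  set z' := (koszulProj A (q + 1)).lTensor _ z₀ with hz'
  have hcov : (freeCover A M).rTensor _ z' = z := by
    rw [hz', ← lTensor_rTensor, hz₀, hz]
  have hk : (freeCover A M).rTensor _ ((koszulD x).lTensor _ z') = 0 := by
    rw [← lTensor_rTensor, hcov, hd]
  obtain ⟨y₀, hy₀⟩ := (rTensor_exact (Koszul A)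
    syzygyIncl_exact freeCover_surjective _).1 hk
  have hproj : (koszulProj A q).lTensor _ ((koszulD x).lTensor _ z') = (koszulD x).lTensor _ z' := by
    rw [hz', ← LinearMap.comp_apply, ← LinearMap.comp_apply, ← LinearMap.comp_apply,
      ← LinearMap.lTensor_comp, ← LinearMap.lTensor_comp, ← koszulD_proj, LinearMap.comp_assoc, koszulProj_proj, LinearMap.lTensor_comp]
  have hy : (syzygyIncl A M).rTensor _ ((koszulProj A q).lTensor _ y₀) =
      (koszulD x).lTensor _ z' := by
    rw [← lTensor_rTensor, hy₀, hproj]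
  have hdd : ∀ {P : Type u} [AddCommGroup P] [Module A P] (z : P ⊗[A] Koszul A),
      (koszulD x).lTensor P ((koszulD x).lTensor P z) = 0 := fun z => by
    have h2 : koszulD x ∘ₗ koszulD x = 0 := LinearMap.ext fun z =>
      CliffordAlgebra.contractLeft_contractLeft (Q := (0 : QuadraticForm A (ℕ →₀ A))) _ z
    rw [← LinearMap.comp_apply, ← LinearMap.lTensor_comp, h2, LinearMap.lTensor_zero,
      LinearMap.zero_apply]
  refine ⟨(koszulProj A q).lTensor _ y₀, z', ?_, ?_, hy, ?_⟩
  · rw [← LinearMap.comp_apply, ← LinearMap.lTensor_comp, koszulProj_proj]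
  · refine rTensor_koszul_injective syzygyIncl_injective ?_
    rw [← lTensor_rTensor, hy, hdd, map_zero]
  · rintro ⟨w, hw⟩
    set w' := w - tensorAug _ w ⊗ₜ 1 with hw'
    have hDw' : (koszulD x).lTensor _ w' =
        (syzygyMap f).rTensor _ ((koszulProj A q).lTensor _ y₀) := by
      rw [hw', map_sub, lTensor_D_one, sub_zero, hw]
    have haug : tensorAug _ w' = 0 := by
      rw [hw', map_sub, tensorAug_tmul, koszulAug_one, one_smul, sub_self]
    have haug' : tensorAug _ z' = 0 := by
      have : tensorAug (M →₀ A) ∘ₗ (koszulProj A (q + 1)).lTensor _ = 0 := by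
        refine TensorProduct.ext' fun m κ => ?_
        rw [LinearMap.comp_apply, LinearMap.lTensor_tmul, tensorAug_tmul, LinearMap.zero_apply]
        have := LinearMap.congr_fun (koszulAug_proj_succ (A := A) q) κ
        rw [LinearMap.comp_apply, LinearMap.zero_apply] at this
        rw [this, zero_smul]
      exact LinearMap.congr_fun this z₀
    obtain ⟨v, hv⟩ := koszul_acyclic x (M := N →₀ A) (fun n m hm => by
        rw [mem_smul_top_finsupp] at hm ⊢
        exact fun i => hx n _ (hm i))
      ((freeCoverMap f).rTensor _ z' - (syzygyIncl A N).rTensor _ w')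
      (by
        rw [map_sub, lTensor_rTensor, lTensor_rTensor, hDw', ← hy,
          rTensor_comp_eq (syzygyIncl_comp f), sub_self])
      (by rw [map_sub, tensorAug_rTensor, tensorAug_rTensor, haug, haug', map_zero, map_zero, sub_zero])
    refine ⟨(freeCover A N).rTensor _ v, ?_⟩
    rw [lTensor_rTensor, hv, map_sub, rTensor_cover_ker, sub_zero,
      rTensor_comp_eq (freeCover_comp f), hcov]

end Cover

section Ext

open CategoryTheory Abelian

variable {A : Type} [CommRing A] (I : Ideal A) {M : Type u} [AddCommGroup M] [Module A M]
  {N : Type u} [AddCommGroup N] [Module A N]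

/-- The map induced by `f` on `Ext` to the residue field vanishes in degree `q`. -/
def ExtVanishes (f : M →ₗ[A] N) (q : ℕ) : Prop :=
  ∀ e : Ext (ModuleCat.of A N) (ModuleCat.of A (ULift.{u} (A ⧸ I))) q,
    (Ext.mk₀ (ModuleCat.ofHom f)).comp e (zero_add q) = 0

/-- The short exact sequence of a free cover. -/
abbrev coverComplex (A : Type) [CommRing A] (M : Type u) [AddCommGroup M] [Module A M] :
    ShortComplex (ModuleCat.{u} A) where
  f := ModuleCat.ofHom (syzygyIncl A M)
  g := ModuleCat.ofHom (freeCover A M)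
  zero := ModuleCat.hom_ext (LinearMap.ext fun z => syzygyIncl_exact.apply_apply_eq_zero z)

lemma coverComplex_shortExact : (coverComplex A M).ShortExact where
  exact := (ShortComplex.ShortExact.moduleCat_exact_iff_function_exact _).2 syzygyIncl_exact
  mono_f := (ModuleCat.mono_iff_injective _).2 syzygyIncl_injective
  epi_g := (ModuleCat.epi_iff_surjective _).2 freeCover_surjective

/-- The morphism of short exact sequences of free covers. -/
def coverHom (f : M →ₗ[A] N) : coverComplex A M ⟶ coverComplex A N where
  τ₁ := ModuleCat.ofHom (syzygyMap f)
  τ₂ := ModuleCat.ofHom (freeCoverMap f)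
  τ₃ := ModuleCat.ofHom f
  comm₁₂ := by
    ext z
    rfl
  comm₂₃ := by
    apply ModuleCat.hom_ext
    exact freeCover_comp f

variable {I} {f : M →ₗ[A] N}

lemma ExtVanishes.exists_extension {q : ℕ} (hf : ExtVanishes I f (q + 1))
    (e : Ext (ModuleCat.of A (Syzygy A N))
      (ModuleCat.of A (ULift.{u} (A ⧸ I))) q) :
    ∃ e' : Ext (ModuleCat.of A (M →₀ A)) (ModuleCat.of A (ULift.{u} (A ⧸ I))) q,
      (Ext.mk₀ (ModuleCat.ofHom (syzygyIncl A M))).comp e' (zero_add q) =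
        (Ext.mk₀ (ModuleCat.ofHom (syzygyMap f))).comp e (zero_add q) := by
  have hM := coverComplex_shortExact (A := A) (M := M)
  have hN := coverComplex_shortExact (A := A) (M := N)
  refine Ext.contravariant_sequence_exact₁ hM _ _ (add_comm 1 q) ?_
  have h := ShortComplex.ShortExact.extClass_naturality hM hN (coverHom f)
  have h1 := Ext.comp_assoc_of_second_deg_zero hM.extClass (Ext.mk₀ (coverHom f).τ₁) e (add_comm 1 q)
  have h2 := Ext.comp_assoc (Ext.mk₀ (coverHom f).τ₃) hN.extClass e (zero_add 1) (add_comm 1 q)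
    (show 0 + 1 + q = q + 1 by omega)
  rw [h, h2] at h1
  exact h1.symm.trans (hf _)

lemma ExtVanishes.syzygy {q : ℕ} (hf : ExtVanishes I f (q + 2)) :
    ExtVanishes I (syzygyMap f) (q + 1) := fun e => by
  obtain ⟨e', he'⟩ := hf.exists_extension e
  have : Projective (ModuleCat.of A (M →₀ A)) :=
    (IsProjective.iff_projective (R := A) (M →₀ A)).1 inferInstance
  rw [← he', Ext.eq_zero_of_projective e', Ext.comp_zero]

/-- A functional as a morphism to the residue field. -/
def residueHom (g : N →ₗ[A] A ⧸ I) : ModuleCat.of A N ⟶ ModuleCat.of A (ULift.{u} (A ⧸ I)) :=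
  ModuleCat.ofHom (ULift.moduleEquiv.symm.toLinearMap ∘ₗ g)

lemma ExtVanishes.comp_eq_zero (hf : ExtVanishes I f 0) (g : N →ₗ[A] A ⧸ I) (m : M) :
    g (f m) = 0 := by
  have h := hf (Ext.mk₀ (residueHom g))
  rw [Ext.mk₀_comp_mk₀, ← Ext.mk₀_zero] at h
  have h1 := (Ext.mk₀_bijective _ _).1 h
  have h2 := congrArg (fun φ => (ModuleCat.Hom.hom φ) m) h1
  exact congrArg ULift.down h2

lemma ExtVanishes.exists_functional (hf : ExtVanishes I f 1)
    (g : Syzygy A N →ₗ[A] A ⧸ I) :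
    ∃ g' : (M →₀ A) →ₗ[A] A ⧸ I, ∀ m : Syzygy A M, g' (syzygyIncl A M m) = g (syzygyMap f m) := by
  obtain ⟨e, he⟩ := hf.exists_extension (Ext.mk₀ (residueHom g))
  obtain ⟨φ, rfl⟩ := (Ext.mk₀_bijective _ _).2 e
  rw [Ext.mk₀_comp_mk₀, Ext.mk₀_comp_mk₀] at he
  have h1 := (Ext.mk₀_bijective _ _).1 he
  refine ⟨ULift.moduleEquiv.toLinearMap ∘ₗ ModuleCat.Hom.hom φ, fun m => ?_⟩
  have h2 := congrArg (fun φ => (ModuleCat.Hom.hom φ) m) h1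
  exact congrArg ULift.down h2

/-- Koszul cycles become boundaries along a map that vanishes on `Ext` to the residue field. -/
theorem ExtVanishes.exists_D_eq {x : ℕ → A} (hI : (Ideal.span (Set.range x)).IsMaximal)
    (hx : ∀ n a, x n * a ∈ initIdeal x n → a ∈ initIdeal x n) {q : ℕ}
    (hf : ExtVanishes (Ideal.span (Set.range x)) f q) (z : M ⊗[A] Koszul A)
    (hz : (koszulProj A q).lTensor M z = z) (hd : (koszulD x).lTensor M z = 0) :
    ∃ v, (koszulD x).lTensor N v = f.rTensor _ z := by
  have hzero : ∀ {P : Type u} [AddCommGroup P] [Module A P] (y : P ⊗[A] Koszul A),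
      (koszulProj A 0).lTensor P y = y → y = tensorAug P y ⊗ₜ 1 := fun {P} _ _ y hy => by
    have e : (koszulProj A 0).lTensor P =
        (TensorProduct.mk A P (Koszul A)).flip 1 ∘ₗ tensorAug P := TensorProduct.ext' fun m κ => by
      rw [LinearMap.lTensor_tmul, koszulProj_zero, ← TensorProduct.smul_tmul, ← tensorAug_tmul]
      rfl
    exact hy.symm.trans (LinearMap.congr_fun e y)
  have base : ∀ {P Q : Type u} [AddCommGroup P] [Module A P] [AddCommGroup Q] [Module A Q]
      (φ : P →ₗ[A] Q) (y : P ⊗[A] Koszul A), (koszulProj A 0).lTensor P y = y →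
      (∀ g : Q →ₗ[A] A ⧸ Ideal.span (Set.range x), g (φ (tensorAug P y)) = 0) →
      ∃ v, (koszulD x).lTensor Q v = φ.rTensor _ y := fun φ y hy h => by
    rw [hzero y hy, LinearMap.rTensor_tmul]
    exact exists_D_eq_of_mem x (mem_smul_top_of_functionals hI _ h)
  have main : ∀ (q : ℕ) {P Q : Type u} [AddCommGroup P] [Module A P] [AddCommGroup Q] [Module A Q]
      (φ : P →ₗ[A] Q), ExtVanishes (Ideal.span (Set.range x)) φ (q + 1) → ∀ z : P ⊗[A] Koszul A,
      (koszulProj A (q + 1)).lTensor P z = z → (koszulD x).lTensor P z = 0 →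
      ∃ v, (koszulD x).lTensor Q v = φ.rTensor _ z := by
    intro q
    induction q with
    | zero =>
      intro P Q _ _ _ _ φ hφ z hz hd
      obtain ⟨y, z', hy, hdy, hyz, h⟩ := exists_syzygy_cycle x hx φ z hz hd
      refine h (base (syzygyMap φ) y hy fun g => ?_)
      obtain ⟨g', hg'⟩ := hφ.exists_functional g
      rw [← hg']
      refine functional_eq_zero g' ?_
      have := tensorAug_D_mem_span x z'
      rwa [← hyz, tensorAug_rTensor] at this
    | succ q ih =>
      intro P Q _ _ _ _ φ hφ z hz hd
      obtain ⟨y, z', hy, hdy, hyz, h⟩ := exists_syzygy_cycle x hx φ z hz hd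
      exact h (ih (syzygyMap φ) hφ.syzygy y hy hdy)
  cases q with
  | zero => exact base f z hz fun g => hf.comp_eq_zero g _
  | succ q => exact main q f hf z hz hd

end Ext

section Bounds

variable {A : Type} [CommRing A] {x : ℕ → A} {Y : Type u} [AddCommGroup Y] [Module A Y]

lemma exists_rTensor_eq_of_mem_powSub {I : Ideal A} {n : ℤ} {u : Y ⊗[A] Koszul A}
    (hu : u ∈ powSub I (Y ⊗[A] Koszul A) n) : ∃ y, (powSub I Y n).subtype.rTensor _ y = u := by
  refine map_mem_of_powSub (AddMonoidHom.id _)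
    (LinearMap.range ((powSub I Y n).subtype.rTensor (Koszul A))).toAddSubgroup
    (fun a ha z => ?_) hu
  change a • z ∈ LinearMap.range ((powSub I Y n).subtype.rTensor (Koszul A))
  induction z using TensorProduct.induction_on with
  | zero => rw [smul_zero]; exact Submodule.zero_mem _
  | add y z hy hz => rw [smul_add]; exact Submodule.add_mem _ hy hz
  | tmul m κ => exact ⟨(⟨a • m, smul_mem_powSub ha m⟩ : powSub I Y n) ⊗ₜ κ, rfl⟩

lemma rTensor_mem_powSub {I : Ideal A} {n : ℤ} (y : powSub I Y n ⊗[A] Koszul A) :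
    (powSub I Y n).subtype.rTensor _ y ∈ powSub I (Y ⊗[A] Koszul A) n := by
  induction y using TensorProduct.induction_on with
  | zero => rw [map_zero]; exact Submodule.zero_mem _
  | add y z hy hz => rw [map_add]; exact Submodule.add_mem _ hy hz
  | tmul m κ => exact powSub_map ((TensorProduct.mk A Y (Koszul A)).flip κ) m.2

/-- Koszul cycles in `I ^ (n + 1) Y` bound in `I ^ n Y` if the inclusion vanishes on `Ext` to the
residue field. -/
lemma exists_mem_powSub_D_eq (hI : (Ideal.span (Set.range x)).IsMaximal)
    (hx : ∀ n a, x n * a ∈ initIdeal x n → a ∈ initIdeal x n) {n m : ℤ} (hnm : n ≤ m) {q : ℕ}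
    (hY : ExtVanishes (Ideal.span (Set.range x))
      (Submodule.inclusion (powSub_anti (Ideal.span (Set.range x)) Y hnm)) q)
    {u : Y ⊗[A] Koszul A} (hu : u ∈ powSub (Ideal.span (Set.range x)) (Y ⊗[A] Koszul A) m)
    (hq : (koszulProj A q).lTensor Y u = u) (hd : (koszulD x).lTensor Y u = 0) :
    ∃ v ∈ powSub (Ideal.span (Set.range x)) (Y ⊗[A] Koszul A) n, (koszulD x).lTensor Y v = u := by
  obtain ⟨y, hy⟩ := exists_rTensor_eq_of_mem_powSub hu
  have hinj : Function.Injective ((powSub (Ideal.span (Set.range x)) Y m).subtype.rTensor (Koszul A)) :=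
    rTensor_koszul_injective (Submodule.injective_subtype _)
  obtain ⟨w, hw⟩ := hY.exists_D_eq hI hx y
    (hinj (by rw [← lTensor_rTensor, hy, hq]))
    (hinj (by rw [← lTensor_rTensor, hy, hd, map_zero]))
  refine ⟨(powSub (Ideal.span (Set.range x)) Y n).subtype.rTensor _ w, rTensor_mem_powSub w, ?_⟩
  rw [lTensor_rTensor, hw, ← hy, ← LinearMap.comp_apply, ← LinearMap.rTensor_comp]
  rfl

end Bounds

section Homogeneous

variable {A : Type} [CommRing A] {x : ℕ → A} {Y : Type u} [AddCommGroup Y] [Module A Y]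
  {Agr : ℤ → AddSubgroup A} {deg : ℕ → ℤ} {Ygr : ℤ → AddSubgroup Y}

/-- The bigrading of `Y ⊗ K`. -/
abbrev koszulTensorGr (Agr : ℤ → AddSubgroup A) (deg : ℕ → ℤ) (Ygr : ℤ → AddSubgroup Y) :
    ℤ → ℤ → AddSubgroup (Y ⊗[A] Koszul A) := tensorGr (concGr Ygr) (koszulGr Agr deg)

lemma koszulProj_mem {q : ℕ} {κ : Koszul A} {k : ℤ} (hκ : κ ∈ koszulGr Agr deg q k) :
    koszulProj A q κ = κ := by
  have : (koszulProj A q - LinearMap.id).toAddMonoidHom κ ∈ (⊥ : AddSubgroup (Koszul A)) := by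
    refine map_mem_of_koszulGr _ _ (fun c a l _ hl _ => ?_) hκ
    obtain rfl : l.length = q := by omega
    change koszulProj A l.length (a • koszulProd A l) - a • koszulProd A l = 0
    rw [map_smul, koszulProj_prod, sub_self]
  exact sub_eq_zero.1 this

lemma eq_zero_of_koszulGr_neg {J k : ℤ} (hJ : J < 0) {κ : Koszul A} (hκ : κ ∈ koszulGr Agr deg J k) :
    κ = 0 := by
  refine map_mem_of_koszulGr (AddMonoidHom.id _) (⊥ : AddSubgroup (Koszul A))
    (fun c a l _ hl _ => ?_) hκ
  omega

lemma lTensor_proj_mem {q : ℕ} {k : ℤ} {u : Y ⊗[A] Koszul A}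
    (hu : u ∈ koszulTensorGr Agr deg Ygr q k) : (koszulProj A q).lTensor Y u = u := by
  have : ((koszulProj A q).lTensor Y - LinearMap.id).toAddMonoidHom u ∈
      (⊥ : AddSubgroup (Y ⊗[A] Koszul A)) := by
    refine map_mem_of_tensorGr _ _ (fun i j a b m κ hm hκ hij _ => ?_) hu
    change m ⊗ₜ[A] koszulProj A q κ - m ⊗ₜ[A] κ = 0
    rcases concGr_cases hm with ⟨rfl, -⟩ | rfl
    · obtain rfl : j = q := by omega
      rw [koszulProj_mem hκ, sub_self]
    · rw [TensorProduct.zero_tmul, TensorProduct.zero_tmul, sub_self]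
  exact sub_eq_zero.1 this

lemma eq_zero_of_koszulTensorGr_neg {J k : ℤ} (hJ : J < 0) {u : Y ⊗[A] Koszul A}
    (hu : u ∈ koszulTensorGr Agr deg Ygr J k) : u = 0 := by
  refine map_mem_of_tensorGr (AddMonoidHom.id _) (⊥ : AddSubgroup (Y ⊗[A] Koszul A))
    (fun i j a b m κ hm hκ hij _ => ?_) hu
  change m ⊗ₜ[A] κ = 0
  rcases concGr_cases hm with ⟨rfl, -⟩ | rfl
  · rw [eq_zero_of_koszulGr_neg (by omega) hκ, TensorProduct.tmul_zero]
  · rw [TensorProduct.zero_tmul]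

lemma tensorCoef_mem (hY : IsGraded Agr Ygr) (l : List ℕ) {J k : ℤ} {z : Y ⊗[A] Koszul A}
    (hz : z ∈ koszulTensorGr Agr deg Ygr J k) :
    tensorCoef Y l z ∈ concGr Ygr (J - l.length) (k - (l.map deg).sum) := by
  induction l generalizing J k z with
  | nil =>
    rw [List.length_nil, List.map_nil, List.sum_nil, Nat.cast_zero, sub_zero, sub_zero]
    exact tensorAug_mem (isGraded_concGr hY) hz
  | cons i l ih =>
    have : (koszulDer A i).lTensor Y z ∈ koszulTensorGr Agr deg Ygr (J - 1) (k - deg i) :=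
      tensorMap_mem LinearMap.id (koszulDer A i) 0 (-1) 0 (-deg i) (fun J k m hm => by simpa using hm)
        (fun J k κ hκ => koszulDer_mem i hκ (by ring) (by ring)) hz (by ring) (by ring)
    have := ih this
    rw [List.length_cons, List.map_cons, List.sum_cons]
    push_cast
    rw [show J - ((l.length : ℤ) + 1) = J - 1 - l.length by ring,
      show k - (deg i + (l.map deg).sum) = k - deg i - (l.map deg).sum by ring]
    exact this

/-- The submodule `I ^ n (Y ⊗ K)` is generated additively by its homogeneous elements. -/
lemma powSub_le_closure (hY : IsGraded Agr Ygr) (hxd : ∀ i, x i ∈ Agr (deg i))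
    (hA : ∀ a : A, a ∈ AddSubgroup.closure {a | ∃ k, a ∈ Agr k})
    (hYgr : ∀ y : Y, y ∈ AddSubgroup.closure {y | ∃ k, y ∈ Ygr k}) (n : ℕ) {z : Y ⊗[A] Koszul A}
    (hz : z ∈ powSub (Ideal.span (Set.range x)) (Y ⊗[A] Koszul A) n) :
    z ∈ AddSubgroup.closure {z | z ∈ powSub (Ideal.span (Set.range x)) (Y ⊗[A] Koszul A) n ∧
      ∃ J k, z ∈ koszulTensorGr Agr deg Ygr J k} := by
  induction n generalizing z with
  | zero =>
    set S := AddSubgroup.closure {z | z ∈ powSub (Ideal.span (Set.range x)) (Y ⊗[A] Koszul A)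
      ((0 : ℕ) : ℤ) ∧ ∃ J k, z ∈ koszulTensorGr Agr deg Ygr J k} with hS
    have h1 : ∀ (y : Y) (a : A) (l : List ℕ), y ⊗ₜ[A] (a • koszulProd A l) ∈ S := by
      intro y a l
      have ha := hA a
      have hy := hYgr y
      induction ha using AddSubgroup.closure_induction with
      | mem a ha =>
        obtain ⟨c, ha⟩ := ha
        induction hy using AddSubgroup.closure_induction with
        | mem y hy =>
          obtain ⟨k, hy⟩ := hy
          exact AddSubgroup.subset_closure ⟨powSub_of_nonpos (by simp) _, _, _,
            tmul_mem_tensorGr (mem_concGr hy) (smul_koszulProd_mem ha rfl rfl) rfl rfl⟩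
        | zero => rw [TensorProduct.zero_tmul]; exact S.zero_mem
        | add y z _ _ hy hz => rw [TensorProduct.add_tmul]; exact S.add_mem hy hz
        | neg y _ hy => rw [TensorProduct.neg_tmul]; exact S.neg_mem hy
      | zero => rw [zero_smul, TensorProduct.tmul_zero]; exact S.zero_mem
      | add a b _ _ ha hb => rw [add_smul, TensorProduct.tmul_add]; exact S.add_mem ha hb
      | neg a _ ha => rw [neg_smul, TensorProduct.tmul_neg]; exact S.neg_mem ha
    clear hz
    induction z using TensorProduct.induction_on with
    | zero => exact S.zero_mem
    | add y z hy hz => exact S.add_mem hy hz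
    | tmul y κ =>
      have hκ : κ ∈ Submodule.span A (Set.range (koszulProd A)) := by rw [koszulProd_span]; trivial
      refine Submodule.closure_induction (p := fun κ _ => y ⊗ₜ[A] κ ∈ S) ?_ ?_ ?_ hκ
      · rw [TensorProduct.tmul_zero]; exact S.zero_mem
      · intro κ κ' _ _ h h'
        rw [TensorProduct.tmul_add]; exact S.add_mem h h'
      · rintro a _ ⟨l, rfl⟩
        exact h1 y a l
  | succ n ih =>
    set S := AddSubgroup.closure {z | z ∈ powSub (Ideal.span (Set.range x)) (Y ⊗[A] Koszul A)
      ((n + 1 : ℕ) : ℤ) ∧ ∃ J k, z ∈ koszulTensorGr Agr deg Ygr J k} with hS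
    have h1 : ∀ (i : ℕ), ∀ z ∈ powSub (Ideal.span (Set.range x)) (Y ⊗[A] Koszul A) n,
        x i • z ∈ S := by
      intro i z hz
      have hz' := ih hz
      clear hz
      induction hz' using AddSubgroup.closure_induction with
      | mem z hz =>
        obtain ⟨hz, J, k, hg⟩ := hz
        have h := smul_mem_powSub_succ (Ideal.subset_span (Set.mem_range_self i) :
          x i ∈ Ideal.span (Set.range x)) hz
        rw [← Nat.cast_succ] at h
        exact AddSubgroup.subset_closure ⟨h, J, _,
          isGraded_tensorGr (isGraded_concGr hY) J _ _ _ _ (hxd i) hg⟩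
      | zero => rw [smul_zero]; exact S.zero_mem
      | add y z _ _ hy hz => rw [smul_add]; exact S.add_mem hy hz
      | neg y _ hy => rw [smul_neg]; exact S.neg_mem hy
    have h2 : ∀ a ∈ Ideal.span (Set.range x),
        ∀ z ∈ powSub (Ideal.span (Set.range x)) (Y ⊗[A] Koszul A) n, a • z ∈ S := by
      intro a ha
      refine Submodule.span_induction (p := fun a _ => ∀ z ∈ powSub (Ideal.span (Set.range x))
        (Y ⊗[A] Koszul A) n, a • z ∈ S) ?_ ?_ ?_ ?_ ha
      · rintro _ ⟨i, rfl⟩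
        exact h1 i
      · intro z _
        rw [zero_smul]; exact S.zero_mem
      · intro a b _ _ ha hb z hz
        rw [add_smul]; exact S.add_mem (ha z hz) (hb z hz)
      · intro c a _ ha z hz
        rw [smul_eq_mul, mul_comm, mul_smul]
        exact ha _ (Submodule.smul_mem _ c hz)
    have e : powSub (Ideal.span (Set.range x)) (Y ⊗[A] Koszul A) ((n + 1 : ℕ) : ℤ) =
        Ideal.span (Set.range x) • powSub (Ideal.span (Set.range x)) (Y ⊗[A] Koszul A) n := by
      rw [powSub, powSub, Int.toNat_natCast, Int.toNat_natCast, pow_succ', Submodule.mul_smul]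
    rw [e] at hz
    exact Submodule.smul_induction_on (p := fun z => z ∈ S) hz h2 fun y z => S.add_mem

/-- Homogeneous Koszul cycles in `I ^ (n + 1) Y` bound homogeneously in `I ^ n Y` if the inclusions
vanish on `Ext` to the residue field. -/
theorem adicAcyclic_of_extVanishes (hI : (Ideal.span (Set.range x)).IsMaximal)
    (hx : ∀ n a, x n * a ∈ initIdeal x n → a ∈ initIdeal x n) (hY : IsGraded Agr Ygr)
    (hAgr : ∀ i j a b, a ∈ Agr i → b ∈ Agr j → a * b ∈ Agr (i + j))
    (hxd : ∀ i, x i ∈ Agr (deg i))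
    (hA : ∀ a : A, a ∈ AddSubgroup.closure {a | ∃ k, a ∈ Agr k}) (hint : DirectSum.IsInternal Ygr)
    (hext : ∀ n q : ℕ, ExtVanishes (Ideal.span (Set.range x)) (Submodule.inclusion
      (powSub_anti (Ideal.span (Set.range x)) Y (Int.le_add_one (le_refl (n : ℤ))))) q) :
    AdicAcyclic (Ideal.span (Set.range x)) ((koszulD x).lTensor Y)
      (koszulTensorGr Agr deg Ygr) := by
  classical
  intro j hj J k u hu hg hd
  obtain ⟨n, rfl⟩ : ∃ n : ℕ, j = n + 1 := ⟨(j - 1).toNat, by omega⟩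
  rw [add_sub_cancel_right]
  by_cases hJ : J < 0
  · refine ⟨0, Submodule.zero_mem _, AddSubgroup.zero_mem _, ?_⟩
    rw [map_zero, eq_zero_of_koszulTensorGr_neg hJ hg]
  obtain ⟨q, rfl⟩ : ∃ q : ℕ, J = q := ⟨J.toNat, by omega⟩
  obtain ⟨v, hv, hdv⟩ := exists_mem_powSub_D_eq hI hx (Int.le_add_one (le_refl (n : ℤ))) (hext n q) hu (lTensor_proj_mem hg) hd
  let dec := hint.chooseDecomposition
  let pr : ℤ → Y →+ Y := fun k => (Ygr k).subtype.comp
    ((DFinsupp.evalAddMonoidHom k).comp (DirectSum.decomposeAddEquiv Ygr).toAddMonoidHom)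
  have pr_same : ∀ k y, y ∈ Ygr k → pr k y = y := fun k y hy =>
    DirectSum.decompose_of_mem_same Ygr hy
  have pr_ne : ∀ k k' y, y ∈ Ygr k' → k' ≠ k → pr k y = 0 := fun k k' y hy h =>
    DirectSum.decompose_of_mem_ne Ygr hy h
  have hYgr : ∀ y : Y, y ∈ AddSubgroup.closure {y | ∃ k, y ∈ Ygr k} := fun y => by
    rw [← DirectSum.sum_support_decompose Ygr y]
    exact AddSubgroup.sum_mem _ fun k _ => AddSubgroup.subset_closure ⟨k, SetLike.coe_mem _⟩
  let comp : List ℕ → Y →+ Y := fun l =>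
    if (l.length : ℤ) = q then pr (k - (l.map deg).sum) else 0
  have comp_same : ∀ l z, z ∈ koszulTensorGr Agr deg Ygr q k →
      comp l (tensorCoef Y l z) = tensorCoef Y l z := fun l z hz => by
    rcases concGr_cases (tensorCoef_mem hY l hz) with ⟨h1, h2⟩ | h
    · simp only [comp]
      rw [if_pos (by omega), pr_same _ _ h2]
    · rw [h, map_zero]
  have comp_ne : ∀ l J' k' z, z ∈ koszulTensorGr Agr deg Ygr J' k' → ¬ (J' = q ∧ k' = k) →
      comp l (tensorCoef Y l z) = 0 := fun l J' k' z hz hne => by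
    rcases concGr_cases (tensorCoef_mem hY l hz) with ⟨h1, h2⟩ | h
    · simp only [comp]
      split_ifs with hl
      · exact pr_ne _ _ _ h2 fun h => hne ⟨by omega, by omega⟩
      · rfl
    · rw [h, map_zero]
  have hDg : ∀ J k z, z ∈ koszulTensorGr Agr deg Ygr J k →
      (koszulD x).lTensor Y z ∈ koszulTensorGr Agr deg Ygr (J - 1) k := fun J k z hz =>
    tensorMap_mem LinearMap.id (koszulD x) 0 (-1) 0 0 (fun J k m hm => by simpa using hm)
      (fun J k κ hκ => by
        rw [add_zero]
        exact koszulD_mem hAgr hxd hκ (by ring)) hz (by ring) (by ring)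
  have key : ∃ v' ∈ powSub (Ideal.span (Set.range x)) (Y ⊗[A] Koszul A) n,
      v' ∈ koszulTensorGr Agr deg Ygr (q + 1) k ∧ ∀ l,
        tensorCoef Y l ((koszulD x).lTensor Y v') =
          comp l (tensorCoef Y l ((koszulD x).lTensor Y v)) := by
    have hc := powSub_le_closure hY hxd hA hYgr n hv
    clear hdv hv
    induction hc using AddSubgroup.closure_induction with
    | mem v hv =>
      obtain ⟨hv, J', k', hg'⟩ := hv
      by_cases h : J' = q + 1 ∧ k' = k
      · obtain ⟨rfl, rfl⟩ := h
        refine ⟨v, hv, hg', fun l => (comp_same l _ ?_).symm⟩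
        have := hDg _ _ _ hg'
        rwa [add_sub_cancel_right] at this
      · refine ⟨0, Submodule.zero_mem _, AddSubgroup.zero_mem _, fun l => ?_⟩
        rw [comp_ne l _ _ _ (hDg _ _ _ hg') (fun h' => h ⟨by omega, h'.2⟩), map_zero, map_zero]
    | zero =>
      refine ⟨0, Submodule.zero_mem _, AddSubgroup.zero_mem _, fun l => ?_⟩
      simp only [map_zero]
    | add y z _ _ hy hz =>
      obtain ⟨y', h1, h2, h3⟩ := hy
      obtain ⟨z', h1', h2', h3'⟩ := hz
      exact ⟨y' + z', Submodule.add_mem _ h1 h1', AddSubgroup.add_mem _ h2 h2', fun l => by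
        simp only [map_add, h3, h3']⟩
    | neg y _ hy =>
      obtain ⟨y', h1, h2, h3⟩ := hy
      exact ⟨-y', Submodule.neg_mem _ h1, AddSubgroup.neg_mem _ h2, fun l => by
        simp only [map_neg, h3]⟩
  obtain ⟨v', hv', hg', hcoef⟩ := key
  refine ⟨v', hv', hg', sub_eq_zero.1 (eq_zero_of_tensorCoef fun l => ?_)⟩
  rw [map_sub, hcoef, hdv, comp_same l u hg, sub_self]

end Homogeneous

section AugIdeal

variable (p : ℕ) [hp : Fact p.Prime]

/-- The constant coefficient of an element of `BP_{2*}`. -/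
def bpConst : BP p →+* ZLoc p := (MvPolynomial.constantCoeff : MvPolynomial ℕ (ZLoc p) →+* ZLoc p)

lemma sub_const_mem (f : BP p) :
    f - algebraMap (ZLoc p) (BP p) (bpConst p f) ∈ augIdeal p := by
  refine MvPolynomial.induction_on (motive := fun f : MvPolynomial ℕ (ZLoc p) =>
    (show BP p from f) - algebraMap (ZLoc p) (BP p) (bpConst p f) ∈ augIdeal p) f
    (fun a => ?_) (fun f g hf hg => ?_) (fun f i _ => ?_)
  · have e : bpConst p (MvPolynomial.C a : MvPolynomial ℕ (ZLoc p)) = a :=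
      MvPolynomial.constantCoeff_C _ a
    rw [e]
    have e' : (show BP p from (MvPolynomial.C a : MvPolynomial ℕ (ZLoc p))) -
      algebraMap (ZLoc p) (BP p) a = 0 := sub_self _
    rw [e']
    exact Ideal.zero_mem _
  · have e : (show BP p from f + g) - algebraMap (ZLoc p) (BP p) (bpConst p (show BP p from f + g)) =
        ((show BP p from f) - algebraMap (ZLoc p) (BP p) (bpConst p f)) +
          ((show BP p from g) - algebraMap (ZLoc p) (BP p) (bpConst p g)) := by
      have e1 : bpConst p (show BP p from f + g) = bpConst p f + bpConst p g :=
        map_add (bpConst p) f g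
      rw [e1, map_add]
      exact add_sub_add_comm _ _ _ _
    exact (congrArg (· ∈ augIdeal p) e).mpr (Ideal.add_mem _ hf hg)
  · have e1 : bpConst p (show BP p from f * MvPolynomial.X i) = 0 := by
      refine (map_mul (MvPolynomial.constantCoeff : MvPolynomial ℕ (ZLoc p) →+* ZLoc p) f _).trans ?_
      rw [MvPolynomial.constantCoeff_X, mul_zero]
    have e : (show BP p from f * MvPolynomial.X i) -
        algebraMap (ZLoc p) (BP p) (bpConst p (show BP p from f * MvPolynomial.X i)) =
        (show BP p from f) * vseq p (i + 1) := by
      rw [e1, map_zero]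
      exact sub_zero _
    exact (congrArg (· ∈ augIdeal p) e).mpr (Ideal.mul_mem_left _ _ (vseq_mem_augIdeal p (i + 1)))

lemma maximalIdeal_zloc :
    IsLocalRing.maximalIdeal (ZLoc p) = Ideal.span {(p : ZLoc p)} := by
  rw [← Localization.AtPrime.map_eq_maximalIdeal, Ideal.map_span, Set.image_singleton]
  simp

lemma augIdeal_le_comap : augIdeal p ≤ (IsLocalRing.maximalIdeal (ZLoc p)).comap (bpConst p) := by
  rw [augIdeal, Ideal.span_le]
  rintro _ ⟨i, rfl⟩
  rw [SetLike.mem_coe, Ideal.mem_comap]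
  cases i with
  | zero =>
    rw [vseq, map_natCast, maximalIdeal_zloc]
    exact Ideal.mem_span_singleton_self _
  | succ i =>
    have e : bpConst p (vseq p (i + 1)) = 0 := MvPolynomial.constantCoeff_X (R := ZLoc p) i
    rw [e]
    exact Ideal.zero_mem _

lemma isMaximal_augIdeal : (augIdeal p).IsMaximal := by
  rw [Ideal.isMaximal_iff]
  constructor
  · intro h
    have := augIdeal_le_comap p h
    rw [Ideal.mem_comap, map_one] at this
    exact (Ideal.ne_top_iff_one _).1 (IsLocalRing.maximalIdeal.isMaximal (ZLoc p)).ne_top this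
  · intro J f hJ hf hfJ
    have hc : bpConst p f ∉ IsLocalRing.maximalIdeal (ZLoc p) := by
      intro hc
      rw [maximalIdeal_zloc] at hc
      obtain ⟨c, hc⟩ := Ideal.mem_span_singleton'.1 hc
      refine hf ?_
      have h := Ideal.add_mem _ (sub_const_mem p f)
        (Ideal.mul_mem_left _ (algebraMap (ZLoc p) (BP p) c) (vseq_mem_augIdeal p 0))
      rwa [vseq, ← map_natCast (algebraMap (ZLoc p) (BP p)), ← map_mul, hc, sub_add_cancel] at h
    have hu : IsUnit (bpConst p f) := by
      by_contra h
      exact hc h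
    obtain ⟨c, hc⟩ := hu.exists_left_inv
    have h := J.mul_mem_left (algebraMap (ZLoc p) (BP p) c)
      (J.sub_mem hfJ (hJ (sub_const_mem p f)))
    rwa [sub_sub_cancel, ← map_mul, hc, map_one] at h

lemma mem_closure_bpGr (a : BP p) : a ∈ AddSubgroup.closure {a | ∃ k, a ∈ bpGr p k} := by
  have e := MvPolynomial.support_sum_monomial_coeff (a : MvPolynomial ℕ (ZLoc p))
  refine (congrArg (· ∈ AddSubgroup.closure {a | ∃ k, a ∈ bpGr p k}) e).mp
    (AddSubgroup.sum_mem _ fun α _ => AddSubgroup.subset_closure ⟨0 + Finsupp.weight (genDeg p) α, ?_⟩)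
  rw [bpGr_eq]
  refine monomial_mem_polyGr ?_ rfl
  rw [mem_zlocGr]
  exact fun _ => rfl

end AugIdeal

section Main

variable {p : ℕ} [hp : Fact p.Prime] (Y : GradedComodule.{u} p)

lemma setting_bp : Setting (bpConj p) (bpGr p) (bpbpGr p) (vseq p) (vdeg p) (augIdeal p) Y.toDG Y.gr where
  hopf := hopfGrading_bp p
  one_mem := (isRingGrading_bpGr p).one_mem
  conj := conj_mem p
  invariant := isInvariant_augIdeal p
  x_mem := vseq_mem p
  x_mem_ideal := vseq_mem_augIdeal p
  graded := fun i k a m ha hm => Y.smul_mem i k a m ha hm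
  ψ_mem := Y.ψ_mem
  d_eq := rfl
  inv_eq := rfl

lemma koszulTensorD_toDG : koszulTensorD Y.toDG (vseq p) = (koszulD (vseq p)).lTensor Y.carrier :=
  TensorProduct.ext' fun m κ => by
    have e : koszulTensorD Y.toDG (vseq p) (m ⊗ₜ κ) =
        (0 : Y.carrier) ⊗ₜ[BP p] κ + (show Y.carrier from m) ⊗ₜ[BP p] koszulD (vseq p) κ := rfl
    rw [TensorProduct.zero_tmul, zero_add] at e
    exact e

lemma adicAcyclic_of_levin (hY : HasLevinIndexOne p Y.carrier) :
    AdicAcyclic (augIdeal p) (koszulTensorD Y.toDG (vseq p))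
      (tensorGr (concGr Y.gr) (koszulGr (bpGr p) (vdeg p))) := by
  rw [koszulTensorD_toDG]
  exact adicAcyclic_of_extVanishes (isMaximal_augIdeal p) (vseq_regular p)
    (fun i k a m ha hm => Y.smul_mem i k a m ha hm) (isRingGrading_bpGr p).mul_mem (vseq_mem p)
    (mem_closure_bpGr p) Y.isInternal hY

lemma mem_cobarW_iff (m s k : ℤ) (x : CobarTotal (bpHopf p).ηR Y.carrier)
    (hx : x ∈ (adicNovikov Y).gr s k) :
    x ∈ cobarW (bpHopf p).ηR Y.carrier (augIdeal p) m ↔ x ∈ (adicNovikov Y).F (m - s) := by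
  refine forall_congr' fun i => Iff.trans ?_
    (range_Bmap_powSub (isInvariant_augIdeal p) (m - s) i (x i)).symm
  by_cases h : (i : ℤ) = s
  · rw [h]
    rfl
  · have e : x i = 0 := (hx i).2 h
    rw [e]
    exact iff_of_true (Submodule.zero_mem _) (Submodule.zero_mem _)

end Main

end AlgNov

end

theorem proposition5p8 (p : ℕ) [Fact p.Prime] (Y : AlgNov.GradedComodule p)
    (hY : AlgNov.HasLevinIndexOne p Y.carrier) :
    Nonempty (AlgNov.Equivalence (AlgNov.adicNovikov Y) (AlgNov.cosimplicialNovikov Y)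
      (AlgNov.novikovAug Y)) := by
  have h := AlgNov.setting_bp Y
  refine AlgNov.equivalence_of_isTight (C := AlgNov.adicNovikov Y)
    (D := AlgNov.cosimplicialNovikov Y) (AlgNov.novikovAug Y)
    (AlgNov.cobarW (AlgNov.bpHopf p).ηR Y.carrier (AlgNov.augIdeal p)) (AlgNov.cobarW_anti _ _ _)
    (AlgNov.totW Y.toDG (AlgNov.hComodule p) (AlgNov.augIdeal p)) (AlgNov.totW_anti _ _ _)
    (AlgNov.mem_cobarW_iff Y) (fun m x hm i => ?_)
    (fun m x hm q => AlgNov.powSub_of_nonpos (by omega) _) h.isTight_coaug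
    (h.isTight_id (h.adicAcyclic_power (AlgNov.bpBasis p) (AlgNov.exists_homogeneous_coeff_etaR p)
      (AlgNov.adicAcyclic_of_levin Y hY)))
  exact (AlgNov.range_Bmap_powSub (AlgNov.isInvariant_augIdeal p) _ _ _).2
    (AlgNov.powSub_of_nonpos hm _)
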